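/- Fix integers $1\le j<k$ and a constant $0<\delta<1/6$. All asymptotics are as $n\to\infty$, and $x\ll y$ means $x=o(y)$. Let $\varepsilon=\varepsilon(n)>0$ satisfy $\varepsilon\to 0$, $\varepsilon^3n^j\to\infty$ and $\varepsilon^2n^{1-2\delta}\to\infty$, and let $\lambda,\varepsilon_*,\eta,\gamma_0$ be positive functions of $n$ with $$n^{-j/3},\ n^{-1/2+\delta}\ \ll\ \lambda\ \ll\ \varepsilon_*\ \ll\ \varepsilon\ \ll\ 1,\qquad \varepsilon_*,\ n^{-\delta/24}\ \ll\ \eta\ \ll\ \gamma_0/\log n\ \ll\ 1/\log n ;$$ put $\gamma_\ell=8^\ell\gamma_0$ for $1\le\ell\le j-1$. Let $\mathcal H^k(n,p)$ be the random $k$-uniform hypergraph on $[n]$ in which each $k$-set is an edge independently with probability $$p=(1+\varepsilon)\,\frac{1}{\binom kj-1}\cdot\frac1{\binom n{k-j}} .$$ For a $j$-set $J$ of vertices, explore the $j$-component of $J$ by breadth-first search: generation $0$ is $\partial C_J(0)=\{J\}$, and generation $i+1$, denoted $\partial C_J(i+1)$, consists of all not yet discovered $j$-sets contained in an edge that also contains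 a $j$-set of $\partial C_J(i)$. Let $C_J(i)=\bigcup_{i'\le i}\partial C_J(i')$. The stopping time $i_{\mathrm{stop}}$ is the first generation $i$ at which $\partial C_J(i)=\emptyset$, or $|C_J(i)|\ge\lambda n^j$, or $|\partial C_J(i)|\ge\lambda^2n^j$. For $1\le\ell\le j-1$ let $i_0(\ell)$ be the least $i$ with $|\partial C_J(i)|\ge n^{\ell+\delta}$ ($\infty$ if there is none), and let the smoothing end time be $$i_1(\ell)=i_0(\ell)+\left\lceil\frac{(j-\ell)\log n}{-\log\big((1+2\eta+2\varepsilon)r_\ell\big)}\right\rceil,\qquad r_\ell=\frac{\binom{k-\ell}{j-\ell}-1}{\binom kj-1};$$ let $i_1(0)=0$. For a set $L$ of vertices let $d_L(\partial C_J(i))$ be the number of $j$-sets in $\partial C_J(i)$ that contain $L$. Then there is a constant $c>0$, depending only on $k,j,\delta$, such that for all sufficiently large $n$, with probability at least $1-\exp(-n^{c})$, the following holds for all $J,\ell,L,i$ such that $J$ is a $j$-set of vertices, $0\le\ell\le j-1$, $L$ is an $\ell$-set of vertices and $i_1(\ell)\le i\le i_{\mathrm{stop}}$: $$(1-\gamma_\ell)\frac{|\partial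 C_J(i)|}{\binom nj}\binom n{j-\ell}\ \le\ d_L(\partial C_J(i))\ \le\ (1+\gamma_\ell)\frac{|\partial C_J(i)|}{\binom nj}\binom n{j-\ell}.$$ -/

import Mathlib

open Filter Topology Asymptotics MeasureTheory

namespace SmoothBoundary

/-- The collection of all `j`-sets of vertices, where the vertex set is `Fin n`. -/
def jSets (n j : ℕ) : Finset (Finset (Fin n)) :=
  Finset.powersetCard j Finset.univ

/-- The binomial random `k`-uniform hypergraph on the vertex set `Fin n`, as a probability measure
on sets of edges: every `k`-set is an edge with probability `p` independently, and there are no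
other edges. -/
noncomputable def randomHypergraph (n k : ℕ) (p : unitInterval) :
    Measure (Set (Finset (Fin n))) :=
  ProbabilityTheory.setBernoulli {E : Finset (Fin n) | E.card = k} p

/-- The critical probability `1 / ((C(k,j) - 1) * C(n,k-j))`. -/
noncomputable def critProb (k j n : ℕ) : ℝ :=
  1 / ((k.choose j : ℝ) - 1) * (1 / (n.choose (k - j) : ℝ))

/-- The state of the breadth-first search at the end of a generation: the discovered `j`-sets and,
among them, the active ones. A `j`-set is neutral if it is not discovered, and explored if it is
discovered and not active. -/
structure SearchState (n : ℕ) where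
  discovered : Finset (Finset (Fin n))
  active : Finset (Finset (Fin n))

open scoped Classical in
/-- One generation of the breadth-first search in the hypergraph with edge set `H`. All `k`-sets
that contain an active `j`-set and a neutral `j`-set are queried; the neutral `j`-sets contained in
an edge found in this way become discovered and form the next generation of active `j`-sets, while
the previously active ones become explored. (The order of the queries within a generation, and
omitting `k`-sets that were queried before, do not affect the outcome: all `j`-sets contained in an
edge found earlier are discovered already.) -/
noncomputable def searchStep {n : ℕ} (j : ℕ) (H : Set (Finset (Fin n))) (s : SearchState n) :
    SearchState n where
  discovered := s.discovered ∪ (jSets n j).filter fun K =>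
    K ∉ s.discovered ∧ ∃ E ∈ H, K ⊆ E ∧ ∃ A ∈ s.active, A ⊆ E
  active := (jSets n j).filter fun K =>
    K ∉ s.discovered ∧ ∃ E ∈ H, K ⊆ E ∧ ∃ A ∈ s.active, A ⊆ E

/-- The state of the breadth-first search from the initial `j`-set `J` after `i` generations. -/
noncomputable def search {n : ℕ} (j : ℕ) (H : Set (Finset (Fin n))) (J : Finset (Fin n)) :
    ℕ → SearchState n
  | 0 => ⟨{J}, {J}⟩
  | i + 1 => searchStep j H (search j H J i)

/-- `C_J(i)`: the partial component, i.e. all `j`-sets discovered up to the `i`-th generation. -/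
noncomputable def partialComponent {n : ℕ} (j : ℕ) (H : Set (Finset (Fin n)))
    (J : Finset (Fin n)) (i : ℕ) : Finset (Finset (Fin n)) :=
  (search j H J i).discovered

/-- `∂C_J(i)`: the `i`-th generation of the search. -/
noncomputable def generation {n : ℕ} (j : ℕ) (H : Set (Finset (Fin n)))
    (J : Finset (Fin n)) (i : ℕ) : Finset (Finset (Fin n)) :=
  (search j H J i).active

/-- The degree `d_L(G)`: the number of members of the family `G` that contain `L`. -/
def degree {n : ℕ} (G : Finset (Finset (Fin n))) (L : Finset (Fin n)) : ℕ :=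
  (G.filter fun K => L ⊆ K).card

/-- The starting time for `ℓ`: the least `i` such that the `i`-th generation has at least
`n ^ (ℓ + δ)` members, and `⊤` if there is no such `i`. -/
noncomputable def startTime {n : ℕ} (j : ℕ) (δ : ℝ) (H : Set (Finset (Fin n)))
    (J : Finset (Fin n)) (ℓ : ℕ) : ℕ∞ :=
  ⨅ (i : ℕ) (_ : (n : ℝ) ^ ((ℓ : ℝ) + δ) ≤ ((generation j H J i).card : ℝ)), (i : ℕ∞)

/-- The stopping time: the least `i` such that, at the end of the `i`-th generation, the component
is fully explored, or it has at least `lam * n ^ j` members, or its boundary has at least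
`lam ^ 2 * n ^ j` members. -/
noncomputable def stopTime {n : ℕ} (j : ℕ) (lam : ℝ) (H : Set (Finset (Fin n)))
    (J : Finset (Fin n)) : ℕ∞ :=
  ⨅ (i : ℕ) (_ : generation j H J i = ∅ ∨
      lam * (n : ℝ) ^ j ≤ ((partialComponent j H J i).card : ℝ) ∨
      lam ^ 2 * (n : ℝ) ^ j ≤ ((generation j H J i).card : ℝ)), (i : ℕ∞)

/-- The ratio `(C(k-ℓ,j-ℓ) - 1) / (C(k,j) - 1)`. -/
noncomputable def branchRatio (k j ℓ : ℕ) : ℝ :=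
  (((k - ℓ).choose (j - ℓ) : ℝ) - 1) / ((k.choose j : ℝ) - 1)

/-- The duration of the smoothing process for `ℓ`-sets,
`⌈(j - ℓ) log n / (-log ((1 + 2 η + 2 ε) r_ℓ))⌉` with `r_ℓ = branchRatio k j ℓ`. -/
noncomputable def smoothTime (k j n : ℕ) (ε η : ℝ) (ℓ : ℕ) : ℕ :=
  ⌈((j : ℝ) - (ℓ : ℝ)) * Real.log n / -Real.log ((1 + 2 * η + 2 * ε) * branchRatio k j ℓ)⌉₊

/-- The end of the smoothing process for `ℓ`-sets. There is nothing to smooth for `ℓ = 0`, where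
we put `0`. -/
noncomputable def smoothEnd {n : ℕ} (k j : ℕ) (δ ε η : ℝ) (H : Set (Finset (Fin n)))
    (J : Finset (Fin n)) (ℓ : ℕ) : ℕ∞ :=
  if ℓ = 0 then 0 else startTime j δ H J ℓ + (smoothTime k j n ε η ℓ : ℕ∞)

/-- The hierarchies between the parameters:
`n^(-j/3), n^(-1/2+δ) ≪ lam ≪ εs ≪ ε ≪ 1` and `εs, n^(-δ/24) ≪ η ≪ γ₀ / log n ≪ 1 / log n`,
for (eventually) positive `lam, εs, η, γ₀`. -/
structure Hierarchy (j : ℕ) (δ : ℝ) (ε lam εs η γ₀ : ℕ → ℝ) : Prop where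
  lam_pos : ∀ᶠ n in atTop, 0 < lam n
  εs_pos : ∀ᶠ n in atTop, 0 < εs n
  η_pos : ∀ᶠ n in atTop, 0 < η n
  γ₀_pos : ∀ᶠ n in atTop, 0 < γ₀ n
  pow_lam : (fun n : ℕ => (n : ℝ) ^ (-(j : ℝ) / 3)) =o[atTop] lam
  sqrt_lam : (fun n : ℕ => (n : ℝ) ^ (-(1 / 2 : ℝ) + δ)) =o[atTop] lam
  lam_εs : lam =o[atTop] εs
  εs_ε : εs =o[atTop] ε
  ε_one : ε =o[atTop] (fun _ => (1 : ℝ))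
  εs_η : εs =o[atTop] η
  pow_η : (fun n : ℕ => (n : ℝ) ^ (-δ / 24)) =o[atTop] η
  η_γ₀ : η =o[atTop] (fun n => γ₀ n / Real.log n)
  γ₀_log : (fun n => γ₀ n / Real.log n) =o[atTop] (fun n : ℕ => 1 / Real.log n)

/-- The property that the boundary of the search is smooth: for every initial `j`-set `J`, every
`0 ≤ ℓ ≤ j - 1`, every `ℓ`-set `L` and every generation `i` from the end of the smoothing process
for `ℓ` to the stopping time, the degree of `L` in the `i`-th generation is
`(1 ± 8 ^ ℓ * γ₀) * |∂C_J(i)| / C(n,j) * C(n,j-ℓ)`. -/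
def IsSmooth {n : ℕ} (k j : ℕ) (δ ε lam η γ₀ : ℝ) (H : Set (Finset (Fin n))) : Prop :=
  ∀ J ∈ jSets n j, ∀ ℓ < j, ∀ L : Finset (Fin n), L.card = ℓ → ∀ i : ℕ,
    smoothEnd k j δ ε η H J ℓ ≤ (i : ℕ∞) → (i : ℕ∞) ≤ stopTime j lam H J →
      |(degree (generation j H J i) L : ℝ)
          - ((generation j H J i).card : ℝ) / (n.choose j : ℝ) * (n.choose (j - ℓ) : ℝ)|
        ≤ 8 ^ ℓ * γ₀ *
          (((generation j H J i).card : ℝ) / (n.choose j : ℝ) * (n.choose (j - ℓ) : ℝ))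

end SmoothBoundary

/-! Let `L` be an ℓ-set with ℓ ≥ 1, and let y be the ratio of its degree in the current generation
to the mean degree. A set of the next generation that contains `L` is found in an edge around some
active set A. If A contains `L` (a pivot), then A yields about (1+ε)r_ℓ such sets in expectation. If
it does not (a jump), the number of edges around A ∪ L depends on A only through |A ∩ L|, and the
number of active sets with a given trace on `L` is governed by the degrees of proper subsets of `L`.
If those degrees are smooth up to γ, the jumps contribute (1 ± γ)(1 - r_ℓ) times the mean, as they
would for the family of all j-sets (`edgeProb_mul_jumpSum_le`, `le_edgeProb_mul_jumpSum`). The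
generation itself grows by a factor of about 1+ε, so y - 1 becomes r_ℓ(y - 1) ± (1 - r_ℓ)γ up to
small errors. Since r_ℓ < 1 this is a contraction. It starts from the trivial bound y ≤ n^(j-ℓ-δ),
valid once the generation has n^(ℓ+δ) members (`Controlled.deviation_init`), and the smoothing time
is long enough to bring this down to the order of γ. The theorem follows by induction on ℓ
(`Controlled.smooth`).

The upper bound for the expected number of new sets is clean, but edges with a second discovered set
B spoil the lower one. If B is not contained in A ∪ L, sparsity of the component makes such edges
negligible. If B ⊆ A ∪ L, every edge around A ∪ L is spoiled, so the pairs (A, B) of this kind must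
be tracked as a second quantity, `pairSum`. A child of A inherits the partner B only if it keeps B \
L, and usually it also keeps A ∩ L. Apart from pairs of small dimension, which are rare, these are
at least ℓ vertices, so the density of pairs contracts at a rate close to r_ℓ as well. The weight
(n/q)^|A ∩ L| with a large constant q makes every change of the trace cheap. Pairs found in
different edges show up as overlaps of the families `nearby`, and their number is the difference of
a sum and the size of a union, both of which are concentrated. A suitable combination of deviation
and pair density then contracts (`Controlled.potential_step`).

The randomness enters through three facts. The edges relevant for the next generation are
independent of the current state (`search_congr`, `expect_search_le`), so Chernoff bounds for sums
and for unions (`prob_sum_upper`, `prob_cover_lower`) apply in each step. An exponential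
supermartingale bounds the degrees in the component (`expect_exp_degreeExcess_le`), and this yields
sparsity by induction on the size of the set (`sparse_of_degreeExcess_le`). A union bound over all
searches, generations and sets (`prob_not_goodRun_le`) leaves a deterministic argument.

Each step is controlled at two precisions. The coarse one, n^(-δ/24), works for generations of size
n^(ℓ+δ) and drives the contraction. The fine one, n^(-1/2+δ/2), works from size n^(1+δ) on and has
error far below ε; it shows that the generations no longer shrink before the stopping time. As
smoothing takes O(log n) steps with growth 1+o(1) each, a generation cannot gain a factor n
meanwhile, so smaller sets are smooth before larger ones start (`Controlled.smoothEnd_le`). -/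

set_option linter.unusedSectionVars false

namespace SmoothBoundary

/-! ### Expectations over a binomial random subset of a finite set -/

section Expectation

variable {α : Type*} [DecidableEq α]

/-- The expectation of `f` evaluated at a `p`-random subset of the finite set `S`. -/
noncomputable def expect (p : ℝ) (S : Finset α) (f : Finset α → ℝ) : ℝ :=
  ∑ T ∈ S.powerset, p ^ T.card * (1 - p) ^ (S.card - T.card) * f T

lemma expect_empty (p : ℝ) (f : Finset α → ℝ) : expect p ∅ f = f ∅ := by
  simp [expect]

lemma expect_insert (p : ℝ) {S : Finset α} {e : α} (he : e ∉ S) (f : Finset α → ℝ) :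
    expect p (insert e S) f
      = p * expect p S (fun T => f (insert e T)) + (1 - p) * expect p S f := by
  unfold expect
  rw [Finset.sum_powerset_insert he, add_comm, Finset.mul_sum, Finset.mul_sum]
  congr 1
  · refine Finset.sum_congr rfl fun T hT => ?_
    rw [Finset.mem_powerset] at hT
    rw [Finset.card_insert_of_notMem he, Finset.card_insert_of_notMem fun h => he (hT h),
      Nat.add_sub_add_right, pow_succ]
    ring
  · refine Finset.sum_congr rfl fun T hT => ?_
    rw [Finset.mem_powerset] at hT
    rw [Finset.card_insert_of_notMem he, Nat.succ_sub (Finset.card_le_card hT), pow_succ]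
    ring

lemma expect_congr {p : ℝ} {S : Finset α} {f g : Finset α → ℝ} (h : ∀ T ⊆ S, f T = g T) :
    expect p S f = expect p S g :=
  Finset.sum_congr rfl fun T hT => by rw [h T (Finset.mem_powerset.1 hT)]

lemma expect_mono {p : ℝ} (hp0 : 0 ≤ p) (hp1 : p ≤ 1) {S : Finset α} {f g : Finset α → ℝ}
    (h : ∀ T ⊆ S, f T ≤ g T) : expect p S f ≤ expect p S g :=
  Finset.sum_le_sum fun T hT => mul_le_mul_of_nonneg_left (h T (Finset.mem_powerset.1 hT))
    (mul_nonneg (pow_nonneg hp0 _) (pow_nonneg (sub_nonneg.2 hp1) _))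

lemma expect_const_mul (p : ℝ) (S : Finset α) (c : ℝ) (f : Finset α → ℝ) :
    expect p S (fun T => c * f T) = c * expect p S f := by
  unfold expect
  rw [Finset.mul_sum]
  exact Finset.sum_congr rfl fun T _ => by ring

lemma expect_sum {ι : Type*} (p : ℝ) (S : Finset α) (I : Finset ι) (f : ι → Finset α → ℝ) :
    expect p S (fun T => ∑ i ∈ I, f i T) = ∑ i ∈ I, expect p S (f i) := by
  unfold expect
  rw [Finset.sum_comm]
  exact Finset.sum_congr rfl fun T _ => by rw [Finset.mul_sum]

lemma expect_const (p : ℝ) (S : Finset α) (c : ℝ) : expect p S (fun _ => c) = c := by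
  induction S using Finset.induction_on with
  | empty => exact expect_empty _ _
  | insert e S he ih => rw [expect_insert p he, ih]; ring

lemma expect_union (p : ℝ) {S₁ S₂ : Finset α} (h : Disjoint S₁ S₂) (f : Finset α → ℝ) :
    expect p (S₁ ∪ S₂) f = expect p S₁ fun T₁ => expect p S₂ fun T₂ => f (T₁ ∪ T₂) := by
  induction S₁ using Finset.induction_on generalizing f with
  | empty => simp [expect_empty]
  | insert e S he ih =>
    rw [Finset.disjoint_insert_left] at h
    have he' : e ∉ S ∪ S₂ := by simp [he, h.1]
    rw [Finset.insert_union, expect_insert p he', ih h.2, ih h.2, expect_insert p he]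
    simp only [Finset.insert_union]

open scoped Classical in
/-- The probability that a `p`-random subset of `S` satisfies `P`. -/
noncomputable def prob (p : ℝ) (S : Finset α) (P : Finset α → Prop) : ℝ :=
  expect p S fun T => if P T then 1 else 0

lemma prob_mono {p : ℝ} (hp0 : 0 ≤ p) (hp1 : p ≤ 1) {S : Finset α} {P Q : Finset α → Prop}
    (h : ∀ T ⊆ S, P T → Q T) : prob p S P ≤ prob p S Q := by
  classical
  refine expect_mono hp0 hp1 fun T hT => ?_
  by_cases hP : P T
  · simp [hP, h T hT hP]
  · simp only [hP, if_false]; split_ifs <;> norm_num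

lemma prob_or_le {p : ℝ} (hp0 : 0 ≤ p) (hp1 : p ≤ 1) (S : Finset α) (P Q : Finset α → Prop) :
    prob p S (fun T => P T ∨ Q T) ≤ prob p S P + prob p S Q := by
  classical
  unfold prob
  have := expect_sum p S Finset.univ fun (b : Bool) T =>
    if b then (if P T then (1 : ℝ) else 0) else (if Q T then 1 else 0)
  simp only [Fintype.sum_bool, if_true, Bool.false_eq_true, if_false] at this
  rw [← this]
  refine expect_mono hp0 hp1 fun T _ => ?_
  by_cases hP : P T <;> by_cases hQ : Q T <;> simp [hP, hQ]

lemma prob_exists_le {p : ℝ} (hp0 : 0 ≤ p) (hp1 : p ≤ 1) (S : Finset α) {ι : Type*}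
    (I : Finset ι) (P : ι → Finset α → Prop) :
    prob p S (fun T => ∃ i ∈ I, P i T) ≤ ∑ i ∈ I, prob p S (P i) := by
  classical
  unfold prob
  rw [← expect_sum]
  refine expect_mono hp0 hp1 fun T _ => ?_
  have hnn : ∀ i ∈ I, (0 : ℝ) ≤ if P i T then 1 else 0 := fun i _ => by split_ifs <;> norm_num
  split_ifs with h
  · obtain ⟨i, hi, hP⟩ := h
    refine le_trans ?_ (Finset.single_le_sum hnn hi)
    simp [hP]
  · exact Finset.sum_nonneg hnn

lemma prob_exists_le_card_mul {p : ℝ} (hp0 : 0 ≤ p) (hp1 : p ≤ 1) (S : Finset α) {ι : Type*}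
    (I : Finset ι) (P : ι → Finset α → Prop) {b : ℝ} (h : ∀ i ∈ I, prob p S (P i) ≤ b) :
    prob p S (fun T => ∃ i ∈ I, P i T) ≤ I.card * b := by
  refine (prob_exists_le hp0 hp1 S I P).trans ?_
  rw [← nsmul_eq_mul]
  exact Finset.sum_le_card_nsmul _ _ _ h

/-- Markov's inequality for exponential moments. -/
lemma prob_le_exp_mul_expect {p : ℝ} (hp0 : 0 ≤ p) (hp1 : p ≤ 1) (S : Finset α)
    (f : Finset α → ℝ) (x : ℝ) :
    prob p S (fun T => x ≤ f T) ≤ Real.exp (-x) * expect p S fun T => Real.exp (f T) := by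
  classical
  rw [← expect_const_mul]
  refine expect_mono hp0 hp1 fun T _ => ?_
  split_ifs with h
  · rw [← Real.exp_add]
    exact Real.one_le_exp (by linarith)
  · positivity

lemma exp_le_one_add_add_sq {y : ℝ} (h : |y| ≤ 1) : Real.exp y ≤ 1 + y + y ^ 2 := by
  have := (abs_le.1 (Real.abs_exp_sub_one_sub_id_le h)).2
  linarith

/-- The exponential moment of a weighted sum over a random subset. -/
lemma expect_exp_sum_le {p : ℝ} (hp0 : 0 ≤ p) (hp1 : p ≤ 1) (S : Finset α) (c : α → ℝ)
    {θ B : ℝ} (hθ : 0 ≤ θ) (hθB : θ * B ≤ 1) (hc0 : ∀ e ∈ S, 0 ≤ c e) (hcB : ∀ e ∈ S, c e ≤ B) :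
    expect p S (fun T => Real.exp (θ * ∑ e ∈ T, c e))
      ≤ Real.exp (θ * (1 + θ * B) * (p * ∑ e ∈ S, c e)) := by
  induction S using Finset.induction_on with
  | empty => simp [expect_empty]
  | insert e S he ih =>
    have ih' := ih (fun e he' => hc0 e (Finset.mem_insert_of_mem he'))
      (fun e he' => hcB e (Finset.mem_insert_of_mem he'))
    have h0 := hc0 e (Finset.mem_insert_self e S)
    have hB := hcB e (Finset.mem_insert_self e S)
    have hstep : expect p S (fun T => Real.exp (θ * ∑ e ∈ insert e T, c e))
        = Real.exp (θ * c e) * expect p S (fun T => Real.exp (θ * ∑ e ∈ T, c e)) := by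
      rw [← expect_const_mul]
      refine expect_congr fun T hT => ?_
      rw [Finset.sum_insert fun h => he (hT h), mul_add, Real.exp_add]
    rw [expect_insert p he, hstep, Finset.sum_insert he]
    have hθc : θ * c e ≤ θ * B := mul_le_mul_of_nonneg_left hB hθ
    have hexp : Real.exp (θ * c e) ≤ 1 + θ * (1 + θ * B) * c e := by
      have h1 := exp_le_one_add_add_sq (y := θ * c e) (by
        rw [abs_of_nonneg (mul_nonneg hθ h0)]; linarith)
      nlinarith [mul_le_mul_of_nonneg_left hθc (mul_nonneg hθ h0)]
    have hfac : p * Real.exp (θ * c e) + (1 - p) ≤ Real.exp (θ * (1 + θ * B) * (p * c e)) := by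
      have := Real.add_one_le_exp (θ * (1 + θ * B) * (p * c e))
      nlinarith [mul_le_mul_of_nonneg_left hexp hp0]
    have hE : 0 ≤ expect p S (fun T => Real.exp (θ * ∑ e ∈ T, c e)) := by
      rw [← expect_const p S 0]
      exact expect_mono hp0 hp1 fun T _ => by positivity
    calc _ = (p * Real.exp (θ * c e) + (1 - p)) *
            expect p S (fun T => Real.exp (θ * ∑ e ∈ T, c e)) := by ring
      _ ≤ Real.exp (θ * (1 + θ * B) * (p * c e)) *
            Real.exp (θ * (1 + θ * B) * (p * ∑ e ∈ S, c e)) :=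
          mul_le_mul hfac ih' hE (Real.exp_nonneg _)
      _ = _ := by rw [← Real.exp_add]; ring_nf

/-- The upper Chernoff bound for weighted sums. -/
lemma prob_sum_upper {p : ℝ} (hp0 : 0 ≤ p) (hp1 : p ≤ 1) (S : Finset α) (c : α → ℝ)
    {t B : ℝ} (ht : 0 < t) (ht1 : t ≤ 1) (hB : 0 < B) (hc0 : ∀ e ∈ S, 0 ≤ c e)
    (hcB : ∀ e ∈ S, c e ≤ B) (x : ℝ) :
    prob p S (fun T => ¬ ∑ e ∈ T, c e ≤ (1 + t) * (p * ∑ e ∈ S, c e) + B * x / t)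
      ≤ Real.exp (-x) := by
  -- With θ = t/B the second-order factor 1 + θB is exactly 1 + t, and Markov's inequality loses x/θ
  -- = Bx/t.
  have hθ : 0 < t / B := by positivity
  have hθB : t / B * B = t := by field_simp
  set m := p * ∑ e ∈ S, c e with hm
  have key := expect_exp_sum_le hp0 hp1 S c hθ.le (hθB.le.trans ht1) hc0 hcB
  rw [hθB, ← hm] at key
  have hmk := prob_le_exp_mul_expect hp0 hp1 S (fun T => t / B * ∑ e ∈ T, c e)
    (t / B * (1 + t) * m + x)
  refine (prob_mono hp0 hp1 fun T _ h => ?_).trans (hmk.trans ?_)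
  · have h' := mul_lt_mul_of_pos_left (not_le.1 h) hθ
    have : t / B * ((1 + t) * m + B * x / t) = t / B * (1 + t) * m + x := by
      field_simp
    linarith
  · refine (mul_le_mul_of_nonneg_left key (Real.exp_nonneg _)).trans ?_
    rw [← Real.exp_add]
    exact Real.exp_le_exp.2 (by linarith)

open Finset in
/-- The exponential moment of the size of a union of random sets: a potential that also accounts
for the degrees of the covered elements. -/
lemma expect_exp_cover_le {β : Type*} [DecidableEq β] {p : ℝ} (hp0 : 0 ≤ p) (hp1 : p ≤ 1)
    (S : Finset α) (N : α → Finset β) {θ φ B : ℝ} (hθ : 0 ≤ θ) (hφ : 0 ≤ φ) (hθB : θ * B ≤ 1)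
    (hφθ : φ ≤ θ * (1 - θ * B)) (hN : ∀ e ∈ S, ((N e).card : ℝ) ≤ B) :
    expect p S (fun T => Real.exp (-(∑ b ∈ T.biUnion N,
      (θ + φ * (p * ((S.filter fun e => b ∈ N e).card : ℝ))))
        + φ * (p * ∑ e ∈ S, ((N e).card : ℝ)))) ≤ 1 := by
  induction S using Finset.induction_on with
  | empty => simp [expect_empty]
  | insert e S he ih =>
    have ih' := ih (fun e he' => hN e (Finset.mem_insert_of_mem he'))
    have hBe := hN e (Finset.mem_insert_self e S)
    set g : Finset α → ℝ := fun T => -(∑ b ∈ T.biUnion N,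
      (θ + φ * (p * ((S.filter fun e => b ∈ N e).card : ℝ))))
        + φ * (p * ∑ e ∈ S, ((N e).card : ℝ)) with hg
    have hdeg : ∀ b, (((insert e S).filter fun e => b ∈ N e).card : ℝ)
        = (S.filter fun e => b ∈ N e).card + if b ∈ N e then 1 else 0 := by
      intro b
      rw [Finset.filter_insert]
      split_ifs with h
      · rw [Finset.card_insert_of_notMem (by simp [he])]; push_cast; ring
      · simp
    -- Admitting e raises the degrees of the covered elements of `N e`, which costs φp|U ∩ N e|,
    -- while the mean grows by φp|N e|. The net change is φp times the number d of uncovered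
    -- elements of `N e`.
    have hsumU : ∀ U : Finset β, ∑ b ∈ U,
        (θ + φ * (p * (((insert e S).filter fun e => b ∈ N e).card : ℝ)))
        = ∑ b ∈ U, (θ + φ * (p * ((S.filter fun e => b ∈ N e).card : ℝ)))
          + φ * (p * ((U ∩ N e).card : ℝ)) := by
      intro U
      have : ((U ∩ N e).card : ℝ) = ∑ b ∈ U, if b ∈ N e then (1 : ℝ) else 0 := by
        rw [Finset.sum_boole, Finset.filter_mem_eq_inter]
      rw [this, Finset.mul_sum, Finset.mul_sum, ← Finset.sum_add_distrib]
      exact Finset.sum_congr rfl fun b _ => by rw [hdeg]; ring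
    rw [expect_insert p he, ← expect_const_mul, ← expect_const_mul]
    have hadd : ∀ f₁ f₂ : Finset α → ℝ, expect p S f₁ + expect p S f₂
        = expect p S (fun T => f₁ T + f₂ T) := by
      intro f₁ f₂
      unfold expect
      rw [← Finset.sum_add_distrib]
      exact Finset.sum_congr rfl fun T _ => by ring
    rw [hadd]
    refine (expect_mono hp0 hp1 fun T hT => ?_).trans ih'
    set U := T.biUnion N with hU
    have hc : ((N e).card : ℝ) = (U ∩ N e).card + (N e \ U).card := by
      rw [Finset.inter_comm]
      exact_mod_cast (Finset.card_inter_add_card_sdiff (N e) U).symm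
    set d : ℝ := ((N e \ U).card : ℝ) with hd
    have hd0 : 0 ≤ d := Nat.cast_nonneg _
    have hdB : d ≤ B := by
      have : (0 : ℝ) ≤ (U ∩ N e).card := Nat.cast_nonneg _
      linarith
    have h2 : -(∑ b ∈ U, (θ + φ * (p * (((insert e S).filter fun e => b ∈ N e).card : ℝ))))
        + φ * (p * ∑ e ∈ insert e S, ((N e).card : ℝ)) = g T + φ * (p * d) := by
      rw [hsumU, Finset.sum_insert he, hc, hg]; ring
    have h1 : -(∑ b ∈ (insert e T).biUnion N,
        (θ + φ * (p * (((insert e S).filter fun e => b ∈ N e).card : ℝ))))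
        + φ * (p * ∑ e ∈ insert e S, ((N e).card : ℝ)) ≤ g T + φ * (p * d) - θ * d := by
      have hsplit : (insert e T).biUnion N = U ∪ (N e \ U) := by
        rw [Finset.biUnion_insert, Finset.union_sdiff_self_eq_union, Finset.union_comm]
      rw [hsplit, Finset.sum_union Finset.disjoint_sdiff, neg_add, add_right_comm, h2]
      have : θ * d ≤ ∑ b ∈ N e \ U,
          (θ + φ * (p * (((insert e S).filter fun e => b ∈ N e).card : ℝ))) := by
        rw [hd, mul_comm, ← nsmul_eq_mul]
        refine Finset.card_nsmul_le_sum _ _ _ fun b _ => ?_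
        have : 0 ≤ φ * (p * (((insert e S).filter fun e => b ∈ N e).card : ℝ)) := by positivity
        linarith
      linarith
    rw [h2]
    refine (add_le_add_left (mul_le_mul_of_nonneg_left (Real.exp_le_exp.2 h1) hp0) _).trans ?_
    have hθd : θ * d ≤ 1 := (mul_le_mul_of_nonneg_left hdB hθ).trans hθB
    -- If e is present it covers d new elements and the exponent drops by θd. The gap between φ and
    -- θ pays for the quadratic term of the exponential.
    have hfac : p * Real.exp (-(θ * d)) + (1 - p) ≤ Real.exp (-(φ * (p * d))) := by
      have e1 := exp_le_one_add_add_sq (y := -(θ * d)) (by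
        rw [abs_neg, abs_of_nonneg (mul_nonneg hθ hd0)]; exact hθd)
      have e2 := Real.add_one_le_exp (-(φ * (p * d)))
      have e3 : φ * d ≤ θ * d - (θ * d) ^ 2 := by
        have := mul_le_mul_of_nonneg_right hφθ hd0
        have h4 : θ * d * (θ * d) ≤ θ * d * (θ * B) :=
          mul_le_mul_of_nonneg_left (mul_le_mul_of_nonneg_left hdB hθ) (mul_nonneg hθ hd0)
        nlinarith
      nlinarith [mul_le_mul_of_nonneg_left e1 hp0, mul_le_mul_of_nonneg_left e3 hp0]
    calc p * Real.exp (g T + φ * (p * d) - θ * d) + (1 - p) * Real.exp (g T + φ * (p * d))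
        = (p * Real.exp (-(θ * d)) + (1 - p)) * (Real.exp (φ * (p * d)) * Real.exp (g T)) := by
          rw [← Real.exp_add, add_mul, mul_assoc, ← Real.exp_add]
          ring_nf
      _ ≤ Real.exp (-(φ * (p * d))) * (Real.exp (φ * (p * d)) * Real.exp (g T)) :=
          mul_le_mul_of_nonneg_right hfac (by positivity)
      _ = Real.exp (g T) := by
          rw [← mul_assoc, ← Real.exp_add, neg_add_cancel, Real.exp_zero, one_mul]

open Finset in
/-- The lower Chernoff bound for the size of a union of random sets. -/
lemma prob_cover_lower {β : Type*} [DecidableEq β] {p : ℝ} (hp0 : 0 ≤ p) (hp1 : p ≤ 1)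
    (S : Finset α) (N : α → Finset β) {t B κ : ℝ} (ht : 0 < t) (ht1 : t ≤ 1) (hB : 0 < B)
    (hN : ∀ e ∈ S, ((N e).card : ℝ) ≤ B)
    (hκ : ∀ b, p * ((S.filter fun e => b ∈ N e).card : ℝ) ≤ κ) (x : ℝ) :
    prob p S (fun T => ¬ (1 - t) * (p * ∑ e ∈ S, ((N e).card : ℝ)) - B * x / t
      ≤ (1 + κ) * ((T.biUnion N).card : ℝ)) ≤ Real.exp (-x) := by
  have hθ : 0 < t / B := by positivity
  have hθB : t / B * B = t := by field_simp
  set m := p * ∑ e ∈ S, ((N e).card : ℝ) with hm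
  -- The largest φ that the potential admits when θ = t/B.
  set φ := t / B * (1 - t) with hφ
  have hφ0 : 0 ≤ φ := mul_nonneg hθ.le (by linarith)
  have hφθ : φ ≤ t / B := by rw [hφ]; nlinarith
  have key := expect_exp_cover_le hp0 hp1 S N hθ.le hφ0 (hθB.le.trans ht1)
    (by rw [hθB]) hN
  rw [← hm] at key
  have hmk := prob_le_exp_mul_expect hp0 hp1 S (fun T => -(∑ b ∈ T.biUnion N,
      (t / B + φ * (p * ((S.filter fun e => b ∈ N e).card : ℝ)))) + φ * m) x
  refine (prob_mono hp0 hp1 fun T _ h => ?_).trans (hmk.trans ?_)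
  · have h' := mul_lt_mul_of_pos_left (not_le.1 h) hθ
    have e1 : t / B * ((1 - t) * m - B * x / t) = φ * m - x := by
      rw [hφ]; field_simp
    have e2 : ∑ b ∈ T.biUnion N, (t / B + φ * (p * ((S.filter fun e => b ∈ N e).card : ℝ)))
        ≤ t / B * ((1 + κ) * ((T.biUnion N).card : ℝ)) := by
      have : t / B * ((1 + κ) * ((T.biUnion N).card : ℝ))
          = (T.biUnion N).card • (t / B * (1 + κ)) := by rw [nsmul_eq_mul]; ring
      rw [this]
      refine Finset.sum_le_card_nsmul _ _ _ fun b _ => ?_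
      have h1 := mul_le_mul_of_nonneg_left (hκ b) hφ0
      have h2 : 0 ≤ p * ((S.filter fun e => b ∈ N e).card : ℝ) := by positivity
      nlinarith [mul_le_mul_of_nonneg_right hφθ (h2.trans (hκ b))]
    linarith
  · refine (mul_le_mul_of_nonneg_left key (Real.exp_nonneg _)).trans ?_
    rw [mul_one]

end Expectation

/-- Events of the binomial random hypergraph can be analysed through random subsets of the set of
all `k`-sets. -/
lemma one_sub_prob_le_randomHypergraph (n k : ℕ) (p : unitInterval)
    (A : Set (Set (Finset (Fin n)))) :
    1 - prob (p : ℝ) (Finset.powersetCard k (Finset.univ : Finset (Fin n)))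
        (fun T => (T : Set (Finset (Fin n))) ∉ A)
      ≤ (randomHypergraph n k p).real A := by
  classical
  set S := Finset.powersetCard k (Finset.univ : Finset (Fin n)) with hS
  have hu : {E : Finset (Fin n) | E.card = k} = (S : Set (Finset (Fin n))) := by
    ext E; simp [hS]
  have hw : ∀ T ∈ S.powerset, (randomHypergraph n k p).real {(T : Set (Finset (Fin n)))}
      = (p : ℝ) ^ T.card * (1 - (p : ℝ)) ^ (S.card - T.card) := by
    intro T hT
    rw [Finset.mem_powerset] at hT
    unfold randomHypergraph
    rw [hu, ProbabilityTheory.setBernoulli_real_singleton p (by exact_mod_cast hT)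
      (Finset.finite_toSet S), Set.ncard_coe_finset, ← Finset.coe_sdiff, Set.ncard_coe_finset,
      Finset.card_sdiff_of_subset hT]
  have h1 : expect (p : ℝ) S (fun T => if (T : Set (Finset (Fin n))) ∈ A then 1 else 0)
      = 1 - prob (p : ℝ) S (fun T => (T : Set (Finset (Fin n))) ∉ A) := by
    refine eq_sub_iff_add_eq.2 (Eq.trans ?_ (expect_const (p : ℝ) S 1))
    unfold prob expect
    rw [← Finset.sum_add_distrib]
    refine Finset.sum_congr rfl fun T _ => ?_
    by_cases h : (T : Set (Finset (Fin n))) ∈ A <;> simp [h]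
  rw [← h1]
  unfold expect
  have : IsProbabilityMeasure (randomHypergraph n k p) := by
    unfold randomHypergraph; infer_instance
  calc _ = ∑ T ∈ S.powerset.filter (fun T : Finset (Finset (Fin n)) =>
              (T : Set (Finset (Fin n))) ∈ A),
            (randomHypergraph n k p).real {(T : Set (Finset (Fin n)))} := by
        rw [Finset.sum_filter]
        refine Finset.sum_congr rfl fun T hT => ?_
        by_cases h : (T : Set (Finset (Fin n))) ∈ A
        · simp only [h, if_true, mul_one, hw T hT]
        · simp only [h, if_false, mul_zero]
    _ = (randomHypergraph n k p).real (⋃ T ∈ S.powerset.filter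
          (fun T : Finset (Finset (Fin n)) => (T : Set (Finset (Fin n))) ∈ A),
            {(T : Set (Finset (Fin n)))}) := by
        rw [measureReal_biUnion_finset]
        · intro T _ T' _ hne
          simpa [Function.onFun] using hne
        · intro T _
          exact measurableSet_singleton _
    -- Monotonicity needs no measurability of `A`, which is an arbitrary set of hypergraphs.
    _ ≤ _ := by
        refine measureReal_mono ?_ (measure_ne_top _ _)
        intro H hH
        simp only [Set.mem_iUnion, Set.mem_singleton_iff, Finset.mem_filter] at hH
        obtain ⟨T, ⟨_, hT⟩, rfl⟩ := hH
        exact hT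

end SmoothBoundary

namespace SmoothBoundary

/-! ### The breadth-first search, one generation at a time -/

/-- The set of all possible edges. -/
def kSets (n k : ℕ) : Finset (Finset (Fin n)) := Finset.powersetCard k Finset.univ

lemma mem_kSets {n k : ℕ} {E : Finset (Fin n)} : E ∈ kSets n k ↔ E.card = k := by
  simp [kSets]

/-- Active sets are discovered, and only `j`-sets are discovered. -/
structure SearchState.Valid {n : ℕ} (j : ℕ) (s : SearchState n) : Prop where
  active_subset : s.active ⊆ s.discovered
  card_eq : ∀ A ∈ s.discovered, A.card = j

open scoped Classical in
/-- The `k`-sets whose presence has not been determined before the current generation and that are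
relevant for it: they contain an active set, and no explored one. -/
noncomputable def fresh {n : ℕ} (k : ℕ) (s : SearchState n) : Finset (Finset (Fin n)) :=
  (kSets n k).filter fun E => (∃ A ∈ s.active, A ⊆ E) ∧ ∀ B ∈ s.discovered, B ⊆ E → B ∈ s.active

/-- The neutral `j`-sets in a set of vertices. -/
def newIn {n : ℕ} (j : ℕ) (s : SearchState n) (E : Finset (Fin n)) : Finset (Finset (Fin n)) :=
  (Finset.powersetCard j E).filter fun K => K ∉ s.discovered

lemma mem_fresh {n k : ℕ} {s : SearchState n} {E : Finset (Fin n)} :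
    E ∈ fresh k s ↔ E.card = k ∧ (∃ A ∈ s.active, A ⊆ E) ∧
      ∀ B ∈ s.discovered, B ⊆ E → B ∈ s.active := by
  simp [fresh, mem_kSets]

lemma mem_newIn {n j : ℕ} {s : SearchState n} {E K : Finset (Fin n)} :
    K ∈ newIn j s E ↔ K ⊆ E ∧ K.card = j ∧ K ∉ s.discovered := by
  simp [newIn, Finset.mem_powersetCard, and_assoc]

lemma fresh_subset {n k : ℕ} (s : SearchState n) : fresh k s ⊆ kSets n k :=
  Finset.filter_subset _ _

variable {n k j : ℕ}

lemma mem_searchStep_active {H : Set (Finset (Fin n))} {s : SearchState n} {K : Finset (Fin n)} :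
    K ∈ (searchStep j H s).active ↔
      K.card = j ∧ K ∉ s.discovered ∧ ∃ E ∈ H, K ⊆ E ∧ ∃ A ∈ s.active, A ⊆ E := by
  simp [searchStep, jSets]

lemma searchStep_discovered (H : Set (Finset (Fin n))) (s : SearchState n) :
    (searchStep j H s).discovered = s.discovered ∪ (searchStep j H s).active := by
  simp [searchStep]

lemma search_succ (H : Set (Finset (Fin n))) (J : Finset (Fin n)) (i : ℕ) :
    search j H J (i + 1) = searchStep j H (search j H J i) := rfl

lemma search_discovered_succ (H : Set (Finset (Fin n))) (J : Finset (Fin n)) (i : ℕ) :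
    (search j H J (i + 1)).discovered
      = (search j H J i).discovered ∪ (search j H J (i + 1)).active :=
  searchStep_discovered _ _

lemma search_valid (H : Set (Finset (Fin n))) {J : Finset (Fin n)} (hJ : J.card = j) (i : ℕ) :
    (search j H J i).Valid j := by
  induction i with
  | zero => exact ⟨subset_rfl, fun A hA => by rw [Finset.mem_singleton.1 hA, hJ]⟩
  | succ i ih =>
    constructor
    · rw [search_discovered_succ]; exact Finset.subset_union_right
    · intro A hA
      rw [search_discovered_succ, Finset.mem_union] at hA
      rcases hA with h | h
      · exact ih.card_eq A h
      · exact (mem_searchStep_active.1 h).1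

lemma search_discovered_mono (H : Set (Finset (Fin n))) (J : Finset (Fin n)) :
    Monotone fun i => (search j H J i).discovered :=
  monotone_nat_of_le_succ fun i => by
    simp only [search_discovered_succ]; exact Finset.subset_union_left

lemma search_active_disjoint (H : Set (Finset (Fin n))) (J : Finset (Fin n)) (i : ℕ) :
    Disjoint (search j H J i).discovered (search j H J (i + 1)).active := by
  rw [Finset.disjoint_right]
  intro K hK
  exact (mem_searchStep_active.1 hK).2.1

/-- Every `j`-set in an edge that contains an explored set is discovered. -/
lemma search_closed (H : Set (Finset (Fin n))) {J : Finset (Fin n)} (i : ℕ)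
    {B E K : Finset (Fin n)} (hB : B ∈ (search j H J i).discovered)
    (hB' : B ∉ (search j H J i).active) (hE : E ∈ H) (hBE : B ⊆ E) (hKE : K ⊆ E)
    (hK : K.card = j) : K ∈ (search j H J i).discovered := by
  induction i with
  | zero => exact absurd hB hB'
  | succ i ih =>
    rw [search_discovered_succ, Finset.mem_union] at hB ⊢
    have hBi := hB.resolve_right hB'
    by_cases h : B ∈ (search j H J i).active
    · by_cases hKi : K ∈ (search j H J i).discovered
      · exact Or.inl hKi
      · exact Or.inr (mem_searchStep_active.2 ⟨hK, hKi, E, hE, hKE, B, h, hBE⟩)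
    · exact Or.inl (ih hBi h)

/-- The next generation is determined by the fresh edges. -/
lemma search_active_succ {T : Finset (Finset (Fin n))} (hT : T ⊆ kSets n k)
    {J : Finset (Fin n)} (i : ℕ) :
    (search j (T : Set (Finset (Fin n))) J (i + 1)).active
      = (T ∩ fresh k (search j T J i)).biUnion (newIn j (search j T J i)) := by
  ext K
  rw [search_succ, mem_searchStep_active]
  simp only [Finset.mem_biUnion, Finset.mem_inter, mem_newIn, mem_fresh]
  constructor
  · rintro ⟨hK, hKD, E, hE, hKE, A, hA, hAE⟩
    refine ⟨E, ⟨hE, mem_kSets.1 (hT hE), ⟨A, hA, hAE⟩, fun B hB hBE => ?_⟩, hKE, hK, hKD⟩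
    by_contra hB'
    exact hKD (search_closed _ i hB hB' hE hBE hKE hK)
  · rintro ⟨E, ⟨hE, _, ⟨A, hA, hAE⟩, _⟩, hKE, hK, hKD⟩
    exact ⟨hK, hKD, E, hE, hKE, A, hA, hAE⟩

lemma searchStep_congr {H H' : Set (Finset (Fin n))} {s : SearchState n}
    (h : ∀ E, (∃ A ∈ s.active, A ⊆ E) → (E ∈ H ↔ E ∈ H')) :
    searchStep j H s = searchStep j H' s := by
  have : (searchStep j H s).active = (searchStep j H' s).active := by
    ext K
    simp only [mem_searchStep_active]
    refine and_congr_right fun _ => and_congr_right fun _ => exists_congr fun E => ?_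
    constructor
    · rintro ⟨hE, hKE, hA⟩; exact ⟨(h E hA).1 hE, hKE, hA⟩
    · rintro ⟨hE, hKE, hA⟩; exact ⟨(h E hA).2 hE, hKE, hA⟩
  have hd : (searchStep j H s).discovered = (searchStep j H' s).discovered := by
    rw [searchStep_discovered, searchStep_discovered, this]
  cases h1 : searchStep j H s
  cases h2 : searchStep j H' s
  simp_all

/-- The state of the search does not depend on the edges that are fresh in this state. -/
lemma search_congr {T T' : Finset (Finset (Fin n))}
    {J : Finset (Fin n)} (hJ : J.card = j) (i : ℕ)
    (h : ∀ E ∉ fresh k (search j (T : Set (Finset (Fin n))) J i), (E ∈ T ↔ E ∈ T')) :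
    search j (T' : Set (Finset (Fin n))) J i = search j (T : Set (Finset (Fin n))) J i := by
  suffices ∀ m ≤ i, search j (T' : Set (Finset (Fin n))) J m
      = search j (T : Set (Finset (Fin n))) J m from this i le_rfl
  intro m
  induction m with
  | zero => intro _; rfl
  | succ m ih =>
    intro hm
    rw [search_succ, search_succ, ih (by omega)]
    symm
    refine searchStep_congr fun E hE => ?_
    obtain ⟨A, hA, hAE⟩ := hE
    -- An edge used in an earlier generation m < i contains a set A that was active then. If the
    -- edge were fresh in generation i, then A would have to be active again, but generation i is
    -- disjoint from what was discovered before it.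
    refine h E fun hf => ?_
    obtain ⟨i, rfl⟩ : ∃ i', i = i' + 1 := ⟨i - 1, by omega⟩
    have hAD : A ∈ (search j (T : Set (Finset (Fin n))) J i).discovered :=
      search_discovered_mono _ _ (by omega : m ≤ i) ((search_valid _ hJ m).active_subset hA)
    have hAD' : A ∈ (search j (T : Set (Finset (Fin n))) J (i + 1)).discovered :=
      search_discovered_mono _ _ (by omega : i ≤ i + 1) hAD
    exact Finset.disjoint_left.1 (search_active_disjoint _ _ _) hAD
      ((mem_fresh.1 hf).2.2 A hAD' hAE)

/-- The fresh edges are independent of the state of the search: a bound for the expectation of a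
function of the state and the fresh edges follows from bounds for fixed states. -/
lemma expect_search_le {p : ℝ} (hp0 : 0 ≤ p) (hp1 : p ≤ 1) {J : Finset (Fin n)} (hJ : J.card = j)
    (i : ℕ) (Φ : SearchState n → Finset (Finset (Fin n)) → ℝ) (b : SearchState n → ℝ)
    (h : ∀ s : SearchState n, s.Valid j → expect p (fresh k s) (Φ s) ≤ b s) :
    expect p (kSets n k) (fun T => Φ (search j T J i) (T ∩ fresh k (search j T J i)))
      ≤ expect p (kSets n k) (fun T => b (search j T J i)) := by
  classical
  set S := kSets n k
  set σ : Finset (Finset (Fin n)) → SearchState n := fun T => search j T J i with hσ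
  set I := S.powerset.image σ with hI
  -- Conditioning on the state is a finite decomposition according to its value.
  have hdec : ∀ g : Finset (Finset (Fin n)) → ℝ,
      expect p S g = ∑ s ∈ I, expect p S (fun T => if σ T = s then g T else 0) := by
    intro g
    rw [← expect_sum]
    refine expect_congr fun T hT => ?_
    rw [Finset.sum_ite_eq, if_pos (Finset.mem_image_of_mem σ (Finset.mem_powerset.2 hT))]
  rw [hdec, hdec]
  refine Finset.sum_le_sum fun s hs => ?_
  obtain ⟨T₀, hT₀, rfl⟩ := Finset.mem_image.1 hs
  set s := σ T₀ with hs'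
  have hval : s.Valid j := search_valid _ hJ i
  set F := fresh k s with hF
  have hFS : F ⊆ S := fresh_subset s
  have hsplit : S = (S \ F) ∪ F := (Finset.sdiff_union_of_subset hFS).symm
  have hdisj : Disjoint (S \ F) F := Finset.sdiff_disjoint
  -- The event that the state equals s is decided by the edges outside `F`. Hence, given this event,
  -- the edges inside `F` are still p-random.
  have hiff : ∀ T₁ ⊆ S \ F, ∀ T₂ ⊆ F, σ (T₁ ∪ T₂) = s ↔ σ T₁ = s := by
    intro T₁ h₁ T₂ h₂
    have hT₁ : T₁ ⊆ S := h₁.trans Finset.sdiff_subset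
    have hT : T₁ ∪ T₂ ⊆ S := Finset.union_subset hT₁ (h₂.trans hFS)
    have hagree : ∀ E ∉ F, (E ∈ T₁ ∪ T₂ ↔ E ∈ T₁) := fun E hE => by
      rw [Finset.mem_union]; exact or_iff_left fun h => hE (h₂ h)
    constructor
    · intro h
      rw [← h]
      refine search_congr (k := k) hJ i fun E hE => hagree E ?_
      rw [hF, ← h]; exact hE
    · intro h
      rw [← h]
      refine search_congr (k := k) hJ i fun E hE => (hagree E ?_).symm
      rw [hF, ← h]; exact hE
  rw [hsplit, expect_union p hdisj, expect_union p hdisj]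
  refine expect_mono hp0 hp1 fun T₁ h₁ => ?_
  by_cases hσ₁ : σ T₁ = s
  · have e1 : expect p F (fun T₂ => if σ (T₁ ∪ T₂) = s then
        Φ (σ (T₁ ∪ T₂)) ((T₁ ∪ T₂) ∩ fresh k (σ (T₁ ∪ T₂))) else 0) = expect p F (Φ s) := by
      refine expect_congr fun T₂ h₂ => ?_
      rw [if_pos ((hiff T₁ h₁ T₂ h₂).2 hσ₁), (hiff T₁ h₁ T₂ h₂).2 hσ₁]
      congr 1
      rw [Finset.union_inter_distrib_right, Finset.inter_eq_left.2 h₂,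
        Finset.disjoint_iff_inter_eq_empty.1 (hdisj.mono_left h₁), Finset.empty_union]
    have e2 : expect p F (fun T₂ => if σ (T₁ ∪ T₂) = s then b (σ (T₁ ∪ T₂)) else 0) = b s := by
      rw [← expect_const p F (b s)]
      refine expect_congr fun T₂ h₂ => ?_
      rw [if_pos ((hiff T₁ h₁ T₂ h₂).2 hσ₁), (hiff T₁ h₁ T₂ h₂).2 hσ₁]
    rw [e1, e2]
    exact h s hval
  · have e1 : ∀ g : Finset (Finset (Fin n)) → ℝ,
        expect p F (fun T₂ => if σ (T₁ ∪ T₂) = s then g (T₁ ∪ T₂) else 0) = 0 := by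
      intro g
      refine Eq.trans ?_ (expect_const p F 0)
      refine expect_congr fun T₂ h₂ => ?_
      rw [if_neg fun h => hσ₁ ((hiff T₁ h₁ T₂ h₂).1 h)]
    rw [e1 fun T => Φ (σ T) (T ∩ fresh k (σ T)), e1 fun T => b (σ T)]

/-- A bound for the probability of an event that concerns the state and the fresh edges. -/
lemma prob_search_le {p : ℝ} (hp0 : 0 ≤ p) (hp1 : p ≤ 1) {J : Finset (Fin n)} (hJ : J.card = j)
    (i : ℕ) (P : SearchState n → Finset (Finset (Fin n)) → Prop) (b : ℝ)
    (h : ∀ s : SearchState n, s.Valid j → prob p (fresh k s) (P s) ≤ b) :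
    prob p (kSets n k) (fun T => P (search j T J i) (T ∩ fresh k (search j T J i))) ≤ b := by
  classical
  have := expect_search_le (k := k) hp0 hp1 hJ i (fun s T => if P s T then (1 : ℝ) else 0)
    (fun _ => b) (fun s hs => le_trans (le_of_eq (by unfold prob; congr!)) (h s hs))
  rw [expect_const] at this
  refine le_trans (le_of_eq ?_) this
  unfold prob
  congr!

/-- A function of the state whose conditional expectation does not increase has its expectation
bounded by the initial value. -/
lemma expect_search_le_of_supermartingale {p : ℝ} (hp0 : 0 ≤ p) (hp1 : p ≤ 1)
    {J : Finset (Fin n)} (hJ : J.card = j) (f : SearchState n → ℝ)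
    (h : ∀ s : SearchState n, s.Valid j → expect p (fresh k s) (fun T =>
      f ⟨s.discovered ∪ T.biUnion (newIn j s), T.biUnion (newIn j s)⟩) ≤ f s) (i : ℕ) :
    expect p (kSets n k) (fun T => f (search j T J i)) ≤ f ⟨{J}, {J}⟩ := by
  induction i with
  | zero =>
    simp only [search]
    rw [expect_const]
  | succ i ih =>
    refine le_trans ?_ ih
    refine le_trans (le_of_eq ?_) (expect_search_le hp0 hp1 hJ i (fun s T =>
      f ⟨s.discovered ∪ T.biUnion (newIn j s), T.biUnion (newIn j s)⟩) f h)
    refine expect_congr fun T hT => ?_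
    congr 1
    have h1 := search_active_succ (j := j) hT (J := J) i
    have h2 := search_discovered_succ (j := j) (T : Set (Finset (Fin n))) J i
    rw [← h1, ← h2]

end SmoothBoundary

namespace SmoothBoundary

/-! ### Counting edges around sets of vertices -/

variable {n k j : ℕ}

/-- The `k`-sets that contain `X`. -/
def superSets (k : ℕ) (X : Finset (Fin n)) : Finset (Finset (Fin n)) :=
  (kSets n k).filter fun E => X ⊆ E

/-- The normalised number of sets that contain `X`. -/
noncomputable def wt (X : Finset (Fin n)) : ℝ := ((n : ℝ) ^ X.card)⁻¹

lemma mem_superSets {X E : Finset (Fin n)} : E ∈ superSets k X ↔ E.card = k ∧ X ⊆ E := by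
  simp [superSets, mem_kSets]

lemma card_filter_powersetCard_superset {α : Type*} [DecidableEq α] {X Y : Finset α} (h : X ⊆ Y)
    {m : ℕ} (hm : X.card ≤ m) :
    ((Y.powersetCard m).filter fun E => X ⊆ E).card = (Y.card - X.card).choose (m - X.card) := by
  rw [← Finset.card_sdiff_of_subset h, ← Finset.card_powersetCard]
  refine Finset.card_bij' (fun E _ => E \ X) (fun E _ => E ∪ X) ?_ ?_ ?_ ?_
  · intro E hE
    simp only [Finset.mem_filter, Finset.mem_powersetCard] at hE ⊢
    exact ⟨Finset.sdiff_subset_sdiff hE.1.1 subset_rfl,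
      by rw [Finset.card_sdiff_of_subset hE.2, hE.1.2]⟩
  · intro E hE
    simp only [Finset.mem_filter, Finset.mem_powersetCard] at hE ⊢
    have hd : Disjoint E X := (Finset.subset_sdiff.1 hE.1).2
    refine ⟨⟨Finset.union_subset (hE.1.trans Finset.sdiff_subset) h, ?_⟩,
      Finset.subset_union_right⟩
    rw [Finset.card_union_of_disjoint hd, hE.2]; omega
  · intro E hE
    simp only [Finset.mem_filter] at hE
    exact Finset.sdiff_union_of_subset hE.2
  · intro E hE
    simp only [Finset.mem_powersetCard] at hE
    have hd : Disjoint E X := (Finset.subset_sdiff.1 hE.1).2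
    rw [Finset.union_sdiff_right, Finset.sdiff_eq_self_of_disjoint hd]

lemma card_superSets {X : Finset (Fin n)} (h : X.card ≤ k) :
    (superSets k X).card = (n - X.card).choose (k - X.card) := by
  unfold superSets kSets
  rw [card_filter_powersetCard_superset (Finset.subset_univ X) h, Finset.card_univ,
    Fintype.card_fin]

lemma superSets_eq_empty {X : Finset (Fin n)} (h : k < X.card) : superSets k X = ∅ := by
  rw [Finset.eq_empty_iff_forall_notMem]
  intro E hE
  rw [mem_superSets] at hE
  have := Finset.card_le_card hE.2
  omega

lemma wt_nonneg (X : Finset (Fin n)) : 0 ≤ wt X := by unfold wt; positivity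

lemma card_superSets_le (hn : 0 < n) (X : Finset (Fin n)) :
    ((superSets k X).card : ℝ) ≤ (n : ℝ) ^ k * wt X := by
  have hn' : (0 : ℝ) < n := by exact_mod_cast hn
  rcases le_or_gt X.card k with h | h
  · rw [card_superSets h, wt, ← div_eq_mul_inv, le_div_iff₀ (by positivity)]
    calc ((n - X.card).choose (k - X.card) : ℝ) * (n : ℝ) ^ X.card
        ≤ (n : ℝ) ^ (k - X.card) * (n : ℝ) ^ X.card := by
          gcongr
          exact_mod_cast (Nat.choose_le_pow _ _).trans (Nat.pow_le_pow_left (Nat.sub_le _ _) _)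
      _ = (n : ℝ) ^ k := by rw [← pow_add]; congr 1; omega
  · rw [superSets_eq_empty h]
    simpa using mul_nonneg (by positivity) (wt_nonneg X)

lemma wt_union_mul (hn : 0 < n) (X Y : Finset (Fin n)) :
    wt (X ∪ Y) = wt X * wt Y * (n : ℝ) ^ (X ∩ Y).card := by
  have hn' : (0 : ℝ) < n := by exact_mod_cast hn
  have h : (n : ℝ) ^ (X ∪ Y).card * (n : ℝ) ^ (X ∩ Y).card
      = (n : ℝ) ^ X.card * (n : ℝ) ^ Y.card := by
    rw [← pow_add, ← pow_add, Finset.card_union_add_card_inter]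
  unfold wt
  field_simp
  linarith

/-- All degrees in the family `D` of `j`-sets are at most a `β`-fraction of their maximum. -/
def Sparse (j : ℕ) (β : ℝ) (D : Finset (Finset (Fin n))) : Prop :=
  ∀ W : Finset (Fin n), W.card < j → (degree D W : ℝ) ≤ β * (n : ℝ) ^ j * wt W

lemma degree_mono {D D' : Finset (Finset (Fin n))} (h : D ⊆ D') (W : Finset (Fin n)) :
    degree D W ≤ degree D' W :=
  Finset.card_le_card (Finset.filter_subset_filter _ h)

lemma Sparse.mono {β : ℝ} {D D' : Finset (Finset (Fin n))} (h : Sparse j β D') (hD : D ⊆ D') :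
    Sparse j β D :=
  fun W hW => le_trans (by exact_mod_cast degree_mono hD W) (h W hW)

/-- In a sparse family, few sets lie close to a given set without being contained in it. -/
lemma Sparse.sum_wt_union_le (hn : 0 < n) {β : ℝ} (hβ : 0 ≤ β) {D : Finset (Finset (Fin n))}
    (h : Sparse j β D) (hcard : ∀ B ∈ D, B.card = j) (X : Finset (Fin n)) :
    ∑ B ∈ D.filter (fun B => ¬ B ⊆ X), wt (X ∪ B) ≤ 2 ^ X.card * (β * wt X) := by
  have hn' : (0 : ℝ) < n := by exact_mod_cast hn
  -- The weight of X ∪ B depends only on the size of the trace W = B ∩ X, and the sets with trace W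
  -- are among those counted by the degree of W. A trace of size j would put B inside X.
  rw [← Finset.sum_fiberwise_of_maps_to (t := X.powerset) (g := fun B => B ∩ X)
    (fun B _ => Finset.mem_powerset.2 Finset.inter_subset_right)]
  have hcp : (2 : ℝ) ^ X.card * (β * wt X) = X.powerset.card • (β * wt X) := by
    rw [nsmul_eq_mul, Finset.card_powerset]; push_cast; ring
  rw [hcp]
  refine Finset.sum_le_card_nsmul _ _ _ fun W _ => ?_
  by_cases hW : W.card < j
  · calc ∑ B ∈ (D.filter fun B => ¬ B ⊆ X).filter (fun B => B ∩ X = W), wt (X ∪ B)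
        = ∑ B ∈ (D.filter fun B => ¬ B ⊆ X).filter (fun B => B ∩ X = W),
            wt X * (((n : ℝ) ^ j)⁻¹ * (n : ℝ) ^ W.card) := by
          refine Finset.sum_congr rfl fun B hB => ?_
          simp only [Finset.mem_filter] at hB
          rw [wt_union_mul hn, Finset.inter_comm, hB.2, mul_assoc]
          unfold wt
          rw [hcard B hB.1.1]
      _ ≤ ∑ B ∈ D.filter (fun B => W ⊆ B), wt X * (((n : ℝ) ^ j)⁻¹ * (n : ℝ) ^ W.card) := by
          refine Finset.sum_le_sum_of_subset_of_nonneg ?_ ?_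
          · intro B hB
            simp only [Finset.mem_filter] at hB ⊢
            exact ⟨hB.1.1, hB.2 ▸ Finset.inter_subset_left⟩
          · intro B _ _
            exact mul_nonneg (wt_nonneg _) (by positivity)
      _ = (degree D W : ℝ) * (wt X * (((n : ℝ) ^ j)⁻¹ * (n : ℝ) ^ W.card)) := by
          rw [Finset.sum_const, nsmul_eq_mul]; rfl
      _ ≤ (β * (n : ℝ) ^ j * wt W) * (wt X * (((n : ℝ) ^ j)⁻¹ * (n : ℝ) ^ W.card)) :=
          mul_le_mul_of_nonneg_right (h W hW) (mul_nonneg (wt_nonneg _) (by positivity))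
      _ = β * wt X := by
          unfold wt
          field_simp
  · rw [Finset.sum_eq_zero]
    · exact mul_nonneg hβ (wt_nonneg X)
    · intro B hB
      simp only [Finset.mem_filter] at hB
      exfalso
      have hBW : W ⊆ B := hB.2 ▸ Finset.inter_subset_left
      have : W = B := Finset.eq_of_subset_of_card_le hBW (by rw [hcard B hB.1.1]; omega)
      apply hB.1.2
      rw [← this, ← hB.2]
      exact Finset.inter_subset_right

/-- A sum over fresh edges is at most the corresponding sum over active sets and edges
containing them. -/
lemma sum_fresh_le (s : SearchState n) (f : Finset (Fin n) → ℝ)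
    (g : Finset (Fin n) → Finset (Fin n) → ℝ) (hg : ∀ A E, 0 ≤ g A E)
    (h : ∀ E ∈ fresh k s, ∀ A ∈ s.active, A ⊆ E → f E ≤ g A E) :
    ∑ E ∈ fresh k s, f E ≤ ∑ A ∈ s.active, ∑ E ∈ superSets k A, g A E := by
  unfold superSets
  simp_rw [Finset.sum_filter]
  rw [Finset.sum_comm]
  calc ∑ E ∈ fresh k s, f E
      ≤ ∑ E ∈ fresh k s, ∑ A ∈ s.active, if A ⊆ E then g A E else 0 := by
        refine Finset.sum_le_sum fun E hE => ?_
        obtain ⟨-, ⟨A, hA, hAE⟩, -⟩ := mem_fresh.1 hE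
        refine (h E hE A hA hAE).trans ?_
        have := Finset.single_le_sum (f := fun A => if A ⊆ E then g A E else 0)
          (fun A _ => by split_ifs <;> [exact hg A E; exact le_rfl]) hA
        simpa [hAE] using this
    _ ≤ _ := by
        refine Finset.sum_le_sum_of_subset_of_nonneg (fresh_subset s) fun E _ _ => ?_
        exact Finset.sum_nonneg fun A _ => by split_ifs <;> [exact hg A E; exact le_rfl]

/-- The number of members of `G` close to `L`, where closer ones have more weight. -/
noncomputable def weightSum (L : Finset (Fin n)) (G : Finset (Finset (Fin n))) : ℝ :=
  ∑ A ∈ G, (n : ℝ) ^ (A ∩ L).card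

/-- Sum over the possible values Z of E ∩ L. Requiring an edge to contain the vertices of Z \ A
costs a factor n for each of them, which cancels against n^|Z| except for the vertices of A ∩ Z. -/
lemma sum_pow_inter_le (hn : 0 < n) (A L : Finset (Fin n)) :
    ∑ E ∈ superSets k A, (n : ℝ) ^ (E ∩ L).card
      ≤ 2 ^ L.card * ((n : ℝ) ^ k * wt A * (n : ℝ) ^ (A ∩ L).card) := by
  have hn' : (0 : ℝ) < n := by exact_mod_cast hn
  have hn1 : (1 : ℝ) ≤ n := by exact_mod_cast hn
  calc ∑ E ∈ superSets k A, (n : ℝ) ^ (E ∩ L).card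
      ≤ ∑ E ∈ superSets k A, ∑ Z ∈ L.powerset, if Z ⊆ E then (n : ℝ) ^ Z.card else 0 := by
        refine Finset.sum_le_sum fun E _ => ?_
        have := Finset.single_le_sum (s := L.powerset)
          (f := fun Z => if Z ⊆ E then (n : ℝ) ^ Z.card else 0)
          (fun Z _ => by split_ifs <;> positivity)
          (Finset.mem_powerset.2 (Finset.inter_subset_right : E ∩ L ⊆ L))
        simpa [Finset.inter_subset_left] using this
    _ = ∑ Z ∈ L.powerset, ((superSets k (A ∪ Z)).card : ℝ) * (n : ℝ) ^ Z.card := by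
        rw [Finset.sum_comm]
        refine Finset.sum_congr rfl fun Z _ => ?_
        rw [← Finset.sum_filter, Finset.sum_const, nsmul_eq_mul]
        congr 3
        ext E
        simp only [superSets, Finset.mem_filter, Finset.union_subset_iff]
        tauto
    _ ≤ ∑ Z ∈ L.powerset, (n : ℝ) ^ k * wt A * (n : ℝ) ^ (A ∩ L).card := by
        refine Finset.sum_le_sum fun Z hZ => ?_
        refine (mul_le_mul_of_nonneg_right (card_superSets_le hn _) (by positivity)).trans ?_
        rw [wt_union_mul hn]
        have h1 : (n : ℝ) ^ (A ∩ Z).card ≤ (n : ℝ) ^ (A ∩ L).card :=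
          pow_le_pow_right₀ hn1 (Finset.card_le_card
            (Finset.inter_subset_inter_left (Finset.mem_powerset.1 hZ)))
        have h2 : wt Z * (n : ℝ) ^ Z.card = 1 := by unfold wt; field_simp
        calc (n : ℝ) ^ k * (wt A * wt Z * (n : ℝ) ^ (A ∩ Z).card) * (n : ℝ) ^ Z.card
            = (n : ℝ) ^ k * wt A * (n : ℝ) ^ (A ∩ Z).card * (wt Z * (n : ℝ) ^ Z.card) := by ring
          _ ≤ _ := by
            rw [h2, mul_one]
            exact mul_le_mul_of_nonneg_left h1 (mul_nonneg (by positivity) (wt_nonneg A))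
    _ = _ := by
        rw [Finset.sum_const, nsmul_eq_mul, Finset.card_powerset]; push_cast; ring

lemma wt_of_card {A : Finset (Fin n)} (h : A.card = j) : wt A = ((n : ℝ) ^ j)⁻¹ := by
  rw [wt, h]

lemma sum_active_pow_inter_le (hn : 0 < n) {s : SearchState n} (hs : s.Valid j)
    (L : Finset (Fin n)) :
    ∑ A ∈ s.active, ∑ E ∈ superSets k A, (n : ℝ) ^ (E ∩ L).card
      ≤ 2 ^ L.card * ((n : ℝ) ^ k * ((n : ℝ) ^ j)⁻¹) * weightSum L s.active := by
  unfold weightSum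
  rw [Finset.mul_sum]
  refine Finset.sum_le_sum fun A hA => (sum_pow_inter_le hn A L).trans (le_of_eq ?_)
  rw [wt_of_card (hs.card_eq A (hs.active_subset hA))]
  ring

/-- A neutral set is contained in few fresh edges. -/
lemma card_fresh_filter_le (hn : 0 < n) {β : ℝ} (hβ : 0 ≤ β) {s : SearchState n}
    (hs : s.Valid j) (hD : Sparse j β s.discovered) {K : Finset (Fin n)} (hK : K.card = j)
    (hK' : K ∉ s.discovered) :
    (((fresh k s).filter fun E => K ⊆ E).card : ℝ)
      ≤ 2 ^ j * β * ((n : ℝ) ^ k * ((n : ℝ) ^ j)⁻¹) := by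
  have hsub : (fresh k s).filter (fun E => K ⊆ E)
      ⊆ (s.discovered.filter fun B => ¬ B ⊆ K).biUnion fun B => superSets k (K ∪ B) := by
    intro E hE
    rw [Finset.mem_filter, mem_fresh] at hE
    obtain ⟨⟨hEk, ⟨A, hA, hAE⟩, -⟩, hKE⟩ := hE
    have hAD := hs.active_subset hA
    simp only [Finset.mem_biUnion, Finset.mem_filter]
    refine ⟨A, ⟨hAD, fun hAK => hK' ?_⟩, mem_superSets.2 ⟨hEk, Finset.union_subset hKE hAE⟩⟩
    rwa [← Finset.eq_of_subset_of_card_le hAK (by rw [hK, hs.card_eq A hAD])]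
  calc (((fresh k s).filter fun E => K ⊆ E).card : ℝ)
      ≤ ∑ B ∈ s.discovered.filter (fun B => ¬ B ⊆ K), ((superSets k (K ∪ B)).card : ℝ) := by
        exact_mod_cast (Finset.card_le_card hsub).trans Finset.card_biUnion_le
    _ ≤ ∑ B ∈ s.discovered.filter (fun B => ¬ B ⊆ K), (n : ℝ) ^ k * wt (K ∪ B) :=
        Finset.sum_le_sum fun B _ => card_superSets_le hn _
    _ ≤ (n : ℝ) ^ k * (2 ^ K.card * (β * wt K)) := by
        rw [← Finset.mul_sum]
        exact mul_le_mul_of_nonneg_left (hD.sum_wt_union_le hn hβ hs.card_eq K) (by positivity)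
    _ = _ := by rw [wt_of_card hK, hK]; ring

/-- The neutral `j`-sets in `E` that contain `L`. -/
def newAt (j : ℕ) (s : SearchState n) (L E : Finset (Fin n)) : Finset (Finset (Fin n)) :=
  (newIn j s E).filter fun K => L ⊆ K

lemma degree_biUnion_newIn (s : SearchState n) (T : Finset (Finset (Fin n)))
    (L : Finset (Fin n)) :
    degree (T.biUnion (newIn j s)) L = (T.biUnion (newAt j s L)).card := by
  unfold degree newAt
  rw [Finset.filter_biUnion]

lemma card_newIn_le (s : SearchState n) {E : Finset (Fin n)} (hE : E.card = k) :
    (newIn j s E).card ≤ 2 ^ k := by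
  rw [← hE, ← Finset.card_powerset]
  refine Finset.card_le_card fun K hK => Finset.mem_powerset.2 (mem_newIn.1 hK).1

lemma card_newAt_le (s : SearchState n) (L : Finset (Fin n)) {E : Finset (Fin n)}
    (hE : E.card = k) : (newAt j s L E).card ≤ 2 ^ k :=
  (Finset.card_le_card (Finset.filter_subset _ _)).trans (card_newIn_le s hE)

/-- The number of triples of an active set `A`, an edge `E` containing it and a `j`-set `K ≠ A` with
`L ⊆ K ⊆ E`. -/
noncomputable def pivotJump (k j : ℕ) (L : Finset (Fin n)) (G : Finset (Finset (Fin n))) : ℝ :=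
  ∑ A ∈ G, if L ⊆ A then
    ((n - j).choose (k - j) : ℝ) * (((k - L.card).choose (j - L.card) : ℝ) - 1)
  else ((superSets k (A ∪ L)).card : ℝ) * ((k - L.card).choose (j - L.card) : ℝ)

/-- The set A is itself one of the j-sets between `L` and the edge exactly when it is a pivot. This
is where the -1 in the branching ratio comes from. -/
lemma sum_card_between (hjk : j ≤ k) {A L : Finset (Fin n)} (hA : A.card = j) (hL : L.card ≤ j) :
    ∑ E ∈ superSets k (A ∪ L),
        ((((E.powersetCard j).filter fun K => L ⊆ K).erase A).card : ℝ)
      = if L ⊆ A then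
          ((n - j).choose (k - j) : ℝ) * (((k - L.card).choose (j - L.card) : ℝ) - 1)
        else ((superSets k (A ∪ L)).card : ℝ) * ((k - L.card).choose (j - L.card) : ℝ) := by
  have hcard : ∀ E ∈ superSets k (A ∪ L), ((E.powersetCard j).filter fun K => L ⊆ K).card
      = (k - L.card).choose (j - L.card) := by
    intro E hE
    rw [mem_superSets] at hE
    rw [card_filter_powersetCard_superset (Finset.subset_union_right.trans hE.2) hL, hE.1]
  split_ifs with h
  · have hAL : A ∪ L = A := Finset.union_eq_left.2 h
    rw [Finset.sum_congr rfl (g := fun _ => ((k - L.card).choose (j - L.card) : ℝ) - 1)]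
    · rw [Finset.sum_const, nsmul_eq_mul, hAL, card_superSets (hA.trans_le hjk), hA]
    · intro E hE
      rw [Finset.card_erase_of_mem, Nat.cast_sub, hcard E hE, Nat.cast_one]
      · rw [hcard E hE]
        exact Nat.choose_pos (by omega)
      · rw [mem_superSets, hAL] at hE
        simp [Finset.mem_powersetCard, hA, h, hE.2]
  · rw [Finset.sum_congr rfl (g := fun _ => ((k - L.card).choose (j - L.card) : ℝ))]
    · rw [Finset.sum_const, nsmul_eq_mul]
    · intro E hE
      rw [Finset.erase_eq_of_notMem (by simp [h]), hcard E hE]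

lemma newAt_subset_erase {s : SearchState n} {A : Finset (Fin n)} (hA : A ∈ s.discovered)
    (L E : Finset (Fin n)) :
    newAt j s L E ⊆ ((E.powersetCard j).filter fun K => L ⊆ K).erase A := by
  intro K hK
  simp only [newAt, Finset.mem_filter, mem_newIn] at hK
  simp only [Finset.mem_erase, Finset.mem_filter, Finset.mem_powersetCard]
  exact ⟨fun h => hK.1.2.2 (h ▸ hA), ⟨hK.1.1, hK.1.2.1⟩, hK.2⟩

/-- Counting an edge once for each active set in it, and counting its discovered j-sets other than A
as if they were new, can only increase the sum. Hence there is no error term in this direction. -/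
lemma sum_card_newAt_le (hjk : j ≤ k) {s : SearchState n} (hs : s.Valid j)
    {L : Finset (Fin n)} (hL : L.card ≤ j) :
    ∑ E ∈ fresh k s, ((newAt j s L E).card : ℝ) ≤ pivotJump k j L s.active := by
  classical
  refine (sum_fresh_le s _ (fun A E => if L ⊆ E then
    ((((E.powersetCard j).filter fun K => L ⊆ K).erase A).card : ℝ) else 0)
    (fun A E => by split_ifs <;> positivity) ?_).trans (le_of_eq ?_)
  · intro E hE A hA hAE
    split_ifs with hLE
    · exact_mod_cast Finset.card_le_card (newAt_subset_erase (hs.active_subset hA) L E)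
    · have : newAt j s L E = ∅ := by
        rw [Finset.eq_empty_iff_forall_notMem]
        intro K hK
        simp only [newAt, Finset.mem_filter, mem_newIn] at hK
        exact hLE (hK.2.trans hK.1.1)
      simp [this]
  · unfold pivotJump
    refine Finset.sum_congr rfl fun A hA => ?_
    rw [← sum_card_between hjk (hs.card_eq A (hs.active_subset hA)) hL, ← Finset.sum_filter]
    refine Finset.sum_congr ?_ fun _ _ => rfl
    ext E
    simp only [superSets, Finset.mem_filter, Finset.union_subset_iff]
    tauto

open scoped Classical in
/-- Edges around `A` and `L` with a second discovered set. -/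
noncomputable def spoiled (k : ℕ) (s : SearchState n) (L A : Finset (Fin n)) :
    Finset (Finset (Fin n)) :=
  (superSets k (A ∪ L)).filter fun E => ∃ B ∈ s.discovered, B ≠ A ∧ B ⊆ E

/-- In an edge around A ∪ L that is not spoiled, A is the only discovered set. Such an edge is
therefore fresh, it determines A, and every other j-set in it is neutral, so nothing is counted
twice. A spoiled edge costs at most 2^k. -/
lemma le_sum_card_newAt (hjk : j ≤ k) {s : SearchState n} (hs : s.Valid j)
    {L : Finset (Fin n)} (hL : L.card ≤ j) :
    pivotJump k j L s.active - 2 ^ k * ∑ A ∈ s.active, ((spoiled k s L A).card : ℝ)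
      ≤ ∑ E ∈ fresh k s, ((newAt j s L E).card : ℝ) := by
  classical
  have h1 : pivotJump k j L s.active - 2 ^ k * ∑ A ∈ s.active, ((spoiled k s L A).card : ℝ)
      ≤ ∑ A ∈ s.active, ∑ E ∈ superSets k (A ∪ L) \ spoiled k s L A,
        ((((E.powersetCard j).filter fun K => L ⊆ K).erase A).card : ℝ) := by
    unfold pivotJump
    rw [Finset.mul_sum, ← Finset.sum_sub_distrib]
    refine Finset.sum_le_sum fun A hA => ?_
    rw [← sum_card_between hjk (hs.card_eq A (hs.active_subset hA)) hL,
      ← Finset.sum_sdiff (Finset.filter_subset _ _ : spoiled k s L A ⊆ superSets k (A ∪ L)),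
      add_sub_assoc]
    refine add_le_of_nonpos_right (sub_nonpos.2 ?_)
    rw [mul_comm, ← nsmul_eq_mul]
    refine Finset.sum_le_card_nsmul _ _ _ fun E hE => ?_
    have hEk : E.card = k := (mem_superSets.1 (Finset.filter_subset _ _ hE)).1
    have : (((E.powersetCard j).filter fun K => L ⊆ K).erase A).card ≤ 2 ^ k := by
      rw [← hEk, ← Finset.card_powerset]
      refine Finset.card_le_card fun K hK => Finset.mem_powerset.2 ?_
      simp only [Finset.mem_erase, Finset.mem_filter, Finset.mem_powersetCard] at hK
      exact hK.2.1.1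
    exact_mod_cast this
  refine h1.trans ?_
  rw [Finset.sum_sigma']
  have hgood : ∀ x ∈ s.active.sigma (fun A => superSets k (A ∪ L) \ spoiled k s L A),
      x.2.card = k ∧ x.1 ⊆ x.2 ∧ x.1 ∈ s.active ∧ ∀ B ∈ s.discovered, B ⊆ x.2 → B = x.1 := by
    rintro ⟨A, E⟩ hx
    simp only [Finset.mem_sigma, Finset.mem_sdiff, spoiled, Finset.mem_filter, mem_superSets,
      Finset.union_subset_iff, not_and, not_exists] at hx
    refine ⟨hx.2.1.1, hx.2.1.2.1, hx.1, fun B hB hBE => ?_⟩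
    by_contra hne
    exact hx.2.2 hx.2.1 B hB hne hBE
  calc _ ≤ ∑ x ∈ s.active.sigma (fun A => superSets k (A ∪ L) \ spoiled k s L A),
        ((newAt j s L x.2).card : ℝ) := by
        refine Finset.sum_le_sum fun x hx => ?_
        obtain ⟨-, -, -, hB⟩ := hgood x hx
        have : (((x.2.powersetCard j).filter fun K => L ⊆ K).erase x.1) ⊆ newAt j s L x.2 := by
          intro K hK
          simp only [Finset.mem_erase, Finset.mem_filter, Finset.mem_powersetCard] at hK
          simp only [newAt, Finset.mem_filter, mem_newIn]
          exact ⟨⟨hK.2.1.1, hK.2.1.2, fun h => hK.1 (hB K h hK.2.1.1)⟩, hK.2.2⟩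
        exact_mod_cast Finset.card_le_card this
    _ = ∑ E ∈ (s.active.sigma (fun A => superSets k (A ∪ L) \ spoiled k s L A)).image Sigma.snd,
        ((newAt j s L E).card : ℝ) := by
        rw [Finset.sum_image]
        rintro ⟨A, E⟩ hx ⟨A', E'⟩ hx' (rfl : E = E')
        obtain ⟨-, -, -, hB⟩ := hgood _ hx
        obtain ⟨-, hA', hA'', -⟩ := hgood _ hx'
        have : A' = A := hB A' (hs.active_subset hA'') hA'
        rw [this]
    _ ≤ _ := by
        refine Finset.sum_le_sum_of_subset_of_nonneg ?_ fun _ _ _ => Nat.cast_nonneg _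
        intro E hE
        obtain ⟨x, hx, rfl⟩ := Finset.mem_image.1 hE
        obtain ⟨h1, h2, h3, h4⟩ := hgood x hx
        exact mem_fresh.2 ⟨h1, ⟨x.1, h3, h2⟩, fun B hB hBE => h4 B hB hBE ▸ h3⟩

/-- The number of pairs of a set `A` in `G` and a different set `B` in `D` contained in `A ∪ L`,
where sets `A` closer to `L` have more weight. -/
noncomputable def pairSum (q : ℝ) (L : Finset (Fin n)) (D G : Finset (Finset (Fin n))) : ℝ :=
  ∑ A ∈ G, (n / q) ^ (A ∩ L).card * ((D.filter fun B => B ≠ A ∧ B ⊆ A ∪ L).card : ℝ)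

/-- The second discovered set B either leaves A ∪ L, and then sparsity gives a factor β, or it lies
in A ∪ L and spoils all edges around A ∪ L. Sparsity is of no use in the second case, which is the
reason for `pairSum`. The power of q converts weights based on n into weights based on n/q. -/
lemma sum_card_spoiled_le (hn : 0 < n) {β q : ℝ} (hβ : 0 ≤ β) (hq : 1 ≤ q)
    {s : SearchState n} (hs : s.Valid j) (hD : Sparse j β s.discovered) (L : Finset (Fin n)) :
    ∑ A ∈ s.active, ((spoiled k s L A).card : ℝ)
      ≤ (n : ℝ) ^ k * ((n : ℝ) ^ j)⁻¹ * wt L * (2 ^ (j + L.card) * β * weightSum L s.active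
          + q ^ L.card * pairSum q L s.discovered s.active) := by
  have hn' : (0 : ℝ) < n := by exact_mod_cast hn
  unfold weightSum pairSum
  rw [Finset.mul_sum, Finset.mul_sum, ← Finset.sum_add_distrib, Finset.mul_sum]
  refine Finset.sum_le_sum fun A hA => ?_
  have hAj := hs.card_eq A (hs.active_subset hA)
  set X := A ∪ L with hX
  set Q := s.discovered.filter fun B => B ≠ A ∧ B ⊆ X with hQ
  have hsub : spoiled k s L A
      ⊆ ((s.discovered.filter fun B => ¬ B ⊆ X).biUnion fun B => superSets k (X ∪ B))
        ∪ Q.biUnion fun _ => superSets k X := by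
    intro E hE
    simp only [spoiled, Finset.mem_filter] at hE
    obtain ⟨hE, B, hB, hne, hBE⟩ := hE
    rw [Finset.mem_union]
    by_cases hBX : B ⊆ X
    · right
      exact Finset.mem_biUnion.2 ⟨B, Finset.mem_filter.2 ⟨hB, hne, hBX⟩, hE⟩
    · left
      rw [mem_superSets] at hE
      exact Finset.mem_biUnion.2 ⟨B, Finset.mem_filter.2 ⟨hB, hBX⟩,
        mem_superSets.2 ⟨hE.1, Finset.union_subset hE.2 hBE⟩⟩
  have hXc : X.card ≤ j + L.card := (Finset.card_union_le _ _).trans (by rw [hAj])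
  have hwX : wt X = ((n : ℝ) ^ j)⁻¹ * wt L * (n : ℝ) ^ (A ∩ L).card := by
    rw [hX, wt_union_mul hn, wt_of_card hAj]
  have hpow : (n : ℝ) ^ (A ∩ L).card ≤ q ^ L.card * (n / q) ^ (A ∩ L).card := by
    rw [div_pow, mul_div_assoc', le_div_iff₀ (by positivity), mul_comm]
    exact mul_le_mul_of_nonneg_right (pow_le_pow_right₀ hq
      (Finset.card_le_card Finset.inter_subset_right)) (by positivity)
  calc ((spoiled k s L A).card : ℝ)
      ≤ ∑ B ∈ s.discovered.filter (fun B => ¬ B ⊆ X), ((superSets k (X ∪ B)).card : ℝ)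
          + ∑ B ∈ Q, ((superSets k X).card : ℝ) := by
        exact_mod_cast (Finset.card_le_card hsub).trans ((Finset.card_union_le _ _).trans
          (add_le_add Finset.card_biUnion_le Finset.card_biUnion_le))
    _ ≤ ∑ B ∈ s.discovered.filter (fun B => ¬ B ⊆ X), (n : ℝ) ^ k * wt (X ∪ B)
          + ∑ B ∈ Q, (n : ℝ) ^ k * wt X :=
        add_le_add (Finset.sum_le_sum fun B _ => card_superSets_le hn _)
          (Finset.sum_le_sum fun B _ => card_superSets_le hn _)
    _ ≤ (n : ℝ) ^ k * (2 ^ X.card * (β * wt X)) + Q.card * ((n : ℝ) ^ k * wt X) := by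
        rw [← Finset.mul_sum, Finset.sum_const, nsmul_eq_mul]
        have := mul_le_mul_of_nonneg_left (hD.sum_wt_union_le hn hβ hs.card_eq X)
          (by positivity : (0 : ℝ) ≤ (n : ℝ) ^ k)
        linarith
    _ ≤ (n : ℝ) ^ k * (2 ^ (j + L.card) * (β * wt X)) + Q.card * ((n : ℝ) ^ k * wt X) := by
        have h1 : (2 : ℝ) ^ X.card ≤ 2 ^ (j + L.card) := pow_le_pow_right₀ (by norm_num) hXc
        have h2 := mul_le_mul_of_nonneg_right h1 (mul_nonneg hβ (wt_nonneg X))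
        have h3 := mul_le_mul_of_nonneg_left h2 (by positivity : (0 : ℝ) ≤ (n : ℝ) ^ k)
        linarith
    _ = (n : ℝ) ^ k * ((n : ℝ) ^ j)⁻¹ * wt L * (2 ^ (j + L.card) * β * (n : ℝ) ^ (A ∩ L).card
          + (n : ℝ) ^ (A ∩ L).card * Q.card) := by rw [hwX]; ring
    _ ≤ (n : ℝ) ^ k * ((n : ℝ) ^ j)⁻¹ * wt L * (2 ^ (j + L.card) * β * (n : ℝ) ^ (A ∩ L).card
          + q ^ L.card * (n / q) ^ (A ∩ L).card * Q.card) := by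
        have := wt_nonneg L
        gcongr
    _ = _ := by ring

end SmoothBoundary

namespace SmoothBoundary

/-! ### Pairs of discovered sets that agree outside a given set -/

variable {n k j : ℕ}

lemma sdiff_subset_of_subset_union {A B L : Finset (Fin n)} (h : B ⊆ A ∪ L) : B \ L ⊆ A :=
  sdiff_le_iff.2 (by rwa [sup_comm])

/-- The contribution of the edge `E` to the pairs counted by `pairSum` in the next generation. -/
noncomputable def pairWeight (q : ℝ) (j : ℕ) (s : SearchState n) (L E : Finset (Fin n)) : ℝ :=
  ∑ A ∈ newIn j s E, (n / q) ^ (A ∩ L).card *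
    (((s.discovered ∪ newIn j s E).filter fun B => B ≠ A ∧ B ⊆ A ∪ L).card : ℝ)

lemma div_pow_le_pow {q : ℝ} (hq : 1 ≤ q) (a : ℕ) : ((n : ℝ) / q) ^ a ≤ (n : ℝ) ^ a :=
  pow_le_pow_left₀ (by positivity) (div_le_self (Nat.cast_nonneg _) hq) _

lemma pairWeight_nonneg {q : ℝ} (hq : 1 ≤ q) (s : SearchState n) (L E : Finset (Fin n)) :
    0 ≤ pairWeight q j s L E := by
  unfold pairWeight
  exact Finset.sum_nonneg fun A _ => by positivity

/-- The worst-case influence of a single edge, as required by the Chernoff bound. -/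
lemma pairWeight_le (hn : 0 < n) {q : ℝ} (hq : 1 ≤ q) (s : SearchState n)
    (L : Finset (Fin n)) {E : Finset (Fin n)} (hE : E.card = k) :
    pairWeight q j s L E ≤ 2 ^ (k + j + L.card) * (n : ℝ) ^ L.card := by
  have hn1 : (1 : ℝ) ≤ n := by exact_mod_cast hn
  calc pairWeight q j s L E ≤ ∑ A ∈ newIn j s E, (n : ℝ) ^ L.card * 2 ^ (j + L.card) := by
        refine Finset.sum_le_sum fun A hA => ?_
        have h1 : ((n : ℝ) / q) ^ (A ∩ L).card ≤ (n : ℝ) ^ L.card :=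
          (div_pow_le_pow hq _).trans
            (pow_le_pow_right₀ hn1 (Finset.card_le_card Finset.inter_subset_right))
        have h2 : ((s.discovered ∪ newIn j s E).filter fun B => B ≠ A ∧ B ⊆ A ∪ L).card
            ≤ 2 ^ (j + L.card) := by
          calc _ ≤ (A ∪ L).powerset.card := by
                refine Finset.card_le_card fun B hB => ?_
                rw [Finset.mem_filter] at hB
                exact Finset.mem_powerset.2 hB.2.2
            _ = 2 ^ (A ∪ L).card := Finset.card_powerset _
            _ ≤ 2 ^ (j + L.card) := Nat.pow_le_pow_right (by norm_num)
                ((Finset.card_union_le _ _).trans (by rw [(mem_newIn.1 hA).2.1]))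
        exact mul_le_mul h1 (by exact_mod_cast h2) (by positivity) (by positivity)
    _ = (newIn j s E).card * ((n : ℝ) ^ L.card * 2 ^ (j + L.card)) := by
        rw [Finset.sum_const, nsmul_eq_mul]
    _ ≤ 2 ^ k * ((n : ℝ) ^ L.card * 2 ^ (j + L.card)) := by
        gcongr
        exact_mod_cast card_newIn_le s hE
    _ = _ := by ring

/-- If `A` and `B` are distinct sets of the same size in `E` and `B ⊆ A ∪ L`, then `A` does not
contain `E ∩ L`. -/
lemma card_inter_lt {A B E L : Finset (Fin n)} (hA : A.card = j) (hB : B.card = j) (hAE : A ⊆ E)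
    (hBE : B ⊆ E) (hne : B ≠ A) (hBA : B ⊆ A ∪ L) : (A ∩ L).card < (E ∩ L).card := by
  refine Finset.card_lt_card ((Finset.inter_subset_inter_right hAE).ssubset_of_ne fun h => ?_)
  refine hne (Finset.eq_of_subset_of_card_le (fun v hv => ?_) (by rw [hA, hB]))
  rcases Finset.mem_union.1 (hBA hv) with h' | h'
  · exact h'
  · have : v ∈ A ∩ L := by rw [h]; exact Finset.mem_inter.2 ⟨hBE hv, h'⟩
    exact (Finset.mem_inter.1 this).1

/-- A partner B of a new set A falls into one of three classes, given the parent A'. It may be A' or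
another new set of the same edge; then A misses a vertex of E ∩ L by `card_inter_lt`, which saves a
factor n. It may be an older set outside A' ∪ L, a generic position. Or it lies in A' ∪ L and was
already a partner of A'; then A must contain B \ L. -/
lemma pairWeight_fresh_le (hn : 0 < n) {q : ℝ} (hq : 1 ≤ q) {s : SearchState n}
    (hs : s.Valid j) (L : Finset (Fin n)) {E A' : Finset (Fin n)} (hE : E.card = k)
    (hA' : A' ∈ s.active) (hA'E : A' ⊆ E) :
    pairWeight q j s L E ≤ 4 ^ k * ((n : ℝ) ^ (E ∩ L).card / n)
      + ∑ B ∈ s.discovered.filter (fun B => ¬ B ⊆ A' ∪ L),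
          (if B ⊆ E ∪ L then 2 ^ k * (n : ℝ) ^ (E ∩ L).card else 0)
      + ∑ B ∈ s.discovered.filter (fun B => B ≠ A' ∧ B ⊆ A' ∪ L),
          ∑ A ∈ ((E.powersetCard j).erase A').filter (fun A => B \ L ⊆ A),
            (n / q) ^ (A ∩ L).card := by
  have hn' : (0 : ℝ) < n := by exact_mod_cast hn
  have hn1 : (1 : ℝ) ≤ n := by exact_mod_cast hn
  have hA'j := hs.card_eq A' (hs.active_subset hA')
  have hcount : ∀ A ∈ newIn j s E,
      (((s.discovered ∪ newIn j s E).filter fun B => B ≠ A ∧ B ⊆ A ∪ L).card : ℝ)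
      ≤ (((insert A' (newIn j s E)).filter fun B => B ≠ A ∧ B ⊆ A ∪ L).card : ℝ)
        + ((s.discovered.filter (fun B => ¬ B ⊆ A' ∪ L)).filter fun B => B ⊆ A ∪ L).card
        + ((s.discovered.filter (fun B => B ≠ A' ∧ B ⊆ A' ∪ L)).filter
            fun B => B ⊆ A ∪ L).card := by
    intro A hA
    norm_cast
    refine (Finset.card_le_card ?_).trans ((Finset.card_union_le _ _).trans
      (add_le_add_left (Finset.card_union_le _ _) _))
    intro B hB
    simp only [Finset.mem_union, Finset.mem_filter, Finset.mem_insert] at hB ⊢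
    tauto
  have hω0 : ∀ A : Finset (Fin n), 0 ≤ (n / q : ℝ) ^ (A ∩ L).card := fun A => by positivity
  have hnew : ∀ A ∈ newIn j s E, A ∈ (E.powersetCard j).erase A' := by
    intro A hA
    rw [mem_newIn] at hA
    exact Finset.mem_erase.2 ⟨fun h => hA.2.2 (h ▸ hs.active_subset hA'),
      Finset.mem_powersetCard.2 ⟨hA.1, hA.2.1⟩⟩
  have part1 : ∑ A ∈ newIn j s E, (n / q : ℝ) ^ (A ∩ L).card *
      (((insert A' (newIn j s E)).filter fun B => B ≠ A ∧ B ⊆ A ∪ L).card : ℝ)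
      ≤ 4 ^ k * ((n : ℝ) ^ (E ∩ L).card / n) := by
    have : (4 : ℝ) ^ k * ((n : ℝ) ^ (E ∩ L).card / n)
        = 2 ^ k * (((n : ℝ) ^ (E ∩ L).card / n) * 2 ^ k) := by
      rw [show (4 : ℝ) = 2 * 2 by norm_num, mul_pow]; ring
    rw [this]
    calc _ ≤ ∑ A ∈ newIn j s E, ((n : ℝ) ^ (E ∩ L).card / n) * 2 ^ k := by
          refine Finset.sum_le_sum fun A hA => ?_
          rcases ((insert A' (newIn j s E)).filter
            fun B => B ≠ A ∧ B ⊆ A ∪ L).eq_empty_or_nonempty with h | ⟨B, hB⟩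
          · rw [h]; simp only [Finset.card_empty, Nat.cast_zero, mul_zero]; positivity
          · have hBE : ∀ B ∈ insert A' (newIn j s E), B ⊆ E ∧ B.card = j := by
              intro B hB
              rcases Finset.mem_insert.1 hB with rfl | h
              · exact ⟨hA'E, hA'j⟩
              · exact ⟨(mem_newIn.1 h).1, (mem_newIn.1 h).2.1⟩
            rw [Finset.mem_filter] at hB
            have hlt := card_inter_lt (mem_newIn.1 hA).2.1 (hBE B hB.1).2 (mem_newIn.1 hA).1
              (hBE B hB.1).1 hB.2.1 hB.2.2
            have h1 : (n / q : ℝ) ^ (A ∩ L).card ≤ (n : ℝ) ^ (E ∩ L).card / n := by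
              rw [le_div_iff₀ hn', ← pow_sub_one_mul (by omega : (E ∩ L).card ≠ 0) (n : ℝ)]
              exact mul_le_mul_of_nonneg_right ((div_pow_le_pow hq _).trans
                (pow_le_pow_right₀ hn1 (by omega))) hn'.le
            have h2 : ((insert A' (newIn j s E)).filter fun B => B ≠ A ∧ B ⊆ A ∪ L).card
                ≤ 2 ^ k := by
              rw [← hE, ← Finset.card_powerset]
              refine Finset.card_le_card fun B hB => Finset.mem_powerset.2 ?_
              exact (hBE B (Finset.mem_of_mem_filter B hB)).1
            exact mul_le_mul h1 (by exact_mod_cast h2) (by positivity) (by positivity)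
      _ = (newIn j s E).card * (((n : ℝ) ^ (E ∩ L).card / n) * 2 ^ k) := by
          rw [Finset.sum_const, nsmul_eq_mul]
      _ ≤ _ := by
          gcongr
          exact_mod_cast card_newIn_le s hE
  have part2 : ∑ A ∈ newIn j s E, (n / q : ℝ) ^ (A ∩ L).card *
      (((s.discovered.filter (fun B => ¬ B ⊆ A' ∪ L)).filter fun B => B ⊆ A ∪ L).card : ℝ)
      ≤ ∑ B ∈ s.discovered.filter (fun B => ¬ B ⊆ A' ∪ L),
          (if B ⊆ E ∪ L then 2 ^ k * (n : ℝ) ^ (E ∩ L).card else 0) := by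
    calc _ ≤ ∑ A ∈ newIn j s E, ∑ B ∈ s.discovered.filter (fun B => ¬ B ⊆ A' ∪ L),
            (if B ⊆ E ∪ L then (n : ℝ) ^ (E ∩ L).card else 0) := by
          refine Finset.sum_le_sum fun A hA => ?_
          rw [Finset.card_filter, Nat.cast_sum, Finset.mul_sum]
          refine Finset.sum_le_sum fun B _ => ?_
          by_cases hBA : B ⊆ A ∪ L
          · have hAE := (mem_newIn.1 hA).1
            rw [if_pos hBA, if_pos (hBA.trans (Finset.union_subset_union_left hAE)), Nat.cast_one,
              mul_one]
            exact (div_pow_le_pow hq _).trans (pow_le_pow_right₀ hn1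
              (Finset.card_le_card (Finset.inter_subset_inter_right hAE)))
          · rw [if_neg hBA, Nat.cast_zero, mul_zero]
            split_ifs <;> positivity
      _ = ∑ B ∈ s.discovered.filter (fun B => ¬ B ⊆ A' ∪ L),
            ((newIn j s E).card : ℝ) * (if B ⊆ E ∪ L then (n : ℝ) ^ (E ∩ L).card else 0) := by
          rw [Finset.sum_comm]
          refine Finset.sum_congr rfl fun B _ => ?_
          rw [Finset.sum_const, nsmul_eq_mul]
      _ ≤ _ := by
          refine Finset.sum_le_sum fun B _ => ?_
          split_ifs
          · gcongr
            exact_mod_cast card_newIn_le s hE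
          · rw [mul_zero]
  have part3 : ∑ A ∈ newIn j s E, (n / q : ℝ) ^ (A ∩ L).card *
      (((s.discovered.filter (fun B => B ≠ A' ∧ B ⊆ A' ∪ L)).filter
        fun B => B ⊆ A ∪ L).card : ℝ)
      ≤ ∑ B ∈ s.discovered.filter (fun B => B ≠ A' ∧ B ⊆ A' ∪ L),
          ∑ A ∈ ((E.powersetCard j).erase A').filter (fun A => B \ L ⊆ A),
            (n / q : ℝ) ^ (A ∩ L).card := by
    simp_rw [Finset.sum_filter (fun A => _ \ L ⊆ A)]
    rw [Finset.sum_comm (s := s.discovered.filter (fun B => B ≠ A' ∧ B ⊆ A' ∪ L))]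
    refine (Finset.sum_le_sum fun A hA => ?_).trans (Finset.sum_le_sum_of_subset_of_nonneg
      (fun A hA => hnew A hA) fun A _ _ => Finset.sum_nonneg fun B _ => by
        split_ifs <;> [exact hω0 A; exact le_rfl])
    rw [Finset.card_filter, Nat.cast_sum, Finset.mul_sum]
    refine Finset.sum_le_sum fun B _ => ?_
    by_cases hBA : B ⊆ A ∪ L
    · rw [if_pos hBA, if_pos (sdiff_subset_of_subset_union ‹_›),
        Nat.cast_one, mul_one]
    · rw [if_neg hBA, Nat.cast_zero, mul_zero]
      split_ifs <;> [exact hω0 A; exact le_rfl]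
  calc pairWeight q j s L E
      ≤ ∑ A ∈ newIn j s E, ((n / q : ℝ) ^ (A ∩ L).card *
          (((insert A' (newIn j s E)).filter fun B => B ≠ A ∧ B ⊆ A ∪ L).card : ℝ)
        + (n / q : ℝ) ^ (A ∩ L).card *
          (((s.discovered.filter (fun B => ¬ B ⊆ A' ∪ L)).filter fun B => B ⊆ A ∪ L).card : ℝ)
        + (n / q : ℝ) ^ (A ∩ L).card *
          (((s.discovered.filter (fun B => B ≠ A' ∧ B ⊆ A' ∪ L)).filter
            fun B => B ⊆ A ∪ L).card : ℝ)) := by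
        unfold pairWeight
        refine Finset.sum_le_sum fun A hA => ?_
        rw [← mul_add, ← mul_add]
        exact mul_le_mul_of_nonneg_left (hcount A hA) (hω0 A)
    _ ≤ _ := by
        rw [Finset.sum_add_distrib, Finset.sum_add_distrib]
        exact add_le_add (add_le_add part1 part2) part3

lemma wt_mul_pow_le (hn : 0 < n) {X Y : Finset (Fin n)} {a b : ℕ} (h : Y.card + a ≤ X.card + b) :
    wt X * (n : ℝ) ^ a ≤ (n : ℝ) ^ b * wt Y := by
  have hn' : (0 : ℝ) < n := by exact_mod_cast hn
  have hn1 : (1 : ℝ) ≤ n := by exact_mod_cast hn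
  unfold wt
  rw [inv_mul_eq_div, ← div_eq_mul_inv, div_le_div_iff₀ (by positivity) (by positivity),
    ← pow_add, ← pow_add]
  exact pow_le_pow_right₀ hn1 (by omega)

/-- Pairs with a generic position relative to the parent. -/
lemma sum_generic_pairs_le (hn : 0 < n) {β : ℝ} (hβ : 0 ≤ β) {s : SearchState n} (hs : s.Valid j)
    (hD : Sparse j β s.discovered) (L : Finset (Fin n)) :
    ∑ A ∈ s.active, ∑ E ∈ superSets k A, ∑ B ∈ s.discovered.filter (fun B => ¬ B ⊆ A ∪ L),
        (if B ⊆ E ∪ L then 2 ^ k * (n : ℝ) ^ (E ∩ L).card else 0)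
      ≤ 2 ^ (k + j + 2 * L.card) * ((n : ℝ) ^ k * ((n : ℝ) ^ j)⁻¹)
          * (β * weightSum L s.active) := by
  have hn' : (0 : ℝ) < n := by exact_mod_cast hn
  unfold weightSum
  rw [Finset.mul_sum, Finset.mul_sum]
  refine Finset.sum_le_sum fun A hA => ?_
  have hAj := hs.card_eq A (hs.active_subset hA)
  rw [Finset.sum_comm]
  have hB : ∀ B, ∑ E ∈ superSets k A, (if B ⊆ E ∪ L then 2 ^ k * (n : ℝ) ^ (E ∩ L).card else 0)
      ≤ 2 ^ (k + L.card) * ((n : ℝ) ^ k * (n : ℝ) ^ L.card) * wt ((A ∪ L) ∪ B) := by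
    intro B
    -- Here Z stands for E ∩ L. The edge contains A ∪ Z ∪ (B \ L), and adding the |L| - |Z| missing
    -- vertices of `L` gives all of A ∪ L ∪ B. So n^|Z| trades the weight of the former set for that
    -- of the latter.
    calc ∑ E ∈ superSets k A, (if B ⊆ E ∪ L then 2 ^ k * (n : ℝ) ^ (E ∩ L).card else 0)
        ≤ ∑ E ∈ superSets k A, ∑ Z ∈ L.powerset,
            if A ∪ Z ∪ (B \ L) ⊆ E then 2 ^ k * (n : ℝ) ^ Z.card else 0 := by
          refine Finset.sum_le_sum fun E hE => ?_
          have hnn : ∀ Z ∈ L.powerset,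
              (0 : ℝ) ≤ if A ∪ Z ∪ (B \ L) ⊆ E then 2 ^ k * (n : ℝ) ^ Z.card else 0 :=
            fun Z _ => by split_ifs <;> positivity
          split_ifs with hBE
          · have := Finset.single_le_sum hnn
              (Finset.mem_powerset.2 (Finset.inter_subset_right : E ∩ L ⊆ L))
            refine le_trans (le_of_eq ?_) this
            rw [if_pos]
            exact Finset.union_subset (Finset.union_subset (mem_superSets.1 hE).2
              Finset.inter_subset_left) (sdiff_subset_of_subset_union ‹_›)
          · exact Finset.sum_nonneg hnn
      _ ≤ ∑ Z ∈ L.powerset, ((superSets k (A ∪ Z ∪ (B \ L))).card : ℝ)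
            * (2 ^ k * (n : ℝ) ^ Z.card) := by
          rw [Finset.sum_comm]
          refine Finset.sum_le_sum fun Z _ => ?_
          rw [← Finset.sum_filter, Finset.sum_const, nsmul_eq_mul]
          refine mul_le_mul_of_nonneg_right ?_ (by positivity)
          norm_cast
          refine Finset.card_le_card fun E hE => ?_
          simp only [superSets, Finset.mem_filter] at hE ⊢
          exact ⟨hE.1.1, hE.2⟩
      _ ≤ ∑ Z ∈ L.powerset, 2 ^ k * ((n : ℝ) ^ k * ((n : ℝ) ^ L.card * wt ((A ∪ L) ∪ B))) := by
          refine Finset.sum_le_sum fun Z hZ => ?_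
          rw [Finset.mem_powerset] at hZ
          have h1 := card_superSets_le (k := k) hn (A ∪ Z ∪ (B \ L))
          have h2 : wt (A ∪ Z ∪ (B \ L)) * (n : ℝ) ^ Z.card
              ≤ (n : ℝ) ^ L.card * wt ((A ∪ L) ∪ B) := by
            refine wt_mul_pow_le hn ?_
            have h3 : (A ∪ L) ∪ B ⊆ (A ∪ Z ∪ (B \ L)) ∪ (L \ Z) := by
              intro v hv
              simp only [Finset.mem_union, Finset.mem_sdiff] at hv ⊢
              tauto
            have h4 := (Finset.card_le_card h3).trans (Finset.card_union_le _ _)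
            have h5 := Finset.card_sdiff_add_card_eq_card hZ
            omega
          calc _ ≤ ((n : ℝ) ^ k * wt (A ∪ Z ∪ (B \ L))) * (2 ^ k * (n : ℝ) ^ Z.card) :=
                mul_le_mul_of_nonneg_right h1 (by positivity)
            _ = 2 ^ k * ((n : ℝ) ^ k * (wt (A ∪ Z ∪ (B \ L)) * (n : ℝ) ^ Z.card)) := by ring
            _ ≤ _ := by gcongr
      _ = _ := by
          rw [Finset.sum_const, nsmul_eq_mul, Finset.card_powerset]
          push_cast
          ring
  refine (Finset.sum_le_sum fun B _ => hB B).trans ?_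
  rw [← Finset.mul_sum]
  refine (mul_le_mul_of_nonneg_left (hD.sum_wt_union_le hn hβ hs.card_eq (A ∪ L))
    (by positivity)).trans ?_
  have hc : (2 : ℝ) ^ (A ∪ L).card ≤ 2 ^ (j + L.card) :=
    pow_le_pow_right₀ (by norm_num) ((Finset.card_union_le _ _).trans (by rw [hAj]))
  have hw : (n : ℝ) ^ L.card * wt (A ∪ L) = ((n : ℝ) ^ j)⁻¹ * (n : ℝ) ^ (A ∩ L).card := by
    rw [wt_union_mul hn, wt_of_card hAj]
    unfold wt
    field_simp
  calc _ = 2 ^ (k + L.card) * (n : ℝ) ^ k * β * ((n : ℝ) ^ L.card * wt (A ∪ L))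
        * 2 ^ (A ∪ L).card := by ring
    _ ≤ 2 ^ (k + L.card) * (n : ℝ) ^ k * β * ((n : ℝ) ^ L.card * wt (A ∪ L))
        * 2 ^ (j + L.card) := by
        have := wt_nonneg (A ∪ L)
        gcongr
    _ = _ := by rw [hw]; ring

end SmoothBoundary

/-! ### Pairs in special position: contraction and error terms -/

namespace SmoothBoundary

variable {n k j : ℕ}

/-- Sets that meet `L` in a different set than `A` contribute little. -/
lemma wt_union_mul_div_pow_le {q : ℝ} (hq : 1 ≤ q) (hqn : q ≤ n) (A : Finset (Fin n))
    {L Z : Finset (Fin n)} (hZ : Z ⊆ L) (hne : Z ≠ A ∩ L) :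
    wt (A ∪ Z) * ((n : ℝ) / q) ^ Z.card
      ≤ wt A * (((n : ℝ) / q) ^ (A ∩ L).card * (q / n + 1 / q)) := by
  have hq0 : 0 < q := by linarith
  have hn' : (0 : ℝ) < n := by linarith
  have hn : 0 < n := by exact_mod_cast hn'
  have hnq : 1 ≤ (n : ℝ) / q := (one_le_div hq0).2 hqn
  have hAZ : A ∩ Z ⊆ A ∩ L := Finset.inter_subset_inter_left hZ
  have hw : wt (A ∪ Z) * ((n : ℝ) / q) ^ Z.card
      = wt A * (((n : ℝ) / q) ^ (A ∩ Z).card * (1 / q) ^ (Z \ A).card) := by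
    have h1 : Z.card = (A ∩ Z).card + (Z \ A).card := by
      rw [Finset.inter_comm, Finset.card_inter_add_card_sdiff]
    rw [wt_union_mul hn]
    unfold wt
    rw [h1, pow_add, pow_add, div_pow, div_pow, div_pow, one_pow]
    field_simp
  rw [hw]
  refine mul_le_mul_of_nonneg_left ?_ (wt_nonneg A)
  -- Losing a vertex of A ∩ L lowers the weight by q/n. Gaining a vertex of L \ A raises the weight
  -- by n/q but costs a factor n in the number of edges, a net factor 1/q. With the weight n in
  -- place of n/q this second case would not be small.
  by_cases hsub : Z ⊆ A ∩ L
  · have hlt : (A ∩ Z).card + 1 ≤ (A ∩ L).card := by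
      refine Finset.card_lt_card (hAZ.ssubset_of_ne fun h => hne ?_)
      refine hsub.antisymm ?_
      rw [← h]; exact Finset.inter_subset_right
    calc ((n : ℝ) / q) ^ (A ∩ Z).card * (1 / q) ^ (Z \ A).card
        ≤ ((n : ℝ) / q) ^ (A ∩ Z).card * 1 := by
          gcongr
          exact pow_le_one₀ (by positivity) ((div_le_one hq0).2 hq)
      _ = ((n : ℝ) / q) ^ ((A ∩ Z).card + 1) * (q / n) := by
          rw [pow_succ]; field_simp
      _ ≤ ((n : ℝ) / q) ^ (A ∩ L).card * (q / n + 1 / q) := by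
          have : 0 < 1 / q := by positivity
          gcongr
          linarith
  · have hpos : (Z \ A).card ≠ 0 := by
      rw [Ne, Finset.card_eq_zero, Finset.sdiff_eq_empty_iff_subset]
      exact fun h => hsub (Finset.subset_inter h hZ)
    calc ((n : ℝ) / q) ^ (A ∩ Z).card * (1 / q) ^ (Z \ A).card
        ≤ ((n : ℝ) / q) ^ (A ∩ L).card * (1 / q) ^ 1 := by
          refine mul_le_mul (pow_le_pow_right₀ hnq (Finset.card_le_card hAZ)) ?_ (by positivity)
            (by positivity)
          exact pow_le_pow_of_le_one (by positivity) ((div_le_one hq0).2 hq)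
            (Nat.one_le_iff_ne_zero.2 hpos)
      _ ≤ ((n : ℝ) / q) ^ (A ∩ L).card * (q / n + 1 / q) := by
          rw [pow_one]
          have : 0 < q / n := by positivity
          gcongr
          linarith

/-- Children that change the trace on `L`, summed over all new traces. For large q they are
negligible against the contraction. -/
lemma sum_div_pow_of_inter_ne_le {q : ℝ} (hq : 1 ≤ q) (hqn : q ≤ n) {L A : Finset (Fin n)}
    (hA : A.card = j) :
    ∑ E ∈ superSets k A, ∑ A' ∈ (E.powersetCard j).filter (fun A' => A' ∩ L ≠ A ∩ L),
        ((n : ℝ) / q) ^ (A' ∩ L).card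
      ≤ 2 ^ (k + L.card) * ((n : ℝ) ^ k * ((n : ℝ) ^ j)⁻¹)
          * (((n : ℝ) / q) ^ (A ∩ L).card * (q / n + 1 / q)) := by
  have hq0 : 0 < q := by linarith
  have hn' : (0 : ℝ) < n := by linarith
  have hn : 0 < n := by exact_mod_cast hn'
  calc ∑ E ∈ superSets k A, ∑ A' ∈ (E.powersetCard j).filter (fun A' => A' ∩ L ≠ A ∩ L),
        ((n : ℝ) / q) ^ (A' ∩ L).card
      ≤ ∑ E ∈ superSets k A, ∑ Z ∈ L.powerset.filter (fun Z => Z ≠ A ∩ L),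
          (if A ∪ Z ⊆ E then 2 ^ k * ((n : ℝ) / q) ^ Z.card else 0) := by
        refine Finset.sum_le_sum fun E hE => ?_
        rw [mem_superSets] at hE
        rw [← Finset.sum_fiberwise_of_maps_to (g := fun A' => A' ∩ L)
          (t := L.powerset.filter (fun Z => Z ≠ A ∩ L)) fun A' hA' =>
            Finset.mem_filter.2 ⟨Finset.mem_powerset.2 Finset.inter_subset_right,
              (Finset.mem_filter.1 hA').2⟩]
        refine Finset.sum_le_sum fun Z _ => ?_
        split_ifs with hZE
        · calc _ = ∑ A' ∈ ((E.powersetCard j).filter (fun A' => A' ∩ L ≠ A ∩ L)).filter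
                (fun A' => A' ∩ L = Z), ((n : ℝ) / q) ^ Z.card :=
                Finset.sum_congr rfl fun A' hA' => by rw [(Finset.mem_filter.1 hA').2]
            _ ≤ _ := by
              rw [Finset.sum_const, nsmul_eq_mul]
              refine mul_le_mul_of_nonneg_right ?_ (by positivity)
              rw [← hE.1]
              exact_mod_cast (Finset.card_le_card (fun A' hA' => Finset.mem_powerset.2
                (Finset.mem_powersetCard.1 (Finset.mem_of_mem_filter _
                  (Finset.mem_of_mem_filter _ hA'))).1)).trans (Finset.card_powerset E).le
        · refine le_of_eq (Finset.sum_eq_zero fun A' hA' => absurd ?_ hZE)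
          rw [Finset.mem_filter, Finset.mem_filter, Finset.mem_powersetCard] at hA'
          refine Finset.union_subset hE.2 ?_
          rw [← hA'.2]
          exact Finset.inter_subset_left.trans hA'.1.1.1
    _ ≤ ∑ Z ∈ L.powerset.filter (fun Z => Z ≠ A ∩ L),
          ((superSets k (A ∪ Z)).card : ℝ) * (2 ^ k * ((n : ℝ) / q) ^ Z.card) := by
        rw [Finset.sum_comm]
        refine Finset.sum_le_sum fun Z _ => ?_
        rw [← Finset.sum_filter, Finset.sum_const, nsmul_eq_mul]
        refine mul_le_mul_of_nonneg_right ?_ (by positivity)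
        norm_cast
        refine Finset.card_le_card fun E hE => ?_
        simp only [superSets, Finset.mem_filter] at hE ⊢
        exact ⟨hE.1.1, hE.2⟩
    _ ≤ ∑ Z ∈ L.powerset.filter (fun Z => Z ≠ A ∩ L),
          2 ^ k * ((n : ℝ) ^ k * (wt A * (((n : ℝ) / q) ^ (A ∩ L).card * (q / n + 1 / q)))) := by
        refine Finset.sum_le_sum fun Z hZ => ?_
        rw [Finset.mem_filter, Finset.mem_powerset] at hZ
        have h1 := card_superSets_le (k := k) hn (A ∪ Z)
        have h2 := wt_union_mul_div_pow_le hq hqn A hZ.1 hZ.2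
        calc _ ≤ ((n : ℝ) ^ k * wt (A ∪ Z)) * (2 ^ k * ((n : ℝ) / q) ^ Z.card) := by gcongr
          _ = 2 ^ k * ((n : ℝ) ^ k * (wt (A ∪ Z) * ((n : ℝ) / q) ^ Z.card)) := by ring
          _ ≤ _ := by gcongr
    _ = ((L.powerset.filter (fun Z => Z ≠ A ∩ L)).card : ℝ) *
          (2 ^ k * ((n : ℝ) ^ k * (wt A * (((n : ℝ) / q) ^ (A ∩ L).card * (q / n + 1 / q))))) := by
        rw [Finset.sum_const, nsmul_eq_mul]
    _ ≤ 2 ^ L.card *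
          (2 ^ k * ((n : ℝ) ^ k * (wt A * (((n : ℝ) / q) ^ (A ∩ L).card * (q / n + 1 / q))))) := by
        have := wt_nonneg A
        refine mul_le_mul_of_nonneg_right ?_ (by positivity)
        exact_mod_cast (Finset.card_filter_le _ _).trans (Finset.card_powerset L).le
    _ = _ := by rw [wt_of_card hA]; ring

lemma choose_sub_sub_le {a b : ℕ} (hab : a ≤ b) (hbj : b ≤ j) (hjk : j ≤ k) :
    (k - b).choose (j - b) ≤ (k - a).choose (j - a) := by
  rw [← Nat.choose_symm (by omega : j - b ≤ k - b), ← Nat.choose_symm (by omega : j - a ≤ k - a),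
    show k - b - (j - b) = k - j by omega, show k - a - (j - a) = k - j by omega]
  exact Nat.choose_le_choose _ (by omega)

open scoped Classical in
/-- Pairs that stay in a special position relative to the parent. -/
lemma sum_special_pair_le {q : ℝ} (hq : 1 ≤ q) (hqn : q ≤ n) (hjk : j ≤ k)
    {L A B : Finset (Fin n)} (hL : L.card ≤ j) (hA : A.card = j) (hBA : B ⊆ A ∪ L) :
    ∑ E ∈ superSets k A, ∑ A' ∈ ((E.powersetCard j).erase A).filter (fun A' => B \ L ⊆ A'),
        ((n : ℝ) / q) ^ (A' ∩ L).card
      ≤ ((n - j).choose (k - j) : ℝ) * (((k - L.card).choose (j - L.card) : ℝ) - 1)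
            * ((n : ℝ) / q) ^ (A ∩ L).card
        + 2 ^ k * ((n : ℝ) ^ k * ((n : ℝ) ^ j)⁻¹)
            * (if (B \ L ∪ (A ∩ L)).card < L.card then (n : ℝ) ^ (A ∩ L).card else 0)
        + 2 ^ (k + L.card) * ((n : ℝ) ^ k * ((n : ℝ) ^ j)⁻¹)
          * (((n : ℝ) / q) ^ (A ∩ L).card * (q / n + 1 / q)) := by
  have hq0 : 0 < q := by linarith
  have hn' : (0 : ℝ) < n := by linarith
  have hn : 0 < n := by exact_mod_cast hn'
  -- A child that keeps the trace of A and the partner B contains U. If U has at least |L| vertices,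
  -- an edge has at most as many such children as a pivot has successors, which gives the branching
  -- ratio of `L`. The remaining case is the low-dimensional one.
  set U := B \ L ∪ (A ∩ L) with hU
  have hUA : U ⊆ A := Finset.union_subset (sdiff_subset_of_subset_union hBA) Finset.inter_subset_left
  have hUj : U.card ≤ j := hA ▸ Finset.card_le_card hUA
  have hR : (0 : ℝ) ≤ ((k - L.card).choose (j - L.card) : ℝ) - 1 := by
    have : 1 ≤ (k - L.card).choose (j - L.card) := Nat.choose_pos (by omega)
    rw [sub_nonneg]
    exact_mod_cast this
  have hsame : ∀ E ∈ superSets k A,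
      ((((E.powersetCard j).filter fun A' => U ⊆ A').erase A).card : ℝ)
      ≤ (((k - L.card).choose (j - L.card) : ℝ) - 1)
        + if U.card < L.card then 2 ^ k else 0 := by
    intro E hE
    rw [mem_superSets] at hE
    have hc := card_filter_powersetCard_superset (hUA.trans hE.2) hUj
    rw [hE.1] at hc
    rw [Finset.card_erase_of_mem (by simp [Finset.mem_powersetCard, hA, hE.2, hUA]), hc,
      Nat.cast_sub (Nat.choose_pos (by omega)), Nat.cast_one]
    split_ifs with h
    · have : ((k - U.card).choose (j - U.card) : ℝ) ≤ 2 ^ k := by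
        exact_mod_cast (Nat.choose_le_two_pow _ _).trans
          (Nat.pow_le_pow_right (by norm_num) (Nat.sub_le _ _))
      linarith
    · have : ((k - U.card).choose (j - U.card) : ℝ) ≤ (k - L.card).choose (j - L.card) := by
        exact_mod_cast choose_sub_sub_le (by omega) hUj hjk
      linarith
  have hsplit : ∀ E ∈ superSets k A,
      ∑ A' ∈ ((E.powersetCard j).erase A).filter (fun A' => B \ L ⊆ A'),
        ((n : ℝ) / q) ^ (A' ∩ L).card
      ≤ ((((E.powersetCard j).filter fun A' => U ⊆ A').erase A).card : ℝ)
          * ((n : ℝ) / q) ^ (A ∩ L).card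
        + ∑ A' ∈ (E.powersetCard j).filter (fun A' => A' ∩ L ≠ A ∩ L),
          ((n : ℝ) / q) ^ (A' ∩ L).card := by
    intro E _
    rw [← Finset.sum_filter_add_sum_filter_not
      (((E.powersetCard j).erase A).filter (fun A' => B \ L ⊆ A')) fun A' => A' ∩ L = A ∩ L]
    refine add_le_add ?_ ?_
    · calc _ = ∑ A' ∈ (((E.powersetCard j).erase A).filter (fun A' => B \ L ⊆ A')).filter
            (fun A' => A' ∩ L = A ∩ L), ((n : ℝ) / q) ^ (A ∩ L).card :=
            Finset.sum_congr rfl fun A' hA' => by rw [(Finset.mem_filter.1 hA').2]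
        _ ≤ _ := by
          rw [Finset.sum_const, nsmul_eq_mul]
          refine mul_le_mul_of_nonneg_right ?_ (by positivity)
          norm_cast
          refine Finset.card_le_card fun A' hA' => ?_
          simp only [Finset.mem_filter, Finset.mem_erase] at hA' ⊢
          refine ⟨hA'.1.1.1, hA'.1.1.2, Finset.union_subset hA'.1.2 ?_⟩
          rw [← hA'.2]
          exact Finset.inter_subset_left
    · refine Finset.sum_le_sum_of_subset_of_nonneg ?_ fun _ _ _ => by positivity
      intro A' hA'
      simp only [Finset.mem_filter, Finset.mem_erase] at hA' ⊢
      exact ⟨hA'.1.1.2, hA'.2⟩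
  have hcard : ((superSets k A).card : ℝ) = ((n - j).choose (k - j) : ℝ) := by
    rw [card_superSets (hA.trans_le hjk), hA]
  have hcard' : ((superSets k A).card : ℝ) ≤ (n : ℝ) ^ k * ((n : ℝ) ^ j)⁻¹ := by
    rw [← wt_of_card hA]; exact card_superSets_le hn A
  have hωn := div_pow_le_pow (n := n) hq (A ∩ L).card
  calc _ ≤ ∑ E ∈ superSets k A, (((((k - L.card).choose (j - L.card) : ℝ) - 1)
        + if U.card < L.card then 2 ^ k else 0) * ((n : ℝ) / q) ^ (A ∩ L).card
        + ∑ A' ∈ (E.powersetCard j).filter (fun A' => A' ∩ L ≠ A ∩ L),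
          ((n : ℝ) / q) ^ (A' ∩ L).card) :=
        Finset.sum_le_sum fun E hE => (hsplit E hE).trans (add_le_add_left
          (mul_le_mul_of_nonneg_right (hsame E hE) (by positivity)) _)
    _ = ((superSets k A).card : ℝ) * (((((k - L.card).choose (j - L.card) : ℝ) - 1)
        + if U.card < L.card then 2 ^ k else 0) * ((n : ℝ) / q) ^ (A ∩ L).card)
        + ∑ E ∈ superSets k A, ∑ A' ∈ (E.powersetCard j).filter (fun A' => A' ∩ L ≠ A ∩ L),
          ((n : ℝ) / q) ^ (A' ∩ L).card := by
        rw [Finset.sum_add_distrib, Finset.sum_const, nsmul_eq_mul]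
    _ ≤ _ := by
        refine add_le_add ?_ (sum_div_pow_of_inter_ne_le hq hqn hA)
        rw [add_mul, mul_add, ← mul_assoc, hcard]
        refine add_le_add le_rfl ?_
        rw [← hcard]
        split_ifs
        · calc _ ≤ ((n : ℝ) ^ k * ((n : ℝ) ^ j)⁻¹) * (2 ^ k * (n : ℝ) ^ (A ∩ L).card) := by gcongr
            _ = _ := by ring
        · simp

/-- Pairs in a position of small dimension. -/
lemma sum_low_pairs_le (hn : 0 < n) {β C : ℝ} (hβ : 0 ≤ β) (hC : 0 ≤ C) {s : SearchState n}
    (hs : s.Valid j) (hD : Sparse j β s.discovered) {L : Finset (Fin n)} (hL : L.card < j)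
    (hdeg : ∀ W : Finset (Fin n), W.card < L.card → (degree s.active W : ℝ) ≤ C * wt W) :
    ∑ A ∈ s.active, ∑ B ∈ s.discovered.filter (fun B => B ≠ A ∧ B ⊆ A ∪ L),
        (if (B \ L ∪ (A ∩ L)).card < L.card then (n : ℝ) ^ (A ∩ L).card else 0)
      ≤ 4 ^ L.card * (C * β) := by
  have hn' : (0 : ℝ) < n := by exact_mod_cast hn
  -- Since |L| < j, no discovered set fits inside `L`, so the sparsity bound around `L` covers the
  -- sum over all B.
  have hDL : s.discovered.filter (fun B => ¬ B ⊆ L) = s.discovered := by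
    refine Finset.filter_true_of_mem fun B hB hBL => ?_
    have := Finset.card_le_card hBL
    rw [hs.card_eq B hB] at this
    omega
  calc _ ≤ ∑ A ∈ s.active, ∑ B ∈ s.discovered, ∑ Y ∈ L.powerset,
        (if (B \ L ∪ Y).card < L.card ∧ B \ L ∪ Y ⊆ A then (n : ℝ) ^ Y.card else 0) := by
        refine Finset.sum_le_sum fun A _ => ?_
        have hnn : ∀ B, ∀ Y ∈ L.powerset, (0 : ℝ) ≤
            if (B \ L ∪ Y).card < L.card ∧ B \ L ∪ Y ⊆ A then (n : ℝ) ^ Y.card else 0 :=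
          fun B Y _ => by split_ifs <;> positivity
        refine (Finset.sum_le_sum fun B hB => ?_).trans (Finset.sum_le_sum_of_subset_of_nonneg
          (Finset.filter_subset _ _) fun B _ _ => Finset.sum_nonneg (hnn B))
        rw [Finset.mem_filter] at hB
        split_ifs with h
        · refine le_trans (le_of_eq ?_) (Finset.single_le_sum (hnn B)
            (Finset.mem_powerset.2 (Finset.inter_subset_right : A ∩ L ⊆ L)))
          rw [if_pos ⟨h, Finset.union_subset (sdiff_subset_of_subset_union hB.2.2)
            Finset.inter_subset_left⟩]
        · exact Finset.sum_nonneg (hnn B)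
    _ = ∑ B ∈ s.discovered, ∑ Y ∈ L.powerset, (if (B \ L ∪ Y).card < L.card then
          (degree s.active (B \ L ∪ Y) : ℝ) * (n : ℝ) ^ Y.card else 0) := by
        rw [Finset.sum_comm]
        refine Finset.sum_congr rfl fun B _ => ?_
        rw [Finset.sum_comm]
        refine Finset.sum_congr rfl fun Y _ => ?_
        by_cases h : (B \ L ∪ Y).card < L.card
        · simp only [h, true_and, if_true]
          rw [← Finset.sum_filter, Finset.sum_const, nsmul_eq_mul]
          rfl
        · simp [h]
    _ ≤ ∑ B ∈ s.discovered, ∑ Y ∈ L.powerset, C * ((n : ℝ) ^ L.card * wt (L ∪ B)) := by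
        refine Finset.sum_le_sum fun B _ => Finset.sum_le_sum fun Y hY => ?_
        have hwl := wt_nonneg (L ∪ B)
        split_ifs with h
        · have h1 : wt (B \ L ∪ Y) * (n : ℝ) ^ Y.card ≤ (n : ℝ) ^ L.card * wt (L ∪ B) := by
            refine wt_mul_pow_le hn ?_
            rw [Finset.card_union_of_disjoint (Finset.disjoint_of_subset_right
              (Finset.mem_powerset.1 hY) Finset.sdiff_disjoint), ← Finset.union_sdiff_self_eq_union,
              Finset.card_union_of_disjoint Finset.disjoint_sdiff]
            omega
          calc _ ≤ (C * wt (B \ L ∪ Y)) * (n : ℝ) ^ Y.card := by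
                gcongr
                exact hdeg _ h
            _ = C * (wt (B \ L ∪ Y) * (n : ℝ) ^ Y.card) := by ring
            _ ≤ _ := by gcongr
        · positivity
    _ = 2 ^ L.card * (C * (n : ℝ) ^ L.card)
          * ∑ B ∈ s.discovered.filter (fun B => ¬ B ⊆ L), wt (L ∪ B) := by
        rw [hDL, Finset.mul_sum]
        refine Finset.sum_congr rfl fun B _ => ?_
        rw [Finset.sum_const, nsmul_eq_mul, Finset.card_powerset]
        push_cast
        ring
    _ ≤ 2 ^ L.card * (C * (n : ℝ) ^ L.card) * (2 ^ L.card * (β * wt L)) := by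
        gcongr
        exact hD.sum_wt_union_le hn hβ hs.card_eq L
    _ = _ := by
        unfold wt
        rw [show (4 : ℝ) = 2 * 2 by norm_num, mul_pow]
        field_simp

/-- The conditional expectation of the contributions of single edges to `pairSum`. -/
lemma sum_pairWeight_le (hn : 0 < n) {β q C : ℝ} (hβ : 0 ≤ β) (hq : 1 ≤ q) (hqn : q ≤ n)
    (hC : 0 ≤ C) (hjk : j < k) {s : SearchState n} (hs : s.Valid j)
    (hD : Sparse j β s.discovered) {L : Finset (Fin n)} (hL : L.card < j)
    (hdeg : ∀ W : Finset (Fin n), W.card < L.card → (degree s.active W : ℝ) ≤ C * wt W) :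
    ∑ E ∈ fresh k s, pairWeight q j s L E
      ≤ ((n - j).choose (k - j) : ℝ) * (((k - L.card).choose (j - L.card) : ℝ) - 1)
            * pairSum q L s.discovered s.active
        + 2 ^ (4 * k) * ((n : ℝ) ^ k * ((n : ℝ) ^ j)⁻¹)
          * ((1 / n + β) * weightSum L s.active + C * β
            + (q / n + 1 / q) * pairSum q L s.discovered s.active) := by
  classical
  have hn' : (0 : ℝ) < n := by exact_mod_cast hn
  have hq0 : 0 < q := by linarith
  set K := (n : ℝ) ^ k * ((n : ℝ) ^ j)⁻¹ with hK
  have hK0 : 0 ≤ K := by positivity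
  have hP0 : 0 ≤ pairSum q L s.discovered s.active :=
    Finset.sum_nonneg fun A _ => by positivity
  have hS0 : 0 ≤ weightSum L s.active := Finset.sum_nonneg fun A _ => by positivity
  have h1 := sum_fresh_le (k := k) s (pairWeight q j s L) (fun A E => if E.card = k then
    (4 ^ k * ((n : ℝ) ^ (E ∩ L).card / n)
      + ∑ B ∈ s.discovered.filter (fun B => ¬ B ⊆ A ∪ L),
          (if B ⊆ E ∪ L then 2 ^ k * (n : ℝ) ^ (E ∩ L).card else 0)
      + ∑ B ∈ s.discovered.filter (fun B => B ≠ A ∧ B ⊆ A ∪ L),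
          ∑ A' ∈ ((E.powersetCard j).erase A).filter (fun A' => B \ L ⊆ A'),
            ((n : ℝ) / q) ^ (A' ∩ L).card) else 0) (fun A E => by
      split_ifs
      · refine add_nonneg (add_nonneg (by positivity) (Finset.sum_nonneg fun B _ => ?_)) ?_
        · split_ifs <;> positivity
        · exact Finset.sum_nonneg fun B _ => Finset.sum_nonneg fun A' _ => by positivity
      · exact le_rfl)
    (fun E hE A hA hAE => by
      rw [if_pos (mem_fresh.1 hE).1]
      exact pairWeight_fresh_le hn hq hs L (mem_fresh.1 hE).1 hA hAE)
  refine h1.trans ?_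
  have h2 : ∀ A ∈ s.active, ∀ E ∈ superSets k A, E.card = k :=
    fun A _ E hE => (mem_superSets.1 hE).1
  rw [Finset.sum_congr rfl fun A hA => Finset.sum_congr rfl fun E hE => if_pos (h2 A hA E hE)]
  simp_rw [Finset.sum_add_distrib]
  have g1 : ∑ A ∈ s.active, ∑ E ∈ superSets k A, (4 : ℝ) ^ k * ((n : ℝ) ^ (E ∩ L).card / n)
      ≤ 2 ^ (4 * k) * K * (1 / n * weightSum L s.active) := by
    simp_rw [← Finset.mul_sum, ← Finset.sum_div]
    calc _ ≤ 4 ^ k * (2 ^ L.card * K * weightSum L s.active / n) := by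
          gcongr
          exact sum_active_pow_inter_le hn hs L
      _ = 2 ^ (2 * k + L.card) * K * (1 / n * weightSum L s.active) := by
          rw [show (4 : ℝ) = 2 ^ 2 by norm_num, ← pow_mul, pow_add]; ring
      _ ≤ _ := by
          gcongr
          · norm_num
          · omega
  have g2 : ∑ A ∈ s.active, ∑ E ∈ superSets k A,
      ∑ B ∈ s.discovered.filter (fun B => ¬ B ⊆ A ∪ L),
        (if B ⊆ E ∪ L then 2 ^ k * (n : ℝ) ^ (E ∩ L).card else 0)
      ≤ 2 ^ (4 * k) * K * (β * weightSum L s.active) := by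
    refine (sum_generic_pairs_le hn hβ hs hD L).trans ?_
    gcongr
    · norm_num
    · omega
  have g3 : ∑ A ∈ s.active, ∑ E ∈ superSets k A,
      ∑ B ∈ s.discovered.filter (fun B => B ≠ A ∧ B ⊆ A ∪ L),
        ∑ A' ∈ ((E.powersetCard j).erase A).filter (fun A' => B \ L ⊆ A'),
          ((n : ℝ) / q) ^ (A' ∩ L).card
      ≤ ((n - j).choose (k - j) : ℝ) * (((k - L.card).choose (j - L.card) : ℝ) - 1)
            * pairSum q L s.discovered s.active
        + 2 ^ (4 * k) * K * (C * β)
        + 2 ^ (4 * k) * K * ((q / n + 1 / q) * pairSum q L s.discovered s.active) := by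
    have hPs : ∀ c : ℝ, c * pairSum q L s.discovered s.active
        = ∑ A ∈ s.active, ∑ B ∈ s.discovered.filter (fun B => B ≠ A ∧ B ⊆ A ∪ L),
          c * ((n : ℝ) / q) ^ (A ∩ L).card := by
      intro c
      unfold pairSum
      rw [Finset.mul_sum]
      refine Finset.sum_congr rfl fun A _ => ?_
      rw [Finset.sum_const, nsmul_eq_mul]
      ring
    calc _ ≤ ∑ A ∈ s.active, ∑ B ∈ s.discovered.filter (fun B => B ≠ A ∧ B ⊆ A ∪ L),
          (((n - j).choose (k - j) : ℝ) * (((k - L.card).choose (j - L.card) : ℝ) - 1)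
              * ((n : ℝ) / q) ^ (A ∩ L).card
            + 2 ^ k * K * (if (B \ L ∪ (A ∩ L)).card < L.card then (n : ℝ) ^ (A ∩ L).card else 0)
            + 2 ^ (k + L.card) * K * (q / n + 1 / q) * ((n : ℝ) / q) ^ (A ∩ L).card) := by
          refine Finset.sum_le_sum fun A hA => ?_
          rw [Finset.sum_comm]
          refine Finset.sum_le_sum fun B hB => ?_
          refine (sum_special_pair_le hq hqn hjk.le hL.le
            (hs.card_eq A (hs.active_subset hA)) (Finset.mem_filter.1 hB).2.2).trans (le_of_eq ?_)
          ring
      _ = ((n - j).choose (k - j) : ℝ) * (((k - L.card).choose (j - L.card) : ℝ) - 1)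
            * pairSum q L s.discovered s.active
          + 2 ^ k * K * ∑ A ∈ s.active, ∑ B ∈ s.discovered.filter (fun B => B ≠ A ∧ B ⊆ A ∪ L),
            (if (B \ L ∪ (A ∩ L)).card < L.card then (n : ℝ) ^ (A ∩ L).card else 0)
          + 2 ^ (k + L.card) * K * (q / n + 1 / q) * pairSum q L s.discovered s.active := by
          rw [hPs, hPs]
          simp_rw [Finset.mul_sum, Finset.sum_add_distrib]
      _ ≤ ((n - j).choose (k - j) : ℝ) * (((k - L.card).choose (j - L.card) : ℝ) - 1)
            * pairSum q L s.discovered s.active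
          + 2 ^ k * K * (4 ^ L.card * (C * β))
          + 2 ^ (k + L.card) * K * (q / n + 1 / q) * pairSum q L s.discovered s.active := by
          gcongr
          exact sum_low_pairs_le hn hβ hC hs hD hL hdeg
      _ ≤ _ := by
          have e1 : 2 ^ k * K * (4 ^ L.card * (C * β))
              = 2 ^ (k + 2 * L.card) * K * (C * β) := by
            rw [show (4 : ℝ) = 2 ^ 2 by norm_num, ← pow_mul, pow_add]; ring
          have e2 : (2 : ℝ) ^ (k + 2 * L.card) * K * (C * β) ≤ 2 ^ (4 * k) * K * (C * β) := by
            gcongr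
            · norm_num
            · omega
          have e3 : (2 : ℝ) ^ (k + L.card) * K * (q / n + 1 / q)
              * pairSum q L s.discovered s.active
              ≤ 2 ^ (4 * k) * K * ((q / n + 1 / q) * pairSum q L s.discovered s.active) := by
            rw [mul_assoc _ (q / n + 1 / q)]
            gcongr
            · norm_num
            · omega
          linarith
  linarith

end SmoothBoundary

/-! ### Pairs found in different edges -/

namespace SmoothBoundary

variable {n k j : ℕ}

open scoped Classical in
/-- The sets of size `j + |L|` that contain `L` and a neutral `j`-set in `E`. -/
noncomputable def nearby (j : ℕ) (s : SearchState n) (L E : Finset (Fin n)) :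
    Finset (Finset (Fin n)) :=
  (superSets (j + L.card) L).filter fun X => ∃ K ∈ newIn j s E, K ⊆ X

lemma mem_nearby {s : SearchState n} {L E X : Finset (Fin n)} :
    X ∈ nearby j s L E ↔ X.card = j + L.card ∧ L ⊆ X ∧ ∃ K ∈ newIn j s E, K ⊆ X := by
  simp [nearby, mem_superSets, and_assoc]

lemma card_nearby_le_pow_inter (hn : 0 < n) (s : SearchState n) (L : Finset (Fin n))
    {E : Finset (Fin n)} (hE : E.card = k) :
    ((nearby j s L E).card : ℝ) ≤ 2 ^ k * (n : ℝ) ^ (E ∩ L).card := by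
  have hn' : (0 : ℝ) < n := by exact_mod_cast hn
  have hn1 : (1 : ℝ) ≤ n := by exact_mod_cast hn
  have hsub : nearby j s L E ⊆ (newIn j s E).biUnion fun K => superSets (j + L.card) (K ∪ L) := by
    intro X hX
    obtain ⟨h1, h2, K, hK, hKX⟩ := mem_nearby.1 hX
    exact Finset.mem_biUnion.2 ⟨K, hK, mem_superSets.2 ⟨h1, Finset.union_subset hKX h2⟩⟩
  calc ((nearby j s L E).card : ℝ)
      ≤ ∑ K ∈ newIn j s E, ((superSets (j + L.card) (K ∪ L)).card : ℝ) := by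
        exact_mod_cast (Finset.card_le_card hsub).trans Finset.card_biUnion_le
    _ ≤ ∑ K ∈ newIn j s E, (n : ℝ) ^ (E ∩ L).card := by
        refine Finset.sum_le_sum fun K hK => (card_superSets_le hn _).trans ?_
        rw [mem_newIn] at hK
        rw [wt_union_mul hn, wt_of_card hK.2.1, pow_add]
        unfold wt
        calc _ = (n : ℝ) ^ (K ∩ L).card := by field_simp
          _ ≤ _ := pow_le_pow_right₀ hn1
              (Finset.card_le_card (Finset.inter_subset_inter_right hK.1))
    _ = (newIn j s E).card * (n : ℝ) ^ (E ∩ L).card := by rw [Finset.sum_const, nsmul_eq_mul]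
    _ ≤ _ := by
        gcongr
        exact_mod_cast card_newIn_le s hE

lemma card_nearby_le (hn : 0 < n) (s : SearchState n) (L : Finset (Fin n))
    {E : Finset (Fin n)} (hE : E.card = k) :
    ((nearby j s L E).card : ℝ) ≤ 2 ^ k * (n : ℝ) ^ L.card := by
  refine (card_nearby_le_pow_inter hn s L hE).trans ?_
  have hn1 : (1 : ℝ) ≤ n := by exact_mod_cast hn
  gcongr
  exact Finset.inter_subset_right

lemma sum_card_nearby_le (hn : 0 < n) {s : SearchState n} (hs : s.Valid j)
    (L : Finset (Fin n)) :
    ∑ E ∈ fresh k s, ((nearby j s L E).card : ℝ)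
      ≤ 2 ^ (k + L.card) * ((n : ℝ) ^ k * ((n : ℝ) ^ j)⁻¹) * weightSum L s.active := by
  refine (sum_fresh_le s _ (fun _ E => 2 ^ k * (n : ℝ) ^ (E ∩ L).card)
    (fun _ _ => by positivity)
    (fun E hE A _ _ => card_nearby_le_pow_inter hn s L (mem_fresh.1 hE).1)).trans ?_
  simp_rw [← Finset.mul_sum]
  refine (mul_le_mul_of_nonneg_left (sum_active_pow_inter_le hn hs L) (by positivity)).trans
    (le_of_eq ?_)
  ring

/-- Such an X has boundedly many neutral j-subsets, and by sparsity each of them lies in few fresh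
edges. This bounds the expected multiplicity κ in the lower Chernoff bound for the union of the
families `nearby`. -/
lemma card_fresh_filter_nearby_le (hn : 0 < n) {β : ℝ} (hβ : 0 ≤ β) {s : SearchState n}
    (hs : s.Valid j) (hD : Sparse j β s.discovered) (L X : Finset (Fin n)) :
    (((fresh k s).filter fun E => X ∈ nearby j s L E).card : ℝ)
      ≤ 2 ^ (2 * j + L.card) * β * ((n : ℝ) ^ k * ((n : ℝ) ^ j)⁻¹) := by
  by_cases hX : X.card = j + L.card
  · have hsub : (fresh k s).filter (fun E => X ∈ nearby j s L E)
        ⊆ ((X.powersetCard j).filter fun K => K ∉ s.discovered).biUnion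
          fun K => (fresh k s).filter fun E => K ⊆ E := by
      intro E hE
      rw [Finset.mem_filter] at hE
      obtain ⟨-, -, K, hK, hKX⟩ := mem_nearby.1 hE.2
      rw [mem_newIn] at hK
      exact Finset.mem_biUnion.2 ⟨K, Finset.mem_filter.2
        ⟨Finset.mem_powersetCard.2 ⟨hKX, hK.2.1⟩, hK.2.2⟩, Finset.mem_filter.2 ⟨hE.1, hK.1⟩⟩
    calc (((fresh k s).filter fun E => X ∈ nearby j s L E).card : ℝ)
        ≤ ∑ K ∈ (X.powersetCard j).filter (fun K => K ∉ s.discovered),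
          (((fresh k s).filter fun E => K ⊆ E).card : ℝ) := by
          exact_mod_cast (Finset.card_le_card hsub).trans Finset.card_biUnion_le
      _ ≤ ∑ K ∈ (X.powersetCard j).filter (fun K => K ∉ s.discovered),
          2 ^ j * β * ((n : ℝ) ^ k * ((n : ℝ) ^ j)⁻¹) := by
          refine Finset.sum_le_sum fun K hK => ?_
          rw [Finset.mem_filter, Finset.mem_powersetCard] at hK
          exact card_fresh_filter_le hn hβ hs hD hK.1.2 hK.2
      _ = ((X.powersetCard j).filter fun K => K ∉ s.discovered).card
            * (2 ^ j * β * ((n : ℝ) ^ k * ((n : ℝ) ^ j)⁻¹)) := by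
          rw [Finset.sum_const, nsmul_eq_mul]
      _ ≤ 2 ^ (j + L.card) * (2 ^ j * β * ((n : ℝ) ^ k * ((n : ℝ) ^ j)⁻¹)) := by
          refine mul_le_mul_of_nonneg_right ?_ (by positivity)
          have : ((X.powersetCard j).filter fun K => K ∉ s.discovered).card
              ≤ 2 ^ (j + L.card) := by
            rw [← hX, ← Finset.card_powerset]
            refine Finset.card_le_card fun K hK => Finset.mem_powerset.2 ?_
            rw [Finset.mem_filter, Finset.mem_powersetCard] at hK
            exact hK.1.1
          exact_mod_cast this
      _ = _ := by ring
  · rw [Finset.filter_false_of_mem fun E _ h => hX (mem_nearby.1 h).1]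
    simp only [Finset.card_empty, Nat.cast_zero]
    positivity

/-- The pairs in the next generation: pairs found in one edge, and pairs found in different edges,
which lead to an overlap of the families `nearby`. -/
lemma pairSum_next_le {q : ℝ} (hq : 0 < q) (s : SearchState n) (L : Finset (Fin n))
    (T : Finset (Finset (Fin n)))
    (hω : ∀ A : Finset (Fin n), A.card = j →
      ((n : ℝ) / q) ^ (A ∩ L).card ≤ ((superSets (j + L.card) (A ∪ L)).card : ℝ)) :
    pairSum q L (s.discovered ∪ T.biUnion (newIn j s)) (T.biUnion (newIn j s))
      ≤ ∑ E ∈ T, pairWeight q j s L E + 4 ^ (j + L.card) *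
        (∑ E ∈ T, ((nearby j s L E).card : ℝ) - ((T.biUnion (nearby j s L)).card : ℝ)) := by
  classical
  set new := T.biUnion (newIn j s) with hnew
  set D' := s.discovered ∪ new with hD'
  set R : Finset (Fin n) → Finset (Fin n) → Prop :=
    fun A B => ∃ E ∈ T, A ∈ newIn j s E ∧ B ∈ s.discovered ∪ newIn j s E with hR
  set ω : Finset (Fin n) → ℝ := fun A => ((n : ℝ) / q) ^ (A ∩ L).card with hωdef
  have hω0 : ∀ A, 0 ≤ ω A := fun A => by positivity
  have hsplit : pairSum q L D' new
      = ∑ A ∈ new, ω A * (((D'.filter fun B => B ≠ A ∧ B ⊆ A ∪ L).filter fun B => R A B).card : ℝ)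
      + ∑ A ∈ new, ω A * (((D'.filter fun B => B ≠ A ∧ B ⊆ A ∪ L).filter
          fun B => ¬ R A B).card : ℝ) := by
    unfold pairSum
    rw [← Finset.sum_add_distrib]
    refine Finset.sum_congr rfl fun A _ => ?_
    rw [← mul_add, ← Nat.cast_add, Finset.card_filter_add_card_filter_not]
  rw [hsplit]
  refine add_le_add ?_ ?_
  · calc ∑ A ∈ new, ω A *
          (((D'.filter fun B => B ≠ A ∧ B ⊆ A ∪ L).filter fun B => R A B).card : ℝ)
        ≤ ∑ A ∈ new, ω A * ∑ E ∈ T.filter (fun E => A ∈ newIn j s E),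
          (((s.discovered ∪ newIn j s E).filter fun B => B ≠ A ∧ B ⊆ A ∪ L).card : ℝ) := by
          refine Finset.sum_le_sum fun A _ => mul_le_mul_of_nonneg_left ?_ (hω0 A)
          have hsub : (D'.filter fun B => B ≠ A ∧ B ⊆ A ∪ L).filter (fun B => R A B)
              ⊆ (T.filter fun E => A ∈ newIn j s E).biUnion fun E =>
                (s.discovered ∪ newIn j s E).filter fun B => B ≠ A ∧ B ⊆ A ∪ L := by
            intro B hB
            rw [Finset.mem_filter, Finset.mem_filter] at hB
            obtain ⟨E, hE, hAE, hBE⟩ := hB.2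
            exact Finset.mem_biUnion.2 ⟨E, Finset.mem_filter.2 ⟨hE, hAE⟩,
              Finset.mem_filter.2 ⟨hBE, hB.1.2⟩⟩
          exact_mod_cast (Finset.card_le_card hsub).trans Finset.card_biUnion_le
      _ = ∑ E ∈ T, ∑ A ∈ new.filter (fun A => A ∈ newIn j s E), ω A *
          (((s.discovered ∪ newIn j s E).filter fun B => B ≠ A ∧ B ⊆ A ∪ L).card : ℝ) := by
          simp_rw [Finset.mul_sum, Finset.sum_filter]
          rw [Finset.sum_comm]
      _ = _ := by
          refine Finset.sum_congr rfl fun E hE => ?_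
          unfold pairWeight
          refine Finset.sum_congr ?_ fun _ _ => rfl
          rw [Finset.filter_mem_eq_inter]
          exact Finset.inter_eq_right.2 (Finset.subset_biUnion_of_mem _ hE)
  · set XS := T.biUnion (nearby j s L) with hXS
    have hmult : ∑ E ∈ T, ((nearby j s L E).card : ℝ)
        = ∑ X ∈ XS, ((T.filter fun E => X ∈ nearby j s L E).card : ℝ) := by
      have h1 : ∀ E ∈ T, ((nearby j s L E).card : ℝ)
          = ∑ X ∈ XS, if X ∈ nearby j s L E then (1 : ℝ) else 0 := by
        intro E hE
        rw [Finset.sum_boole, Finset.filter_mem_eq_inter,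
          Finset.inter_eq_right.2 (Finset.subset_biUnion_of_mem (nearby j s L) hE)]
      rw [Finset.sum_congr rfl h1, Finset.sum_comm]
      refine Finset.sum_congr rfl fun X _ => ?_
      rw [Finset.sum_boole]
    have hXpos : ∀ X ∈ XS, (1 : ℝ) ≤ ((T.filter fun E => X ∈ nearby j s L E).card : ℝ) := by
      intro X hX
      obtain ⟨E, hE, hXE⟩ := Finset.mem_biUnion.1 hX
      exact_mod_cast Finset.card_pos.2 ⟨E, Finset.mem_filter.2 ⟨hE, hXE⟩⟩
    have hR' : ∀ A ∈ new, ∀ B ∈ D', ¬ R A B → ∀ X, X.card = j + L.card → A ∪ L ⊆ X →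
        B ⊆ X → X ∈ XS ∧ (2 : ℝ) ≤ ((T.filter fun E => X ∈ nearby j s L E).card : ℝ) := by
      intro A hA B hB hAB X hX hAX hBX
      obtain ⟨E, hE, hAE⟩ := Finset.mem_biUnion.1 hA
      have hBD : B ∉ s.discovered := fun h =>
        hAB ⟨E, hE, hAE, Finset.mem_union_left _ h⟩
      have hBnew : B ∈ new := (Finset.mem_union.1 hB).resolve_left hBD
      obtain ⟨E', hE', hBE'⟩ := Finset.mem_biUnion.1 hBnew
      have hne : E ≠ E' := by
        rintro rfl
        exact hAB ⟨E, hE, hAE, Finset.mem_union_right _ hBE'⟩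
      have hLX := Finset.subset_union_right.trans hAX
      have h1 : X ∈ nearby j s L E :=
        mem_nearby.2 ⟨hX, hLX, A, hAE, Finset.subset_union_left.trans hAX⟩
      have h2 : X ∈ nearby j s L E' := mem_nearby.2 ⟨hX, hLX, B, hBE', hBX⟩
      refine ⟨Finset.mem_biUnion.2 ⟨E, hE, h1⟩, ?_⟩
      have : 1 < (T.filter fun E => X ∈ nearby j s L E).card :=
        Finset.one_lt_card.2 ⟨E, Finset.mem_filter.2 ⟨hE, h1⟩, E',
          Finset.mem_filter.2 ⟨hE', h2⟩, hne⟩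
      exact_mod_cast this
    -- The weight of a pair (A, B) from different edges is at most the number of sets X ⊇ A ∪ L of
    -- size j + |L|. Each such X also contains B, hence it is covered by the families of two edges.
    -- Conversely X contains at most 4^(j+|L|) pairs, and its multiplicity minus one is at least 1.
    calc ∑ A ∈ new, ω A *
          (((D'.filter fun B => B ≠ A ∧ B ⊆ A ∪ L).filter fun B => ¬ R A B).card : ℝ)
        ≤ ∑ A ∈ new, ((superSets (j + L.card) (A ∪ L)).card : ℝ) *
          (((D'.filter fun B => B ≠ A ∧ B ⊆ A ∪ L).filter fun B => ¬ R A B).card : ℝ) := by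
          refine Finset.sum_le_sum fun A hA => mul_le_mul_of_nonneg_right (hω A ?_)
            (Nat.cast_nonneg _)
          obtain ⟨E, hE, hAE⟩ := Finset.mem_biUnion.1 hA
          exact (mem_newIn.1 hAE).2.1
      _ = ((new.sigma fun A => (superSets (j + L.card) (A ∪ L)) ×ˢ
            ((D'.filter fun B => B ≠ A ∧ B ⊆ A ∪ L).filter fun B => ¬ R A B)).card : ℝ) := by
          rw [Finset.card_sigma]
          push_cast [Finset.card_product]
          rfl
      _ ≤ ((XS.filter (fun X => 2 ≤ (T.filter fun E => X ∈ nearby j s L E).card)).sigma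
            fun X => X.powerset ×ˢ X.powerset).card := by
          norm_cast
          refine Finset.card_le_card_of_injOn (fun x => ⟨x.2.1, x.1, x.2.2⟩) ?_ ?_
          · rintro ⟨A, X, B⟩ hx
            simp only [Finset.coe_sigma, Set.mem_sigma_iff, Finset.mem_coe, Finset.mem_product,
              Finset.mem_filter, mem_superSets] at hx
            obtain ⟨hA, ⟨hX, hAX⟩, ⟨hB, -, hBA⟩, hAB⟩ := hx
            have hBX := hBA.trans hAX
            obtain ⟨h1, h2⟩ := hR' A hA B hB hAB X hX hAX hBX
            simp only [Finset.coe_sigma, Set.mem_sigma_iff, Finset.mem_coe, Finset.mem_product,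
              Finset.mem_filter, Finset.mem_powerset]
            exact ⟨⟨h1, by exact_mod_cast h2⟩, Finset.subset_union_left.trans hAX, hBX⟩
          · rintro ⟨A, X, B⟩ _ ⟨A', X', B'⟩ _ h
            simp only [Sigma.mk.injEq, heq_eq_eq, Prod.mk.injEq] at h
            obtain ⟨rfl, rfl, rfl⟩ := h
            rfl
      _ = ∑ X ∈ XS.filter (fun X => 2 ≤ (T.filter fun E => X ∈ nearby j s L E).card),
            (4 : ℝ) ^ (j + L.card) := by
          rw [Finset.card_sigma]
          push_cast [Finset.card_product, Finset.card_powerset]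
          refine Finset.sum_congr rfl fun X hX => ?_
          obtain ⟨E, hE, hXE⟩ := Finset.mem_biUnion.1 (Finset.mem_filter.1 hX).1
          rw [(mem_nearby.1 hXE).1, ← mul_pow]
          norm_num
      _ ≤ ∑ X ∈ XS, (4 : ℝ) ^ (j + L.card) *
            (((T.filter fun E => X ∈ nearby j s L E).card : ℝ) - 1) := by
          refine (Finset.sum_le_sum fun X hX => ?_).trans
            (Finset.sum_le_sum_of_subset_of_nonneg (Finset.filter_subset _ _) fun X hX _ =>
              mul_nonneg (by positivity) (sub_nonneg.2 (hXpos X hX)))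
          have : (2 : ℝ) ≤ ((T.filter fun E => X ∈ nearby j s L E).card : ℝ) := by
            exact_mod_cast (Finset.mem_filter.1 hX).2
          exact le_mul_of_one_le_right (by positivity) (by linarith)
      _ = _ := by
          rw [← Finset.mul_sum, Finset.sum_sub_distrib, hmult]
          simp

end SmoothBoundary

namespace SmoothBoundary

/-! ### The random part: degrees of the component, and one step of the search -/

variable {n k j : ℕ}

/-- The weighted sum of the degrees of the proper subsets of `L`. -/
noncomputable def lowerSum (L : Finset (Fin n)) (G : Finset (Finset (Fin n))) : ℝ :=
  ∑ Y ∈ L.powerset.erase L, (n : ℝ) ^ Y.card * (degree G Y : ℝ)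

lemma lowerSum_nonneg (L : Finset (Fin n)) (G : Finset (Finset (Fin n))) : 0 ≤ lowerSum L G :=
  Finset.sum_nonneg fun _ _ => by positivity

lemma sum_not_subset_pow_inter_le (L : Finset (Fin n)) (G : Finset (Finset (Fin n))) :
    ∑ A ∈ G.filter (fun A => ¬ L ⊆ A), (n : ℝ) ^ (A ∩ L).card ≤ lowerSum L G := by
  unfold lowerSum degree
  have h : ∀ Y, (n : ℝ) ^ Y.card * ((G.filter fun K => Y ⊆ K).card : ℝ)
      = ∑ A ∈ G, if Y ⊆ A then (n : ℝ) ^ Y.card else 0 := by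
    intro Y
    rw [← Finset.sum_filter, Finset.sum_const, nsmul_eq_mul, mul_comm]
  simp_rw [h]
  rw [Finset.sum_comm]
  have hnn : ∀ A : Finset (Fin n), ∀ Y ∈ L.powerset.erase L,
      (0 : ℝ) ≤ if Y ⊆ A then (n : ℝ) ^ Y.card else 0 :=
    fun A Y _ => by split_ifs <;> positivity
  refine (Finset.sum_le_sum fun A hA => ?_).trans (Finset.sum_le_sum_of_subset_of_nonneg
    (Finset.filter_subset _ _) fun A _ _ => Finset.sum_nonneg (hnn A))
  have hmem : A ∩ L ∈ L.powerset.erase L := by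
    refine Finset.mem_erase.2 ⟨fun h => (Finset.mem_filter.1 hA).2 ?_,
      Finset.mem_powerset.2 Finset.inter_subset_right⟩
    rw [← h]; exact Finset.inter_subset_left
  refine le_trans (le_of_eq ?_) (Finset.single_le_sum (hnn A) hmem)
  rw [if_pos Finset.inter_subset_left]

lemma weightSum_le (L : Finset (Fin n)) (G : Finset (Finset (Fin n))) :
    weightSum L G ≤ lowerSum L G + (n : ℝ) ^ L.card * (degree G L : ℝ) := by
  unfold weightSum
  rw [← Finset.sum_filter_add_sum_filter_not G (fun A => ¬ L ⊆ A)]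
  refine add_le_add (sum_not_subset_pow_inter_le L G) (le_of_eq ?_)
  simp only [not_not]
  rw [Finset.sum_congr rfl (g := fun _ => (n : ℝ) ^ L.card), Finset.sum_const, nsmul_eq_mul,
    mul_comm]
  · rfl
  · intro A hA
    rw [Finset.inter_eq_right.2 (Finset.mem_filter.1 hA).2]

/-- The jumps are bounded crudely by the degrees of proper subsets of `L`, without any smoothness.
This suffices for sparsity of the component. -/
lemma pivotJump_le (hn : 0 < n) {G : Finset (Finset (Fin n))} (hG : ∀ A ∈ G, A.card = j)
    (L : Finset (Fin n)) :
    pivotJump k j L G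
      ≤ ((n - j).choose (k - j) : ℝ) * (((k - L.card).choose (j - L.card) : ℝ) - 1) * degree G L
        + 2 ^ k * ((n : ℝ) ^ k * ((n : ℝ) ^ j)⁻¹) * (wt L * lowerSum L G) := by
  have hn' : (0 : ℝ) < n := by exact_mod_cast hn
  unfold pivotJump
  rw [← Finset.sum_filter_add_sum_filter_not G (fun A => L ⊆ A)]
  refine add_le_add (le_of_eq ?_) ?_
  · rw [Finset.sum_congr rfl (g := fun _ => ((n - j).choose (k - j) : ℝ) *
        (((k - L.card).choose (j - L.card) : ℝ) - 1)), Finset.sum_const, nsmul_eq_mul, mul_comm]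
    · rfl
    · intro A hA
      rw [if_pos (Finset.mem_filter.1 hA).2]
  · calc _ ≤ ∑ A ∈ G.filter (fun A => ¬ L ⊆ A), 2 ^ k * ((n : ℝ) ^ k * ((n : ℝ) ^ j)⁻¹) * wt L
          * (n : ℝ) ^ (A ∩ L).card := by
          refine Finset.sum_le_sum fun A hA => ?_
          rw [Finset.mem_filter] at hA
          rw [if_neg hA.2]
          have h1 := card_superSets_le (k := k) hn (A ∪ L)
          rw [wt_union_mul hn, wt_of_card (hG A hA.1)] at h1
          have h2 : ((k - L.card).choose (j - L.card) : ℝ) ≤ 2 ^ k := by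
            exact_mod_cast (Nat.choose_le_two_pow _ _).trans
              (Nat.pow_le_pow_right (by norm_num) (Nat.sub_le _ _))
          have h3 := wt_nonneg L
          calc _ ≤ ((n : ℝ) ^ k * (((n : ℝ) ^ j)⁻¹ * wt L * (n : ℝ) ^ (A ∩ L).card)) * 2 ^ k := by
                gcongr
            _ = _ := by ring
      _ ≤ _ := by
          rw [← Finset.mul_sum, mul_assoc]
          have := wt_nonneg L
          gcongr
          exact sum_not_subset_pow_inter_le L G

lemma degree_union_of_disjoint {D G : Finset (Finset (Fin n))} (h : Disjoint D G)
    (L : Finset (Fin n)) : degree (D ∪ G) L = degree D L + degree G L := by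
  unfold degree
  rw [Finset.filter_union, Finset.card_union_of_disjoint
    (Finset.disjoint_filter_filter h)]

lemma lowerSum_union_of_disjoint {D G : Finset (Finset (Fin n))} (h : Disjoint D G)
    (L : Finset (Fin n)) : lowerSum L (D ∪ G) = lowerSum L D + lowerSum L G := by
  unfold lowerSum
  rw [← Finset.sum_add_distrib]
  refine Finset.sum_congr rfl fun Y _ => ?_
  rw [degree_union_of_disjoint h]
  push_cast
  ring

/-- The excess of the degree of `L` in the component over its expectation. -/
noncomputable def degreeExcess (ρ C : ℝ) (L : Finset (Fin n)) (s : SearchState n) : ℝ :=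
  degree s.discovered L - ρ * degree (s.discovered \ s.active) L
    - C * (wt L * lowerSum L (s.discovered \ s.active))

lemma disjoint_biUnion_newIn (s : SearchState n) (T : Finset (Finset (Fin n))) :
    Disjoint s.discovered (T.biUnion (newIn j s)) := by
  rw [Finset.disjoint_right]
  intro K hK
  obtain ⟨E, -, hKE⟩ := Finset.mem_biUnion.1 hK
  exact (mem_newIn.1 hKE).2.2

/-- Every discovered set except the root is a child of a set that is no longer active. The two
subtracted terms bound the expected contribution of these parents through pivots and jumps, so they
act as a compensator. The factor 1 + θ2^k is the second-order loss of the exponential moment; it is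
absorbed into ρ and, being at most 2, into C. -/
lemma expect_exp_degreeExcess_le (hn : 0 < n) {p θ ρ C M : ℝ} (hp0 : 0 ≤ p) (hp1 : p ≤ 1)
    (hjk : j < k) (hθ : 0 ≤ θ) (hθk : θ * 2 ^ k ≤ 1) {L : Finset (Fin n)} (hL : L.card < j)
    (hρ : (1 + θ * 2 ^ k) * (p * (((n - j).choose (k - j) : ℝ) *
      (((k - L.card).choose (j - L.card) : ℝ) - 1))) ≤ ρ)
    (hM : p * ((n : ℝ) ^ k * ((n : ℝ) ^ j)⁻¹) ≤ M)
    (hC : 2 ^ (k + 1) * M ≤ C) {s : SearchState n} (hs : s.Valid j) :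
    expect p (fresh k s) (fun T => Real.exp (θ * degreeExcess ρ C L
        ⟨s.discovered ∪ T.biUnion (newIn j s), T.biUnion (newIn j s)⟩))
      ≤ Real.exp (θ * degreeExcess ρ C L s) := by
  have hn' : (0 : ℝ) < n := by exact_mod_cast hn
  set m := ∑ E ∈ fresh k s, ((newAt j s L E).card : ℝ) with hm
  have hm1 : m ≤ pivotJump k j L s.active := sum_card_newAt_le hjk.le hs hL.le
  have hm2 := pivotJump_le (k := k) hn
    (fun A hA => hs.card_eq A (hs.active_subset hA)) L
  have hS0 : 0 ≤ wt L * lowerSum L s.active :=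
    mul_nonneg (wt_nonneg L) (lowerSum_nonneg L s.active)
  have hd0 : (0 : ℝ) ≤ degree s.active L := Nat.cast_nonneg _
  have hmean : (1 + θ * 2 ^ k) * (p * m)
      ≤ ρ * degree s.active L + C * (wt L * lowerSum L s.active) := by
    have hK : 0 ≤ p * ((n : ℝ) ^ k * ((n : ℝ) ^ j)⁻¹) := by positivity
    calc (1 + θ * 2 ^ k) * (p * m)
        ≤ (1 + θ * 2 ^ k) * (p * (((n - j).choose (k - j) : ℝ) *
            (((k - L.card).choose (j - L.card) : ℝ) - 1) * degree s.active L
            + 2 ^ k * ((n : ℝ) ^ k * ((n : ℝ) ^ j)⁻¹) * (wt L * lowerSum L s.active))) := by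
          gcongr
          exact hm1.trans hm2
      _ = (1 + θ * 2 ^ k) * (p * (((n - j).choose (k - j) : ℝ) *
            (((k - L.card).choose (j - L.card) : ℝ) - 1))) * degree s.active L
          + (1 + θ * 2 ^ k) * (2 ^ k * (p * ((n : ℝ) ^ k * ((n : ℝ) ^ j)⁻¹)))
            * (wt L * lowerSum L s.active) := by ring
      _ ≤ ρ * degree s.active L + (2 * (2 ^ k * M)) * (wt L * lowerSum L s.active) := by
          gcongr
          linarith
      _ ≤ _ := by
          gcongr
          calc 2 * (2 ^ k * M) = 2 ^ (k + 1) * M := by ring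
            _ ≤ C := hC
  have hactive : s.discovered \ s.active ∪ s.active = s.discovered :=
    Finset.sdiff_union_of_subset hs.active_subset
  have hdd := degree_union_of_disjoint (D := s.discovered \ s.active) Finset.sdiff_disjoint L
  have hdl := lowerSum_union_of_disjoint (D := s.discovered \ s.active) Finset.sdiff_disjoint L
  rw [hactive] at hdd hdl
  -- After the step, the explored sets are exactly the sets discovered before it. The subtracted
  -- terms thus grow by the contribution of the previously active sets.
  have hstep : ∀ T, degreeExcess ρ C L
      ⟨s.discovered ∪ T.biUnion (newIn j s), T.biUnion (newIn j s)⟩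
      ≤ degreeExcess ρ C L s + ((∑ E ∈ T, ((newAt j s L E).card : ℝ))
        - (ρ * degree s.active L + C * (wt L * lowerSum L s.active))) := by
    intro T
    have hdisj := disjoint_biUnion_newIn (j := j) s T
    unfold degreeExcess
    simp only
    rw [Finset.union_sdiff_right, Finset.sdiff_eq_self_of_disjoint hdisj,
      degree_union_of_disjoint hdisj, hdl]
    have h1 : (degree (T.biUnion (newIn j s)) L : ℝ) ≤ ∑ E ∈ T, ((newAt j s L E).card : ℝ) := by
      rw [degree_biUnion_newIn]
      exact_mod_cast Finset.card_biUnion_le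
    have h2 : (degree s.discovered L : ℝ)
        = degree (s.discovered \ s.active) L + degree s.active L := by exact_mod_cast hdd
    push_cast
    rw [show ρ * (degree s.discovered L : ℝ)
      = ρ * (degree (s.discovered \ s.active) L + degree s.active L) by rw [h2]]
    linarith
  calc _ ≤ expect p (fresh k s) (fun T => Real.exp (θ * degreeExcess ρ C L s
          - θ * (ρ * degree s.active L + C * (wt L * lowerSum L s.active)))
          * Real.exp (θ * ∑ E ∈ T, ((newAt j s L E).card : ℝ))) := by
        refine expect_mono hp0 hp1 fun T _ => ?_
        rw [← Real.exp_add]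
        refine Real.exp_le_exp.2 ?_
        have := mul_le_mul_of_nonneg_left (hstep T) hθ
        linarith
    _ ≤ Real.exp (θ * degreeExcess ρ C L s
          - θ * (ρ * degree s.active L + C * (wt L * lowerSum L s.active)))
          * Real.exp (θ * (1 + θ * 2 ^ k) * (p * m)) := by
        rw [expect_const_mul]
        refine mul_le_mul_of_nonneg_left ?_ (Real.exp_nonneg _)
        exact expect_exp_sum_le hp0 hp1 _ _ hθ hθk (fun _ _ => Nat.cast_nonneg _)
          fun E hE => by exact_mod_cast card_newAt_le s L (mem_fresh.1 hE).1
    _ ≤ _ := by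
        rw [← Real.exp_add]
        refine Real.exp_le_exp.2 ?_
        have := mul_le_mul_of_nonneg_left hmean hθ
        linarith

lemma prob_degreeExcess_le (hn : 0 < n) {p θ ρ C M : ℝ} (hp0 : 0 ≤ p) (hp1 : p ≤ 1)
    (hjk : j < k) (hθ : 0 ≤ θ) (hθk : θ * 2 ^ k ≤ 1) {L : Finset (Fin n)} (hL : L.card < j)
    (hρ : (1 + θ * 2 ^ k) * (p * (((n - j).choose (k - j) : ℝ) *
      (((k - L.card).choose (j - L.card) : ℝ) - 1))) ≤ ρ)
    (hM : p * ((n : ℝ) ^ k * ((n : ℝ) ^ j)⁻¹) ≤ M)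
    (hC : 2 ^ (k + 1) * M ≤ C) {J : Finset (Fin n)} (hJ : J.card = j) (i : ℕ) (x : ℝ) :
    prob p (kSets n k) (fun T => x ≤ degreeExcess ρ C L (search j T J i))
      ≤ Real.exp (θ - θ * x) := by
  have h1 := prob_le_exp_mul_expect hp0 hp1 (kSets n k)
    (fun T => θ * degreeExcess ρ C L (search j T J i)) (θ * x)
  refine (prob_mono hp0 hp1 fun T _ h => mul_le_mul_of_nonneg_left h hθ).trans (h1.trans ?_)
  have h2 := expect_search_le_of_supermartingale (k := k) hp0 hp1 hJ
    (fun s => Real.exp (θ * degreeExcess ρ C L s))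
    (fun s hs => expect_exp_degreeExcess_le hn hp0 hp1 hjk hθ hθk hL hρ hM hC hs) i
  refine (mul_le_mul_of_nonneg_left h2 (Real.exp_nonneg _)).trans ?_
  rw [← Real.exp_add]
  refine Real.exp_le_exp.2 ?_
  -- Initially only the root is discovered and nothing is explored, which accounts for the summand θ
  -- in the exponent.
  have h3 : degreeExcess ρ C L ⟨{J}, {J}⟩ ≤ 1 := by
    unfold degreeExcess lowerSum degree
    simp only [Finset.sdiff_self, Finset.filter_empty, Finset.card_empty, Nat.cast_zero, mul_zero,
      Finset.sum_const_zero, sub_zero]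
    exact_mod_cast (Finset.card_filter_le _ _).trans (Finset.card_singleton J).le
  have := mul_le_mul_of_nonneg_left h3 hθ
  linarith

/-- If no degree exceeds its expectation by much, then the component is sparse as long as it is
small. -/
lemma sparse_of_degreeExcess_le (hn : 0 < n) {ρ C x lam : ℝ} (hρ0 : 0 ≤ ρ) (hρ1 : ρ < 1)
    (hC : 0 ≤ C) (hlam : 0 ≤ lam) (hx : x ≤ lam * n) (s : SearchState n)
    (hcard : (s.discovered.card : ℝ) ≤ lam * (n : ℝ) ^ j)
    (h : ∀ L : Finset (Fin n), 0 < L.card → L.card < j → degreeExcess ρ C L s ≤ x) :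
    Sparse j (lam * ((C * 2 ^ j + 1) / (1 - ρ)) ^ j) s.discovered := by
  have hn' : (0 : ℝ) < n := by exact_mod_cast hn
  have hn1 : (1 : ℝ) ≤ n := by exact_mod_cast hn
  set Γ := (C * 2 ^ j + 1) / (1 - ρ) with hΓ
  have hρ' : 0 < 1 - ρ := by linarith
  have hΓ1 : 1 ≤ Γ := by
    rw [hΓ, le_div_iff₀ hρ']
    have : 0 ≤ C * 2 ^ j := by positivity
    linarith
  have key : ∀ w < j, ∀ W : Finset (Fin n), W.card = w →
      (degree s.discovered W : ℝ) ≤ lam * Γ ^ w * (n : ℝ) ^ j * wt W := by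
    intro w
    induction w using Nat.strong_induction_on with
    | _ w ih =>
      intro hw W hW
      rcases Nat.eq_zero_or_pos w with h0 | hpos
      · subst h0
        have : W = ∅ := Finset.card_eq_zero.1 hW
        subst this
        simpa [degree, wt] using hcard
      · have hex := h W (hW ▸ hpos) (hW ▸ hw)
        unfold degreeExcess at hex
        have hsub : s.discovered \ s.active ⊆ s.discovered := Finset.sdiff_subset
        have h1 : (degree (s.discovered \ s.active) W : ℝ) ≤ degree s.discovered W := by
          exact_mod_cast degree_mono hsub W
        have h2 : lowerSum W (s.discovered \ s.active)
            ≤ 2 ^ j * (lam * Γ ^ (w - 1) * (n : ℝ) ^ j) := by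
          calc lowerSum W (s.discovered \ s.active)
              ≤ ∑ Y ∈ W.powerset.erase W, lam * Γ ^ (w - 1) * (n : ℝ) ^ j := by
                refine Finset.sum_le_sum fun Y hY => ?_
                rw [Finset.mem_erase, Finset.mem_powerset] at hY
                have hYW : Y.card < w := hW ▸ Finset.card_lt_card (hY.2.ssubset_of_ne hY.1)
                have h3 : (degree (s.discovered \ s.active) Y : ℝ)
                    ≤ lam * Γ ^ Y.card * (n : ℝ) ^ j * wt Y :=
                  le_trans (by exact_mod_cast degree_mono hsub Y)
                    (ih Y.card hYW (hYW.trans hw) Y rfl)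
                calc (n : ℝ) ^ Y.card * (degree (s.discovered \ s.active) Y : ℝ)
                    ≤ (n : ℝ) ^ Y.card * (lam * Γ ^ Y.card * (n : ℝ) ^ j * wt Y) := by gcongr
                  _ = lam * Γ ^ Y.card * (n : ℝ) ^ j := by unfold wt; field_simp
                  _ ≤ _ := by
                      gcongr
                      omega
            _ = (W.powerset.erase W).card * (lam * Γ ^ (w - 1) * (n : ℝ) ^ j) := by
                rw [Finset.sum_const, nsmul_eq_mul]
            _ ≤ _ := by
                refine mul_le_mul_of_nonneg_right ?_ (by positivity)
                exact_mod_cast (Finset.card_erase_le.trans (Finset.card_powerset W).le).trans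
                  (Nat.pow_le_pow_right (by norm_num) (by omega))
        -- As |W| < j, the additive error is no larger than the target n^(j-|W|) times lam.
        have h3 : lam * n ≤ lam * Γ ^ (w - 1) * (n : ℝ) ^ j * wt W := by
          have e1 : (n : ℝ) ≤ (n : ℝ) ^ j * wt W := by
            unfold wt
            rw [hW, ← div_eq_mul_inv, le_div_iff₀ (by positivity), ← pow_succ']
            exact pow_le_pow_right₀ hn1 (by omega)
          have e2 : 1 ≤ Γ ^ (w - 1) := one_le_pow₀ hΓ1
          calc lam * n ≤ lam * ((n : ℝ) ^ j * wt W) := by gcongr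
            _ = lam * 1 * (n : ℝ) ^ j * wt W := by ring
            _ ≤ _ := by have := wt_nonneg W; gcongr
        -- The pivot term involves the same degree and moves to the left, which is possible because
        -- ρ < 1. The jump term is bounded by induction on the size of W.
        have h4 : (1 - ρ) * (degree s.discovered W : ℝ)
            ≤ (C * 2 ^ j + 1) * (lam * Γ ^ (w - 1) * (n : ℝ) ^ j * wt W) := by
          have e1 := mul_le_mul_of_nonneg_left h1 hρ0
          have e2 := mul_le_mul_of_nonneg_left (mul_le_mul_of_nonneg_left h2 (wt_nonneg W)) hC
          have e3 : C * (wt W * (2 ^ j * (lam * Γ ^ (w - 1) * (n : ℝ) ^ j)))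
            = C * 2 ^ j * (lam * Γ ^ (w - 1) * (n : ℝ) ^ j * wt W) := by ring
          linarith
        rw [mul_comm, ← le_div_iff₀ hρ'] at h4
        refine h4.trans (le_of_eq ?_)
        rw [show Γ ^ w = Γ ^ (w - 1) * Γ by rw [← pow_succ]; congr 1; omega, hΓ]
        ring
  intro W hW
  refine (key W.card hW W rfl).trans ?_
  have := wt_nonneg W
  gcongr

/-- The quantities governing the degree of `L` in the next generation are close to their
conditional expectations. -/
structure GoodStep (k j : ℕ) (p q t x κ : ℝ) (s : SearchState n) (T : Finset (Finset (Fin n)))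
    (L : Finset (Fin n)) : Prop where
  degree_le : (degree (T.biUnion (newIn j s)) L : ℝ)
    ≤ (1 + t) * (p * ∑ E ∈ fresh k s, ((newAt j s L E).card : ℝ)) + 2 ^ k * x / t
  le_degree : (1 - t) * (p * ∑ E ∈ fresh k s, ((newAt j s L E).card : ℝ)) - 2 ^ k * x / t
    ≤ (1 + κ) * (degree (T.biUnion (newIn j s)) L : ℝ)
  pair_le : ∑ E ∈ T, pairWeight q j s L E ≤ (1 + t) * (p * ∑ E ∈ fresh k s, pairWeight q j s L E)
    + 2 ^ (k + j + L.card) * (n : ℝ) ^ L.card * x / t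
  nearby_le : ∑ E ∈ T, ((nearby j s L E).card : ℝ)
    ≤ (1 + t) * (p * ∑ E ∈ fresh k s, ((nearby j s L E).card : ℝ))
      + 2 ^ k * (n : ℝ) ^ L.card * x / t
  le_nearby : (1 - t) * (p * ∑ E ∈ fresh k s, ((nearby j s L E).card : ℝ))
      - 2 ^ k * (n : ℝ) ^ L.card * x / t ≤ (1 + κ) * ((T.biUnion (nearby j s L)).card : ℝ)

/-- Three Chernoff bounds for sums and two for unions. Sparsity enters only through κ, the bound for
the expected number of edges that cover a given element. -/
lemma prob_not_goodStep_le (hn : 0 < n) {p q t x κ β : ℝ} (hp0 : 0 ≤ p) (hp1 : p ≤ 1)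
    (hq : 1 ≤ q) (ht : 0 < t) (ht1 : t ≤ 1) (hβ : 0 ≤ β)
    (hκ : p * (2 ^ (3 * j) * β * ((n : ℝ) ^ k * ((n : ℝ) ^ j)⁻¹)) ≤ κ)
    {s : SearchState n} (hs : s.Valid j) (hD : Sparse j β s.discovered)
    {L : Finset (Fin n)} (hL : L.card < j) :
    prob p (fresh k s) (fun T => ¬ GoodStep k j p q t x κ s T L) ≤ 5 * Real.exp (-x) := by
  have hn' : (0 : ℝ) < n := by exact_mod_cast hn
  have hK : 0 ≤ p * ((n : ℝ) ^ k * ((n : ℝ) ^ j)⁻¹) := by positivity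
  have hκ0 : 0 ≤ κ := le_trans (by positivity) hκ
  have hκ1 : ∀ b, p * (((fresh k s).filter fun E => b ∈ newAt j s L E).card : ℝ) ≤ κ := by
    intro b
    by_cases hb : b.card = j ∧ b ∉ s.discovered
    · refine le_trans (mul_le_mul_of_nonneg_left ?_ hp0) hκ
      calc _ ≤ (((fresh k s).filter fun E => b ⊆ E).card : ℝ) := by
            norm_cast
            refine Finset.card_le_card (Finset.monotone_filter_right _ fun E _ hE => ?_)
            exact (mem_newIn.1 (Finset.mem_filter.1 hE).1).1
        _ ≤ 2 ^ j * β * ((n : ℝ) ^ k * ((n : ℝ) ^ j)⁻¹) :=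
            card_fresh_filter_le hn hβ hs hD hb.1 hb.2
        _ ≤ _ := by
            gcongr
            · norm_num
            · omega
    · have : (fresh k s).filter (fun E => b ∈ newAt j s L E) = ∅ :=
        Finset.filter_false_of_mem fun E _ hE => hb (mem_newIn.1 (Finset.mem_filter.1 hE).1).2
      rw [this]
      simpa using hκ0
  have hκ2 : ∀ b, p * (((fresh k s).filter fun E => b ∈ nearby j s L E).card : ℝ) ≤ κ := by
    intro b
    refine le_trans (mul_le_mul_of_nonneg_left
      ((card_fresh_filter_nearby_le hn hβ hs hD L b).trans ?_) hp0) hκ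
    gcongr
    · norm_num
    · omega
  have p1 := prob_sum_upper hp0 hp1 (fresh k s) (fun E => ((newAt j s L E).card : ℝ))
    (B := 2 ^ k) ht ht1 (by positivity) (fun _ _ => Nat.cast_nonneg _)
    (fun E hE => by exact_mod_cast card_newAt_le s L (mem_fresh.1 hE).1) x
  have p2 := prob_cover_lower hp0 hp1 (fresh k s) (newAt j s L) (B := 2 ^ k) ht ht1 (by positivity)
    (fun E hE => by exact_mod_cast card_newAt_le s L (mem_fresh.1 hE).1) hκ1 x
  have p3 := prob_sum_upper hp0 hp1 (fresh k s) (pairWeight q j s L)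
    (B := 2 ^ (k + j + L.card) * (n : ℝ) ^ L.card) ht ht1 (by positivity)
    (fun E _ => pairWeight_nonneg hq s L E)
    (fun E hE => pairWeight_le hn hq s L (mem_fresh.1 hE).1) x
  have p4 := prob_sum_upper hp0 hp1 (fresh k s) (fun E => ((nearby j s L E).card : ℝ))
    (B := 2 ^ k * (n : ℝ) ^ L.card) ht ht1 (by positivity) (fun _ _ => Nat.cast_nonneg _)
    (fun E hE => card_nearby_le hn s L (mem_fresh.1 hE).1) x
  have p5 := prob_cover_lower hp0 hp1 (fresh k s) (nearby j s L)
    (B := 2 ^ k * (n : ℝ) ^ L.card) ht ht1 (by positivity)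
    (fun E hE => card_nearby_le hn s L (mem_fresh.1 hE).1) hκ2 x
  have hor := fun P Q => prob_or_le hp0 hp1 (fresh k s) P Q
  refine (prob_mono hp0 hp1 fun T _ hT => ?_).trans
    ((hor _ _).trans (add_le_add ((hor _ _).trans (add_le_add ((hor _ _).trans
      (add_le_add ((hor _ _).trans (add_le_add p1 p2)) p3)) p4)) p5) |>.trans (le_of_eq (by ring)))
  by_contra hcon
  simp only [not_or, not_not] at hcon
  obtain ⟨⟨⟨⟨h1, h2⟩, h3⟩, h4⟩, h5⟩ := hcon
  refine hT ⟨?_, ?_, h3, h4, h5⟩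
  · refine le_trans ?_ h1
    rw [degree_biUnion_newIn]
    exact_mod_cast Finset.card_biUnion_le
  · rw [degree_biUnion_newIn]
    exact h2

end SmoothBoundary

/-! ### A union bound over all searches -/

namespace SmoothBoundary

variable {n k j : ℕ}

/-- The event that all searches behave as expected, as long as the component is sparse. -/
structure GoodRun (k j : ℕ) (p q t₁ t₂ x κ β ρ C : ℝ) (T : Finset (Finset (Fin n))) : Prop where
  step₁ : ∀ J : Finset (Fin n), J.card = j → ∀ i ≤ n ^ j, ∀ L : Finset (Fin n), L.card < j →
    Sparse j β (search j (T : Set (Finset (Fin n))) J i).discovered →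
    GoodStep k j p q t₁ x κ (search j T J i) (T ∩ fresh k (search j T J i)) L
  step₂ : ∀ J : Finset (Fin n), J.card = j → ∀ i ≤ n ^ j, ∀ L : Finset (Fin n), L.card < j →
    Sparse j β (search j (T : Set (Finset (Fin n))) J i).discovered →
    GoodStep k j p q t₂ x κ (search j T J i) (T ∩ fresh k (search j T J i)) L
  excess : ∀ J : Finset (Fin n), J.card = j → ∀ i ≤ n ^ j, ∀ L : Finset (Fin n), 0 < L.card →
    L.card < j → degreeExcess ρ C L (search j (T : Set (Finset (Fin n))) J i) ≤ x

lemma card_filter_card_lt_le (hn : 0 < n) (j : ℕ) :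
    ((Finset.univ : Finset (Finset (Fin n))).filter fun L => L.card < j).card ≤ j * n ^ j := by
  have hsub : ((Finset.univ : Finset (Finset (Fin n))).filter fun L => L.card < j)
      ⊆ (Finset.range j).biUnion fun l => Finset.powersetCard l Finset.univ := by
    intro L hL
    simp only [Finset.mem_filter, Finset.mem_univ, true_and] at hL
    simpa using hL
  refine (Finset.card_le_card hsub).trans (Finset.card_biUnion_le.trans ?_)
  calc ∑ l ∈ Finset.range j, (Finset.powersetCard l (Finset.univ : Finset (Fin n))).card
      ≤ ∑ l ∈ Finset.range j, n ^ j := by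
        refine Finset.sum_le_sum fun l hl => ?_
        rw [Finset.card_powersetCard, Finset.card_univ, Fintype.card_fin]
        exact (Nat.choose_le_pow _ _).trans
          (Nat.pow_le_pow_right hn (Finset.mem_range.1 hl).le)
    _ = j * n ^ j := by simp

/-- There are at most 2j n^(3j) triples of a root, a generation and a set, and each has 5 + 5 + 1
possible failures. Sparsity is a property of the state, so it can be part of the event and is
resolved once the state is fixed. -/
lemma prob_not_goodRun_le (hn : 0 < n) {p q t₁ t₂ x κ β ρ C θ M : ℝ} (hp0 : 0 ≤ p) (hp1 : p ≤ 1)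
    (hjk : j < k) (hq : 1 ≤ q) (ht₁ : 0 < t₁) (ht₁' : t₁ ≤ 1) (ht₂ : 0 < t₂) (ht₂' : t₂ ≤ 1)
    (hx : 0 ≤ x) (hβ : 0 ≤ β) (hκ : p * (2 ^ (3 * j) * β * ((n : ℝ) ^ k * ((n : ℝ) ^ j)⁻¹)) ≤ κ)
    (hθ : 0 ≤ θ) (hθk : θ * 2 ^ k ≤ 1)
    (hρ : ∀ l, 0 < l → l < j → (1 + θ * 2 ^ k) * (p * (((n - j).choose (k - j) : ℝ) *
      (((k - l).choose (j - l) : ℝ) - 1))) ≤ ρ)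
    (hM : p * ((n : ℝ) ^ k * ((n : ℝ) ^ j)⁻¹) ≤ M) (hC : 2 ^ (k + 1) * M ≤ C) :
    prob p (kSets n k) (fun T => ¬ GoodRun k j p q t₁ t₂ x κ β ρ C T)
      ≤ 22 * j * (n : ℝ) ^ (3 * j) * Real.exp (θ - θ * x) := by
  classical
  have hn1 : (1 : ℝ) ≤ n := by exact_mod_cast hn
  set I := (Finset.powersetCard j (Finset.univ : Finset (Fin n))) ×ˢ Finset.range (n ^ j + 1) ×ˢ
    ((Finset.univ : Finset (Finset (Fin n))).filter fun L => L.card < j) with hI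
  have hIcard : (I.card : ℝ) ≤ 2 * j * (n : ℝ) ^ (3 * j) := by
    rw [hI, Finset.card_product, Finset.card_product, Finset.card_powersetCard, Finset.card_range,
      Finset.card_univ, Fintype.card_fin]
    have h1 : n.choose j ≤ n ^ j := Nat.choose_le_pow _ _
    have h2 : n ^ j + 1 ≤ 2 * n ^ j := by have := Nat.one_le_pow j n hn; omega
    have h3 := card_filter_card_lt_le hn j
    calc _ ≤ ((n ^ j * (2 * n ^ j * (j * n ^ j)) : ℕ) : ℝ) := by
          exact_mod_cast Nat.mul_le_mul h1 (Nat.mul_le_mul h2 h3)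
      _ = _ := by push_cast; ring
  have hθ1 : θ ≤ 1 := by
    have : (1 : ℝ) ≤ 2 ^ k := one_le_pow₀ (by norm_num)
    nlinarith
  have hexp : Real.exp (-x) ≤ Real.exp (θ - θ * x) := Real.exp_le_exp.2 (by nlinarith)
  have hbad : ∀ y ∈ I, prob p (kSets n k) (fun T =>
      ((Sparse j β (search j (T : Set (Finset (Fin n))) y.1 y.2.1).discovered ∧
        ¬ GoodStep k j p q t₁ x κ (search j T y.1 y.2.1)
          (T ∩ fresh k (search j T y.1 y.2.1)) y.2.2) ∨
      (Sparse j β (search j (T : Set (Finset (Fin n))) y.1 y.2.1).discovered ∧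
        ¬ GoodStep k j p q t₂ x κ (search j T y.1 y.2.1)
          (T ∩ fresh k (search j T y.1 y.2.1)) y.2.2)) ∨
      (0 < y.2.2.card ∧ x ≤ degreeExcess ρ C y.2.2 (search j T y.1 y.2.1)))
      ≤ 11 * Real.exp (θ - θ * x) := by
    rintro ⟨J, i, L⟩ hy
    simp only [hI, Finset.mem_product, Finset.mem_powersetCard, Finset.mem_filter,
      Finset.mem_univ, true_and] at hy
    obtain ⟨⟨-, hJ⟩, -, hL⟩ := hy
    have hgood : ∀ t : ℝ, 0 < t → t ≤ 1 → prob p (kSets n k) (fun T =>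
        Sparse j β (search j (T : Set (Finset (Fin n))) J i).discovered ∧
        ¬ GoodStep k j p q t x κ (search j T J i) (T ∩ fresh k (search j T J i)) L)
        ≤ 5 * Real.exp (-x) := by
      intro t ht ht'
      refine prob_search_le hp0 hp1 hJ i (fun s T => Sparse j β s.discovered ∧
        ¬ GoodStep k j p q t x κ s T L) _ fun s hs => ?_
      -- For a state that is not sparse the event is empty.
      by_cases hD : Sparse j β s.discovered
      · refine (prob_mono hp0 hp1 fun T _ h => h.2).trans
          (prob_not_goodStep_le hn hp0 hp1 hq ht ht' hβ hκ hs hD hL)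
      · refine (prob_mono hp0 hp1 (Q := fun _ => False) fun T _ h => hD h.1).trans ?_
        unfold prob
        simp only [if_false]
        rw [expect_const]
        positivity
    have hex : prob p (kSets n k) (fun T => 0 < L.card ∧
        x ≤ degreeExcess ρ C L (search j (T : Set (Finset (Fin n))) J i))
        ≤ Real.exp (θ - θ * x) := by
      by_cases hL0 : 0 < L.card
      · exact (prob_mono hp0 hp1 fun T _ h => h.2).trans
          (prob_degreeExcess_le hn hp0 hp1 hjk hθ hθk hL (hρ _ hL0 hL) hM hC hJ i x)
      · refine (prob_mono hp0 hp1 (Q := fun _ => False) fun T _ h => hL0 h.1).trans ?_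
        unfold prob
        simp only [if_false]
        rw [expect_const]
        positivity
    refine (prob_or_le hp0 hp1 _ _ _).trans ((add_le_add ((prob_or_le hp0 hp1 _ _ _).trans
      (add_le_add (hgood t₁ ht₁ ht₁') (hgood t₂ ht₂ ht₂'))) hex).trans ?_)
    linarith
  have hall := prob_exists_le_card_mul hp0 hp1 (kSets n k) I _ hbad
  refine (prob_mono hp0 hp1 fun T _ hT => ?_).trans (hall.trans ?_)
  · by_contra hcon
    simp only [not_exists, not_and, not_or] at hcon
    have hmem : ∀ J : Finset (Fin n), J.card = j → ∀ i ≤ n ^ j, ∀ L : Finset (Fin n),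
        L.card < j → (J, i, L) ∈ I := by
      intro J hJ i hi L hL
      simp only [hI, Finset.mem_product, Finset.mem_powersetCard, Finset.mem_filter,
        Finset.mem_univ, true_and, Finset.mem_range, Finset.subset_univ]
      exact ⟨hJ, by omega, hL⟩
    refine hT ⟨fun J hJ i hi L hL hD => ?_, fun J hJ i hi L hL hD => ?_,
      fun J hJ i hi L hL0 hL => ?_⟩
    · exact not_not.1 ((hcon _ (hmem J hJ i hi L hL)).1.1 hD)
    · exact not_not.1 ((hcon _ (hmem J hJ i hi L hL)).1.2 hD)
    · exact (not_le.1 ((hcon _ (hmem J hJ i hi L hL)).2 hL0)).le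
  · calc (I.card : ℝ) * (11 * Real.exp (θ - θ * x))
        ≤ (2 * j * (n : ℝ) ^ (3 * j)) * (11 * Real.exp (θ - θ * x)) := by gcongr
      _ = _ := by ring

end SmoothBoundary

namespace SmoothBoundary

/-! ### Estimates for binomial coefficients -/

variable {n k j : ℕ}

/-- Removing one point from m + 1 points multiplies the binomial coefficient by 1 - b/(m+1), and m +
1 ≥ n/2 throughout. -/
lemma le_choose_sub {n b : ℕ} (hb : 2 * b ≤ n) (a : ℕ) (ha : 2 * a ≤ n) :
    (1 - 2 * a * b / n) * (n.choose b : ℝ) ≤ ((n - a).choose b : ℝ) := by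
  induction a with
  | zero => simp
  | succ a ih =>
    have hn : (0 : ℝ) < n := by
      have : 0 < n := by omega
      exact_mod_cast this
    have ih := ih (by omega)
    obtain ⟨m, hm⟩ : ∃ m, n - a = m + 1 := ⟨n - a - 1, by omega⟩
    have hm' : n - (a + 1) = m := by omega
    rw [hm] at ih
    rw [hm']
    have h1 := Nat.choose_mul_succ_eq m b
    have h2 : ((m.choose b : ℝ)) * (m + 1) = ((m + 1).choose b : ℝ) * (m + 1 - b) := by
      have h3 : b ≤ m + 1 := by omega
      have h4 : ((m + 1 - b : ℕ) : ℝ) = (m : ℝ) + 1 - b := by push_cast [Nat.cast_sub h3]; ring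
      rw [← h4]
      exact_mod_cast h1
    have h3 : (n : ℝ) ≤ 2 * (m + 1) := by
      have : n ≤ 2 * (m + 1) := by omega
      exact_mod_cast this
    have hc : (0 : ℝ) ≤ ((m + 1).choose b : ℝ) := Nat.cast_nonneg _
    have h4 : (1 - 2 * b / n) * ((m + 1).choose b : ℝ) ≤ (m.choose b : ℝ) := by
      have hm0 : (0 : ℝ) < m + 1 := by positivity
      have : (m.choose b : ℝ) = ((m + 1).choose b : ℝ) * (1 - b / (m + 1)) := by
        field_simp
        linarith
      rw [this, mul_comm]
      refine mul_le_mul_of_nonneg_left ?_ hc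
      have : (b : ℝ) / (m + 1) ≤ 2 * b / n := by
        rw [div_le_div_iff₀ hm0 hn]
        nlinarith [(Nat.cast_nonneg b : (0 : ℝ) ≤ b)]
      linarith
    have h5 : (0 : ℝ) ≤ 1 - 2 * b / n := by
      rw [sub_nonneg, div_le_one hn]
      exact_mod_cast hb
    refine le_trans ?_ h4
    refine le_trans ?_ (mul_le_mul_of_nonneg_left ih h5)
    rw [← mul_assoc]
    refine mul_le_mul_of_nonneg_right ?_ (Nat.cast_nonneg _)
    have h6 : (0 : ℝ) ≤ 2 * b / n * (2 * a * b / n) := by positivity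
    have h7 : 2 * ((a : ℝ) + 1) * b / n = 2 * a * b / n + 2 * b / n := by ring
    push_cast
    rw [h7]
    linarith

lemma choose_succ_le (n m : ℕ) : n.choose (m + 1) ≤ n.choose m * n := by
  have h := Nat.choose_succ_right_eq n m
  calc n.choose (m + 1) ≤ n.choose (m + 1) * (m + 1) := Nat.le_mul_of_pos_right _ (by omega)
    _ = n.choose m * (n - m) := h
    _ ≤ _ := Nat.mul_le_mul_left _ (Nat.sub_le _ _)

lemma choose_mul_le {n m : ℕ} (h : 2 * m ≤ n) :
    n.choose m * n ≤ 2 * (m + 1) * n.choose (m + 1) := by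
  have h1 := Nat.choose_succ_right_eq n m
  calc n.choose m * n ≤ n.choose m * (2 * (n - m)) := Nat.mul_le_mul_left _ (by omega)
    _ = 2 * (n.choose m * (n - m)) := by ring
    _ = _ := by rw [← h1]; ring

lemma pow_le_mul_choose {n m : ℕ} (h : 2 * m ≤ n) : n ^ m ≤ (2 * m) ^ m * n.choose m := by
  suffices H : ∀ i ≤ m, n ^ i ≤ (2 * m) ^ i * n.choose i from H m le_rfl
  intro i
  induction i with
  | zero => simp
  | succ i ih =>
    intro hi
    calc n ^ (i + 1) = n ^ i * n := pow_succ _ _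
      _ ≤ (2 * m) ^ i * n.choose i * n := Nat.mul_le_mul_right _ (ih (by omega))
      _ = (2 * m) ^ i * (n.choose i * n) := by ring
      _ ≤ (2 * m) ^ i * (2 * m * n.choose (i + 1)) := by
          refine Nat.mul_le_mul_left _ ((choose_mul_le (by omega)).trans ?_)
          exact Nat.mul_le_mul_right _ (by omega)
      _ = _ := by ring

/-- The proportion of the `j`-sets which contain a given `l`-set, up to a factor `1 + O(1/n)`. -/
noncomputable def meanRatio (n j l : ℕ) : ℝ := (n.choose (j - l) : ℝ) / (n.choose j : ℝ)

lemma meanRatio_zero (h : j ≤ n) : meanRatio n j 0 = 1 := by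
  have : (n.choose j : ℝ) ≠ 0 := by exact_mod_cast (Nat.choose_pos h).ne'
  simp [meanRatio, this]

lemma meanRatio_pos (h : j ≤ n) (l : ℕ) : 0 < meanRatio n j l := by
  have h1 : 0 < n.choose j := Nat.choose_pos h
  have h2 : 0 < n.choose (j - l) := Nat.choose_pos (by omega)
  unfold meanRatio
  positivity

lemma inv_pow_le_meanRatio (hn : 0 < n) (h : j ≤ n) {l : ℕ} (hl : l ≤ j) :
    ((n : ℝ) ^ l)⁻¹ ≤ meanRatio n j l := by
  have hn' : (0 : ℝ) < n := by exact_mod_cast hn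
  have h1 : (0 : ℝ) < n.choose j := by exact_mod_cast Nat.choose_pos h
  unfold meanRatio
  rw [inv_le_iff_one_le_mul₀ (by positivity), mul_comm, ← div_le_iff₀' (by positivity)]
  rw [div_le_div_iff₀ (by positivity) h1]
  have key : ∀ l ≤ j, n.choose j ≤ n.choose (j - l) * n ^ l := by
    intro l
    induction l with
    | zero => simp
    | succ l ih =>
      intro hl
      refine (ih (by omega)).trans ?_
      obtain ⟨m, hm⟩ : ∃ m, j - l = m + 1 := ⟨j - l - 1, by omega⟩
      rw [hm, show j - (l + 1) = m by omega, pow_succ']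
      calc _ ≤ n.choose m * n * n ^ l := Nat.mul_le_mul_right _ (choose_succ_le n m)
        _ = _ := by ring
  rw [one_mul]
  exact_mod_cast key l hl

lemma meanRatio_succ_le (hn : 0 < n) (h : 2 * j ≤ n) {l : ℕ} (hl : l < j) :
    meanRatio n j (l + 1) ≤ 2 * j / n * meanRatio n j l := by
  have hn' : (0 : ℝ) < n := by exact_mod_cast hn
  have h1 : (0 : ℝ) < n.choose j := by exact_mod_cast Nat.choose_pos (by omega)
  unfold meanRatio
  rw [div_mul_div_comm, div_le_div_iff₀ h1 (by positivity)]
  obtain ⟨m, hm⟩ : ∃ m, j - l = m + 1 := ⟨j - l - 1, by omega⟩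
  rw [hm, show j - (l + 1) = m by omega]
  have h2 : n.choose m * n ≤ 2 * j * n.choose (m + 1) :=
    (choose_mul_le (by omega)).trans (Nat.mul_le_mul_right _ (by omega))
  have h3 : (n.choose m : ℝ) * n ≤ 2 * j * n.choose (m + 1) := by exact_mod_cast h2
  nlinarith

lemma pow_mul_meanRatio_le (hn : 0 < n) (h : 2 * j ≤ n) {l : ℕ} (hl : l ≤ j) :
    (n : ℝ) ^ l * meanRatio n j l ≤ (2 * j) ^ j := by
  have hn' : (0 : ℝ) < n := by exact_mod_cast hn
  have key : ∀ l ≤ j, (n : ℝ) ^ l * meanRatio n j l ≤ (2 * j) ^ l := by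
    intro l
    induction l with
    | zero => intro _; simp [meanRatio_zero (show j ≤ n by omega)]
    | succ l ih =>
      intro hl
      have h1 := meanRatio_succ_le hn h (show l < j by omega)
      calc (n : ℝ) ^ (l + 1) * meanRatio n j (l + 1)
          ≤ (n : ℝ) ^ (l + 1) * (2 * j / n * meanRatio n j l) := by gcongr
        _ = 2 * j * ((n : ℝ) ^ l * meanRatio n j l) := by rw [pow_succ]; field_simp
        _ ≤ 2 * j * (2 * j) ^ l := by
            gcongr
            exact ih (by omega)
        _ = _ := by ring
  refine (key l hl).trans ?_
  rcases Nat.eq_zero_or_pos j with h0 | hj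
  · subst h0
    have : l = 0 := by omega
    subst this
    simp
  · refine pow_le_pow_right₀ ?_ hl
    have : (1 : ℝ) ≤ j := by exact_mod_cast hj
    linarith

lemma one_lt_choose {k j : ℕ} (hj : 0 < j) (hjk : j < k) : 1 < k.choose j := by
  obtain ⟨k, rfl⟩ : ∃ k', k = k' + 1 := ⟨k - 1, by omega⟩
  obtain ⟨j, rfl⟩ : ∃ j', j = j' + 1 := ⟨j - 1, by omega⟩
  rw [Nat.choose_succ_succ']
  have h1 : 0 < k.choose j := Nat.choose_pos (by omega)
  have h2 : 0 < k.choose (j + 1) := Nat.choose_pos (by omega)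
  omega

lemma choose_sub_sub_lt {k j l : ℕ} (hl : 0 < l) (hlj : l < j) (hjk : j < k) :
    (k - l).choose (j - l) < k.choose j := by
  induction l with
  | zero => omega
  | succ l ih =>
    have hstep : (k - (l + 1)).choose (j - (l + 1)) < (k - l).choose (j - l) := by
      obtain ⟨k', hk'⟩ : ∃ k', k - l = k' + 1 := ⟨k - l - 1, by omega⟩
      obtain ⟨j', hj'⟩ : ∃ j', j - l = j' + 1 := ⟨j - l - 1, by omega⟩
      rw [hk', hj', show k - (l + 1) = k' by omega, show j - (l + 1) = j' by omega,
        Nat.choose_succ_succ']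
      have : 0 < k'.choose (j' + 1) := Nat.choose_pos (by omega)
      omega
    rcases Nat.eq_zero_or_pos l with h0 | hpos
    · subst h0; simpa using hstep
    · exact hstep.trans (ih hpos (by omega))

lemma choose_sub_one_pos (hj : 0 < j) (hjk : j < k) : (1 : ℝ) ≤ (k.choose j : ℝ) - 1 := by
  have h : 2 ≤ k.choose j := one_lt_choose hj hjk
  have : (2 : ℝ) ≤ k.choose j := by exact_mod_cast h
  linarith

lemma branchRatio_pos {l : ℕ} (hlj : l < j) (hjk : j < k) : 0 < branchRatio k j l := by
  unfold branchRatio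
  have h1 := choose_sub_one_pos (show 0 < j - l by omega) (show j - l < k - l by omega)
  have h2 := choose_sub_one_pos (show 0 < j by omega) hjk
  exact div_pos (by linarith) (by linarith)

lemma branchRatio_lt_one {l : ℕ} (hl : 0 < l) (hlj : l < j) (hjk : j < k) :
    branchRatio k j l < 1 := by
  unfold branchRatio
  have h2 := choose_sub_one_pos (show 0 < j by omega) hjk
  rw [div_lt_one (by linarith)]
  have : ((k - l).choose (j - l) : ℝ) < k.choose j := by exact_mod_cast choose_sub_sub_lt hl hlj hjk
  linarith

lemma branchRatio_zero (hj : 0 < j) (hjk : j < k) : branchRatio k j 0 = 1 := by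
  unfold branchRatio
  have h2 := choose_sub_one_pos hj hjk
  simp only [Nat.sub_zero]
  exact div_self (by linarith)

/-- The expected number of edges containing a `j`-set, compared with the critical value. -/
lemma edgeProb_mul_choose {ε p : ℝ} (hj : 0 < j) (hjk : j < k) (hn : k ≤ n)
    (hp : p = (1 + ε) * critProb k j n) (l : ℕ) :
    p * (((n - j).choose (k - j) : ℝ) * (((k - l).choose (j - l) : ℝ) - 1))
      = (1 + ε) * ((n - j).choose (k - j) / n.choose (k - j) : ℝ) * branchRatio k j l := by
  have h2 := choose_sub_one_pos hj hjk
  have h3 : (n.choose (k - j) : ℝ) ≠ 0 := by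
    exact_mod_cast (Nat.choose_pos (show k - j ≤ n by omega)).ne'
  have h4 : (k.choose j : ℝ) - 1 ≠ 0 := by linarith
  rw [hp, critProb, branchRatio]
  field_simp

lemma choose_sub_div_le_one (n a b : ℕ) : ((n - a).choose b / n.choose b : ℝ) ≤ 1 := by
  refine div_le_one_of_le₀ ?_ (Nat.cast_nonneg _)
  exact_mod_cast Nat.choose_le_choose b (Nat.sub_le _ _)

lemma le_choose_sub_div {n b : ℕ} (hb : 2 * b ≤ n) (a : ℕ) (ha : 2 * a ≤ n) :
    1 - 2 * a * b / n ≤ ((n - a).choose b / n.choose b : ℝ) := by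
  have : (0 : ℝ) < n.choose b := by exact_mod_cast Nat.choose_pos (by omega)
  rw [le_div_iff₀ this]
  exact le_choose_sub hb a ha

/-- Source of the constant M: the edge probability is of order n^(j-k), so the expected number of
edges at a j-set is bounded. -/
lemma edgeProb_mul_pow_le {ε p : ℝ} (hj : 0 < j) (hjk : j < k) (hn : 2 * k ≤ n)
    (hε0 : 0 ≤ ε) (hε : ε ≤ 1) (hp : p = (1 + ε) * critProb k j n) :
    p * ((n : ℝ) ^ k * ((n : ℝ) ^ j)⁻¹) ≤ 2 * (2 * k) ^ k := by
  have hn' : (0 : ℝ) < n := by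
    have : 0 < n := by omega
    exact_mod_cast this
  have h1 := choose_sub_one_pos hj hjk
  have h2 : (n : ℝ) ^ (k - j) ≤ (2 * k) ^ k * n.choose (k - j) := by
    have h := pow_le_mul_choose (show 2 * (k - j) ≤ n by omega)
    have h' : (2 * (k - j)) ^ (k - j) ≤ (2 * k) ^ k :=
      (Nat.pow_le_pow_left (show 2 * (k - j) ≤ 2 * k by omega) _).trans
        (Nat.pow_le_pow_right (by omega) (by omega))
    exact_mod_cast h.trans (Nat.mul_le_mul_right _ h')
  have h3 : (0 : ℝ) < n.choose (k - j) := by exact_mod_cast Nat.choose_pos (by omega)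
  have h4 : (n : ℝ) ^ k * ((n : ℝ) ^ j)⁻¹ = (n : ℝ) ^ (k - j) := by
    rw [pow_sub₀ _ hn'.ne' hjk.le]
  rw [h4, hp, critProb]
  have h5 : (1 : ℝ) / ((k.choose j : ℝ) - 1) ≤ 1 := by
    rw [div_le_one (by linarith)]; exact h1
  have h5' : (0 : ℝ) ≤ 1 / ((k.choose j : ℝ) - 1) := by
    apply div_nonneg <;> linarith
  calc (1 + ε) * (1 / ((k.choose j : ℝ) - 1) * (1 / (n.choose (k - j) : ℝ))) * (n : ℝ) ^ (k - j)
      ≤ (1 + ε) * (1 / ((k.choose j : ℝ) - 1) * (1 / (n.choose (k - j) : ℝ)))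
          * ((2 * k) ^ k * n.choose (k - j)) := by
        gcongr
    _ = (1 + ε) * (1 / ((k.choose j : ℝ) - 1)) * (2 * k) ^ k := by field_simp
    _ ≤ 2 * 1 * (2 * k) ^ k := by
        gcongr
        linarith
    _ = _ := by ring

/-- The supersets arise by adding z = |A ∩ L| vertices out of m ≥ n/2, and C(m, z) ≥ (m/2z)^z. This
is why q has to be at least 4j. -/
lemma pow_inter_le_card_superSets {q : ℝ} (hq : 4 * j ≤ q) (hq0 : 0 < q) (hn : 8 * j ≤ n)
    {L : Finset (Fin n)} (hL : L.card ≤ j) {A : Finset (Fin n)} (hA : A.card = j) :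
    (n / q : ℝ) ^ (A ∩ L).card ≤ ((superSets (j + L.card) (A ∪ L)).card : ℝ) := by
  have hcard : (A ∪ L).card + (A ∩ L).card = j + L.card := by
    rw [Finset.card_union_add_card_inter, hA]
  have hz : (A ∩ L).card ≤ j := (Finset.card_le_card Finset.inter_subset_right).trans hL
  set z := (A ∩ L).card with hzdef
  rw [card_superSets (by omega)]
  rw [show j + L.card - (A ∪ L).card = z by omega]
  set m := n - (A ∪ L).card with hm
  have hmn : n ≤ 2 * m := by omega
  have h1 := pow_le_mul_choose (show 2 * z ≤ m by omega)
  rcases Nat.eq_zero_or_pos z with h0 | hpos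
  · rw [h0]; simp
  have hz' : (0 : ℝ) < z := by exact_mod_cast hpos
  have h2 : (m : ℝ) ^ z ≤ (2 * z) ^ z * (m.choose z : ℝ) := by exact_mod_cast h1
  have h3 : ((m : ℝ) / (2 * z)) ^ z ≤ (m.choose z : ℝ) := by
    rw [div_pow, div_le_iff₀ (by positivity), mul_comm]
    exact h2
  refine le_trans (pow_le_pow_left₀ (by positivity) ?_ z) h3
  rw [div_le_div_iff₀ hq0 (by positivity)]
  have h4 : (n : ℝ) ≤ 2 * m := by exact_mod_cast hmn
  have h5 : (z : ℝ) ≤ j := by exact_mod_cast hz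
  calc (n : ℝ) * (2 * z) ≤ (2 * m) * (2 * j) := by gcongr
    _ = m * (4 * j) := by ring
    _ ≤ m * q := by gcongr

end SmoothBoundary

namespace SmoothBoundary

/-! ### The contribution of jumps to a smooth family -/

variable {n k j : ℕ}

/-- The members of `G` with prescribed intersection with `L`. -/
def withTrace (G : Finset (Finset (Fin n))) (L Z : Finset (Fin n)) : Finset (Finset (Fin n)) :=
  G.filter fun A => A ∩ L = Z

/-- The contribution to `pivotJump` of those members of `G` which do not contain `L`. -/
noncomputable def jumpSum (k j : ℕ) (L : Finset (Fin n)) (G : Finset (Finset (Fin n))) : ℝ :=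
  ∑ A ∈ G.filter (fun A => ¬ L ⊆ A),
    ((superSets k (A ∪ L)).card : ℝ) * ((k - L.card).choose (j - L.card) : ℝ)

lemma pivotJump_eq (L : Finset (Fin n)) (G : Finset (Finset (Fin n))) :
    pivotJump k j L G
      = ((n - j).choose (k - j) : ℝ) * (((k - L.card).choose (j - L.card) : ℝ) - 1) * degree G L
        + jumpSum k j L G := by
  unfold pivotJump jumpSum
  rw [← Finset.sum_filter_add_sum_filter_not G (fun A => L ⊆ A)]
  congr 1
  · rw [Finset.sum_congr rfl (g := fun _ => ((n - j).choose (k - j) : ℝ) *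
        (((k - L.card).choose (j - L.card) : ℝ) - 1)), Finset.sum_const, nsmul_eq_mul, mul_comm]
    · rfl
    · intro A hA
      rw [if_pos (Finset.mem_filter.1 hA).2]
  · refine Finset.sum_congr rfl fun A hA => ?_
    rw [if_neg (Finset.mem_filter.1 hA).2]

lemma card_superSets_union {A L : Finset (Fin n)} (hA : A.card = j) :
    (superSets k (A ∪ L)).card = if j + L.card - (A ∩ L).card ≤ k then
      (n - (j + L.card - (A ∩ L).card)).choose (k - (j + L.card - (A ∩ L).card)) else 0 := by
  have hcard : (A ∪ L).card + (A ∩ L).card = j + L.card := by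
    rw [Finset.card_union_add_card_inter, hA]
  have : j + L.card - (A ∩ L).card = (A ∪ L).card := by omega
  rw [this]
  split_ifs with h
  · exact card_superSets h
  · rw [superSets_eq_empty (by omega), Finset.card_empty]

/-- The number of edges around A ∪ L depends on A only through |A ∩ L|. Jumps are therefore a
nonnegative linear combination of trace counts, and two families can be compared trace by trace. -/
lemma jumpSum_eq {G : Finset (Finset (Fin n))} (hG : ∀ A ∈ G, A.card = j) (L : Finset (Fin n)) :
    jumpSum k j L G = ∑ Z ∈ L.powerset.erase L, ((withTrace G L Z).card : ℝ) *
      (((if j + L.card - Z.card ≤ k then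
        (n - (j + L.card - Z.card)).choose (k - (j + L.card - Z.card)) else 0 : ℕ) : ℝ) *
        ((k - L.card).choose (j - L.card) : ℝ)) := by
  have hmaps : ∀ A ∈ G.filter (fun A => ¬ L ⊆ A), A ∩ L ∈ L.powerset.erase L := by
    intro A hA
    refine Finset.mem_erase.2 ⟨fun h => (Finset.mem_filter.1 hA).2 ?_,
      Finset.mem_powerset.2 Finset.inter_subset_right⟩
    rw [← h]; exact Finset.inter_subset_left
  unfold jumpSum
  rw [← Finset.sum_fiberwise_of_maps_to hmaps]
  refine Finset.sum_congr rfl fun Z hZ => ?_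
  rw [Finset.mem_erase, Finset.mem_powerset] at hZ
  have hfil : (G.filter (fun A => ¬ L ⊆ A)).filter (fun A => A ∩ L = Z) = withTrace G L Z := by
    unfold withTrace
    rw [Finset.filter_filter]
    refine Finset.filter_congr fun A _ => ⟨fun h => h.2, fun h => ⟨fun hLA => hZ.1 ?_, h⟩⟩
    rw [← h, Finset.inter_eq_right.2 hLA]
  rw [hfil, ← nsmul_eq_mul, ← Finset.sum_const]
  refine Finset.sum_congr rfl fun A hA => ?_
  unfold withTrace at hA
  rw [Finset.mem_filter] at hA
  rw [card_superSets_union (hG A hA.1), hA.2]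

lemma jumpSum_le_mul {G G' : Finset (Finset (Fin n))} (hG : ∀ A ∈ G, A.card = j)
    (hG' : ∀ A ∈ G', A.card = j) (L : Finset (Fin n)) {c c' : ℝ}
    (h : ∀ Z ⊂ L, c' * ((withTrace G L Z).card : ℝ) ≤ c * ((withTrace G' L Z).card : ℝ)) :
    c' * jumpSum k j L G ≤ c * jumpSum k j L G' := by
  rw [jumpSum_eq hG, jumpSum_eq hG', Finset.mul_sum, Finset.mul_sum]
  refine Finset.sum_le_sum fun Z hZ => ?_
  rw [Finset.mem_erase, Finset.mem_powerset] at hZ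
  rw [← mul_assoc c', ← mul_assoc c]
  exact mul_le_mul_of_nonneg_right (h Z (hZ.2.ssubset_of_ne hZ.1))
    (mul_nonneg (Nat.cast_nonneg _) (Nat.cast_nonneg _))

lemma card_withTrace_le (G : Finset (Finset (Fin n))) (L Z : Finset (Fin n)) :
    (withTrace G L Z).card ≤ degree G Z := by
  unfold withTrace degree
  refine Finset.card_le_card (Finset.monotone_filter_right _ fun A _ h => ?_)
  rw [← h]; exact Finset.inter_subset_left

/-- A member that contains Z but has a larger trace contains a further vertex of `L`. -/
lemma degree_le_card_withTrace (G : Finset (Finset (Fin n))) {L Z : Finset (Fin n)} (hZ : Z ⊆ L) :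
    degree G Z ≤ (withTrace G L Z).card + ∑ v ∈ L \ Z, degree G (insert v Z) := by
  unfold withTrace degree
  refine le_trans ?_ (add_le_add_right (Finset.card_biUnion_le) _)
  refine le_trans (Finset.card_le_card ?_) (Finset.card_union_le _ _)
  intro A hA
  rw [Finset.mem_filter] at hA
  rw [Finset.mem_union, Finset.mem_filter, Finset.mem_biUnion]
  by_cases h : A ∩ L = Z
  · exact Or.inl ⟨hA.1, h⟩
  · right
    have hsub : Z ⊆ A ∩ L := Finset.subset_inter hA.2 hZ
    obtain ⟨v, hv, hvZ⟩ := Finset.exists_of_ssubset (hsub.ssubset_of_ne (Ne.symm h))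
    rw [Finset.mem_inter] at hv
    exact ⟨v, Finset.mem_sdiff.2 ⟨hv.2, hvZ⟩, Finset.mem_filter.2
      ⟨hA.1, Finset.insert_subset hv.1 hA.2⟩⟩

lemma card_withTrace_jSets {L Z : Finset (Fin n)} (hZ : Z ⊆ L) (hZj : Z.card ≤ j) :
    (withTrace (jSets n j) L Z).card = (n - L.card).choose (j - Z.card) := by
  have h : (Finset.powersetCard (j - Z.card) Lᶜ).card = (n - L.card).choose (j - Z.card) := by
    rw [Finset.card_powersetCard, Finset.card_compl, Fintype.card_fin]
  rw [← h]
  have hdisj : ∀ Y ⊆ Lᶜ, Disjoint Y L := fun Y hY =>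
    Finset.disjoint_left.2 fun v hv => Finset.mem_compl.1 (hY hv)
  refine Finset.card_nbij' (fun A => A \ L) (fun Y => Y ∪ Z) ?_ ?_ ?_ ?_
  · intro A hA
    simp only [withTrace, jSets, Finset.coe_filter, Finset.mem_powersetCard, Set.mem_ofPred_eq,
      Finset.subset_univ, true_and] at hA
    simp only [Finset.mem_coe, Finset.mem_powersetCard]
    refine ⟨fun v hv => Finset.mem_compl.2 (Finset.mem_sdiff.1 hv).2, ?_⟩
    have := Finset.card_sdiff_add_card_inter A L
    rw [hA.2, hA.1] at this
    omega
  · intro Y hY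
    simp only [Finset.mem_coe, Finset.mem_powersetCard] at hY
    have h1 := hdisj Y hY.1
    simp only [withTrace, jSets, Finset.coe_filter, Finset.mem_powersetCard, Set.mem_ofPred_eq,
      Finset.subset_univ, true_and]
    refine ⟨?_, ?_⟩
    · rw [Finset.card_union_of_disjoint (h1.mono_right hZ), hY.2]
      omega
    · rw [Finset.union_inter_distrib_right, Finset.disjoint_iff_inter_eq_empty.1 h1,
        Finset.empty_union, Finset.inter_eq_left.2 hZ]
  · intro A hA
    simp only [withTrace, Finset.coe_filter, Set.mem_ofPred_eq] at hA
    simp only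
    rw [← hA.2, Finset.sdiff_union_inter]
  · intro Y hY
    simp only [Finset.mem_coe, Finset.mem_powersetCard] at hY
    have h1 := hdisj Y hY.1
    simp only
    rw [Finset.union_sdiff_distrib, Finset.sdiff_eq_empty_iff_subset.2 hZ, Finset.union_empty,
      Finset.sdiff_eq_self_of_disjoint h1]

lemma mem_jSets {A : Finset (Fin n)} : A ∈ jSets n j ↔ A.card = j := by
  simp [jSets]

/-- Double counting of the pairs of an edge around `L` and a j-set in this edge that does not
contain `L`. -/
lemma sum_card_superSets_jSets {L : Finset (Fin n)} (hL : L.card ≤ j) :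
    ∑ A ∈ (jSets n j).filter (fun A => ¬ L ⊆ A), (superSets k (A ∪ L)).card
      = (superSets k L).card * (k.choose j - (k - L.card).choose (j - L.card)) := by
  have h1 : ∀ A, (superSets k (A ∪ L)).card = ∑ E ∈ superSets k L, if A ⊆ E then 1 else 0 := by
    intro A
    rw [← Finset.card_filter]
    congr 1
    ext E
    rw [mem_superSets, Finset.mem_filter, mem_superSets, Finset.union_subset_iff]
    tauto
  simp_rw [h1]
  rw [Finset.sum_comm, Finset.card_eq_sum_ones, Finset.sum_mul]
  refine Finset.sum_congr rfl fun E hE => ?_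
  rw [mem_superSets] at hE
  rw [← Finset.card_filter, one_mul, Finset.filter_filter]
  have h2 : (jSets n j).filter (fun A => ¬ L ⊆ A ∧ A ⊆ E)
      = (Finset.powersetCard j E) \ ((Finset.powersetCard j E).filter fun A => L ⊆ A) := by
    ext A
    rw [Finset.mem_filter, mem_jSets, Finset.mem_sdiff, Finset.mem_filter,
      Finset.mem_powersetCard]
    tauto
  rw [h2, Finset.card_sdiff_of_subset (Finset.filter_subset _ _), Finset.card_powersetCard, hE.1,
    card_filter_powersetCard_superset hE.2 hL, hE.1]

/-- The family of all j-sets is perfectly smooth and serves as the reference for jumps. The double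
count is rewritten with C(N,K)C(K,S) = C(N,S)C(N-S,K-S). -/
lemma jumpSum_jSets (hjk : j ≤ k) {L : Finset (Fin n)} (hL : L.card ≤ j) (hn : k ≤ n) :
    jumpSum k j L (jSets n j) = ((n - L.card).choose (j - L.card) : ℝ) *
      ((n - j).choose (k - j) * ((k.choose j : ℝ) - (k - L.card).choose (j - L.card))) := by
  have h1 := sum_card_superSets_jSets (n := n) (k := k) hL
  rw [card_superSets (hL.trans hjk)] at h1
  have h2 : (k - L.card).choose (j - L.card) ≤ k.choose j := by
    rw [← Nat.choose_symm_of_eq_add (show k - L.card = (k - j) + (j - L.card) by omega),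
      ← Nat.choose_symm hjk]
    exact Nat.choose_le_choose _ (Nat.sub_le _ _)
  have h3 := Nat.choose_mul (n := n - L.card) (k := k - L.card) (s := j - L.card) (by omega)
  rw [show n - L.card - (j - L.card) = n - j by omega,
    show k - L.card - (j - L.card) = k - j by omega] at h3
  unfold jumpSum
  rw [← Finset.sum_mul, ← Nat.cast_sum, h1]
  push_cast [Nat.cast_sub h2]
  have h3' : ((n - L.card).choose (k - L.card) : ℝ) * ((k - L.card).choose (j - L.card) : ℝ)
    = ((n - L.card).choose (j - L.card) : ℝ) * ((n - j).choose (k - j) : ℝ) := by exact_mod_cast h3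
  linear_combination ((k.choose j : ℝ) - (k - L.card).choose (j - L.card)) * h3'

end SmoothBoundary

/-! ### Comparing jumps with those of the family of all `j`-sets -/

namespace SmoothBoundary

variable {n k j : ℕ}

/-- All degrees of sets with fewer than `l` elements are within a factor `1 ± γ` of their mean. -/
def SmoothBelow (j l : ℕ) (γ : ℝ) (G : Finset (Finset (Fin n))) : Prop :=
  ∀ Z : Finset (Fin n), Z.card < l →
    |(degree G Z : ℝ) - G.card * meanRatio n j Z.card| ≤ γ * (G.card * meanRatio n j Z.card)

lemma SmoothBelow.degree_le {l : ℕ} {γ : ℝ} {G : Finset (Finset (Fin n))}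
    (h : SmoothBelow j l γ G) {Z : Finset (Fin n)} (hZ : Z.card < l) :
    (degree G Z : ℝ) ≤ (1 + γ) * (G.card * meanRatio n j Z.card) := by
  have := (abs_le.1 (h Z hZ)).2
  linarith

lemma SmoothBelow.le_degree {l : ℕ} {γ : ℝ} {G : Finset (Finset (Fin n))}
    (h : SmoothBelow j l γ G) {Z : Finset (Fin n)} (hZ : Z.card < l) :
    (1 - γ) * (G.card * meanRatio n j Z.card) ≤ degree G Z := by
  have := (abs_le.1 (h Z hZ)).1
  linarith

lemma jumpSum_nonneg (L : Finset (Fin n)) (G : Finset (Finset (Fin n))) : 0 ≤ jumpSum k j L G :=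
  Finset.sum_nonneg fun _ _ => by positivity

lemma div_le_sq_div (hjk : j < k) {a b : ℕ} (ha : a ≤ j) (hb : b ≤ k) :
    2 * (a : ℝ) * b / n ≤ 2 * (k : ℝ) ^ 2 / n := by
  have h1 : (a : ℝ) ≤ k := by exact_mod_cast ha.trans hjk.le
  have h2 : (b : ℝ) ≤ k := by exact_mod_cast hb
  have : 2 * (a : ℝ) * b ≤ 2 * (k : ℝ) ^ 2 := by
    rw [sq, mul_assoc]; gcongr
  gcongr

/-- The factor 1 - r_ℓ is the difference of the expected branching for the empty set, which is 1 up
to the common factor, and for `L`. Thus pivots and jumps together reproduce the mean. -/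
lemma edgeProb_mul_jumpSum_jSets {ε p : ℝ} (hj : 0 < j) (hjk : j < k) (hn : k ≤ n)
    (hp : p = (1 + ε) * critProb k j n) {L : Finset (Fin n)} (hL : L.card < j) :
    p * jumpSum k j L (jSets n j) = (1 + ε) * (1 - branchRatio k j L.card) *
      (((n - j).choose (k - j) / n.choose (k - j) : ℝ) * (n - L.card).choose (j - L.card)) := by
  rw [jumpSum_jSets hjk.le hL.le hn]
  have h0 := edgeProb_mul_choose hj hjk hn hp 0
  have h1 := edgeProb_mul_choose hj hjk hn hp L.card
  rw [branchRatio_zero hj hjk, Nat.sub_zero, Nat.sub_zero] at h0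
  linear_combination ((n - L.card).choose (j - L.card) : ℝ) * (h0 - h1)

/-- The expected contribution of jumps is at most what it would be for a perfectly smooth
family. -/
lemma edgeProb_mul_jumpSum_le {ε p γ : ℝ} (hj : 0 < j) (hjk : j < k) (hn : 8 * k ^ 2 ≤ n)
    (hε0 : 0 ≤ ε) (hp : p = (1 + ε) * critProb k j n) (hp0 : 0 ≤ p) (hγ : 0 ≤ γ)
    {L : Finset (Fin n)} (hL0 : 0 < L.card)
    (hL : L.card < j) {G : Finset (Finset (Fin n))} (hG : ∀ A ∈ G, A.card = j)
    (hsm : SmoothBelow j L.card γ G) :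
    p * jumpSum k j L G ≤ (1 + ε) * (G.card * meanRatio n j L.card) *
      ((1 - branchRatio k j L.card) * ((1 + γ) * (1 + 4 * k ^ 2 / n))) := by
  have hkn : 8 * k ≤ n := by nlinarith
  have hn0 : 0 < n := by omega
  have hn' : (0 : ℝ) < n := by exact_mod_cast hn0
  have hcj : (0 : ℝ) < n.choose j := by exact_mod_cast Nat.choose_pos (by omega)
  have hr := branchRatio_lt_one hL0 hL hjk
  set u : ℝ := 2 * k ^ 2 / n with hu
  have hu0 : 0 ≤ u := by positivity
  have hu1 : u ≤ 1 / 4 := by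
    rw [hu, div_le_iff₀ hn']
    have : (8 * k ^ 2 : ℝ) ≤ n := by exact_mod_cast hn
    linarith
  set a : ℝ := (G.card : ℝ) with ha
  have ha0 : 0 ≤ a := Nat.cast_nonneg _
  -- For each proper subset Z of `L` the trace count of G is at most the degree of Z, while that of
  -- all j-sets is C(n - |L|, j - |Z|). The factor 1 - u covers the difference to C(n, j - |Z|).
  have key : (1 - u) * jumpSum k j L G
      ≤ ((1 + γ) * (a / n.choose j)) * jumpSum k j L (jSets n j) := by
    refine jumpSum_le_mul hG (fun A hA => mem_jSets.1 hA) L fun Z hZ => ?_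
    have hZL : Z.card < L.card := Finset.card_lt_card hZ
    rw [card_withTrace_jSets hZ.subset (by omega)]
    have h1 : ((withTrace G L Z).card : ℝ) ≤ degree G Z := by exact_mod_cast card_withTrace_le G L Z
    have h2 := hsm.degree_le hZL
    have h3 := le_choose_sub (n := n) (b := j - Z.card) (by omega) L.card (by omega)
    have h4 := div_le_sq_div (n := n) hjk (a := L.card) (b := j - Z.card) hL.le (by omega)
    have hb0 : (0 : ℝ) ≤ (n.choose (j - Z.card) : ℝ) := Nat.cast_nonneg _
    calc (1 - u) * ((withTrace G L Z).card : ℝ)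
        ≤ (1 - u) * ((1 + γ) * (a * meanRatio n j Z.card)) := by
          have : 0 ≤ 1 - u := by linarith
          gcongr
          exact h1.trans h2
      _ = ((1 + γ) * (a / n.choose j)) * ((1 - u) * (n.choose (j - Z.card) : ℝ)) := by
          unfold meanRatio; ring
      _ ≤ ((1 + γ) * (a / n.choose j)) * ((n - L.card).choose (j - Z.card) : ℝ) := by
          refine mul_le_mul_of_nonneg_left ?_ (by positivity)
          refine le_trans (mul_le_mul_of_nonneg_right ?_ hb0) h3
          linarith
  have hfull := edgeProb_mul_jumpSum_jSets hj hjk (show k ≤ n by omega) hp hL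
  have hg := choose_sub_div_le_one n j (k - j)
  have hch : ((n - L.card).choose (j - L.card) : ℝ) ≤ n.choose (j - L.card) := by
    exact_mod_cast Nat.choose_le_choose _ (Nat.sub_le _ _)
  set X : ℝ := (1 + ε) * (a * meanRatio n j L.card) * ((1 - branchRatio k j L.card) * (1 + γ))
    with hX
  have hτ := meanRatio_pos (show j ≤ n by omega) L.card
  have hr' : 0 ≤ 1 - branchRatio k j L.card := by linarith
  have hX0 : 0 ≤ X := by positivity
  have key2 : (1 - u) * (p * jumpSum k j L G) ≤ X := by
    calc (1 - u) * (p * jumpSum k j L G) = p * ((1 - u) * jumpSum k j L G) := by ring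
      _ ≤ p * (((1 + γ) * (a / n.choose j)) * jumpSum k j L (jSets n j)) := by gcongr
      _ = ((1 + γ) * (a / n.choose j)) * (p * jumpSum k j L (jSets n j)) := by ring
      _ ≤ ((1 + γ) * (a / n.choose j)) * ((1 + ε) * (1 - branchRatio k j L.card) *
            (1 * (n.choose (j - L.card) : ℝ))) := by
          rw [hfull]
          gcongr
      _ = X := by rw [hX]; unfold meanRatio; ring
  have hY0 : 0 ≤ p * jumpSum k j L G := mul_nonneg hp0 (jumpSum_nonneg L G)
  have : p * jumpSum k j L G ≤ (1 + 2 * u) * X := by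
    have h1 : 1 ≤ (1 + 2 * u) * (1 - u) := by nlinarith
    calc p * jumpSum k j L G ≤ (1 + 2 * u) * (1 - u) * (p * jumpSum k j L G) :=
          le_mul_of_one_le_left hY0 h1
      _ = (1 + 2 * u) * ((1 - u) * (p * jumpSum k j L G)) := by ring
      _ ≤ _ := by gcongr
  refine this.trans (le_of_eq ?_)
  rw [hX, hu]
  ring

/-- The expected contribution of jumps is at least what it would be for a perfectly smooth
family. -/
lemma le_edgeProb_mul_jumpSum {ε p γ x : ℝ} (hj : 0 < j) (hjk : j < k) (hn : 8 * k ^ 2 ≤ n)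
    (hε0 : 0 ≤ ε) (hp : p = (1 + ε) * critProb k j n) (hp0 : 0 ≤ p) (hγ : 0 ≤ γ) (hγ1 : γ ≤ 1)
    (hx : 0 ≤ x) {L : Finset (Fin n)} (hL0 : 0 < L.card)
    (hL : L.card < j) {G : Finset (Finset (Fin n))} (hG : ∀ A ∈ G, A.card = j)
    (hsm : SmoothBelow j L.card γ G)
    (hLx : (degree G L : ℝ) ≤ x * (G.card * meanRatio n j L.card)) :
    (1 + ε) * (G.card * meanRatio n j L.card) *
      ((1 - branchRatio k j L.card) * (1 - γ - (4 + x) * (2 * k ^ 2 / n)))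
      ≤ p * jumpSum k j L G := by
  have hkn : 8 * k ≤ n := by nlinarith
  have hn0 : 0 < n := by omega
  have hn' : (0 : ℝ) < n := by exact_mod_cast hn0
  have hcj : (0 : ℝ) < n.choose j := by exact_mod_cast Nat.choose_pos (by omega)
  have hr := branchRatio_lt_one hL0 hL hjk
  set u : ℝ := 2 * k ^ 2 / n with hu
  have hu0 : 0 ≤ u := by positivity
  have hu1 : u ≤ 1 / 4 := by
    rw [hu, div_le_iff₀ hn']
    have : (8 * k ^ 2 : ℝ) ≤ n := by exact_mod_cast hn
    linarith
  set a : ℝ := (G.card : ℝ) with ha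
  have ha0 : 0 ≤ a := Nat.cast_nonneg _
  have hτ := meanRatio_pos (show j ≤ n by omega) L.card
  have hr' : 0 ≤ 1 - branchRatio k j L.card := by linarith
  have hY0 : 0 ≤ p * jumpSum k j L G := mul_nonneg hp0 (jumpSum_nonneg L G)
  set f : ℝ := 1 - γ - (2 + x) * u with hf
  have hxu : 0 ≤ x * u := mul_nonneg hx hu0
  -- If f is negative, the claimed lower bound is not positive and there is nothing to prove.
  rcases lt_or_ge f 0 with hneg | hpos
  · refine le_trans ?_ hY0
    refine mul_nonpos_of_nonneg_of_nonpos (by positivity)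
      (mul_nonpos_of_nonneg_of_nonpos hr' ?_)
    rw [hf] at hneg
    nlinarith
  have key : (f * (a / n.choose j)) * jumpSum k j L (jSets n j) ≤ 1 * jumpSum k j L G := by
    refine jumpSum_le_mul (fun A hA => mem_jSets.1 hA) hG L fun Z hZ => ?_
    have hZL : Z.card < L.card := Finset.card_lt_card hZ
    rw [card_withTrace_jSets hZ.subset (by omega), one_mul]
    have hτz := meanRatio_pos (show j ≤ n by omega) Z.card
    have h1 : (degree G Z : ℝ) ≤ (withTrace G L Z).card
        + ∑ v ∈ L \ Z, (degree G (insert v Z) : ℝ) := by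
      exact_mod_cast degree_le_card_withTrace G hZ.subset
    have h2 := hsm.le_degree hZL
    -- Members with a trace larger than Z are rarer by a factor of order 1/n. When Z with one more
    -- vertex is `L` itself, smoothness below `L` is silent, and the assumed bound on the degree of
    -- `L` takes over.
    have h3 : ∑ v ∈ L \ Z, (degree G (insert v Z) : ℝ)
        ≤ (2 + x) * u * (a * meanRatio n j Z.card) := by
      have hstep := meanRatio_succ_le hn0 (show 2 * j ≤ n by omega) (show Z.card < j by omega)
      have h4 : ∀ v ∈ L \ Z, (degree G (insert v Z) : ℝ)
          ≤ (2 + x) * (a * (2 * j / n * meanRatio n j Z.card)) := by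
        intro v hv
        rw [Finset.mem_sdiff] at hv
        have hc : (insert v Z).card = Z.card + 1 := Finset.card_insert_of_notMem hv.2
        have hτs := meanRatio_pos (show j ≤ n by omega) (Z.card + 1)
        have h5 : (degree G (insert v Z) : ℝ) ≤ (2 + x) * (a * meanRatio n j (Z.card + 1)) := by
          rcases Nat.lt_or_ge (insert v Z).card L.card with hlt | hge
          · have := hsm.degree_le hlt
            rw [hc] at this
            exact this.trans (mul_le_mul_of_nonneg_right (by linarith) (by positivity))
          · have heq : insert v Z = L :=
              Finset.eq_of_subset_of_card_le (Finset.insert_subset hv.1 hZ.subset) hge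
            rw [← hc, heq]
            refine hLx.trans ?_
            gcongr
            linarith
        refine h5.trans ?_
        gcongr
      refine (Finset.sum_le_card_nsmul _ _ _ h4).trans ?_
      rw [nsmul_eq_mul]
      have h6 : ((L \ Z).card : ℝ) ≤ j := by
        exact_mod_cast (Finset.card_le_card Finset.sdiff_subset).trans hL.le
      have h7 := div_le_sq_div (n := n) hjk (a := j) (b := j) le_rfl hjk.le
      calc ((L \ Z).card : ℝ) * ((2 + x) * (a * (2 * j / n * meanRatio n j Z.card)))
          ≤ j * ((2 + x) * (a * (2 * j / n * meanRatio n j Z.card))) := by gcongr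
        _ = (2 + x) * (2 * j * j / n) * (a * meanRatio n j Z.card) := by ring
        _ ≤ _ := by gcongr
    have h8 : ((n - L.card).choose (j - Z.card) : ℝ) ≤ n.choose (j - Z.card) := by
      exact_mod_cast Nat.choose_le_choose _ (Nat.sub_le _ _)
    calc f * (a / n.choose j) * ((n - L.card).choose (j - Z.card) : ℝ)
        ≤ f * (a / n.choose j) * (n.choose (j - Z.card) : ℝ) := by gcongr
      _ = f * (a * meanRatio n j Z.card) := by unfold meanRatio; ring
      _ ≤ _ := by rw [hf]; linarith
  have hfull := edgeProb_mul_jumpSum_jSets hj hjk (show k ≤ n by omega) hp hL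
  have hg := le_choose_sub_div (n := n) (b := k - j) (by omega) j (by omega)
  have hg' := div_le_sq_div (n := n) hjk (a := j) (b := k - j) le_rfl (by omega)
  have hch := le_choose_sub (n := n) (b := j - L.card) (by omega) L.card (by omega)
  have hch' := div_le_sq_div (n := n) hjk (a := L.card) (b := j - L.card) hL.le (by omega)
  have hb0 : (0 : ℝ) ≤ (n.choose (j - L.card) : ℝ) := Nat.cast_nonneg _
  have hu2 : 0 ≤ 1 - u := by linarith
  have h9 : (1 - u) * ((1 - u) * (n.choose (j - L.card) : ℝ))
      ≤ ((n - j).choose (k - j) / n.choose (k - j) : ℝ) * (n - L.card).choose (j - L.card) := by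
    have e1 : (1 - u) * (n.choose (j - L.card) : ℝ) ≤ (n - L.card).choose (j - L.card) :=
      le_trans (mul_le_mul_of_nonneg_right (by linarith) hb0) hch
    have e2 : (1 - u) ≤ ((n - j).choose (k - j) / n.choose (k - j) : ℝ) := by linarith
    exact mul_le_mul e2 e1 (by positivity) (by positivity)
  calc (1 + ε) * (a * meanRatio n j L.card) *
      ((1 - branchRatio k j L.card) * (1 - γ - (4 + x) * u))
      ≤ (1 + ε) * (a * meanRatio n j L.card) *
      ((1 - branchRatio k j L.card) * (f * ((1 - u) * (1 - u)))) := by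
        gcongr
        have hf1 : f ≤ 1 := by rw [hf]; nlinarith
        have : 1 - γ - (4 + x) * u = f - 2 * u := by rw [hf]; ring
        rw [this]
        nlinarith [mul_nonneg hu0 (sub_nonneg.2 hf1), mul_nonneg hpos (mul_nonneg hu0 hu0)]
    _ = f * (a / n.choose j) * ((1 + ε) * (1 - branchRatio k j L.card) *
          ((1 - u) * ((1 - u) * (n.choose (j - L.card) : ℝ)))) := by unfold meanRatio; ring
    _ ≤ f * (a / n.choose j) * (p * jumpSum k j L (jSets n j)) := by
        rw [hfull]
        gcongr
    _ = p * (f * (a / n.choose j) * jumpSum k j L (jSets n j)) := by ring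
    _ ≤ p * (1 * jumpSum k j L G) := by gcongr
    _ = _ := by rw [one_mul]

end SmoothBoundary

namespace SmoothBoundary

/-! ### One step of the search: size, degrees and pairs -/

variable {n k j : ℕ}

/-- Standing assumptions on the parameters. -/
structure Regime (n k j : ℕ) (p ε q M β : ℝ) : Prop where
  j_pos : 0 < j
  j_lt : j < k
  large : 8 * k ^ 2 ≤ n
  ε_nonneg : 0 ≤ ε
  p_nonneg : 0 ≤ p
  p_eq : p = (1 + ε) * critProb k j n
  codeg_le : p * ((n : ℝ) ^ k * ((n : ℝ) ^ j)⁻¹) ≤ M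
  one_le_q : 1 ≤ q
  le_q : 4 * (j : ℝ) ≤ q
  q_le : q ≤ n
  β_nonneg : 0 ≤ β

section

variable {p ε q M β t x κ γ y : ℝ} {s : SearchState n} {T : Finset (Finset (Fin n))}
  {L : Finset (Fin n)}

lemma Regime.n_ge (h : Regime n k j p ε q M β) : 8 * k ≤ n := by
  have := h.large
  have := h.j_lt
  nlinarith

lemma Regime.n_pos (h : Regime n k j p ε q M β) : 0 < n := by
  have := h.n_ge
  have := h.j_lt
  omega

lemma Regime.M_nonneg (h : Regime n k j p ε q M β) : 0 ≤ M :=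
  le_trans (mul_nonneg h.p_nonneg (by positivity)) h.codeg_le

lemma degree_empty (G : Finset (Finset (Fin n))) : degree G ∅ = G.card := by
  simp [degree]

lemma weightSum_empty (G : Finset (Finset (Fin n))) : weightSum ∅ G = G.card := by
  simp [weightSum]

/-- For the empty set no pair can obstruct, since B ⊆ A forces B = A. Controlling the size of the
generation therefore needs only sparsity. -/
lemma pairSum_empty {D G : Finset (Finset (Fin n))} (hD : ∀ B ∈ D, B.card = j)
    (hG : ∀ A ∈ G, A.card = j) : pairSum q ∅ D G = 0 := by
  unfold pairSum
  refine Finset.sum_eq_zero fun A hA => ?_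
  have : (D.filter fun B => B ≠ A ∧ B ⊆ A ∪ ∅) = ∅ := by
    refine Finset.filter_false_of_mem fun B hB h => h.1 ?_
    rw [Finset.union_empty] at h
    exact Finset.eq_of_subset_of_card_le h.2 (by rw [hD B hB, hG A hA])
  rw [this]
  simp

lemma jumpSum_empty (G : Finset (Finset (Fin n))) : jumpSum k j ∅ G = 0 := by
  simp [jumpSum]

/-- An upper bound for the expected number of new sets containing `L` in terms of jumps. -/
lemma Regime.mean_le (h : Regime n k j p ε q M β) (hs : s.Valid j) (hL : L.card < j) :
    p * ∑ E ∈ fresh k s, ((newAt j s L E).card : ℝ)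
      ≤ (1 + ε) * branchRatio k j L.card * degree s.active L + p * jumpSum k j L s.active := by
  have h1 := mul_le_mul_of_nonneg_left (sum_card_newAt_le h.j_lt.le hs hL.le) h.p_nonneg
  rw [pivotJump_eq, mul_add] at h1
  have h2 := edgeProb_mul_choose h.j_pos h.j_lt (show k ≤ n by have := h.n_ge; omega) h.p_eq L.card
  have h3 := choose_sub_div_le_one n j (k - j)
  have hr := (branchRatio_pos hL h.j_lt).le
  have hε := h.ε_nonneg
  refine h1.trans (add_le_add_left ?_ _)
  rw [← mul_assoc, h2]
  gcongr
  exact mul_le_of_le_one_right (by linarith) h3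

lemma Regime.le_mean (h : Regime n k j p ε q M β) (hs : s.Valid j) (hL : L.card < j)
    (hD : Sparse j β s.discovered) :
    (1 + ε) * (1 - 2 * k ^ 2 / n) * branchRatio k j L.card * degree s.active L
        + p * jumpSum k j L s.active
        - 2 ^ k * M * wt L * (2 ^ (j + L.card) * β * weightSum L s.active
          + q ^ L.card * pairSum q L s.discovered s.active)
      ≤ p * ∑ E ∈ fresh k s, ((newAt j s L E).card : ℝ) := by
  have hkn := h.n_ge
  have hjk := h.j_lt
  have hq := h.one_le_q
  have h1 := mul_le_mul_of_nonneg_left (le_sum_card_newAt h.j_lt.le hs hL.le) h.p_nonneg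
  rw [pivotJump_eq] at h1
  have h2 := edgeProb_mul_choose h.j_pos h.j_lt (show k ≤ n by omega) h.p_eq L.card
  have h3 := le_choose_sub_div (n := n) (b := k - j) (by omega) j (by omega)
  have h3' := div_le_sq_div (n := n) hjk (a := j) (b := k - j) le_rfl (by omega)
  have hr := (branchRatio_pos hL h.j_lt).le
  have hε := h.ε_nonneg
  have h4 := sum_card_spoiled_le h.n_pos h.β_nonneg h.one_le_q hs hD L (k := k)
  have hwt := wt_nonneg L
  have hX : 0 ≤ 2 ^ (j + L.card) * β * weightSum L s.active
      + q ^ L.card * pairSum q L s.discovered s.active := by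
    have e1 : 0 ≤ weightSum L s.active := Finset.sum_nonneg fun _ _ => by positivity
    have e2 : 0 ≤ pairSum q L s.discovered s.active := Finset.sum_nonneg fun _ _ => by positivity
    have e3 := h.β_nonneg
    positivity
  have h5 : p * (2 ^ k * ∑ A ∈ s.active, ((spoiled k s L A).card : ℝ))
      ≤ 2 ^ k * M * wt L * (2 ^ (j + L.card) * β * weightSum L s.active
          + q ^ L.card * pairSum q L s.discovered s.active) := by
    have hp := h.p_nonneg
    calc _ ≤ p * (2 ^ k * ((n : ℝ) ^ k * ((n : ℝ) ^ j)⁻¹ * wt L *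
          (2 ^ (j + L.card) * β * weightSum L s.active
          + q ^ L.card * pairSum q L s.discovered s.active))) := by gcongr
      _ = (p * ((n : ℝ) ^ k * ((n : ℝ) ^ j)⁻¹)) * (2 ^ k * wt L *
          (2 ^ (j + L.card) * β * weightSum L s.active
          + q ^ L.card * pairSum q L s.discovered s.active)) := by ring
      _ ≤ M * (2 ^ k * wt L *
          (2 ^ (j + L.card) * β * weightSum L s.active
          + q ^ L.card * pairSum q L s.discovered s.active)) := by
          gcongr
          exact h.codeg_le
      _ = _ := by ring
  have h6 : (1 + ε) * (1 - 2 * k ^ 2 / n) * branchRatio k j L.card * degree s.active L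
      ≤ p * (((n - j).choose (k - j) : ℝ) * (((k - L.card).choose (j - L.card) : ℝ) - 1)
        * degree s.active L) := by
    rw [← mul_assoc, h2]
    have : 1 - 2 * (k : ℝ) ^ 2 / n ≤ ((n - j).choose (k - j) / n.choose (k - j) : ℝ) := by linarith
    gcongr
  rw [mul_sub, mul_add] at h1
  linarith

/-- The case of the empty set: there are no jumps and the branching ratio is 1, so a generation
grows by 1 + ε. -/
lemma Regime.card_next_le (h : Regime n k j p ε q M β) (ht : 0 ≤ t) (hs : s.Valid j)
    (hstep : GoodStep k j p q t x κ s T ∅) :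
    ((T.biUnion (newIn j s)).card : ℝ) ≤ (1 + t) * ((1 + ε) * s.active.card) + 2 ^ k * x / t := by
  have h1 := hstep.degree_le
  have h2 := h.mean_le hs (L := ∅) (by simpa using h.j_pos)
  rw [Finset.card_empty, branchRatio_zero h.j_pos h.j_lt, jumpSum_empty, degree_empty] at h2
  rw [degree_empty] at h1
  exact h1.trans (add_le_add_left (mul_le_mul_of_nonneg_left (by linarith) (by linarith)) _)

lemma Regime.le_card_next (h : Regime n k j p ε q M β) (ht : t ≤ 1) (hs : s.Valid j)
    (hD : Sparse j β s.discovered) (hstep : GoodStep k j p q t x κ s T ∅) :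
    (1 - t) * (((1 + ε) * (1 - 2 * k ^ 2 / n) - 2 ^ (k + j) * M * β) * s.active.card)
        - 2 ^ k * x / t
      ≤ (1 + κ) * ((T.biUnion (newIn j s)).card : ℝ) := by
  have h1 := hstep.le_degree
  have h2 := h.le_mean hs (L := ∅) (by simpa using h.j_pos) hD
  rw [Finset.card_empty, branchRatio_zero h.j_pos h.j_lt, jumpSum_empty, degree_empty,
    weightSum_empty, pairSum_empty hs.card_eq (fun A hA => hs.card_eq A (hs.active_subset hA)),
    show wt (∅ : Finset (Fin n)) = 1 by simp [wt]] at h2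
  rw [degree_empty] at h1
  refine le_trans (sub_le_sub_right ?_ _) h1
  refine mul_le_mul_of_nonneg_left (le_trans (le_of_eq ?_) h2) (by linarith)
  rw [pow_add, Nat.add_zero]
  ring

/-- Every proper subset Y of `L` has degree of order |G|/n^|Y|, so each weighted degree contributes
O(|G|). Only `L` itself brings in its unknown ratio y. -/
lemma weightSum_le_of_smoothBelow (h : Regime n k j p ε q M β) (hγ1 : γ ≤ 1) (hy : 0 ≤ y)
    (hL : L.card < j) {G : Finset (Finset (Fin n))} (hsm : SmoothBelow j L.card γ G)
    (hLy : (degree G L : ℝ) = y * (G.card * meanRatio n j L.card)) :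
    weightSum L G ≤ 2 ^ (j + 1) * (2 * j) ^ j * G.card * (1 + y) := by
  have hn0 := h.n_pos
  have hkn := h.n_ge
  have hjk := h.j_lt
  have ha : (0 : ℝ) ≤ G.card := Nat.cast_nonneg _
  refine (weightSum_le L G).trans ?_
  have h1 : lowerSum L G ≤ 2 ^ j * (2 * (G.card * (2 * j) ^ j)) := by
    calc lowerSum L G ≤ ∑ Y ∈ L.powerset.erase L, 2 * (G.card * (2 * (j : ℝ)) ^ j) := by
          refine Finset.sum_le_sum fun Y hY => ?_
          rw [Finset.mem_erase, Finset.mem_powerset] at hY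
          have hYL : Y.card < L.card := Finset.card_lt_card (hY.2.ssubset_of_ne hY.1)
          have e1 := hsm.degree_le hYL
          have e2 := pow_mul_meanRatio_le hn0 (show 2 * j ≤ n by omega) (show Y.card ≤ j by omega)
          have e3 := meanRatio_pos (show j ≤ n by omega) Y.card
          calc (n : ℝ) ^ Y.card * (degree G Y : ℝ)
              ≤ (n : ℝ) ^ Y.card * (2 * (G.card * meanRatio n j Y.card)) := by
                refine mul_le_mul_of_nonneg_left (e1.trans ?_) (by positivity)
                exact mul_le_mul_of_nonneg_right (by linarith) (by positivity)
            _ = 2 * (G.card * ((n : ℝ) ^ Y.card * meanRatio n j Y.card)) := by ring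
            _ ≤ _ := by gcongr
      _ = (L.powerset.erase L).card * (2 * (G.card * (2 * (j : ℝ)) ^ j)) := by
          rw [Finset.sum_const, nsmul_eq_mul]
      _ ≤ _ := by
          refine mul_le_mul_of_nonneg_right ?_ (by positivity)
          exact_mod_cast (Finset.card_erase_le.trans (Finset.card_powerset L).le).trans
            (Nat.pow_le_pow_right (by norm_num) hL.le)
  have h2 : (n : ℝ) ^ L.card * (degree G L : ℝ) ≤ y * (G.card * (2 * j) ^ j) := by
    rw [hLy]
    calc (n : ℝ) ^ L.card * (y * (G.card * meanRatio n j L.card))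
        = y * (G.card * ((n : ℝ) ^ L.card * meanRatio n j L.card)) := by ring
      _ ≤ _ := by
          gcongr
          exact pow_mul_meanRatio_le hn0 (by omega) hL.le
  have h3 : (1 : ℝ) ≤ 2 ^ (j + 1) := one_le_pow₀ (by norm_num)
  have h4 : 0 ≤ (G.card : ℝ) * (2 * j) ^ j := by positivity
  calc lowerSum L G + (n : ℝ) ^ L.card * (degree G L : ℝ)
      ≤ 2 ^ j * (2 * (G.card * (2 * j) ^ j)) + y * (G.card * (2 * j) ^ j) := add_le_add h1 h2
    _ ≤ 2 ^ j * (2 * (G.card * (2 * j) ^ j)) + 2 ^ (j + 1) * (y * (G.card * (2 * j) ^ j)) := by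
        have : 0 ≤ y * (G.card * (2 * (j : ℝ)) ^ j) := by positivity
        nlinarith
    _ = _ := by ring

/-- The affine map that drives the smoothing: pivots reproduce the ratio y with weight r, and jumps
pull towards 1 with weight 1 - r. -/
lemma Regime.degree_next_le (h : Regime n k j p ε q M β) (ht : 0 ≤ t) (hγ : 0 ≤ γ)
    (hs : s.Valid j) (hL0 : 0 < L.card) (hL : L.card < j)
    (hsm : SmoothBelow j L.card γ s.active)
    (hLy : (degree s.active L : ℝ) = y * (s.active.card * meanRatio n j L.card))
    (hstep : GoodStep k j p q t x κ s T L) :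
    (degree (T.biUnion (newIn j s)) L : ℝ) ≤ (1 + t) * ((1 + ε) *
      (s.active.card * meanRatio n j L.card) * (branchRatio k j L.card * y
        + (1 - branchRatio k j L.card) * ((1 + γ) * (1 + 4 * k ^ 2 / n)))) + 2 ^ k * x / t := by
  refine hstep.degree_le.trans (add_le_add_left ?_ _)
  refine mul_le_mul_of_nonneg_left ?_ (by linarith)
  have h1 := h.mean_le hs hL
  have h2 := edgeProb_mul_jumpSum_le h.j_pos h.j_lt h.large h.ε_nonneg h.p_eq h.p_nonneg hγ hL0 hL
    (fun A hA => hs.card_eq A (hs.active_subset hA)) hsm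
  rw [hLy] at h1
  linarith

lemma Regime.le_degree_next (h : Regime n k j p ε q M β) (ht1 : t ≤ 1) (hγ : 0 ≤ γ)
    (hγ1 : γ ≤ 1) (hs : s.Valid j) (hL0 : 0 < L.card) (hL : L.card < j)
    (hD : Sparse j β s.discovered) (hy : 0 ≤ y)
    (hsm : SmoothBelow j L.card γ s.active)
    (hLy : (degree s.active L : ℝ) = y * (s.active.card * meanRatio n j L.card))
    (hstep : GoodStep k j p q t x κ s T L) :
    (1 - t) * ((1 + ε) * (s.active.card * meanRatio n j L.card) *
        ((1 - 2 * k ^ 2 / n) * branchRatio k j L.card * y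
        + (1 - branchRatio k j L.card) * (1 - γ - (4 + y) * (2 * k ^ 2 / n)))
        - 2 ^ k * M * meanRatio n j L.card * (2 ^ (2 * j) * β *
          (2 ^ (j + 1) * (2 * j) ^ j * s.active.card * (1 + y))
          + q ^ j * pairSum q L s.discovered s.active)) - 2 ^ k * x / t
      ≤ (1 + κ) * (degree (T.biUnion (newIn j s)) L : ℝ) := by
  have hkn := h.n_ge
  have hjk := h.j_lt
  refine le_trans (sub_le_sub_right ?_ _) hstep.le_degree
  refine mul_le_mul_of_nonneg_left ?_ (by linarith)
  have h1 := h.le_mean hs hL hD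
  have h2 := le_edgeProb_mul_jumpSum h.j_pos h.j_lt h.large h.ε_nonneg h.p_eq h.p_nonneg hγ hγ1 hy
    hL0 hL (fun A hA => hs.card_eq A (hs.active_subset hA)) hsm hLy.le
  have h3 := weightSum_le_of_smoothBelow h hγ1 hy hL hsm hLy
  have h4 : 2 ^ k * M * wt L * (2 ^ (j + L.card) * β * weightSum L s.active
          + q ^ L.card * pairSum q L s.discovered s.active)
      ≤ 2 ^ k * M * meanRatio n j L.card * (2 ^ (2 * j) * β *
          (2 ^ (j + 1) * (2 * j) ^ j * s.active.card * (1 + y))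
          + q ^ j * pairSum q L s.discovered s.active) := by
    have hM := h.M_nonneg
    have hq := h.one_le_q
    have hβ := h.β_nonneg
    have e0 : wt L ≤ meanRatio n j L.card :=
      inv_pow_le_meanRatio h.n_pos (by omega) hL.le
    have e1 : 0 ≤ weightSum L s.active := Finset.sum_nonneg fun _ _ => by positivity
    have e2 : 0 ≤ pairSum q L s.discovered s.active := Finset.sum_nonneg fun _ _ => by positivity
    have e3 := wt_nonneg L
    have e4 : 0 ≤ meanRatio n j L.card := e3.trans e0
    have e5 : j + L.card ≤ 2 * j := by omega
    gcongr
    norm_num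
  rw [hLy] at h1
  have h5 : (1 + ε) * (1 - 2 * k ^ 2 / n) * branchRatio k j L.card
      * (y * (s.active.card * meanRatio n j L.card))
    = (1 + ε) * (s.active.card * meanRatio n j L.card)
      * ((1 - 2 * k ^ 2 / n) * branchRatio k j L.card * y) := by ring
  rw [h5] at h1
  linarith

/-- Inherited pairs shrink by the branching ratio, up to the terms with q. All other sources carry
one of the small factors 1/n, β, t, κ or the additive concentration error. -/
lemma Regime.pairSum_next_le (h : Regime n k j p ε q M β) (ht : 0 ≤ t) (ht1 : t ≤ 1)
    (hκ : 0 ≤ κ) (hκ1 : κ ≤ 1) (hx : 0 ≤ x / t) (hγ1 : γ ≤ 1)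
    (hs : s.Valid j) (hL : L.card < j)
    (hD : Sparse j β s.discovered) (hy : 0 ≤ y)
    (hsm : SmoothBelow j L.card γ s.active)
    (hLy : (degree s.active L : ℝ) = y * (s.active.card * meanRatio n j L.card))
    (hstep : GoodStep k j p q t x κ s T L) :
    pairSum q L (s.discovered ∪ T.biUnion (newIn j s)) (T.biUnion (newIn j s))
      ≤ (1 + t) * ((1 + ε) * branchRatio k j L.card * pairSum q L s.discovered s.active
          + 2 ^ (4 * k) * M * ((1 / n + β) * (2 ^ (j + 1) * (2 * j) ^ j * s.active.card * (1 + y))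
            + 2 * (2 * j) ^ j * s.active.card * β
            + (q / n + 1 / q) * pairSum q L s.discovered s.active))
        + 4 ^ (2 * j) * (2 * (t + κ) *
          (2 ^ (2 * k) * M * (2 ^ (j + 1) * (2 * j) ^ j * s.active.card * (1 + y))))
        + (2 ^ (3 * k) + 3 * 4 ^ (2 * j) * 2 ^ k) * ((n : ℝ) ^ L.card * (x / t)) := by
  have hn0 := h.n_pos
  have hkn := h.n_ge
  have hjk := h.j_lt
  have hM := h.M_nonneg
  have hq := h.one_le_q
  have hq0 : 0 < q := by linarith
  have hβ := h.β_nonneg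
  have hp := h.p_nonneg
  have hS := weightSum_le_of_smoothBelow h hγ1 hy hL hsm hLy
  set S := 2 ^ (j + 1) * (2 * (j : ℝ)) ^ j * s.active.card * (1 + y) with hSdef
  have hS0 : 0 ≤ weightSum L s.active := Finset.sum_nonneg fun _ _ => by positivity
  set P := pairSum q L s.discovered s.active with hP
  have hP0 : 0 ≤ P := Finset.sum_nonneg fun _ _ => by positivity
  have ha : (0 : ℝ) ≤ s.active.card := Nat.cast_nonneg _
  have h1 := SmoothBoundary.pairSum_next_le hq0 s L T
    (fun A hA => pow_inter_le_card_superSets h.le_q hq0 (by omega) hL.le hA)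
  have hdeg : ∀ W : Finset (Fin n), W.card < L.card →
      (degree s.active W : ℝ) ≤ (2 * (2 * j) ^ j * s.active.card) * wt W := by
    intro W hW
    have e1 := hsm.degree_le hW
    have e2 := pow_mul_meanRatio_le hn0 (show 2 * j ≤ n by omega) (show W.card ≤ j by omega)
    have e3 := meanRatio_pos (show j ≤ n by omega) W.card
    have hn' : (0 : ℝ) < n := by exact_mod_cast hn0
    have e4 : meanRatio n j W.card ≤ (2 * j) ^ j * wt W := by
      unfold wt
      rw [← div_eq_mul_inv, le_div_iff₀ (by positivity), mul_comm]
      exact e2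
    calc (degree s.active W : ℝ) ≤ (1 + γ) * (s.active.card * meanRatio n j W.card) := e1
      _ ≤ 2 * (s.active.card * meanRatio n j W.card) :=
          mul_le_mul_of_nonneg_right (by linarith) (by positivity)
      _ ≤ 2 * (s.active.card * ((2 * j) ^ j * wt W)) := by gcongr
      _ = _ := by ring
  have h2 := sum_pairWeight_le hn0 hβ h.one_le_q h.q_le
    (C := 2 * (2 * (j : ℝ)) ^ j * s.active.card) (by positivity) h.j_lt hs hD hL hdeg
  have h3 := edgeProb_mul_choose h.j_pos h.j_lt (show k ≤ n by omega) h.p_eq L.card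
  have hg := choose_sub_div_le_one n j (k - j)
  have hr := (branchRatio_pos hL h.j_lt).le
  have hε := h.ε_nonneg
  have hY0 : 0 ≤ (1 / n + β) * S + 2 * (2 * j) ^ j * s.active.card * β + (q / n + 1 / q) * P := by
    positivity
  have h4 : p * ∑ E ∈ fresh k s, pairWeight q j s L E
      ≤ (1 + ε) * branchRatio k j L.card * P
          + 2 ^ (4 * k) * M * ((1 / n + β) * S
            + 2 * (2 * j) ^ j * s.active.card * β + (q / n + 1 / q) * P) := by
    have e1 : p * (((n - j).choose (k - j) : ℝ) *
        (((k - L.card).choose (j - L.card) : ℝ) - 1) * P)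
        ≤ (1 + ε) * branchRatio k j L.card * P := by
      rw [← mul_assoc, h3]
      gcongr
      exact mul_le_of_le_one_right (by linarith) hg
    have e2 : p * (2 ^ (4 * k) * ((n : ℝ) ^ k * ((n : ℝ) ^ j)⁻¹)
          * ((1 / n + β) * weightSum L s.active + 2 * (2 * j) ^ j * s.active.card * β
            + (q / n + 1 / q) * P))
        ≤ 2 ^ (4 * k) * M * ((1 / n + β) * S
            + 2 * (2 * j) ^ j * s.active.card * β + (q / n + 1 / q) * P) := by
      calc _ ≤ p * (2 ^ (4 * k) * ((n : ℝ) ^ k * ((n : ℝ) ^ j)⁻¹)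
          * ((1 / n + β) * S + 2 * (2 * j) ^ j * s.active.card * β
            + (q / n + 1 / q) * P)) := by gcongr
        _ = (p * ((n : ℝ) ^ k * ((n : ℝ) ^ j)⁻¹)) * (2 ^ (4 * k) * ((1 / n + β) * S
            + 2 * (2 * j) ^ j * s.active.card * β + (q / n + 1 / q) * P)) := by ring
        _ ≤ M * (2 ^ (4 * k) * ((1 / n + β) * S
            + 2 * (2 * j) ^ j * s.active.card * β + (q / n + 1 / q) * P)) := by
            gcongr
            exact h.codeg_le
        _ = _ := by ring
    have e3 := mul_le_mul_of_nonneg_left h2 hp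
    rw [mul_add] at e3
    exact e3.trans (add_le_add e1 e2)
  have h5 : p * ∑ E ∈ fresh k s, ((nearby j s L E).card : ℝ) ≤ 2 ^ (2 * k) * M * S := by
    have e1 := mul_le_mul_of_nonneg_left (sum_card_nearby_le (k := k) hn0 hs L) hp
    refine e1.trans ?_
    calc _ = (p * ((n : ℝ) ^ k * ((n : ℝ) ^ j)⁻¹)) * (2 ^ (k + L.card) * weightSum L s.active) := by
          ring
      _ ≤ M * (2 ^ (2 * k) * S) := by
          gcongr
          · exact h.codeg_le
          · norm_num
          · omega
      _ = _ := by ring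
  have h6 := hstep.pair_le
  have h7 := hstep.nearby_le
  have h8 := hstep.le_nearby
  set N := ∑ E ∈ T, ((nearby j s L E).card : ℝ) with hN
  set V := ((T.biUnion (nearby j s L)).card : ℝ) with hV
  set m := p * ∑ E ∈ fresh k s, ((nearby j s L E).card : ℝ) with hm
  set Z := (n : ℝ) ^ L.card * (x / t) with hZ
  have hZ0 : 0 ≤ Z := by positivity
  have hm0 : 0 ≤ m := mul_nonneg hp (Finset.sum_nonneg fun _ _ => Nat.cast_nonneg _)
  have hVN : V ≤ N := by
    rw [hV, hN]
    exact_mod_cast Finset.card_biUnion_le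
  have e7 : N ≤ (1 + t) * m + 2 ^ k * Z := by
    have : 2 ^ k * (n : ℝ) ^ L.card * x / t = 2 ^ k * Z := by rw [hZ]; ring
    linarith
  have e8 : (1 - t) * m - 2 ^ k * Z ≤ (1 + κ) * V := by
    have : 2 ^ k * (n : ℝ) ^ L.card * x / t = 2 ^ k * Z := by rw [hZ]; ring
    linarith
  -- The overlap is the sum minus the size of the union. Both are concentrated around the same mean
  -- m, which cancels and leaves only the relative errors.
  have h9 : N - V ≤ 2 * (t + κ) * m + 3 * (2 ^ k * Z) := by
    have hz : 0 ≤ 2 ^ k * Z := by positivity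
    have c1 : κ * V ≤ κ * ((1 + t) * m + 2 ^ k * Z) :=
      mul_le_mul_of_nonneg_left (hVN.trans e7) hκ
    have c2 : κ * (t * m) ≤ κ * m := by
      have : t * m ≤ m := mul_le_of_le_one_left hm0 ht1
      gcongr
    have c3 : κ * (2 ^ k * Z) ≤ 2 ^ k * Z := mul_le_of_le_one_left hz hκ1
    linarith
  have h10 : 2 * (t + κ) * m + 3 * (2 ^ k * Z)
      ≤ 2 * (t + κ) * (2 ^ (2 * k) * M * S) + 3 * (2 ^ k * Z) := by gcongr
  have hfour : (4 : ℝ) ^ (j + L.card) ≤ 4 ^ (2 * j) :=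
    pow_le_pow_right₀ (by norm_num) (by omega)
  have hthree : (2 : ℝ) ^ (k + j + L.card) ≤ 2 ^ (3 * k) :=
    pow_le_pow_right₀ (by norm_num) (by omega)
  have hNV : 0 ≤ N - V := by linarith
  have hS0' : 0 ≤ S := hS0.trans hS
  calc _ ≤ ∑ E ∈ T, pairWeight q j s L E + 4 ^ (j + L.card) * (N - V) := h1
    _ ≤ ((1 + t) * (p * ∑ E ∈ fresh k s, pairWeight q j s L E)
        + 2 ^ (k + j + L.card) * Z) + 4 ^ (2 * j) * (2 * (t + κ) * (2 ^ (2 * k) * M * S)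
          + 3 * (2 ^ k * Z)) := by
        refine add_le_add (h6.trans (le_of_eq ?_))
          (mul_le_mul hfour (h9.trans h10) hNV (by positivity))
        rw [hZ]; ring
    _ ≤ ((1 + t) * ((1 + ε) * branchRatio k j L.card * P
          + 2 ^ (4 * k) * M * ((1 / n + β) * S
            + 2 * (2 * j) ^ j * s.active.card * β + (q / n + 1 / q) * P))
        + 2 ^ (3 * k) * Z) + 4 ^ (2 * j) * (2 * (t + κ) * (2 ^ (2 * k) * M * S)
          + 3 * (2 ^ k * Z)) := by gcongr
    _ = _ := by ring

end

end SmoothBoundary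

namespace SmoothBoundary

/-! ### Normalized form of the one-step estimates -/

section

variable {a a' b c d' t u v β κ σ ε γ r y π e B τ : ℝ}

/-- All errors are multiples of w = cσ, which is at most 1/12. Two factors and the additive term
lose 4w, and dividing by 1 + κ costs the rest of the 6w. -/
lemma size_lower_of (hc : 1 ≤ c) (hσ : 0 ≤ σ) (hcσ : c * σ ≤ 1 / 12) (hε : 0 ≤ ε) (ha : 0 ≤ a)
    (ha' : 0 ≤ a') (htσ : t ≤ σ) (hu : u ≤ c * σ) (he : e ≤ c * σ)
    (hB : B ≤ c * σ * a) (hκσ : κ ≤ c * σ)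
    (h : (1 - t) * (((1 + ε) * (1 - u) - e) * a) - B ≤ (1 + κ) * a') :
    (1 - 6 * (c * σ)) * ((1 + ε) * a) ≤ a' := by
  set w := c * σ with hw
  have hw0 : 0 ≤ w := by positivity
  have hσw : σ ≤ w := le_mul_of_one_le_left hσ hc
  have hb : a ≤ (1 + ε) * a := le_mul_of_one_le_left ha (by linarith)
  set b := (1 + ε) * a with hbdef
  have hb0 : 0 ≤ b := by positivity
  have h1 : (1 - 2 * w) * b ≤ ((1 + ε) * (1 - u) - e) * a := by
    have e1 : u * b ≤ w * b := by gcongr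
    have e2 : e * a ≤ w * b := by
      calc e * a ≤ w * a := by gcongr
        _ ≤ w * b := by gcongr
    have e3 : ((1 + ε) * (1 - u) - e) * a = b - u * b - e * a := by rw [hbdef]; ring
    rw [e3]; linarith
  have h2 : (1 - w) * ((1 - 2 * w) * b) ≤ (1 - t) * (((1 + ε) * (1 - u) - e) * a) := by
    refine mul_le_mul (by linarith) h1 (mul_nonneg (by linarith) hb0) (by linarith)
  have h3 : (1 + κ) * a' ≤ (1 + w) * a' := by gcongr
  have h4 : B ≤ w * b := hB.trans (by gcongr)
  have h5 : (1 - 4 * w) * b ≤ (1 + w) * a' := by nlinarith [mul_nonneg hw0 (mul_nonneg hw0 hb0)]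
  by_contra hcon
  rw [not_le] at hcon
  have h6 : (1 + w) * a' < (1 + w) * ((1 - 6 * w) * b) := by gcongr
  nlinarith [mul_nonneg hw0 hb0, mul_nonneg hw0 (mul_nonneg hw0 hb0)]

lemma size_upper_of (hc : 1 ≤ c) (hσ : 0 ≤ σ) (hε : 0 ≤ ε) (ha : 0 ≤ a)
    (htσ : t ≤ σ) (hB : B ≤ c * σ * a)
    (h : a' ≤ (1 + t) * ((1 + ε) * a) + B) :
    a' ≤ (1 + 2 * (c * σ)) * ((1 + ε) * a) := by
  have hσw : σ ≤ c * σ := le_mul_of_one_le_left hσ hc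
  have hb : a ≤ (1 + ε) * a := le_mul_of_one_le_left ha (by linarith)
  have h1 : t * ((1 + ε) * a) ≤ c * σ * ((1 + ε) * a) := by
    gcongr
    exact htσ.trans hσw
  have h2 : c * σ * a ≤ c * σ * ((1 + ε) * a) := by gcongr
  linarith

/-- The bound on the degree is divided by the lower bound on the new size, so that the growth factor
inside b cancels. Errors are measured relative to 1 + y because y may still be large. -/
lemma degree_upper_of (hc : 1 ≤ c) (hσ : 0 ≤ σ) (hcσ : c * σ ≤ 1 / 12) (hb : 0 ≤ b) (hτ : 0 < τ)
    (ha' : 0 < a') (ht : 0 ≤ t) (htσ : t ≤ σ) (hv : v ≤ 2 * (c * σ)) (hB : B ≤ c * σ * (b * τ))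
    (hγ : 0 ≤ γ) (hγ1 : γ ≤ 1) (hr : 0 ≤ r) (hr1 : r ≤ 1) (hy : 0 ≤ y)
    (hsize : (1 - 6 * (c * σ)) * b ≤ a')
    (h : d' ≤ (1 + t) * (b * τ * (r * y + (1 - r) * ((1 + γ) * (1 + v)))) + B) :
    d' / (a' * τ) ≤ r * y + (1 - r) * (1 + γ) + 40 * c * (σ * (1 + y)) := by
  rw [div_le_iff₀ (by positivity)]
  set w := c * σ with hw
  have hw0 : 0 ≤ w := by positivity
  have hσw : σ ≤ w := le_mul_of_one_le_left hσ hc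
  set W := r * y + (1 - r) * (1 + γ) with hW
  have hr' : 0 ≤ 1 - r := by linarith
  have hW0 : 0 ≤ W := by positivity
  have hry : r * y ≤ y := mul_le_of_le_one_left hy hr1
  have hrg : (1 - r) * (1 + γ) ≤ 2 := by nlinarith
  have hW1 : W ≤ y + 2 := by linarith
  have h1 : r * y + (1 - r) * ((1 + γ) * (1 + v)) ≤ W + 4 * w := by
    have : (1 - r) * ((1 + γ) * (1 + v)) = (1 - r) * (1 + γ) + (1 - r) * (1 + γ) * v := by ring
    rw [this, hW]
    have : (1 - r) * (1 + γ) * v ≤ 2 * (2 * w) := by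
      calc _ ≤ (1 - r) * (1 + γ) * (2 * w) := by gcongr
        _ ≤ _ := by gcongr
    linarith
  have h2 : (1 + t) * (r * y + (1 - r) * ((1 + γ) * (1 + v))) ≤ W + 7 * (w * (1 + y)) := by
    calc _ ≤ (1 + t) * (W + 4 * w) := by gcongr
      _ ≤ (1 + w) * (W + 4 * w) := by gcongr; linarith
      _ ≤ _ := by nlinarith [mul_nonneg hw0 hy, mul_le_mul_of_nonneg_left hW1 hw0,
          mul_nonneg hw0 hw0]
  have h3 : d' ≤ (b * τ) * (W + 8 * (w * (1 + y))) := by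
    have hbt : 0 ≤ b * τ := by positivity
    have e1 := mul_le_mul_of_nonneg_left h2 hbt
    have e2 : (1 + t) * (b * τ * (r * y + (1 - r) * ((1 + γ) * (1 + v))))
      = b * τ * ((1 + t) * (r * y + (1 - r) * ((1 + γ) * (1 + v)))) := by ring
    have e3 : w * (b * τ) ≤ w * (1 + y) * (b * τ) := by
      gcongr
      nlinarith [mul_nonneg hw0 hy]
    rw [e2] at h
    linarith
  refine h3.trans ?_
  have h4 : W + 8 * (w * (1 + y)) ≤ (1 - 6 * w) * (W + 40 * c * (σ * (1 + y))) := by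
    have e1 : 40 * c * (σ * (1 + y)) = 40 * (w * (1 + y)) := by rw [hw]; ring
    rw [e1]
    have hX : 0 ≤ w * (1 + y) := by positivity
    have e2 : w * (w * (1 + y)) ≤ 1 / 12 * (w * (1 + y)) := by gcongr
    have e3 := mul_le_mul_of_nonneg_left hW1 hw0
    have e4 : 0 ≤ w * y := by positivity
    linarith
  have h5 : 0 ≤ W + 40 * c * (σ * (1 + y)) := by positivity
  calc b * τ * (W + 8 * (w * (1 + y)))
      ≤ b * τ * ((1 - 6 * w) * (W + 40 * c * (σ * (1 + y)))) := by gcongr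
    _ = (W + 40 * c * (σ * (1 + y))) * (((1 - 6 * w) * b) * τ) := by ring
    _ ≤ _ := by gcongr

set_option maxHeartbeats 800000 in
lemma degree_lower_of (hc : 1 ≤ c) (hσ : 0 ≤ σ) (hcσ : c * σ ≤ 1 / 12) (hb : 0 ≤ b) (hτ : 0 < τ)
    (ha' : 0 < a') (hd' : 0 ≤ d') (ht : 0 ≤ t) (htσ : t ≤ σ) (hu : u ≤ c * σ)
    (hκ : 0 ≤ κ) (hκσ : κ ≤ c * σ) (hB : B ≤ c * σ * (b * τ))
    (hγ : 0 ≤ γ) (hγ1 : γ ≤ 1) (hr : 0 ≤ r) (hr1 : r ≤ 1) (hy : 0 ≤ y) (hπ : 0 ≤ π)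
    (he : e ≤ c * (σ * (1 + y) + π) * (b * τ))
    (hsize : a' ≤ (1 + 2 * (c * σ)) * b)
    (h : (1 - t) * (b * τ * ((1 - u) * r * y + (1 - r) * (1 - γ - (4 + y) * u)) - e) - B
      ≤ (1 + κ) * d') :
    r * y + (1 - r) * (1 - γ) - 40 * c * (σ * (1 + y) + π) ≤ d' / (a' * τ) := by
  set w := c * σ with hw
  have hw0 : 0 ≤ w := by positivity
  have hσw : σ ≤ w := le_mul_of_one_le_left hσ hc
  set V := r * y + (1 - r) * (1 - γ) with hV
  set Q := σ * (1 + y) + π with hQ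
  have hQ0 : 0 ≤ Q := by positivity
  have hbt : 0 ≤ b * τ := by positivity
  have hr' : 0 ≤ 1 - r := by linarith
  have hV1 : V ≤ 1 + y := by
    have e1 : r * y ≤ y := mul_le_of_le_one_left hy hr1
    have e2 : (1 - r) * (1 - γ) ≤ 1 := mul_le_one₀ (by linarith) (by linarith) (by linarith)
    linarith
  -- Positivity of the bound is needed below, when it is multiplied by the upper bound on the new
  -- size. Otherwise the claim is trivial.
  rcases le_or_gt (V - 40 * c * Q) 0 with hneg | hpos
  · exact hneg.trans (by positivity)
  have hwQ : w * (1 + y) ≤ c * Q := by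
    rw [hw, hQ, mul_assoc]
    gcongr
    linarith
  have hV0 : 0 ≤ V := by
    have : 0 ≤ (1 - r) * (1 - γ) := mul_nonneg hr' (by linarith)
    positivity
  have h1 : V - 4 * (w * (1 + y)) ≤ (1 - u) * r * y + (1 - r) * (1 - γ - (4 + y) * u) := by
    have e1 : (1 - u) * r * y + (1 - r) * (1 - γ - (4 + y) * u)
      = V - u * (r * y + (1 - r) * (4 + y)) := by rw [hV]; ring
    have e2 : 0 ≤ r * y + (1 - r) * (4 + y) := by positivity
    have e3 : r * y + (1 - r) * (4 + y) ≤ 4 * (1 + y) := by linarith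
    have e4 : u * (r * y + (1 - r) * (4 + y)) ≤ w * (4 * (1 + y)) :=
      (mul_le_mul_of_nonneg_right hu e2).trans (mul_le_mul_of_nonneg_left e3 hw0)
    rw [e1]; linarith
  have h2 : b * τ * (V - 5 * (c * Q))
      ≤ b * τ * ((1 - u) * r * y + (1 - r) * (1 - γ - (4 + y) * u)) - e := by
    have e1 := mul_le_mul_of_nonneg_left h1 hbt
    have e2 := mul_le_mul_of_nonneg_left hwQ hbt
    linarith
  have h3 : b * τ * (V - 6 * (c * Q)) ≤ (1 - t) * (b * τ * (V - 5 * (c * Q))) := by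
    have e1 : t * V ≤ c * Q := by
      calc t * V ≤ w * (1 + y) := by
            refine mul_le_mul (htσ.trans hσw) hV1 hV0 hw0
        _ ≤ c * Q := hwQ
    have e2 : 0 ≤ t * (5 * (c * Q)) := by positivity
    have e3 : (1 - t) * (b * τ * (V - 5 * (c * Q)))
      = b * τ * (V - 5 * (c * Q) - t * V + t * (5 * (c * Q))) := by ring
    rw [e3]
    refine mul_le_mul_of_nonneg_left ?_ hbt
    linarith
  have h4 : (1 - t) * (b * τ * (V - 5 * (c * Q))) ≤ (1 - t) *
      (b * τ * ((1 - u) * r * y + (1 - r) * (1 - γ - (4 + y) * u)) - e) :=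
    mul_le_mul_of_nonneg_left h2 (by linarith)
  have h5 : B ≤ b * τ * (c * Q) := by
    have : w * (b * τ) ≤ (c * Q) * (b * τ) := by
      gcongr
      have := mul_nonneg hw0 hy
      linarith
    linarith
  have h6 : b * τ * (V - 7 * (c * Q)) ≤ (1 + w) * d' := by
    have : (1 + κ) * d' ≤ (1 + w) * d' := by gcongr
    linarith
  rw [le_div_iff₀ (by positivity)]
  have hX0 : 0 ≤ V - 40 * c * Q := hpos.le
  by_contra hcon
  rw [not_le] at hcon
  have h7 : (1 + w) * d' < (1 + w) * ((V - 40 * c * Q) * (a' * τ)) := by gcongr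
  have h8 : (1 + w) * ((V - 40 * c * Q) * (a' * τ)) ≤ b * τ * (V - 7 * (c * Q)) := by
    calc (1 + w) * ((V - 40 * c * Q) * (a' * τ))
        ≤ (1 + w) * ((V - 40 * c * Q) * (((1 + 2 * w) * b) * τ)) := by gcongr
      _ = b * τ * (((1 + w) * (1 + 2 * w)) * (V - 40 * c * Q)) := by ring
      _ ≤ b * τ * ((1 + 4 * w) * (V - 40 * c * Q)) := by
          have : w * w ≤ w * (1 / 12) := by gcongr
          gcongr
          linarith
      _ ≤ _ := by
          refine mul_le_mul_of_nonneg_left ?_ hbt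
          have e1 := mul_le_mul_of_nonneg_left hV1 hw0
          have e2 : 0 ≤ c * Q := by positivity
          have e3 : 0 ≤ w * (c * Q) := by positivity
          linarith
  linarith

end

/-- Numerical constants used in the one-step estimates. -/
structure ConstBound (k j : ℕ) (q M c : ℝ) : Prop where
  one_le : 1 ≤ c
  sq_le : 2 * (k : ℝ) ^ 2 ≤ c
  size_le : 2 ^ (k + j) * M ≤ c
  κ_le : 2 ^ (3 * j) * M ≤ c
  err_le : 2 ^ k ≤ c
  spoil_le : 2 ^ k * M * (2 ^ (2 * j) * (2 ^ (j + 1) * (2 * j) ^ j) + q ^ j) ≤ c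
  pair_le : 2 * (2 ^ (4 * k) * M * (2 * (2 ^ (j + 1) * (2 * j) ^ j) + 2 * (2 * j) ^ j))
    + 4 ^ (2 * j) * (2 * (1 + 2 ^ (3 * j) * M) * (2 ^ (2 * k) * M * (2 ^ (j + 1) * (2 * j) ^ j)))
    + (2 ^ (3 * k) + 3 * 4 ^ (2 * j) * 2 ^ k) ≤ c

lemma exists_constBound (k j : ℕ) (q M : ℝ) : ∃ c, ConstBound k j q M c := by
  obtain ⟨c, hc⟩ := Finset.exists_le (({1, 2 * (k : ℝ) ^ 2, 2 ^ (k + j) * M, 2 ^ (3 * j) * M,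
    2 ^ k, 2 ^ k * M * (2 ^ (2 * j) * (2 ^ (j + 1) * (2 * j) ^ j) + q ^ j),
    2 * (2 ^ (4 * k) * M * (2 * (2 ^ (j + 1) * (2 * j) ^ j) + 2 * (2 * j) ^ j))
    + 4 ^ (2 * j) * (2 * (1 + 2 ^ (3 * j) * M) * (2 ^ (2 * k) * M * (2 ^ (j + 1) * (2 * j) ^ j)))
    + (2 ^ (3 * k) + 3 * 4 ^ (2 * j) * 2 ^ k)} : Finset ℝ))
  exact ⟨c, hc _ (by simp), hc _ (by simp), hc _ (by simp), hc _ (by simp), hc _ (by simp),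
    hc _ (by simp), hc _ (by simp)⟩

end SmoothBoundary

/-! ### Recursions for the deviation and the density of pairs -/

namespace SmoothBoundary

variable {n k j : ℕ}

/-- The relative deviation of the degree of `L` in the boundary from its mean. -/
noncomputable def deviation (j : ℕ) (s : SearchState n) (L : Finset (Fin n)) : ℝ :=
  |(degree s.active L : ℝ) / (s.active.card * meanRatio n j L.card) - 1|

/-- The density of pairs obstructing the smoothing at `L`. -/
noncomputable def pairDensity (q : ℝ) (s : SearchState n) (L : Finset (Fin n)) : ℝ :=
  pairSum q L s.discovered s.active / s.active.card

lemma pairSum_nonneg {q : ℝ} (hq : 1 ≤ q) (L : Finset (Fin n)) (D G : Finset (Finset (Fin n))) :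
    0 ≤ pairSum q L D G := Finset.sum_nonneg fun _ _ => by positivity

lemma pairDensity_nonneg {q : ℝ} (hq : 1 ≤ q) (s : SearchState n) (L : Finset (Fin n)) :
    0 ≤ pairDensity q s L := div_nonneg (pairSum_nonneg hq _ _ _) (Nat.cast_nonneg _)

lemma deviation_nonneg (s : SearchState n) (L : Finset (Fin n)) : 0 ≤ deviation j s L :=
  abs_nonneg _

/-- Smallness of the error terms relative to `σ`. -/
structure ErrorBound (n j : ℕ) (M β t κ c σ : ℝ) : Prop where
  t_pos : 0 < t
  t_le : t ≤ σ
  β_le : β ≤ σ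
  inv_le : 1 / (n : ℝ) ≤ σ
  κ_eq : κ = 2 ^ (3 * j) * β * M
  mul_le : c * σ ≤ 1 / 12

section

variable {p ε q M β t x κ c σ γ : ℝ} {s s' : SearchState n} {T : Finset (Finset (Fin n))}
  {L : Finset (Fin n)}

lemma ErrorBound.σ_nonneg (e : ErrorBound n j M β t κ c σ) : 0 ≤ σ := e.t_pos.le.trans e.t_le

lemma ErrorBound.κ_le (e : ErrorBound n j M β t κ c σ) (hc : ConstBound k j q M c)
    (h : Regime n k j p ε q M β) : 0 ≤ κ ∧ κ ≤ c * σ := by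
  have hM := h.M_nonneg
  have hβ := h.β_nonneg
  rw [e.κ_eq]
  refine ⟨by positivity, ?_⟩
  calc 2 ^ (3 * j) * β * M = (2 ^ (3 * j) * M) * β := by ring
    _ ≤ c * σ := mul_le_mul hc.κ_le e.β_le hβ (by linarith [hc.one_le])

lemma ErrorBound.inv_mul_le (e : ErrorBound n j M β t κ c σ) (hc : ConstBound k j q M c) :
    2 * (k : ℝ) ^ 2 / n ≤ c * σ := by
  calc 2 * (k : ℝ) ^ 2 / n = (2 * (k : ℝ) ^ 2) * (1 / n) := by ring
    _ ≤ c * σ := mul_le_mul hc.sq_le e.inv_le (by positivity) (by linarith [hc.one_le])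

lemma ErrorBound.t_le_one (e : ErrorBound n j M β t κ c σ) (hc : ConstBound k j q M c) :
    t ≤ 1 := by
  have h1 : σ ≤ c * σ := le_mul_of_one_le_left e.σ_nonneg hc.one_le
  linarith [e.t_le, e.mul_le]

lemma Regime.le_card_next' (h : Regime n k j p ε q M β) (hc : ConstBound k j q M c)
    (e : ErrorBound n j M β t κ c σ) (hs : s.Valid j)
    (hD : Sparse j β s.discovered) (hx : x / t ≤ σ * s.active.card)
    (hstep : GoodStep k j p q t x κ s T ∅) :
    (1 - 6 * (c * σ)) * ((1 + ε) * s.active.card) ≤ ((T.biUnion (newIn j s)).card : ℝ) := by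
  refine size_lower_of hc.one_le e.σ_nonneg e.mul_le h.ε_nonneg (Nat.cast_nonneg _)
    (Nat.cast_nonneg _) e.t_le (e.inv_mul_le hc) (e := 2 ^ (k + j) * M * β)
    (mul_le_mul hc.size_le e.β_le h.β_nonneg (by linarith [hc.one_le])) ?_
    (e.κ_le hc h).2 (h.le_card_next (e.t_le_one hc) hs hD hstep)
  calc 2 ^ k * x / t = 2 ^ k * (x / t) := by ring
    _ ≤ 2 ^ k * (σ * s.active.card) := by gcongr
    _ ≤ c * (σ * s.active.card) := mul_le_mul_of_nonneg_right hc.err_le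
        (mul_nonneg e.σ_nonneg (Nat.cast_nonneg _))
    _ = _ := by ring

lemma Regime.card_next_le' (h : Regime n k j p ε q M β) (hc : ConstBound k j q M c)
    (e : ErrorBound n j M β t κ c σ) (hs : s.Valid j) (hx : x / t ≤ σ * s.active.card)
    (hstep : GoodStep k j p q t x κ s T ∅) :
    ((T.biUnion (newIn j s)).card : ℝ) ≤ (1 + 2 * (c * σ)) * ((1 + ε) * s.active.card) := by
  refine size_upper_of hc.one_le e.σ_nonneg h.ε_nonneg (Nat.cast_nonneg _) e.t_le ?_
    (h.card_next_le e.t_pos.le hs hstep)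
  calc 2 ^ k * x / t = 2 ^ k * (x / t) := by ring
    _ ≤ 2 ^ k * (σ * s.active.card) := by gcongr
    _ ≤ c * (σ * s.active.card) := mul_le_mul_of_nonneg_right hc.err_le
        (mul_nonneg e.σ_nonneg (Nat.cast_nonneg _))
    _ = _ := by ring

/-- One step of the smoothing of degrees. -/
lemma Regime.deviation_next_le (h : Regime n k j p ε q M β) (hc : ConstBound k j q M c)
    (e : ErrorBound n j M β t κ c σ) (hs : s.Valid j)
    (hD : Sparse j β s.discovered) (hx0 : 0 ≤ x)
    (hx : (n : ℝ) ^ L.card * (x / t) ≤ σ * s.active.card)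
    (ha : 0 < s.active.card) (hγ : 0 ≤ γ) (hγ1 : γ ≤ 1) (hL0 : 0 < L.card) (hL : L.card < j)
    (hsm : SmoothBelow j L.card γ s.active)
    (hstep₀ : GoodStep k j p q t x κ s T ∅) (hstep : GoodStep k j p q t x κ s T L)
    (hs' : s'.active = T.biUnion (newIn j s)) :
    0 < s'.active.card ∧ deviation j s' L ≤ branchRatio k j L.card * deviation j s L
      + (1 - branchRatio k j L.card) * γ
      + 40 * c * (σ * (2 + deviation j s L) + pairDensity q s L) := by
  have hn0 := h.n_pos
  have hkn := h.n_ge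
  have hjk := h.j_lt
  have hn' : (0 : ℝ) < n := by exact_mod_cast hn0
  have hn1 : (1 : ℝ) ≤ n := by exact_mod_cast hn0
  have hc1 := hc.one_le
  have hσ := e.σ_nonneg
  have hM := h.M_nonneg
  have hβ := h.β_nonneg
  have hq := h.one_le_q
  have hε := h.ε_nonneg
  have hxt : 0 ≤ x / t := div_nonneg hx0 e.t_pos.le
  have ha0 : (0 : ℝ) < s.active.card := by exact_mod_cast ha
  have hxa : x / t ≤ σ * s.active.card :=
    le_trans (le_mul_of_one_le_left hxt (one_le_pow₀ hn1)) hx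
  have hlow := h.le_card_next' hc e hs hD hxa hstep₀
  have hup := h.card_next_le' hc e hs hxa hstep₀
  rw [hs'.symm] at hlow hup
  have hcσ := e.mul_le
  have hpos : (0 : ℝ) < s'.active.card := by
    refine lt_of_lt_of_le ?_ hlow
    have : 0 < 1 - 6 * (c * σ) := by linarith
    positivity
  refine ⟨by exact_mod_cast hpos, ?_⟩
  set τ := meanRatio n j L.card with hτdef
  have hτ : 0 < τ := meanRatio_pos (by omega) _
  obtain ⟨y, hdev, hy0, hLy⟩ : ∃ y : ℝ, deviation j s L = |y - 1| ∧ 0 ≤ y ∧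
      (degree s.active L : ℝ) = y * (s.active.card * τ) :=
    ⟨_, rfl, div_nonneg (Nat.cast_nonneg _) (mul_pos ha0 hτ).le,
      (div_mul_cancel₀ _ (mul_pos ha0 hτ).ne').symm⟩
  obtain ⟨π, hπ, hπ0, hP⟩ : ∃ π : ℝ, pairDensity q s L = π ∧ 0 ≤ π ∧
      pairSum q L s.discovered s.active = π * s.active.card :=
    ⟨_, rfl, pairDensity_nonneg hq s L, (div_mul_cancel₀ _ ha0.ne').symm⟩
  have hb : (s.active.card : ℝ) ≤ (1 + ε) * s.active.card :=
    le_mul_of_one_le_left ha0.le (by linarith)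
  have hb0 : 0 ≤ (1 + ε) * (s.active.card : ℝ) := by positivity
  have hB : 2 ^ k * x / t ≤ c * σ * ((1 + ε) * s.active.card * τ) := by
    have e1 : x / t ≤ σ * s.active.card * τ := by
      have e2 : ((n : ℝ) ^ L.card)⁻¹ ≤ τ := inv_pow_le_meanRatio hn0 (by omega) hL.le
      have e3 : x / t ≤ (σ * s.active.card) * ((n : ℝ) ^ L.card)⁻¹ := by
        rw [← div_eq_mul_inv, le_div_iff₀ (by positivity), mul_comm]
        exact hx
      exact e3.trans (mul_le_mul_of_nonneg_left e2 (by positivity))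
    calc 2 ^ k * x / t = 2 ^ k * (x / t) := by ring
      _ ≤ c * (σ * s.active.card * τ) := mul_le_mul hc.err_le e1 hxt (by linarith)
      _ = c * σ * (s.active.card * τ) := by ring
      _ ≤ _ := by gcongr
  have hr := (branchRatio_pos hL hjk).le
  have hr1 := (branchRatio_lt_one hL0 hL hjk).le
  set r := branchRatio k j L.card with hrdef
  have hκ := e.κ_le hc h
  have hdev' : deviation j s' L
      = |(degree s'.active L : ℝ) / (s'.active.card * τ) - 1| := rfl
  have hdegup := h.degree_next_le e.t_pos.le hγ hs hL0 hL hsm hLy hstep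
  have hdeglo := h.le_degree_next (e.t_le_one hc) hγ hγ1 hs hL0 hL hD hy0 hsm hLy hstep
  rw [hs'.symm] at hdegup hdeglo
  have hU := degree_upper_of (c := c) (σ := σ) (b := (1 + ε) * s.active.card)
    (v := 4 * k ^ 2 / n) (y := y) (γ := γ) (r := r)
    hc1 hσ hcσ hb0 hτ hpos e.t_pos.le e.t_le
    (by have := e.inv_mul_le hc
        have h2 : 4 * (k : ℝ) ^ 2 / n = 2 * (2 * k ^ 2 / n) := by ring
        rw [h2]; linarith) hB hγ hγ1 hr hr1 hy0 hlow
    (by refine hdegup.trans (le_of_eq ?_); ring)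
  have hE : 2 ^ k * M * τ * (2 ^ (2 * j) * β *
      (2 ^ (j + 1) * (2 * j) ^ j * s.active.card * (1 + y)) + q ^ j * (π * s.active.card))
      ≤ c * (σ * (1 + y) + π) * ((1 + ε) * s.active.card * τ) := by
    calc _ ≤ 2 ^ k * M * τ * (2 ^ (2 * j) * σ *
          (2 ^ (j + 1) * (2 * j) ^ j * s.active.card * (1 + y)) + q ^ j * (π * s.active.card)) := by
          have := e.β_le
          gcongr
      _ = 2 ^ k * M * (2 ^ (2 * j) * (2 ^ (j + 1) * (2 * j) ^ j) * (σ * (1 + y)) + q ^ j * π)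
          * (s.active.card * τ) := by ring
      _ ≤ 2 ^ k * M * ((2 ^ (2 * j) * (2 ^ (j + 1) * (2 * j) ^ j) + q ^ j) * (σ * (1 + y) + π))
          * (s.active.card * τ) := by
          gcongr
          have e1 : 0 ≤ 2 ^ (2 * j) * (2 ^ (j + 1) * (2 * (j : ℝ)) ^ j) * π := by positivity
          have e2 : 0 ≤ q ^ j * (σ * (1 + y)) := by positivity
          linarith
      _ = (2 ^ k * M * (2 ^ (2 * j) * (2 ^ (j + 1) * (2 * j) ^ j) + q ^ j)) * (σ * (1 + y) + π)
          * (s.active.card * τ) := by ring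
      _ ≤ c * (σ * (1 + y) + π) * (s.active.card * τ) := by
          gcongr
          exact hc.spoil_le
      _ ≤ _ := by gcongr
  have hLo := degree_lower_of (c := c) (σ := σ) (b := (1 + ε) * s.active.card)
    (u := 2 * k ^ 2 / n) (y := y) (γ := γ) (r := r) (d' := (degree s'.active L : ℝ))
    hc1 hσ hcσ hb0 hτ hpos (Nat.cast_nonneg _) e.t_pos.le e.t_le (e.inv_mul_le hc)
    hκ.1 hκ.2 hB hγ hγ1 hr hr1 hy0 hπ0 hE hup
    (by rw [hP] at hdeglo; refine le_trans (le_of_eq ?_) hdeglo; ring)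
  have hy1 : 1 + y ≤ 2 + |y - 1| := by linarith [le_abs_self (y - 1)]
  have hterm : 40 * c * (σ * (1 + y)) ≤ 40 * c * (σ * (2 + |y - 1|)) := by gcongr
  have hπc : 0 ≤ 40 * c * π := by positivity
  have habs1 : r * (y - 1) ≤ r * |y - 1| := by gcongr; exact le_abs_self _
  have habs2 : -(r * |y - 1|) ≤ r * (y - 1) := by
    have := mul_le_mul_of_nonneg_left (neg_abs_le (y - 1)) hr
    linarith
  rw [hdev', hdev, hπ, abs_le]
  constructor <;> linarith

/-- One step of the recursion for the pairs. -/
lemma Regime.pairDensity_next_le {ρ₀ : ℝ} (h : Regime n k j p ε q M β) (hc : ConstBound k j q M c)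
    (e : ErrorBound n j M β t κ c σ) (hs : s.Valid j)
    (hD : Sparse j β s.discovered) (hx0 : 0 ≤ x)
    (hx : (n : ℝ) ^ L.card * (x / t) ≤ σ * s.active.card)
    (ha : 0 < s.active.card) (hγ1 : γ ≤ 1) (hL : L.card < j)
    (hsm : SmoothBelow j L.card γ s.active)
    (hρ₀ : (1 + σ) * ((1 + ε) * branchRatio k j L.card + 2 ^ (4 * k) * M * (q / n + 1 / q))
      ≤ (1 - 6 * (c * σ)) * ρ₀)
    (hstep₀ : GoodStep k j p q t x κ s T ∅) (hstep : GoodStep k j p q t x κ s T L)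
    (hs' : s'.active = T.biUnion (newIn j s))
    (hs'' : s'.discovered = s.discovered ∪ T.biUnion (newIn j s)) :
    pairDensity q s' L ≤ ρ₀ * pairDensity q s L + 2 * c * (σ * (2 + deviation j s L)) := by
  have hn0 := h.n_pos
  have hkn := h.n_ge
  have hjk := h.j_lt
  have hn' : (0 : ℝ) < n := by exact_mod_cast hn0
  have hn1 : (1 : ℝ) ≤ n := by exact_mod_cast hn0
  have hc1 := hc.one_le
  have hσ := e.σ_nonneg
  have hM := h.M_nonneg
  have hβ := h.β_nonneg
  have hq := h.one_le_q
  have hε := h.ε_nonneg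
  have hxt : 0 ≤ x / t := div_nonneg hx0 e.t_pos.le
  have ha0 : (0 : ℝ) < s.active.card := by exact_mod_cast ha
  have hxa : x / t ≤ σ * s.active.card :=
    le_trans (le_mul_of_one_le_left hxt (one_le_pow₀ hn1)) hx
  have hlow := h.le_card_next' hc e hs hD hxa hstep₀
  rw [hs'.symm] at hlow
  have hcσ := e.mul_le
  have hb : (s.active.card : ℝ) ≤ (1 + ε) * s.active.card :=
    le_mul_of_one_le_left ha0.le (by linarith)
  have hlow' : (1 - 6 * (c * σ)) * s.active.card ≤ (s'.active.card : ℝ) := by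
    refine le_trans (mul_le_mul_of_nonneg_left hb (by linarith)) hlow
  have hpos : (0 : ℝ) < s'.active.card := by
    refine lt_of_lt_of_le ?_ hlow'
    have : 0 < 1 - 6 * (c * σ) := by linarith
    positivity
  set τ := meanRatio n j L.card with hτdef
  have hτ : 0 < τ := meanRatio_pos (by omega) _
  obtain ⟨y, hdev, hy0, hLy⟩ : ∃ y : ℝ, deviation j s L = |y - 1| ∧ 0 ≤ y ∧
      (degree s.active L : ℝ) = y * (s.active.card * τ) :=
    ⟨_, rfl, div_nonneg (Nat.cast_nonneg _) (mul_pos ha0 hτ).le,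
      (div_mul_cancel₀ _ (mul_pos ha0 hτ).ne').symm⟩
  obtain ⟨π, hπ, hπ0, hP⟩ : ∃ π : ℝ, pairDensity q s L = π ∧ 0 ≤ π ∧
      pairSum q L s.discovered s.active = π * s.active.card :=
    ⟨_, rfl, pairDensity_nonneg hq s L, (div_mul_cancel₀ _ ha0.ne').symm⟩
  have hy1 : 1 + y ≤ 2 + |y - 1| := by linarith [le_abs_self (y - 1)]
  have hκ := e.κ_le hc h
  have ht1 := e.t_le_one hc
  have hκ' : κ ≤ 2 ^ (3 * j) * M * σ := by
    rw [e.κ_eq]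
    calc 2 ^ (3 * j) * β * M = 2 ^ (3 * j) * M * β := by ring
      _ ≤ _ := by
          have := e.β_le
          gcongr
  have hr := (branchRatio_pos hL hjk).le
  have hmain := h.pairSum_next_le e.t_pos.le ht1 hκ.1 (hκ.2.trans (by linarith)) hxt hγ1 hs hL hD
    hy0 hsm hLy hstep
  rw [← hs'', ← hs', hP] at hmain
  set r := branchRatio k j L.card with hrdef
  set a := (s.active.card : ℝ) with hadef
  set W : ℝ := 2 ^ (j + 1) * (2 * j) ^ j with hW
  have hW0 : 0 ≤ W := by positivity
  have hZ0 : 0 ≤ (n : ℝ) ^ L.card * (x / t) := by positivity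
  have hκ0 := hκ.1
  have ht0 := e.t_pos.le
  have h1 : (1 + t) * ((1 + ε) * r * (π * a) + 2 ^ (4 * k) * M * ((1 / n + β) * (W * a * (1 + y))
      + 2 * (2 * j) ^ j * a * β + (q / n + 1 / q) * (π * a)))
      ≤ (1 - 6 * (c * σ)) * ρ₀ * (π * a) + 2 * (2 ^ (4 * k) * M * (2 * W + 2 * (2 * j) ^ j))
        * (σ * (1 + y) * a) := by
    have e1 : (1 + t) * (((1 + ε) * r + 2 ^ (4 * k) * M * (q / n + 1 / q)) * (π * a))
        ≤ (1 - 6 * (c * σ)) * ρ₀ * (π * a) := by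
      rw [← mul_assoc]
      refine mul_le_mul_of_nonneg_right (le_trans ?_ hρ₀) (by positivity)
      have := e.t_le
      gcongr
    have e2 : (1 / n + β) * (W * a * (1 + y)) + 2 * (2 * j) ^ j * a * β
        ≤ (2 * W + 2 * (2 * j) ^ j) * (σ * (1 + y) * a) := by
      have f1 : 1 / (n : ℝ) + β ≤ 2 * σ := by linarith [e.inv_le, e.β_le]
      have f2 : β ≤ σ * (1 + y) := e.β_le.trans (le_mul_of_one_le_right hσ (by linarith))
      calc _ ≤ (2 * σ) * (W * a * (1 + y)) + 2 * (2 * j) ^ j * a * (σ * (1 + y)) := by gcongr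
        _ = _ := by ring
    calc _ = (1 + t) * (((1 + ε) * r + 2 ^ (4 * k) * M * (q / n + 1 / q)) * (π * a))
          + (1 + t) * (2 ^ (4 * k) * M * ((1 / n + β) * (W * a * (1 + y))
            + 2 * (2 * j) ^ j * a * β)) := by ring
      _ ≤ (1 - 6 * (c * σ)) * ρ₀ * (π * a) + 2 * (2 ^ (4 * k) * M *
          ((2 * W + 2 * (2 * j) ^ j) * (σ * (1 + y) * a))) := by
          refine add_le_add e1 ?_
          gcongr
          linarith
      _ = _ := by ring
  have h2 : 4 ^ (2 * j) * (2 * (t + κ) * (2 ^ (2 * k) * M * (W * a * (1 + y))))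
      ≤ 4 ^ (2 * j) * (2 * (1 + 2 ^ (3 * j) * M) * (2 ^ (2 * k) * M * W)) * (σ * (1 + y) * a) := by
    have e1 : t + κ ≤ (1 + 2 ^ (3 * j) * M) * σ := by linarith [e.t_le]
    calc _ ≤ 4 ^ (2 * j) * (2 * ((1 + 2 ^ (3 * j) * M) * σ)
          * (2 ^ (2 * k) * M * (W * a * (1 + y)))) := by gcongr
      _ = _ := by ring
  have h3 : (2 ^ (3 * k) + 3 * 4 ^ (2 * j) * 2 ^ k) * ((n : ℝ) ^ L.card * (x / t))
      ≤ (2 ^ (3 * k) + 3 * 4 ^ (2 * j) * 2 ^ k) * (σ * (1 + y) * a) := by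
    refine mul_le_mul_of_nonneg_left (hx.trans ?_) (by positivity)
    refine mul_le_mul_of_nonneg_right ?_ ha0.le
    exact le_mul_of_one_le_right hσ (by linarith)
  have h4 : pairSum q L s'.discovered s'.active
      ≤ (1 - 6 * (c * σ)) * ρ₀ * (π * a) + c * (σ * (1 + y) * a) := by
    have h5 := mul_le_mul_of_nonneg_right hc.pair_le
      (show 0 ≤ σ * (1 + y) * a by positivity)
    linarith
  have hρ₀0 : 0 ≤ (1 - 6 * (c * σ)) * ρ₀ := by
    refine le_trans ?_ hρ₀
    positivity
  have hσ6 : 0 < 1 - 6 * (c * σ) := by linarith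
  have hρ0' : 0 ≤ ρ₀ := nonneg_of_mul_nonneg_right hρ₀0 hσ6
  rw [hπ, pairDensity, div_le_iff₀ hpos, hdev]
  refine h4.trans ?_
  calc (1 - 6 * (c * σ)) * ρ₀ * (π * a) + c * (σ * (1 + y) * a)
      ≤ (1 - 6 * (c * σ)) * ρ₀ * (π * a)
        + (2 * (1 - 6 * (c * σ))) * (c * (σ * (2 + |y - 1|) * a)) := by
        have e0 : c * (σ * (1 + y) * a) ≤ c * (σ * (2 + |y - 1|) * a) := by gcongr
        have e1 : 0 ≤ c * (σ * (2 + |y - 1|) * a) := by positivity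
        have e2 : 1 ≤ 2 * (1 - 6 * (c * σ)) := by linarith
        have e3 := mul_le_mul_of_nonneg_right e2 e1
        linarith
    _ = (ρ₀ * π + 2 * c * (σ * (2 + |y - 1|))) * ((1 - 6 * (c * σ)) * a) := by ring
    _ ≤ _ := by gcongr

end

end SmoothBoundary

namespace SmoothBoundary

/-! ### The search up to the stopping time -/

variable {n k j : ℕ}

/-- The parameters are such that one step of the search is under control. -/
structure Controlled (n k j : ℕ) (p ε q M β t₁ t₂ x κ c σ₁ σ₂ δ : ℝ) : Prop where
  regime : Regime n k j p ε q M β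
  const : ConstBound k j q M c
  err₁ : ErrorBound n j M β t₁ κ c σ₁
  err₂ : ErrorBound n j M β t₂ κ c σ₂
  x_nonneg : 0 ≤ x
  x_le₁ : x / t₁ ≤ σ₁ * (n : ℝ) ^ δ
  x_le₂ : x / t₂ ≤ σ₂ * (n : ℝ) ^ (1 + δ)
  grow : 24 * (c * σ₂) ≤ ε
  ε_le : ε ≤ 1
  δ_pos : 0 < δ
  δ_le : δ ≤ 1

/-- The first `N` generations behave as expected. -/
structure Live (k j : ℕ) (p q t₁ t₂ x κ β : ℝ) (T : Finset (Finset (Fin n)))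
    (J : Finset (Fin n)) (N : ℕ) : Prop where
  subset : T ⊆ kSets n k
  card_eq : J.card = j
  sparse : ∀ i < N, Sparse j β (search j (T : Set (Finset (Fin n))) J i).discovered
  step₁ : ∀ i < N, ∀ L : Finset (Fin n), L.card < j →
    GoodStep k j p q t₁ x κ (search j T J i) (T ∩ fresh k (search j T J i)) L
  step₂ : ∀ i < N, ∀ L : Finset (Fin n), L.card < j →
    GoodStep k j p q t₂ x κ (search j T J i) (T ∩ fresh k (search j T J i)) L

/-- Each nonempty generation adds at least one set, so a live search has fewer than C(n,j)
generations. This justifies the range i ≤ n^j in the union bound. -/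
lemma lt_card_discovered {H : Set (Finset (Fin n))} {J : Finset (Fin n)} (i : ℕ)
    (h : ∀ i' ≤ i, (search j H J i').active ≠ ∅) : i < (search j H J i).discovered.card := by
  induction i with
  | zero => simp [search]
  | succ i ih =>
    have ih := ih fun i' hi' => h i' (by omega)
    have h1 := search_active_disjoint (j := j) H J i
    rw [search_discovered_succ, Finset.card_union_of_disjoint h1]
    have : 0 < (search j H J (i + 1)).active.card :=
      Finset.card_pos.2 (Finset.nonempty_iff_ne_empty.2 (h _ le_rfl))
    omega

/-- Before the stopping time the component has at most lam·n^j members, so the bounds on the excess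
degrees give sparsity. This fulfils the hypothesis under which `GoodRun` controls the individual
steps. -/
lemma live_of_goodRun {p q t₁ t₂ x κ β ρ C lam : ℝ} {T : Finset (Finset (Fin n))}
    (hn : 0 < n) (hT : T ⊆ kSets n k)
    (hrun : GoodRun k j p q t₁ t₂ x κ β ρ C T) (hρ0 : 0 ≤ ρ) (hρ1 : ρ < 1) (hC : 0 ≤ C)
    (hlam : 0 ≤ lam) (hx : x ≤ lam * n) (hβ : lam * ((C * 2 ^ j + 1) / (1 - ρ)) ^ j = β)
    {J : Finset (Fin n)} (hJ : J.card = j) {N : ℕ}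
    (hN : (N : ℕ∞) ≤ stopTime j lam (T : Set (Finset (Fin n))) J) :
    Live k j p q t₁ t₂ x κ β T J N := by
  have hlive : ∀ i < N, (search j (T : Set (Finset (Fin n))) J i).active ≠ ∅ ∧
      ((search j (T : Set (Finset (Fin n))) J i).discovered.card : ℝ) ≤ lam * (n : ℝ) ^ j := by
    intro i hi
    by_contra hcon
    have hle : stopTime j lam (T : Set (Finset (Fin n))) J ≤ (i : ℕ∞) := by
      refine iInf₂_le i ?_
      rw [not_and_or, not_not, not_le] at hcon
      rcases hcon with h | h
      · exact Or.inl h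
      · exact Or.inr (Or.inl h.le)
    have : (N : ℕ∞) ≤ i := hN.trans hle
    rw [Nat.cast_le] at this
    omega
  have hle : ∀ i < N, i ≤ n ^ j := by
    intro i hi
    have h1 := lt_card_discovered (j := j) (H := (T : Set (Finset (Fin n)))) (J := J) i
      fun i' hi' => (hlive i' (by omega)).1
    have h2 : (search j (T : Set (Finset (Fin n))) J i).discovered.card ≤ n.choose j := by
      rw [← show (jSets n j).card = n.choose j by simp [jSets]]
      exact Finset.card_le_card fun A hA =>
        mem_jSets.2 ((search_valid (T : Set (Finset (Fin n))) hJ i).card_eq A hA)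
    have := Nat.choose_le_pow n j
    omega
  have hsp : ∀ i < N, Sparse j β (search j (T : Set (Finset (Fin n))) J i).discovered := by
    intro i hi
    rw [← hβ]
    exact sparse_of_degreeExcess_le hn hρ0 hρ1 hC hlam hx _ (hlive i hi).2
      fun L hL0 hL => hrun.excess J hJ i (hle i hi) L hL0 hL
  exact ⟨hT, hJ, hsp, fun i hi L hL => hrun.step₁ J hJ i (hle i hi) L hL (hsp i hi),
    fun i hi L hL => hrun.step₂ J hJ i (hle i hi) L hL (hsp i hi)⟩

section

variable {p ε q M β t₁ t₂ x κ c σ₁ σ₂ δ : ℝ} {T : Finset (Finset (Fin n))} {J : Finset (Fin n)}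
  {N : ℕ}

lemma Controlled.one_le_pow (h : Controlled n k j p ε q M β t₁ t₂ x κ c σ₁ σ₂ δ) {e : ℝ}
    (he : 0 ≤ e) : 1 ≤ (n : ℝ) ^ e :=
  Real.one_le_rpow (by exact_mod_cast h.regime.n_pos) he

lemma Controlled.n_pos (h : Controlled n k j p ε q M β t₁ t₂ x κ c σ₁ σ₂ δ) : (0 : ℝ) < n := by
  exact_mod_cast h.regime.n_pos

lemma Controlled.pow_mul_le (h : Controlled n k j p ε q M β t₁ t₂ x κ c σ₁ σ₂ δ) {l : ℕ} {a : ℝ}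
    (ha : (n : ℝ) ^ ((l : ℝ) + δ) ≤ a) : (n : ℝ) ^ l * (x / t₁) ≤ σ₁ * a := by
  have hn := h.n_pos
  calc (n : ℝ) ^ l * (x / t₁) ≤ (n : ℝ) ^ l * (σ₁ * (n : ℝ) ^ δ) := by
        gcongr
        exact h.x_le₁
    _ = σ₁ * (n : ℝ) ^ ((l : ℝ) + δ) := by
        rw [Real.rpow_add hn, Real.rpow_natCast]; ring
    _ ≤ σ₁ * a := mul_le_mul_of_nonneg_left ha h.err₁.σ_nonneg

/-- Here the fine precision is needed: its error is at most ε/4, and (1 - ε/4)(1 + ε) ≥ 1 for ε ≤ 1.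
The coarse error may exceed ε. -/
lemma Controlled.card_mono_step (h : Controlled n k j p ε q M β t₁ t₂ x κ c σ₁ σ₂ δ)
    (hlive : Live k j p q t₁ t₂ x κ β T J N) {i : ℕ} (hi : i < N)
    (ha : (n : ℝ) ^ (1 + δ) ≤ ((search j (T : Set (Finset (Fin n))) J i).active.card : ℝ)) :
    ((search j (T : Set (Finset (Fin n))) J i).active.card : ℝ)
      ≤ (search j (T : Set (Finset (Fin n))) J (i + 1)).active.card := by
  have hs := search_valid (T : Set (Finset (Fin n))) hlive.card_eq i
  have hL : (∅ : Finset (Fin n)).card < j := by simpa using h.regime.j_pos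
  have hε := h.regime.ε_nonneg
  have hε1 := h.ε_le
  have hg := h.grow
  have h1 := h.regime.le_card_next' h.const h.err₂ hs (hlive.sparse i hi)
    (h.x_le₂.trans (mul_le_mul_of_nonneg_left ha h.err₂.σ_nonneg)) (hlive.step₂ i hi ∅ hL)
  rw [search_active_succ hlive.subset]
  refine le_trans ?_ h1
  rw [← mul_assoc]
  refine le_mul_of_one_le_left (Nat.cast_nonneg _) ?_
  have : (1 - ε / 4) * (1 + ε) ≤ (1 - 6 * (c * σ₂)) * (1 + ε) := by gcongr; linarith
  nlinarith

lemma Controlled.card_step_le (h : Controlled n k j p ε q M β t₁ t₂ x κ c σ₁ σ₂ δ)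
    (hlive : Live k j p q t₁ t₂ x κ β T J N) {i : ℕ} (hi : i < N)
    (ha : (n : ℝ) ^ (1 + δ) ≤ ((search j (T : Set (Finset (Fin n))) J i).active.card : ℝ)) :
    ((search j (T : Set (Finset (Fin n))) J (i + 1)).active.card : ℝ)
      ≤ (1 + 2 * (c * σ₁)) * (1 + ε) * (search j (T : Set (Finset (Fin n))) J i).active.card := by
  have hs := search_valid (T : Set (Finset (Fin n))) hlive.card_eq i
  have hL : (∅ : Finset (Fin n)).card < j := by simpa using h.regime.j_pos
  have hx : x / t₁ ≤ σ₁ * (search j (T : Set (Finset (Fin n))) J i).active.card := by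
    have := h.pow_mul_le (l := 0) (a := (search j (T : Set (Finset (Fin n))) J i).active.card)
      (le_trans (Real.rpow_le_rpow_of_exponent_le (by exact_mod_cast h.regime.n_pos)
        (by push_cast; linarith)) ha)
    simpa using this
  have h1 := h.regime.card_next_le' h.const h.err₁ hs hx (hlive.step₁ i hi ∅ hL)
  rw [search_active_succ hlive.subset, mul_assoc]
  exact h1

/-- Limits the overshoot when a generation first passes a threshold b: the branching contributes at
most 2·2·b and the additive error at most b. -/
lemma Controlled.card_step_le_of_lt (h : Controlled n k j p ε q M β t₁ t₂ x κ c σ₁ σ₂ δ)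
    (hlive : Live k j p q t₁ t₂ x κ β T J N) {i : ℕ} (hi : i < N) {b : ℝ}
    (hb : (n : ℝ) ^ (1 + δ) ≤ b)
    (ha : ((search j (T : Set (Finset (Fin n))) J i).active.card : ℝ) ≤ b) :
    ((search j (T : Set (Finset (Fin n))) J (i + 1)).active.card : ℝ) ≤ 5 * b := by
  have hs := search_valid (T : Set (Finset (Fin n))) hlive.card_eq i
  have hL : (∅ : Finset (Fin n)).card < j := by simpa using h.regime.j_pos
  have hε := h.regime.ε_nonneg
  have h1 := h.regime.card_next_le h.err₁.t_pos.le hs (hlive.step₁ i hi ∅ hL)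
  rw [← search_active_succ hlive.subset] at h1
  have hb0 : 0 ≤ b := le_trans (by positivity) hb
  have ht := h.err₁.t_le_one h.const
  have h2 : (1 + t₁) * ((1 + ε) * ((search j (T : Set (Finset (Fin n))) J i).active.card : ℝ))
      ≤ 2 * (2 * b) := by
    have := h.ε_le
    gcongr <;> linarith
  have h3 : 2 ^ k * x / t₁ ≤ b := by
    have e1 : x / t₁ ≤ σ₁ * b := by
      have := h.pow_mul_le (l := 0) (a := b)
        (le_trans (Real.rpow_le_rpow_of_exponent_le (by exact_mod_cast h.regime.n_pos)
          (by push_cast; linarith)) hb)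
      simpa using this
    have hσ := h.err₁.σ_nonneg
    calc 2 ^ k * x / t₁ = 2 ^ k * (x / t₁) := by ring
      _ ≤ 2 ^ k * (σ₁ * b) := by gcongr
      _ ≤ c * (σ₁ * b) := by
          gcongr
          exact h.const.err_le
      _ = c * σ₁ * b := by ring
      _ ≤ 1 * b := by
          gcongr
          linarith [h.err₁.mul_le]
      _ = b := one_mul b
  linarith

lemma Controlled.le_card (h : Controlled n k j p ε q M β t₁ t₂ x κ c σ₁ σ₂ δ)
    (hlive : Live k j p q t₁ t₂ x κ β T J N) {m : ℕ} {b : ℝ} (hb : (n : ℝ) ^ (1 + δ) ≤ b)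
    (hm : b ≤ ((search j (T : Set (Finset (Fin n))) J m).active.card : ℝ)) (i : ℕ)
    (hmi : m ≤ i) (hi : i ≤ N) :
    b ≤ ((search j (T : Set (Finset (Fin n))) J i).active.card : ℝ) := by
  induction i, hmi using Nat.le_induction with
  | base => exact hm
  | succ i hmi ih =>
    have ih := ih (by omega)
    exact ih.trans (h.card_mono_step hlive (by omega) (hb.trans ih))

lemma Controlled.card_le (h : Controlled n k j p ε q M β t₁ t₂ x κ c σ₁ σ₂ δ)
    (hlive : Live k j p q t₁ t₂ x κ β T J N) {m : ℕ} {b : ℝ} (hb : (n : ℝ) ^ (1 + δ) ≤ b)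
    (hm : b ≤ ((search j (T : Set (Finset (Fin n))) J m).active.card : ℝ))
    (hm' : ((search j (T : Set (Finset (Fin n))) J m).active.card : ℝ) ≤ 5 * b) (i : ℕ)
    (hmi : m ≤ i) (hi : i ≤ N) :
    ((search j (T : Set (Finset (Fin n))) J i).active.card : ℝ)
      ≤ ((1 + 2 * (c * σ₁)) * (1 + ε)) ^ (i - m) * (5 * b) := by
  have hε := h.regime.ε_nonneg
  have hc := h.const.one_le
  have hσ := h.err₁.σ_nonneg
  induction i, hmi using Nat.le_induction with
  | base => simpa using hm'
  | succ i hmi ih =>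
    have ih := ih (by omega)
    have h1 := h.card_step_le hlive (show i < N by omega)
      (hb.trans (h.le_card hlive hb hm i hmi (by omega)))
    refine h1.trans ?_
    rw [show i + 1 - m = (i - m) + 1 by omega, pow_succ', mul_assoc _ (_ ^ (i - m))]
    gcongr

/-- The starting time, if finite, is attained. -/
lemma startTime_spec {H : Set (Finset (Fin n))} {l i : ℕ}
    (h : startTime j δ H J l ≤ (i : ℕ∞)) : ∃ m ≤ i, startTime j δ H J l = (m : ℕ∞) ∧
      (n : ℝ) ^ ((l : ℝ) + δ) ≤ ((search j H J m).active.card : ℝ) ∧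
      ∀ m' < m, ((search j H J m').active.card : ℝ) < (n : ℝ) ^ ((l : ℝ) + δ) := by
  classical
  have hex : ∃ i, (n : ℝ) ^ ((l : ℝ) + δ) ≤ ((generation j H J i).card : ℝ) := by
    by_contra hcon
    push Not at hcon
    have : startTime j δ H J l = ⊤ := by
      unfold startTime
      simp only [iInf_eq_top]
      intro i hi
      exact absurd hi (not_le.2 (hcon i))
    rw [this] at h
    exact absurd h (by simp)
  have heq : startTime j δ H J l = ((Nat.find hex : ℕ) : ℕ∞) := by
    refine le_antisymm (iInf₂_le (f := fun (i : ℕ) _ => (i : ℕ∞)) (Nat.find hex)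
      (Nat.find_spec hex)) (le_iInf₂ fun i hi => ?_)
    exact_mod_cast Nat.find_min' hex hi
  refine ⟨Nat.find hex, ?_, heq, Nat.find_spec hex, fun m' hm' => ?_⟩
  · rw [heq] at h
    exact_mod_cast h
  · exact not_le.1 (Nat.find_min hex hm')

/-- Smaller sets are smoothed before the smoothing process for larger sets begins. -/
lemma Controlled.smoothEnd_le {η : ℝ} (h : Controlled n k j p ε q M β t₁ t₂ x κ c σ₁ σ₂ δ)
    (hlive : Live k j p q t₁ t₂ x κ β T J N) {z l m : ℕ} (hzl : z < l)
    (hfast : 0 < z → 5 * ((1 + 2 * (c * σ₁)) * (1 + ε)) ^ smoothTime k j n ε η z < n)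
    (hm : (n : ℝ) ^ ((l : ℝ) + δ) ≤ ((search j (T : Set (Finset (Fin n))) J m).active.card : ℝ))
    (hmN : m ≤ N) :
    smoothEnd k j δ ε η (T : Set (Finset (Fin n))) J z ≤ (m : ℕ∞) := by
  unfold smoothEnd
  split_ifs with hz
  · simp
  have hz0 : 0 < z := Nat.pos_of_ne_zero hz
  have hfast := hfast hz0
  have hn := h.n_pos
  have hn1 : (1 : ℝ) ≤ n := by exact_mod_cast h.regime.n_pos
  have hzl' : (z : ℝ) + 1 ≤ l := by exact_mod_cast hzl
  have hz1 : (1 : ℝ) ≤ z := by exact_mod_cast hz0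
  have hle : (n : ℝ) ^ ((z : ℝ) + δ) ≤ (n : ℝ) ^ ((l : ℝ) + δ) :=
    Real.rpow_le_rpow_of_exponent_le hn1 (by linarith)
  have hb : (n : ℝ) ^ (1 + δ) ≤ (n : ℝ) ^ ((z : ℝ) + δ) :=
    Real.rpow_le_rpow_of_exponent_le hn1 (by linarith)
  have hstart : startTime j δ (T : Set (Finset (Fin n))) J z ≤ (m : ℕ∞) :=
    iInf₂_le m (hle.trans hm)
  obtain ⟨i₀, hi₀m, heq, hi₀, hmin⟩ := startTime_spec hstart
  rw [heq]
  -- The preceding generation was below the threshold, so the first one above it overshoots by a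
  -- factor of at most 5. If the starting time is 0, the generation is a single set.
  have hi₀5 : ((search j (T : Set (Finset (Fin n))) J i₀).active.card : ℝ)
      ≤ 5 * (n : ℝ) ^ ((z : ℝ) + δ) := by
    rcases Nat.eq_zero_or_pos i₀ with h0 | hpos
    · subst h0
      have := h.one_le_pow (e := (z : ℝ) + δ) (by linarith [h.δ_pos])
      simp only [search, Finset.card_singleton, Nat.cast_one]
      linarith
    · obtain ⟨i, rfl⟩ : ∃ i, i₀ = i + 1 := ⟨i₀ - 1, by omega⟩
      exact h.card_step_le_of_lt hlive (by omega) hb (hmin i (by omega)).le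
  have hup := h.card_le hlive hb hi₀ hi₀5 m hi₀m hmN
  by_contra hcon
  have hlt : m - i₀ < smoothTime k j n ε η z := by
    by_contra hge
    refine hcon ?_
    have : i₀ + smoothTime k j n ε η z ≤ m := by omega
    exact_mod_cast this
  have hG : 1 ≤ (1 + 2 * (c * σ₁)) * (1 + ε) := by
    have hε := h.regime.ε_nonneg
    have hc := h.const.one_le
    have hσ := h.err₁.σ_nonneg
    have : 0 ≤ c * σ₁ := by positivity
    nlinarith
  -- As l ≥ z + 1, the generation at time m exceeds the threshold for z by a factor n. If smoothing
  -- for z were still running, the growth since its start would be smaller than that.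
  have hlow : (n : ℝ) * (n : ℝ) ^ ((z : ℝ) + δ)
      ≤ ((search j (T : Set (Finset (Fin n))) J m).active.card : ℝ) := by
    refine le_trans ?_ hm
    rw [← Real.rpow_one_add' hn.le (by linarith [h.δ_pos])]
    exact Real.rpow_le_rpow_of_exponent_le hn1 (by linarith)
  have hpow : ((1 + 2 * (c * σ₁)) * (1 + ε)) ^ (m - i₀)
      ≤ ((1 + 2 * (c * σ₁)) * (1 + ε)) ^ smoothTime k j n ε η z :=
    pow_le_pow_right₀ hG hlt.le
  have hnz : 0 < (n : ℝ) ^ ((z : ℝ) + δ) := by positivity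
  have : (n : ℝ) * (n : ℝ) ^ ((z : ℝ) + δ) < (n : ℝ) * (n : ℝ) ^ ((z : ℝ) + δ) := by
    calc _ ≤ ((1 + 2 * (c * σ₁)) * (1 + ε)) ^ (m - i₀) * (5 * (n : ℝ) ^ ((z : ℝ) + δ)) :=
          hlow.trans hup
      _ ≤ ((1 + 2 * (c * σ₁)) * (1 + ε)) ^ smoothTime k j n ε η z
            * (5 * (n : ℝ) ^ ((z : ℝ) + δ)) := by gcongr
      _ = (5 * ((1 + 2 * (c * σ₁)) * (1 + ε)) ^ smoothTime k j n ε η z)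
            * (n : ℝ) ^ ((z : ℝ) + δ) := by ring
      _ < _ := by gcongr
  exact lt_irrefl _ this

end

end SmoothBoundary

namespace SmoothBoundary

/-! ### The smoothing process -/

variable {n k j : ℕ}

lemma degree_le_choose {G : Finset (Finset (Fin n))} (hG : ∀ A ∈ G, A.card = j)
    {L : Finset (Fin n)} (hL : L.card ≤ j) : degree G L ≤ n.choose (j - L.card) := by
  have h1 : degree G L ≤ (superSets j L).card := by
    unfold degree
    refine Finset.card_le_card fun A hA => ?_
    rw [Finset.mem_filter] at hA
    exact mem_superSets.2 ⟨hG A hA.1, hA.2⟩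
  rw [card_superSets hL] at h1
  exact h1.trans (Nat.choose_le_choose _ (Nat.sub_le _ _))

lemma pairSum_le_weightSum {q : ℝ} (hq : 1 ≤ q) {D G : Finset (Finset (Fin n))}
    (hG : ∀ A ∈ G, A.card = j) {L : Finset (Fin n)} (hL : L.card ≤ j) :
    pairSum q L D G ≤ 2 ^ (2 * j) * weightSum L G := by
  unfold pairSum weightSum
  rw [Finset.mul_sum]
  refine Finset.sum_le_sum fun A hA => ?_
  rw [mul_comm]
  have h1 : ((D.filter fun B => B ≠ A ∧ B ⊆ A ∪ L).card : ℝ) ≤ 2 ^ (2 * j) := by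
    have e1 : (D.filter fun B => B ≠ A ∧ B ⊆ A ∪ L) ⊆ (A ∪ L).powerset := fun B hB =>
      Finset.mem_powerset.2 (Finset.mem_filter.1 hB).2.2
    have e2 := (Finset.card_le_card e1).trans (Finset.card_powerset _).le
    have e3 : (A ∪ L).card ≤ 2 * j := by
      have := Finset.card_union_le A L
      rw [hG A hA] at this
      omega
    exact_mod_cast e2.trans (Nat.pow_le_pow_right (by norm_num) e3)
  have h2 : ((n : ℝ) / q) ^ (A ∩ L).card ≤ (n : ℝ) ^ (A ∩ L).card := by
    refine pow_le_pow_left₀ (by positivity) ?_ _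
    exact div_le_self (Nat.cast_nonneg _) hq
  exact mul_le_mul h1 h2 (by positivity) (by positivity)

/-- The rate `ρ` at which deviations at `l`-sets decay, with a total duration `s`. The pairs decay
at the rate `ρ₀`, and are weighted with the factor `K` against the deviations. -/
structure Rate (n k j : ℕ) (ε q M c σ γ₀ δ : ℝ) (l s : ℕ) (ρ ρ₀ K : ℝ) : Prop where
  ρ_nonneg : 0 ≤ ρ
  ρ_lt : ρ < 1
  K_nonneg : 0 ≤ K
  pair : (1 + σ) * ((1 + ε) * branchRatio k j l + 2 ^ (4 * k) * M * (q / n + 1 / q))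
    ≤ (1 - 6 * (c * σ)) * ρ₀
  dev : branchRatio k j l + (40 * c + 2 * c * K) * σ ≤ ρ
  mix : 40 * c + K * ρ₀ ≤ ρ * K
  ratio : 1 - branchRatio k j l ≤ 2 * (1 - ρ)
  fast : ρ ^ s * (n : ℝ) ^ ((j : ℝ) - l - δ) * (2 + K * (2 ^ (2 * j) * (2 ^ (j + 2) * (2 * j) ^ j)))
    + (80 * c + 4 * c * K) * σ / (1 - ρ) ≤ γ₀

section

variable {p ε q M β t₁ t₂ x κ c σ₁ σ₂ δ γ : ℝ} {T : Finset (Finset (Fin n))} {J : Finset (Fin n)}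
  {N : ℕ}

/-- `L` lies in at most C(n, j-ℓ) j-sets, and the generation has at least n^(ℓ+δ) members; so the
ratio y is at most n^(j-ℓ-δ). The smoothing time is designed to contract this quantity. -/
lemma Controlled.deviation_init (h : Controlled n k j p ε q M β t₁ t₂ x κ c σ₁ σ₂ δ)
    {s : SearchState n} (hs : s.Valid j) {L : Finset (Fin n)} (hL : L.card < j)
    (hδ : (L.card : ℝ) + δ ≤ j) (hγ1 : γ ≤ 1)
    (hsm : SmoothBelow j L.card γ s.active)
    (ha : (n : ℝ) ^ ((L.card : ℝ) + δ) ≤ (s.active.card : ℝ)) {K : ℝ} (hK : 0 ≤ K) :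
    deviation j s L + K * pairDensity q s L
      ≤ (n : ℝ) ^ ((j : ℝ) - L.card - δ) *
        (2 + K * (2 ^ (2 * j) * (2 ^ (j + 2) * (2 * j) ^ j))) := by
  have hn := h.n_pos
  have hn1 : (1 : ℝ) ≤ n := by exact_mod_cast h.regime.n_pos
  have hkn := h.regime.n_ge
  have hjk := h.regime.j_lt
  have hcard : ∀ A ∈ s.active, A.card = j := fun A hA => hs.card_eq A (hs.active_subset hA)
  have ha0 : (0 : ℝ) < s.active.card := lt_of_lt_of_le (by positivity) ha
  set τ := meanRatio n j L.card with hτdef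
  have hτ : 0 < τ := meanRatio_pos (by omega) _
  obtain ⟨y, hdev, hy0, hLy⟩ : ∃ y : ℝ, deviation j s L = |y - 1| ∧ 0 ≤ y ∧
      (degree s.active L : ℝ) = y * (s.active.card * τ) :=
    ⟨_, rfl, div_nonneg (Nat.cast_nonneg _) (mul_pos ha0 hτ).le,
      (div_mul_cancel₀ _ (mul_pos ha0 hτ).ne').symm⟩
  set R := (n : ℝ) ^ ((j : ℝ) - L.card - δ) with hR
  have hR1 : 1 ≤ R := Real.one_le_rpow hn1 (by linarith)
  have hyR : y ≤ R := by
    have h1 : (degree s.active L : ℝ) ≤ τ * n.choose j := by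
      have hc : (n.choose j : ℝ) ≠ 0 := by exact_mod_cast (Nat.choose_pos (show j ≤ n by omega)).ne'
      rw [hτdef, meanRatio, div_mul_cancel₀ _ hc]
      exact_mod_cast degree_le_choose hcard hL.le
    have h2 : y * s.active.card ≤ n.choose j := by
      rw [hLy] at h1
      refine le_of_mul_le_mul_right ?_ hτ
      linarith
    have h3 : (n.choose j : ℝ) ≤ (n : ℝ) ^ j := by exact_mod_cast Nat.choose_le_pow n j
    have h4 : y * (n : ℝ) ^ ((L.card : ℝ) + δ) ≤ (n : ℝ) ^ j :=
      (mul_le_mul_of_nonneg_left ha hy0).trans (h2.trans h3)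
    have h5 : (n : ℝ) ^ j = R * (n : ℝ) ^ ((L.card : ℝ) + δ) := by
      rw [hR, ← Real.rpow_add hn, ← Real.rpow_natCast]
      congr 1
      ring
    rw [h5] at h4
    exact le_of_mul_le_mul_right h4 (by positivity)
  have hd : deviation j s L ≤ 2 * R := by
    rw [hdev, abs_le]
    constructor <;> linarith
  have hpd : pairDensity q s L ≤ 2 ^ (2 * j) * (2 ^ (j + 2) * (2 * j) ^ j) * R := by
    unfold pairDensity
    rw [div_le_iff₀ ha0]
    have h1 := pairSum_le_weightSum (D := s.discovered) h.regime.one_le_q hcard hL.le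
    have h2 := weightSum_le_of_smoothBelow h.regime hγ1 hy0 hL hsm hLy
    calc _ ≤ 2 ^ (2 * j) * weightSum L s.active := h1
      _ ≤ 2 ^ (2 * j) * (2 ^ (j + 1) * (2 * j) ^ j * s.active.card * (1 + y)) := by gcongr
      _ ≤ 2 ^ (2 * j) * (2 ^ (j + 1) * (2 * j) ^ j * s.active.card * (2 * R)) := by
          refine mul_le_mul_of_nonneg_left (mul_le_mul_of_nonneg_left ?_
            (mul_nonneg (by positivity) ha0.le)) (by positivity)
          linarith
      _ = _ := by ring
  calc _ ≤ 2 * R + K * (2 ^ (2 * j) * (2 ^ (j + 2) * (2 * j) ^ j) * R) := by gcongr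
    _ = _ := by ring

/-- One step of the recursion for the combination of deviation and pairs. -/
lemma Controlled.potential_step (h : Controlled n k j p ε q M β t₁ t₂ x κ c σ₁ σ₂ δ)
    (hlive : Live k j p q t₁ t₂ x κ β T J N) {i : ℕ} (hi : i < N)
    {L : Finset (Fin n)} (hL0 : 0 < L.card) (hL : L.card < j) (hγ : 0 ≤ γ) (hγ1 : γ ≤ 1)
    (hsm : SmoothBelow j L.card γ (search j (T : Set (Finset (Fin n))) J i).active)
    (ha : (n : ℝ) ^ ((L.card : ℝ) + δ)
      ≤ ((search j (T : Set (Finset (Fin n))) J i).active.card : ℝ))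
    {γ₀ : ℝ} {s : ℕ} {ρ ρ₀ K : ℝ} (hR : Rate n k j ε q M c σ₁ γ₀ δ L.card s ρ ρ₀ K) :
    deviation j (search j (T : Set (Finset (Fin n))) J (i + 1)) L
        + K * pairDensity q (search j T J (i + 1)) L
      ≤ ρ * (deviation j (search j (T : Set (Finset (Fin n))) J i) L
        + K * pairDensity q (search j T J i) L)
        + ((1 - branchRatio k j L.card) * γ + (80 * c + 4 * c * K) * σ₁) := by
  have hs := search_valid (T : Set (Finset (Fin n))) hlive.card_eq i
  have hL' : (∅ : Finset (Fin n)).card < j := by simpa using h.regime.j_pos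
  have hx := h.pow_mul_le ha
  have hn := h.n_pos
  have ha0 : 0 < (search j (T : Set (Finset (Fin n))) J i).active.card := by
    have : (0 : ℝ) < (search j (T : Set (Finset (Fin n))) J i).active.card :=
      lt_of_lt_of_le (by positivity) ha
    exact_mod_cast this
  have hact := search_active_succ hlive.subset (j := j) (J := J) i
  have hdis := search_discovered_succ (j := j) (T : Set (Finset (Fin n))) J i
  rw [hact] at hdis
  have h1 := (h.regime.deviation_next_le h.const h.err₁ hs (hlive.sparse i hi) h.x_nonneg hx ha0
    hγ hγ1 hL0 hL hsm (hlive.step₁ i hi ∅ hL') (hlive.step₁ i hi L hL) hact).2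
  have h2 := h.regime.pairDensity_next_le h.const h.err₁ hs (hlive.sparse i hi) h.x_nonneg hx ha0
    hγ1 hL hsm hR.pair (hlive.step₁ i hi ∅ hL') (hlive.step₁ i hi L hL) hact hdis
  have hd := deviation_nonneg (j := j) (search j (T : Set (Finset (Fin n))) J i) L
  have hp := pairDensity_nonneg h.regime.one_le_q (search j (T : Set (Finset (Fin n))) J i) L
  set d := deviation j (search j (T : Set (Finset (Fin n))) J i) L
  set π := pairDensity q (search j (T : Set (Finset (Fin n))) J i) L
  -- The pair density enters the deviation with factor 40c. Weighting it by K lets its own faster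
  -- decay at rate ρ₀ absorb this term, by `Rate.mix`.
  have h3 := mul_le_mul_of_nonneg_left h2 hR.K_nonneg
  have h4 := mul_le_mul_of_nonneg_right hR.dev hd
  have h5 := mul_le_mul_of_nonneg_right hR.mix hp
  linarith

lemma potential_le {U : ℕ → ℝ} {ρ E : ℝ} (hρ : 0 ≤ ρ) (hρ1 : ρ < 1) (hE : 0 ≤ E) {m N : ℕ}
    (hU : ∀ i, m ≤ i → i < N → U (i + 1) ≤ ρ * U i + E) (i : ℕ) (hmi : m ≤ i) (hi : i ≤ N) :
    U i ≤ ρ ^ (i - m) * U m + E / (1 - ρ) := by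
  have h1 : 0 < 1 - ρ := by linarith
  induction i, hmi using Nat.le_induction with
  | base =>
    have : 0 ≤ E / (1 - ρ) := by positivity
    simpa using this
  | succ i hmi ih =>
    have ih := ih (by omega)
    refine (hU i hmi (by omega)).trans ?_
    rw [show i + 1 - m = (i - m) + 1 by omega, pow_succ']
    have h2 : ρ * (E / (1 - ρ)) + E = E / (1 - ρ) := by field_simp; ring
    have h3 := mul_le_mul_of_nonneg_left ih hρ
    linarith

/-- The boundary is smooth from the end of the smoothing process to the stopping time. -/
theorem Controlled.smooth {η γ₀ : ℝ} (h : Controlled n k j p ε q M β t₁ t₂ x κ c σ₁ σ₂ δ)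
    (hγ₀ : 0 ≤ γ₀) (hγ₀1 : 8 ^ j * γ₀ ≤ 1)
    (hfast : ∀ z, 0 < z → z < j →
      5 * ((1 + 2 * (c * σ₁)) * (1 + ε)) ^ smoothTime k j n ε η z < n)
    (hrate : ∀ l, 0 < l → l < j →
      ∃ ρ ρ₀ K, Rate n k j ε q M c σ₁ γ₀ δ l (smoothTime k j n ε η l) ρ ρ₀ K)
    {N : ℕ} (hlive : Live k j p q t₁ t₂ x κ β T J N) (l : ℕ) (hl : l < j) :
    ∀ L : Finset (Fin n), L.card = l → ∀ i ≤ N,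
      smoothEnd k j δ ε η (T : Set (Finset (Fin n))) J l ≤ (i : ℕ∞) →
      |(degree (search j (T : Set (Finset (Fin n))) J i).active L : ℝ)
        - (search j (T : Set (Finset (Fin n))) J i).active.card * meanRatio n j l|
      ≤ 8 ^ l * γ₀ * ((search j (T : Set (Finset (Fin n))) J i).active.card * meanRatio n j l) := by
  have hkn := h.regime.n_ge
  have hjk := h.regime.j_lt
  have hn := h.n_pos
  have hn1 : (1 : ℝ) ≤ n := by exact_mod_cast h.regime.n_pos
  induction l using Nat.strong_induction_on with
  | _ l ih =>
    intro L hL i hiN hsi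
    rcases Nat.eq_zero_or_pos l with h0 | hpos
    · subst h0
      rw [Finset.card_eq_zero.1 hL, degree_empty, meanRatio_zero (by omega), mul_one, sub_self,
        abs_zero]
      positivity
    · have hsmo : smoothEnd k j δ ε η (T : Set (Finset (Fin n))) J l
          = startTime j δ (T : Set (Finset (Fin n))) J l + (smoothTime k j n ε η l : ℕ∞) := by
        unfold smoothEnd
        rw [if_neg hpos.ne']
      rw [hsmo] at hsi
      obtain ⟨m, hmi, hmeq, hm, -⟩ := startTime_spec (le_trans le_self_add hsi)
      rw [hmeq] at hsi
      have hms : m + smoothTime k j n ε η l ≤ i := by exact_mod_cast hsi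
      have hl1 : (1 : ℝ) ≤ l := by exact_mod_cast hpos
      have hb : (n : ℝ) ^ (1 + δ) ≤ (n : ℝ) ^ ((l : ℝ) + δ) :=
        Real.rpow_le_rpow_of_exponent_le hn1 (by linarith)
      have hcard : ∀ i', m ≤ i' → i' ≤ N → (n : ℝ) ^ ((l : ℝ) + δ)
          ≤ ((search j (T : Set (Finset (Fin n))) J i').active.card : ℝ) :=
        fun i' => h.le_card hlive hb hm i'
      -- The common accuracy for all smaller sets; the new accuracy is 8γ.
      set γ : ℝ := 8 ^ (l - 1) * γ₀ with hγ
      have hγnn : 0 ≤ γ := by positivity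
      have hγ8 : 8 ^ l * γ₀ = 8 * γ := by
        rw [hγ, ← mul_assoc, ← pow_succ', Nat.sub_add_cancel hpos]
      have hγ1 : γ ≤ 1 := by
        refine le_trans ?_ hγ₀1
        rw [hγ]
        gcongr
        · norm_num
        · omega
      have hγγ₀ : γ₀ ≤ γ := le_mul_of_one_le_left hγ₀ (one_le_pow₀ (by norm_num))
      -- The generation is large enough for l from time m on, so smoothing of all smaller sets has
      -- ended and the induction hypothesis applies to each of them.
      have hsm : ∀ i', m ≤ i' → i' ≤ N →
          SmoothBelow j l γ (search j (T : Set (Finset (Fin n))) J i').active := by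
        intro i' hmi' hi'N Z hZ
        have h1 := ih Z.card hZ (by omega) Z rfl i' hi'N
          (h.smoothEnd_le hlive hZ (fun hz => hfast _ hz (by omega)) (hcard i' hmi' hi'N) hi'N)
        refine h1.trans ?_
        have hτ := meanRatio_pos (show j ≤ n by omega) Z.card
        refine mul_le_mul_of_nonneg_right ?_ (by positivity)
        rw [hγ]
        gcongr
        · norm_num
        · omega
      obtain ⟨ρ, ρ₀, K, hR⟩ := hrate l hpos hl
      subst hL
      set E := (1 - branchRatio k j L.card) * γ + (80 * c + 4 * c * K) * σ₁ with hE
      have hr1 := branchRatio_lt_one hpos hl hjk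
      have hc1 := h.const.one_le
      have hσ := h.err₁.σ_nonneg
      have hK := hR.K_nonneg
      have hρ := hR.ρ_lt
      have hρ0 := hR.ρ_nonneg
      have hρ1 : 0 < 1 - ρ := by linarith
      have hE0 : 0 ≤ E := by
        have : 0 ≤ 1 - branchRatio k j L.card := by linarith
        positivity
      have hpot := potential_le (U := fun i => deviation j (search j (T : Set (Finset (Fin n))) J i) L
          + K * pairDensity q (search j T J i) L) hR.ρ_nonneg hR.ρ_lt hE0 (m := m) (N := N)
        (fun i' hmi' hi' => h.potential_step hlive hi' hpos hl hγnn hγ1 (hsm i' hmi' hi'.le)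
          (hcard i' hmi' hi'.le) hR) i hmi hiN
      have hinit := h.deviation_init (search_valid (T : Set (Finset (Fin n))) hlive.card_eq m) hl
        (by have : (L.card : ℝ) + 1 ≤ j := by exact_mod_cast hl
            linarith [h.δ_le]) hγ1 (hsm m le_rfl (hmi.trans hiN)) hm hK
      have hdec : ρ ^ (i - m) ≤ ρ ^ smoothTime k j n ε η L.card :=
        pow_le_pow_of_le_one hρ0 hρ.le (by omega)
      have hU0 : 0 ≤ deviation j (search j (T : Set (Finset (Fin n))) J m) L
          + K * pairDensity q (search j T J m) L :=
        add_nonneg (deviation_nonneg _ _)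
          (mul_nonneg hK (pairDensity_nonneg h.regime.one_le_q _ _))
      have hpd := mul_nonneg hK (pairDensity_nonneg h.regime.one_le_q
        (search j (T : Set (Finset (Fin n))) J i) L)
      have hEdiv : E / (1 - ρ) ≤ 2 * γ + (80 * c + 4 * c * K) * σ₁ / (1 - ρ) := by
        rw [hE, add_div]
        gcongr
        rw [div_le_iff₀ hρ1]
        calc (1 - branchRatio k j L.card) * γ ≤ (2 * (1 - ρ)) * γ := by
              gcongr
              exact hR.ratio
          _ = _ := by ring
      -- The limit of the recursion contributes 2γ, and the initial value together with the errors
      -- at most γ₀ ≤ γ. So 3γ would do.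
      have hdev : deviation j (search j (T : Set (Finset (Fin n))) J i) L ≤ 8 * γ := by
        have h1 : ρ ^ (i - m) * (deviation j (search j (T : Set (Finset (Fin n))) J m) L
            + K * pairDensity q (search j T J m) L)
            ≤ ρ ^ smoothTime k j n ε η L.card * ((n : ℝ) ^ ((j : ℝ) - L.card - δ) *
        (2 + K * (2 ^ (2 * j) * (2 ^ (j + 2) * (2 * j) ^ j)))) :=
          mul_le_mul hdec hinit hU0 (by positivity)
        have h2 := hR.fast
        linarith
      have ha0 : (0 : ℝ) < (search j (T : Set (Finset (Fin n))) J i).active.card :=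
        lt_of_lt_of_le (by positivity) (hcard i hmi hiN)
      have hτ := meanRatio_pos (show j ≤ n by omega) L.card
      rw [hγ8]
      unfold deviation at hdev
      have hX := mul_pos ha0 hτ
      set X := ((search j (T : Set (Finset (Fin n))) J i).active.card : ℝ) * meanRatio n j L.card
      rw [div_sub_one hX.ne', abs_div, abs_of_pos hX, div_le_iff₀ hX] at hdev
      exact hdev

end

end SmoothBoundary

namespace SmoothBoundary

/-! ### Asymptotics -/

variable {n k j : ℕ}

/-- Good behaviour of all searches implies smoothness of all boundaries. -/
theorem Controlled.isSmooth {p ε q M β t₁ t₂ x κ c σ₁ σ₂ δ η γ₀ ρ C lam : ℝ}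
    (h : Controlled n k j p ε q M β t₁ t₂ x κ c σ₁ σ₂ δ)
    (hγ₀ : 0 ≤ γ₀) (hγ₀1 : 8 ^ j * γ₀ ≤ 1)
    (hfast : ∀ z, 0 < z → z < j →
      5 * ((1 + 2 * (c * σ₁)) * (1 + ε)) ^ smoothTime k j n ε η z < n)
    (hrate : ∀ l, 0 < l → l < j →
      ∃ ρ ρ₀ K, Rate n k j ε q M c σ₁ γ₀ δ l (smoothTime k j n ε η l) ρ ρ₀ K)
    (hρ0 : 0 ≤ ρ) (hρ1 : ρ < 1) (hC : 0 ≤ C)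
    (hlam : 0 ≤ lam) (hx : x ≤ lam * n) (hβ : lam * ((C * 2 ^ j + 1) / (1 - ρ)) ^ j = β)
    {T : Finset (Finset (Fin n))} (hT : T ⊆ kSets n k)
    (hrun : GoodRun k j p q t₁ t₂ x κ β ρ C T) :
    IsSmooth k j δ ε lam η γ₀ (T : Set (Finset (Fin n))) := by
  intro J hJ l hl L hL i hsi hi
  have hlive := live_of_goodRun h.regime.n_pos hT hrun hρ0 hρ1 hC hlam hx hβ
    (mem_jSets.1 hJ) hi
  have := h.smooth hγ₀ hγ₀1 hfast hrate hlive l hl L hL i le_rfl hsi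
  have hX : ((generation j (T : Set (Finset (Fin n))) J i).card : ℝ) / (n.choose j : ℝ)
      * (n.choose (j - l) : ℝ)
    = (search j (T : Set (Finset (Fin n))) J i).active.card * meanRatio n j l := by
    unfold generation meanRatio; ring
  rw [hX]
  exact this

lemma branchRatio_le {l : ℕ} (hl : 0 < l) (hlj : l < j) (hjk : j < k) :
    branchRatio k j l ≤ 1 - 1 / ((k.choose j : ℝ) - 1) := by
  have h1 := choose_sub_one_pos (show 0 < j by omega) hjk
  have h2 : ((k - l).choose (j - l) : ℝ) + 1 ≤ k.choose j := by
    exact_mod_cast choose_sub_sub_lt hl hlj hjk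
  have h0 : 0 < (k.choose j : ℝ) - 1 := by linarith
  rw [branchRatio, one_sub_div h0.ne']
  gcongr
  linarith

/-- The decay rate for `l`-sets. -/
noncomputable def decayRate (k j : ℕ) (δ : ℝ) (l : ℕ) : ℝ :=
  min ((1 + branchRatio k j l) / 2) (branchRatio k j l ^ (1 - δ / (2 * j)))

lemma lt_decayRate {δ : ℝ} (hδ : 0 < δ) {l : ℕ} (hl : 0 < l) (hlj : l < j) (hjk : j < k) :
    branchRatio k j l < decayRate k j δ l := by
  have h0 := branchRatio_pos hlj hjk
  have h1 := branchRatio_lt_one hl hlj hjk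
  have hj : (0 : ℝ) < j := by
    have : 0 < j := by omega
    exact_mod_cast this
  refine lt_min (by linarith) ?_
  conv_lhs => rw [← Real.rpow_one (branchRatio k j l)]
  refine Real.rpow_lt_rpow_of_exponent_gt h0 h1 ?_
  have : 0 < δ / (2 * j) := by positivity
  linarith

lemma decayRate_lt_one {δ : ℝ} {l : ℕ} (hl : 0 < l) (hlj : l < j) (hjk : j < k) :
    decayRate k j δ l < 1 := by
  have h1 := branchRatio_lt_one hl hlj hjk
  exact (min_le_left _ _).trans_lt (by linarith)

/-- The smoothing time s satisfies r^s ≤ n^(-(j-l)). Replacing r by the slightly larger rate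
r^(1-δ/(2j)) loses at most n^(δ/2), half of the margin n^(-δ) in the initial deviation. -/
lemma decayRate_pow_le {δ ε η : ℝ} (hδ : 0 < δ) (hδj : δ ≤ 2 * j) {l : ℕ} (hl : 0 < l)
    (hlj : l < j) (hjk : j < k) (hn : 0 < n) (hε : 0 ≤ ε) (hη : 0 ≤ η)
    (hlt : (1 + 2 * η + 2 * ε) * branchRatio k j l < 1) :
    decayRate k j δ l ^ smoothTime k j n ε η l ≤ (n : ℝ) ^ (-((j : ℝ) - l) + δ / 2) := by
  have h0 := branchRatio_pos hlj hjk
  have h1 := branchRatio_lt_one hl hlj hjk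
  have hn' : (0 : ℝ) < n := by exact_mod_cast hn
  have hn1 : (1 : ℝ) ≤ n := by exact_mod_cast hn
  have hj : (0 : ℝ) < j := by
    have : 0 < j := by omega
    exact_mod_cast this
  set r := branchRatio k j l with hr
  set s := smoothTime k j n ε η l with hs
  have hlr : Real.log r < 0 := Real.log_neg h0 h1
  have hrr : r ≤ (1 + 2 * η + 2 * ε) * r := le_mul_of_one_le_left h0.le (by linarith)
  have hlr' : Real.log ((1 + 2 * η + 2 * ε) * r) < 0 := Real.log_neg (by positivity) hlt
  have hjl : (0 : ℝ) ≤ (j : ℝ) - l := by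
    have : (l : ℝ) < j := by exact_mod_cast hlj
    linarith
  have hlog : 0 ≤ Real.log n := Real.log_nonneg hn1
  have hs1 : ((j : ℝ) - l) * Real.log n ≤ s * -Real.log r := by
    have e1 : ((j : ℝ) - l) * Real.log n / -Real.log r ≤ s := by
      refine le_trans ?_ (Nat.le_ceil _)
      refine div_le_div_of_nonneg_left (by positivity) (by linarith) ?_
      have := Real.log_le_log h0 hrr
      linarith
    rwa [div_le_iff₀ (by linarith)] at e1
  set w := 1 - δ / (2 * j) with hw
  have hw0 : 0 ≤ w := by
    rw [hw, sub_nonneg, div_le_one (by positivity)]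
    exact hδj
  calc decayRate k j δ l ^ s ≤ (r ^ w) ^ s := by
        refine pow_le_pow_left₀ ?_ (min_le_right _ _) _
        exact h0.le.trans (lt_decayRate hδ hl hlj hjk).le
    _ = Real.exp (w * (s * Real.log r)) := by
        rw [← Real.rpow_natCast (r ^ w), ← Real.rpow_mul h0.le, Real.rpow_def_of_pos h0]
        congr 1; ring
    _ ≤ Real.exp (w * -(((j : ℝ) - l) * Real.log n)) := by
        refine Real.exp_le_exp.2 (mul_le_mul_of_nonneg_left ?_ hw0)
        linarith
    _ ≤ Real.exp (Real.log n * (-((j : ℝ) - l) + δ / 2)) := by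
        refine Real.exp_le_exp.2 ?_
        have e1 : δ / (2 * j) * ((j : ℝ) - l) ≤ δ / 2 := by
          rw [div_mul_eq_mul_div, div_le_div_iff₀ (by positivity) (by norm_num)]
          have : (0 : ℝ) ≤ l := Nat.cast_nonneg _
          nlinarith
        have e2 := mul_le_mul_of_nonneg_left e1 hlog
        rw [hw]
        linarith
    _ = _ := by rw [Real.rpow_def_of_pos hn']

lemma smoothTime_le {ε η R : ℝ} {l : ℕ} (hlj : l < j) (hn : 0 < n) (hR1 : R < 1)
    (h0 : 0 < (1 + 2 * η + 2 * ε) * branchRatio k j l)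
    (hR : (1 + 2 * η + 2 * ε) * branchRatio k j l ≤ R) :
    (smoothTime k j n ε η l : ℝ) ≤ j / -Real.log R * Real.log n + 1 := by
  have hn1 : (1 : ℝ) ≤ n := by exact_mod_cast hn
  have hlog : 0 ≤ Real.log n := Real.log_nonneg hn1
  have hl : (l : ℝ) < j := by exact_mod_cast hlj
  have hRlog : Real.log R < 0 := Real.log_neg (h0.trans_le hR) hR1
  have h1 : Real.log ((1 + 2 * η + 2 * ε) * branchRatio k j l) ≤ Real.log R := Real.log_le_log h0 hR
  have h2 : 0 ≤ ((j : ℝ) - l) * Real.log n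
      / -Real.log ((1 + 2 * η + 2 * ε) * branchRatio k j l) :=
    div_nonneg (mul_nonneg (by linarith) hlog) (by linarith)
  refine (Nat.ceil_lt_add_one h2).le.trans ?_
  gcongr
  rw [div_mul_eq_mul_div]
  have h3 : (0 : ℝ) ≤ l := Nat.cast_nonneg _
  have h4 : 0 < -Real.log R := by linarith
  gcongr
  linarith

/-- Smoothing takes O(log n) steps, because the base of the logarithm stays below some R < 1. Each
step grows by 1 + o(1), so the total growth is at most n^(1/4) for large n. -/
lemma eventually_smoothTime {ε η σ : ℕ → ℝ} {c : ℝ} (hc : 0 ≤ c) {l : ℕ} (hl : 0 < l)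
    (hlj : l < j) (hjk : j < k)
    (hε : Tendsto ε atTop (𝓝 0)) (hη : Tendsto η atTop (𝓝 0)) (hσ : Tendsto σ atTop (𝓝 0))
    (hε0 : ∀ᶠ n in atTop, 0 ≤ ε n) (hη0 : ∀ᶠ n in atTop, 0 ≤ η n)
    (hσ0 : ∀ᶠ n in atTop, 0 ≤ σ n) :
    ∀ᶠ n : ℕ in atTop,
      5 * ((1 + 2 * (c * σ n)) * (1 + ε n)) ^ smoothTime k j n (ε n) (η n) l < n := by
  have h0 := branchRatio_pos hlj hjk
  have h1 := branchRatio_lt_one hl hlj hjk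
  set r := branchRatio k j l with hr
  obtain ⟨R, hrR, hR1⟩ := exists_between h1
  have t1 : Tendsto (fun n => (1 + 2 * η n + 2 * ε n) * r) atTop (𝓝 r) := by
    have := (((hη.const_mul 2).const_add 1).add (hε.const_mul 2)).mul_const r
    simpa using this
  have hRlog : Real.log R < 0 := Real.log_neg (h0.trans hrR) hR1
  set A := (j : ℝ) / -Real.log R with hA
  have hA0 : 0 ≤ A := div_nonneg (Nat.cast_nonneg _) (by linarith)
  have t2 : Tendsto (fun n => (1 + 2 * (c * σ n)) * (1 + ε n)) atTop (𝓝 1) := by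
    have := (((hσ.const_mul c).const_mul 2).const_add 1).mul (hε.const_add 1)
    simpa using this
  have t3 : Tendsto (fun n => Real.log ((1 + 2 * (c * σ n)) * (1 + ε n))) atTop (𝓝 0) := by
    have := (Real.continuousAt_log one_ne_zero).tendsto.comp t2
    simpa [Function.comp_def] using this
  have t4 : Tendsto (fun n : ℕ => Real.log (n : ℝ)) atTop atTop :=
    Real.tendsto_log_atTop.comp tendsto_natCast_atTop_atTop
  have hpos : (0 : ℝ) < 1 / (4 * (A + 1)) := by positivity
  filter_upwards [t1.eventually_lt_const hrR, t3.eventually_lt_const hpos, hε0, hη0, hσ0,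
    t4.eventually_ge_atTop (4 * (Real.log 5 + 1)), eventually_gt_atTop 0] with
    n hn1 hn3 hε hη hσ hlog hn0
  have hn' : (0 : ℝ) < n := by exact_mod_cast hn0
  have hs := smoothTime_le (k := k) hlj hn0 hR1 (by positivity) hn1.le
  rw [← hA] at hs
  set G := (1 + 2 * (c * σ n)) * (1 + ε n) with hG
  have hG1 : 1 ≤ G := by
    have : 0 ≤ c * σ n := by positivity
    rw [hG]; nlinarith
  have hlogG : 0 ≤ Real.log G := Real.log_nonneg hG1
  rw [← Real.log_lt_log_iff (by positivity) hn', Real.log_mul (by norm_num) (by positivity),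
    Real.log_pow]
  have hl5 : 0 < Real.log 5 := Real.log_pos (by norm_num)
  have h5 : (smoothTime k j n (ε n) (η n) l : ℝ) * Real.log G
      ≤ (A + 1) * Real.log n * (1 / (4 * (A + 1))) := by
    refine mul_le_mul ?_ hn3.le hlogG (mul_nonneg (by linarith) (by linarith))
    linarith
  have h6 : (A + 1) * Real.log n * (1 / (4 * (A + 1))) = Real.log n / 4 := by
    field_simp
  linarith

/-- The rate ρ₀ for pairs is halfway between r and ρ, and the condition on q leaves room for the
terms in 1/q. The value of K solves 40c + Kρ₀ = ρK. For the last field, the contracted initial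
deviation is of order n^(-δ/2) ≤ σ, and σ is of smaller order than γ₀. The part ρ ≤ (1+r)/2 of the
decay rate gives 1 - r ≤ 2(1 - ρ). -/
lemma eventually_rate {ε η σ γ₀ : ℕ → ℝ} {q M c δ : ℝ} (hδ : 0 < δ) (hδ1 : δ ≤ 1) (hc : 1 ≤ c)
    {l : ℕ} (hl : 0 < l) (hlj : l < j) (hjk : j < k)
    (hq : 2 ^ (4 * k) * M * (1 / q) < (decayRate k j δ l - branchRatio k j l) / 2)
    (hε : Tendsto ε atTop (𝓝 0)) (hη : Tendsto η atTop (𝓝 0)) (hσ : Tendsto σ atTop (𝓝 0))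
    (hε0 : ∀ᶠ n in atTop, 0 ≤ ε n) (hη0 : ∀ᶠ n in atTop, 0 ≤ η n)
    (hσ0 : ∀ᶠ n : ℕ in atTop, (n : ℝ) ^ (-(δ / 2)) ≤ σ n) (hγ₀ : ∀ᶠ n in atTop, 0 ≤ γ₀ n)
    (hσγ : σ =o[atTop] γ₀) :
    ∃ ρ ρ₀ K, ∀ᶠ n : ℕ in atTop, Rate n k j (ε n) q M c (σ n) (γ₀ n) δ l
      (smoothTime k j n (ε n) (η n) l) ρ ρ₀ K := by
  have h0 := branchRatio_pos hlj hjk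
  have h1 := branchRatio_lt_one hl hlj hjk
  have hρr := lt_decayRate hδ hl hlj hjk
  have hρ1 := decayRate_lt_one (δ := δ) hl hlj hjk
  have hρle : decayRate k j δ l ≤ (1 + branchRatio k j l) / 2 := min_le_left _ _
  have hpow := fun (n : ℕ) ε η hn hε hη hlt =>
    decayRate_pow_le (n := n) (ε := ε) (η := η) hδ (by
      have : (1 : ℝ) ≤ j := by exact_mod_cast (show 1 ≤ j by omega)
      linarith) hl hlj hjk hn hε hη hlt
  set r := branchRatio k j l with hr
  set ρ := decayRate k j δ l with hρ
  set ρ₀ := (r + ρ) / 2 with hρ₀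
  set K := 40 * c / (ρ - ρ₀) with hK
  have hρρ₀ : 0 < ρ - ρ₀ := by rw [hρ₀]; linarith
  have hK0 : 0 ≤ K := by positivity
  have hρ' : 0 < 1 - ρ := by linarith
  refine ⟨ρ, ρ₀, K, ?_⟩
  have tn : Tendsto (fun n : ℕ => q / (n : ℝ)) atTop (𝓝 0) :=
    tendsto_natCast_atTop_atTop.const_div_atTop q
  have t1 : Tendsto (fun n => (1 + 2 * η n + 2 * ε n) * r) atTop (𝓝 r) := by
    have := (((hη.const_mul 2).const_add 1).add (hε.const_mul 2)).mul_const r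
    simpa using this
  have t2 : Tendsto (fun n : ℕ => (1 + σ n) * ((1 + ε n) * r
      + 2 ^ (4 * k) * M * (q / n + 1 / q)) - (1 - 6 * (c * σ n)) * ρ₀) atTop
      (𝓝 (r + 2 ^ (4 * k) * M * (1 / q) - ρ₀)) := by
    have := ((hσ.const_add 1).mul (((hε.const_add 1).mul_const r).add
      ((tn.add_const (1 / q)).const_mul (2 ^ (4 * k) * M)))).sub
      ((((hσ.const_mul c).const_mul 6).const_sub 1).mul_const ρ₀)
    simpa using this
  have t3 : Tendsto (fun n => r + (40 * c + 2 * c * K) * σ n) atTop (𝓝 r) := by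
    have := (hσ.const_mul (40 * c + 2 * c * K)).const_add r
    simpa using this
  set F := (2 + K * (2 ^ (2 * j) * (2 ^ (j + 2) * (2 * (j : ℝ)) ^ j)))
    + (80 * c + 4 * c * K) / (1 - ρ) with hF
  have hF0 : 0 < F := by positivity
  have t4 := hσγ.bound (show (0 : ℝ) < F⁻¹ by positivity)
  filter_upwards [t1.eventually_lt_const h1, t2.eventually_lt_const (show _ < (0 : ℝ) by
    rw [hρ₀]; linarith), t3.eventually_lt_const hρr, t4, hε0, hη0, hσ0, hγ₀,
    eventually_gt_atTop 0] with n hn1 hn2 hn3 hn4 hε hη hσ hγ₀ hn0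
  have hn' : (0 : ℝ) < n := by exact_mod_cast hn0
  refine ⟨h0.le.trans hρr.le, hρ1, hK0, by linarith, hn3.le, ?_, by linarith, ?_⟩
  · have : 40 * c = K * (ρ - ρ₀) := by rw [hK]; field_simp
    rw [this]; linarith
  · have hp := hpow n (ε n) (η n) hn0 hε hη hn1
    have hσn : 0 ≤ σ n := le_trans (by positivity) hσ
    have e1 : ρ ^ smoothTime k j n (ε n) (η n) l * (n : ℝ) ^ ((j : ℝ) - l - δ) ≤ σ n := by
      refine le_trans (le_trans (mul_le_mul_of_nonneg_right hp (by positivity)) (le_of_eq ?_)) hσ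
      rw [← Real.rpow_add hn']
      congr 1; ring
    rw [Real.norm_of_nonneg hσn, Real.norm_of_nonneg hγ₀, inv_mul_eq_div, le_div_iff₀ hF0] at hn4
    refine le_trans ?_ hn4
    rw [hF, mul_add (σ n)]
    refine add_le_add (mul_le_mul_of_nonneg_right e1 (by positivity)) (le_of_eq ?_)
    ring

end SmoothBoundary

/-! ### Choice of the constants and the final probability estimate -/

namespace SmoothBoundary

variable {n k j : ℕ}

/-- In terms of X = n^(δ/4) the exponent is -θX², which dominates X and the logarithm of the
polynomial factor. -/
lemma eventually_failure_le {θ δ : ℝ} (hθ : 0 < θ) (hδ : 0 < δ) (hj : 0 < j) :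
    ∀ᶠ n : ℕ in atTop, 22 * j * (n : ℝ) ^ (3 * j) * Real.exp (θ - θ * (n : ℝ) ^ (δ / 2))
      ≤ Real.exp (-((n : ℝ) ^ (δ / 4))) := by
  have h1 : ∀ᶠ x : ℝ in atTop, Real.log x ≤ x ^ (δ / 4) := by
    have := (isLittleO_log_rpow_atTop (show 0 < δ / 4 by positivity)).bound zero_lt_one
    filter_upwards [this, eventually_ge_atTop 1] with x hx hx1
    rw [Real.norm_of_nonneg (Real.log_nonneg hx1), Real.norm_of_nonneg (by positivity),
      one_mul] at hx
    exact hx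
  have h2 : Tendsto (fun x : ℝ => x ^ (δ / 4)) atTop atTop := tendsto_rpow_atTop (by positivity)
  set B := Real.log (22 * j) + θ with hB
  have h3 := tendsto_natCast_atTop_atTop.eventually ((h1.and (h2.eventually_ge_atTop
    ((|B| + 3 * j + 1) / θ + 1))).and (eventually_ge_atTop (1 : ℝ)))
  filter_upwards [h3] with n ⟨⟨hn1, hn2⟩, hn3⟩
  have hj' : (0 : ℝ) < j := by exact_mod_cast hj
  have hn' : (0 : ℝ) < n := by linarith
  set X := (n : ℝ) ^ (δ / 4) with hX
  have hXX : (n : ℝ) ^ (δ / 2) = X * X := by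
    rw [hX, ← Real.rpow_add hn']; congr 1; ring
  have e1 : 22 * j * (n : ℝ) ^ (3 * j)
      = Real.exp (Real.log (22 * j) + (3 * j : ℕ) * Real.log n) := by
    rw [Real.exp_add, Real.exp_log (by positivity), Real.exp_nat_mul, Real.exp_log hn']
  rw [e1, ← Real.exp_add, hXX]
  refine Real.exp_le_exp.2 ?_
  have hY : (|B| + 3 * j + 1) ≤ θ * X := by
    have : (|B| + 3 * j + 1) / θ ≤ X := by linarith
    rwa [div_le_iff₀' hθ] at this
  have hX1 : 1 ≤ X := by
    have : 0 ≤ (|B| + 3 * j + 1) / θ := by positivity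
    linarith
  have e2 := mul_le_mul_of_nonneg_right hY (show 0 ≤ X by linarith)
  have e3 : |B| ≤ |B| * X := le_mul_of_one_le_right (abs_nonneg _) hX1
  have e4 := le_abs_self B
  have e5 : 3 * (j : ℝ) * Real.log n ≤ 3 * j * X := by gcongr
  push_cast
  linarith

lemma eventually_abs_le_of_isLittleO {f g : ℕ → ℝ} (h : f =o[atTop] g)
    (hg : ∀ᶠ n in atTop, 0 ≤ g n) {a : ℝ} (ha : 0 < a) : ∀ᶠ n in atTop, |f n| ≤ a * g n := by
  filter_upwards [h.bound ha, hg] with n hn hg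
  rwa [Real.norm_of_nonneg hg, Real.norm_eq_abs] at hn

/-- One factor 1 + φ makes room for 1 + ε, the other for the loss 1 + θ2^k in the exponential moment
of the degrees. The gap between the branching ratios and 1 is uniform in l. -/
lemma exists_growthRate (hj : 0 < j) (hjk : j < k) : ∃ φ ρ : ℝ, 0 < φ ∧ φ ≤ 1 ∧ 0 ≤ ρ ∧ ρ < 1 ∧
    ∀ l, 0 < l → l < j → (1 + φ) * (1 + φ) * branchRatio k j l ≤ ρ := by
  set r := 1 - 1 / ((k.choose j : ℝ) - 1) with hr
  have hcb := choose_sub_one_pos hj hjk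
  have hr0 : 0 ≤ r := by
    rw [hr, sub_nonneg, div_le_one (by linarith)]
    exact hcb
  have hr1 : r < 1 := by
    have : 0 < 1 / ((k.choose j : ℝ) - 1) := div_pos one_pos (by linarith)
    linarith
  set φ := (1 - r) / 8 with hφ
  have hφ0 : 0 < φ := by rw [hφ]; linarith
  have hφ1 : φ ≤ 1 := by rw [hφ]; linarith
  set ρ := (1 + r) / 2 with hρ
  have hρ0 : 0 ≤ ρ := by rw [hρ]; linarith
  have hρ1 : ρ < 1 := by rw [hρ]; linarith
  have hrφ : (1 + φ) * (1 + φ) * r ≤ ρ := by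
    have : (1 + φ) * (1 + φ) ≤ 1 + 3 * φ := by nlinarith
    calc (1 + φ) * (1 + φ) * r ≤ (1 + 3 * φ) * r := by gcongr
      _ ≤ r + 3 * φ := by nlinarith
      _ ≤ ρ := by rw [hρ, hφ]; linarith
  refine ⟨φ, ρ, hφ0, hφ1, hρ0, hρ1, fun l hl0 hl => le_trans ?_ hrφ⟩
  exact mul_le_mul_of_nonneg_left (branchRatio_le hl0 hl hjk) (by positivity)

/-- The scale q must be fixed before the constant c, which depends on it. It can be, because the
condition on q compares it only with M and with the gap between the rates. -/
lemma exists_pairScale (hjk : j < k) {δ : ℝ} (hδ : 0 < δ) (M : ℝ) :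
    ∃ q : ℝ, 1 ≤ q ∧ 4 * (j : ℝ) ≤ q ∧ ∀ l, 0 < l → l < j →
      2 ^ (4 * k) * M * (1 / q) < (decayRate k j δ l - branchRatio k j l) / 2 := by
  have hev : ∀ᶠ q : ℝ in atTop, ∀ l ∈ Finset.range j, 0 < l →
      2 ^ (4 * k) * M * (1 / q) < (decayRate k j δ l - branchRatio k j l) / 2 := by
    rw [Filter.eventually_all_finset]
    intro l hl
    rw [Finset.mem_range] at hl
    rcases Nat.eq_zero_or_pos l with h0 | hpos
    · exact Eventually.of_forall fun q hq => absurd h0 hq.ne'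
    · have t : Tendsto (fun q : ℝ => 2 ^ (4 * k) * M * (1 / q)) atTop (𝓝 0) := by
        have := (tendsto_id.const_div_atTop (1 : ℝ)).const_mul (2 ^ (4 * k) * M)
        simpa using this
      have := lt_decayRate hδ hpos hl hjk
      filter_upwards [t.eventually_lt_const (show (0 : ℝ) <
        (decayRate k j δ l - branchRatio k j l) / 2 by linarith)] with q hq _ using hq
  obtain ⟨q, ⟨h1, h2⟩, h3⟩ := ((hev.and (eventually_ge_atTop 1)).and
    (eventually_ge_atTop (4 * (j : ℝ)))).exists
  exact ⟨q, h2, h3, fun l hl0 hl => h1 l (Finset.mem_range.2 hl) hl0⟩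

/-- The probability of smoothness for a fixed number of vertices. -/
lemma le_randomHypergraph_isSmooth (hj : 0 < j) (hjk : j < k)
    {δ ε lam η γ₀ M C φ ρ θ Γ q c σ₁ σ₂ : ℝ} {p : unitInterval} (hM : M = 2 * (2 * k) ^ k)
    (hC : C = 2 ^ (k + 1) * M) (hφ0 : 0 < φ) (hφ1 : φ ≤ 1) (hρ0 : 0 ≤ ρ) (hρ1 : ρ < 1)
    (hrφ : ∀ l, 0 < l → l < j → (1 + φ) * (1 + φ) * branchRatio k j l ≤ ρ)
    (hθ0 : 0 < θ) (hθk : θ * 2 ^ k = φ) (hΓ : Γ = ((C * 2 ^ j + 1) / (1 - ρ)) ^ j)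
    (hq1 : 1 ≤ q) (hqj : 4 * (j : ℝ) ≤ q) (hc : ConstBound k j q M c)
    (hσ₁ : σ₁ = lam * Γ + (n : ℝ) ^ (-δ / 24)) (hσ₂ : σ₂ = lam * Γ + (n : ℝ) ^ (-(1 / 2) + δ / 2))
    (hδ : 0 < δ) (hδ' : δ < 1 / 6) (hε : 0 ≤ ε) (hlam : 0 ≤ lam) (hγ₀ : 0 ≤ γ₀)
    (hγ₀small : 8 ^ j * γ₀ ≤ 1)
    (hsqrt : (n : ℝ) ^ (-(1 / 2 : ℝ) + δ) ≤ lam) (hgrow : 24 * (c * σ₂) ≤ ε)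
    (hfast : ∀ z, 0 < z → z < j →
      5 * ((1 + 2 * (c * σ₁)) * (1 + ε)) ^ smoothTime k j n ε η z < n)
    (hrate : ∀ l, 0 < l → l < j →
      ∃ ρ ρ₀ K, Rate n k j ε q M c σ₁ γ₀ δ l (smoothTime k j n ε η l) ρ ρ₀ K)
    (hcσ : c * σ₁ ≤ 1 / 12) (hεφ : ε ≤ φ) (hp : (p : ℝ) = (1 + ε) * critProb k j n)
    (hnk : 8 * k ^ 2 ≤ n) (hnq : q ≤ n) :
    1 - 22 * j * (n : ℝ) ^ (3 * j) * Real.exp (θ - θ * (n : ℝ) ^ (δ / 2))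
      ≤ (randomHypergraph n k p).real {H | IsSmooth k j δ ε lam η γ₀ H} := by
  have hM0 : 0 ≤ M := by rw [hM]; positivity
  have hC0 : 0 ≤ C := by rw [hC]; positivity
  have hρ' : 0 < 1 - ρ := by linarith
  have hΓ0 : 0 ≤ Γ := by rw [hΓ]; positivity
  have hσ₁pow : (n : ℝ) ^ (-δ / 24) ≤ σ₁ := by
    have : 0 ≤ lam * Γ := by positivity
    linarith
  have hkk : 8 * k ≤ n := by nlinarith
  have hn0 : 0 < n := by omega
  have hn' : (0 : ℝ) < n := by exact_mod_cast hn0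
  have hn1 : (1 : ℝ) ≤ n := by exact_mod_cast hn0
  have hpn0 := p.2.1
  have hpn1 := p.2.2
  have hcodeg : (p : ℝ) * ((n : ℝ) ^ k * ((n : ℝ) ^ j)⁻¹) ≤ M :=
    hM ▸ edgeProb_mul_pow_le hj hjk (by omega) hε (hεφ.trans hφ1) hp
  have hβ0 : 0 ≤ lam * Γ := by positivity
  have hpow := fun a b (hab : a ≤ b) => Real.rpow_le_rpow_of_exponent_le hn1 hab
  -- The deviation parameter is x = n^(δ/2). At the coarse precision x/t₁ = n^(13δ/24) is below
  -- n^(-δ/24)·n^δ, and at the fine one x/t₂ = n^(1/2) is below n^(-1/2+δ/2)·n^(1+δ).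
  have hcontrol : Controlled n k j p ε q M (lam * Γ) ((n : ℝ) ^ (-δ / 24))
      ((n : ℝ) ^ (-(1 / 2) + δ / 2)) ((n : ℝ) ^ (δ / 2)) (2 ^ (3 * j) * (lam * Γ) * M) c
      σ₁ σ₂ δ := by
    have hinv : 1 / (n : ℝ) = (n : ℝ) ^ (-1 : ℝ) := by
      rw [Real.rpow_neg_one, one_div]
    refine ⟨⟨hj, hjk, hnk, hε, hpn0, hp, hcodeg, hq1, hqj, hnq, hβ0⟩, hc,
      ⟨by positivity, hσ₁pow, ?_, ?_, rfl, hcσ⟩, ⟨by positivity, ?_, ?_, ?_, rfl, ?_⟩,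
      by positivity, ?_, ?_, hgrow, hεφ.trans hφ1, hδ, by linarith⟩
    · rw [hσ₁]
      have : 0 ≤ (n : ℝ) ^ (-δ / 24) := by positivity
      linarith
    · rw [hinv]
      exact (hpow _ _ (by linarith)).trans hσ₁pow
    · rw [hσ₂]
      linarith
    · rw [hσ₂]
      have : 0 ≤ (n : ℝ) ^ (-(1 / 2) + δ / 2) := by positivity
      linarith
    · rw [hinv]
      refine (hpow _ (-(1 / 2) + δ / 2) (by linarith)).trans ?_
      rw [hσ₂]
      linarith
    · linarith [hεφ.trans hφ1]
    · rw [← Real.rpow_sub hn']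
      refine le_trans ?_ (mul_le_mul_of_nonneg_right hσ₁pow (by positivity))
      rw [← Real.rpow_add hn']
      exact hpow _ _ (by linarith)
    · rw [← Real.rpow_sub hn']
      have : (n : ℝ) ^ (-(1 / 2) + δ / 2) ≤ σ₂ := by rw [hσ₂]; linarith
      refine le_trans ?_ (mul_le_mul_of_nonneg_right this (by positivity))
      rw [← Real.rpow_add hn']
      exact hpow _ _ (by linarith)
  have hxlam : (n : ℝ) ^ (δ / 2) ≤ lam * n := by
    refine le_trans ?_ (mul_le_mul_of_nonneg_right hsqrt hn'.le)
    rw [← Real.rpow_add_one hn'.ne']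
    exact hpow _ _ (by linarith)
  have hprob := prob_not_goodRun_le (k := k) (j := j) (q := q) (t₁ := (n : ℝ) ^ (-δ / 24))
    (t₂ := (n : ℝ) ^ (-(1 / 2) + δ / 2)) (x := (n : ℝ) ^ (δ / 2)) (β := lam * Γ)
    (κ := 2 ^ (3 * j) * (lam * Γ) * M) (ρ := ρ) (C := C) (θ := θ) (M := M)
    hn0 hpn0 hpn1 hjk hq1 hcontrol.err₁.t_pos (hcontrol.err₁.t_le_one hc) hcontrol.err₂.t_pos
    (hcontrol.err₂.t_le_one hc) (by positivity) hβ0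
    (by
      calc (p : ℝ) * (2 ^ (3 * j) * (lam * Γ) * ((n : ℝ) ^ k * ((n : ℝ) ^ j)⁻¹))
          = 2 ^ (3 * j) * (lam * Γ) * ((p : ℝ) * ((n : ℝ) ^ k * ((n : ℝ) ^ j)⁻¹)) := by ring
        _ ≤ _ := by gcongr)
    hθ0.le (by rw [hθk]; exact hφ1)
    (by
      intro l hl0 hl
      rw [hθk, edgeProb_mul_choose hj hjk (by omega) hp l]
      have e1 := choose_sub_div_le_one n j (k - j)
      have e3 := (branchRatio_pos hl hjk).le
      refine le_trans ?_ (hrφ l hl0 hl)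
      calc (1 + φ) * ((1 + ε) * ((n - j).choose (k - j) / n.choose (k - j) : ℝ)
            * branchRatio k j l) ≤ (1 + φ) * ((1 + φ) * 1 * branchRatio k j l) := by gcongr
        _ = _ := by ring)
    hcodeg hC.ge
  have hbad : prob (p : ℝ) (kSets n k) (fun T => (T : Set (Finset (Fin n))) ∉
      {H | IsSmooth k j δ ε lam η γ₀ H})
      ≤ prob (p : ℝ) (kSets n k) (fun T => ¬ GoodRun k j p q ((n : ℝ) ^ (-δ / 24))
        ((n : ℝ) ^ (-(1 / 2) + δ / 2)) ((n : ℝ) ^ (δ / 2)) (2 ^ (3 * j) * (lam * Γ) * M)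
        (lam * Γ) ρ C T) := by
    refine prob_mono hpn0 hpn1 fun T hT hbad hgood => hbad ?_
    exact hcontrol.isSmooth hγ₀ hγ₀small hfast hrate hρ0 hρ1 hC0 hlam hxlam (by rw [hΓ]) hT hgood
  have hmeas := one_sub_prob_le_randomHypergraph n k p
    {H | IsSmooth k j δ ε lam η γ₀ H}
  exact (sub_le_sub_left (hbad.trans hprob) 1).trans hmeas

/-- With high probability, the boundaries of all searches are smooth. -/
theorem eventually_isSmooth (hj : 1 ≤ j) (hjk : j < k) {δ : ℝ} (hδ : 0 < δ) (hδ' : δ < 1 / 6)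
    {ε lam εs η γ₀ : ℕ → ℝ} {p : ℕ → unitInterval} (hε0 : ∀ᶠ n in atTop, 0 < ε n)
    (hε : Tendsto ε atTop (𝓝 0)) (hH : Hierarchy j δ ε lam εs η γ₀)
    (hp : ∀ᶠ n in atTop, (p n : ℝ) = (1 + ε n) * critProb k j n) :
    ∀ᶠ n : ℕ in atTop, 1 - Real.exp (-((n : ℝ) ^ (δ / 4))) ≤
      (randomHypergraph n k (p n)).real {H | IsSmooth k j δ (ε n) (lam n) (η n) (γ₀ n) H} := by
  have hj0 : 0 < j := hj
  have hk0 : 0 < k := by omega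
  -- constants
  set M : ℝ := 2 * (2 * k) ^ k with hM
  have hM0 : 0 < M := by positivity
  set C : ℝ := 2 ^ (k + 1) * M with hC
  have hC0 : 0 ≤ C := by positivity
  obtain ⟨φ, ρ, hφ0, hφ1, hρ0, hρ1, hrφ⟩ := exists_growthRate hj0 hjk
  set θ := φ / 2 ^ k with hθ
  have hθ0 : 0 < θ := by positivity
  have hθk : θ * 2 ^ k = φ := by rw [hθ]; field_simp
  set Γ := ((C * 2 ^ j + 1) / (1 - ρ)) ^ j with hΓ
  have hρ' : 0 < 1 - ρ := by linarith
  have hΓ0 : 0 < Γ := by positivity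
  obtain ⟨q, hq1, hqj, hqr⟩ := exists_pairScale hjk hδ M
  obtain ⟨c, hc⟩ := exists_constBound k j q M
  have hc1 := hc.one_le
  -- error terms
  set σ₁ : ℕ → ℝ := fun n => lam n * Γ + (n : ℝ) ^ (-δ / 24) with hσ₁
  set σ₂ : ℕ → ℝ := fun n => lam n * Γ + (n : ℝ) ^ (-(1 / 2) + δ / 2) with hσ₂
  have hlog1 : ∀ᶠ n : ℕ in atTop, 1 ≤ Real.log n :=
    (Real.tendsto_log_atTop.comp tendsto_natCast_atTop_atTop).eventually_ge_atTop 1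
  have hγlog : (fun n => γ₀ n / Real.log n) =O[atTop] γ₀ := by
    refine IsBigO.of_bound 1 ?_
    filter_upwards [hlog1] with n hn
    rw [norm_div, one_mul, Real.norm_of_nonneg (show 0 ≤ Real.log n by linarith)]
    exact div_le_self (norm_nonneg _) hn
  have hηγ : η =o[atTop] γ₀ := hH.η_γ₀.trans_isBigO hγlog
  -- Both parts of the coarse error are of smaller order than η: lam through εs, and n^(-δ/24) by
  -- assumption.
  have hσγ : σ₁ =o[atTop] γ₀ := by
    refine IsLittleO.trans ?_ hηγ
    refine IsLittleO.add ?_ hH.pow_η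
    have := (hH.lam_εs.trans hH.εs_η).const_mul_left Γ
    simpa only [mul_comm Γ] using this
  have hγ₀small : ∀ᶠ n : ℕ in atTop, 8 ^ j * γ₀ n ≤ 1 := by
    have h8 : (0 : ℝ) < (8 ^ j)⁻¹ := by positivity
    filter_upwards [hH.γ₀_log.bound h8, hlog1, hH.γ₀_pos] with n h1 h2 h3
    have h2' : 0 < Real.log n := by linarith
    rw [Real.norm_of_nonneg (by positivity), Real.norm_of_nonneg (by positivity),
      ← mul_div_assoc, mul_one, div_le_div_iff_of_pos_right h2', le_inv_comm₀ h3 (by positivity),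
      ] at h1
    calc 8 ^ j * γ₀ n ≤ (γ₀ n)⁻¹ * γ₀ n := by gcongr
      _ = 1 := inv_mul_cancel₀ h3.ne'
  have hγ₀1 : γ₀ =O[atTop] (fun _ => (1 : ℝ)) := by
    refine IsBigO.of_bound 1 ?_
    filter_upwards [hγ₀small, hH.γ₀_pos] with n h1 h2
    rw [Real.norm_of_nonneg h2.le, norm_one, mul_one]
    refine le_trans ?_ h1
    exact le_mul_of_one_le_left h2.le (one_le_pow₀ (by norm_num))
  have hσ₁0 : Tendsto σ₁ atTop (𝓝 0) := (isLittleO_one_iff ℝ).1 (hσγ.trans_isBigO hγ₀1)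
  have hη0 : Tendsto η atTop (𝓝 0) := (isLittleO_one_iff ℝ).1 (hηγ.trans_isBigO hγ₀1)
  have hlamε : lam =o[atTop] ε := hH.lam_εs.trans hH.εs_ε
  have hpowle : ∀ a b : ℝ, a ≤ b → ∀ᶠ n : ℕ in atTop, (n : ℝ) ^ a ≤ (n : ℝ) ^ b := by
    intro a b hab
    filter_upwards [eventually_ge_atTop 1] with n hn
    exact Real.rpow_le_rpow_of_exponent_le (by exact_mod_cast hn) hab
  have hε0' : ∀ᶠ n in atTop, 0 ≤ ε n := hε0.mono fun n h => h.le
  have hlam0 : ∀ᶠ n in atTop, 0 ≤ lam n := hH.lam_pos.mono fun n h => h.le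
  have hη0' : ∀ᶠ n in atTop, 0 ≤ η n := hH.η_pos.mono fun n h => h.le
  have hγ₀0 : ∀ᶠ n in atTop, 0 ≤ γ₀ n := hH.γ₀_pos.mono fun n h => h.le
  have hσ₁pow : ∀ᶠ n : ℕ in atTop, (n : ℝ) ^ (-δ / 24) ≤ σ₁ n := by
    filter_upwards [hlam0] with n hn
    have : 0 ≤ lam n * Γ := by positivity
    simp only [hσ₁]; linarith
  have hsqrt : ∀ᶠ n : ℕ in atTop, (n : ℝ) ^ (-(1 / 2 : ℝ) + δ) ≤ lam n := by
    filter_upwards [eventually_abs_le_of_isLittleO hH.sqrt_lam hlam0 one_pos] with n hn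
    rw [one_mul] at hn
    exact (le_abs_self _).trans hn
  -- The fine precision n^(-1/2+δ/2) is below n^(-1/2+δ), hence below lam for large n, and lam is of
  -- smaller order than ε.
  have hgrow : ∀ᶠ n : ℕ in atTop, 24 * (c * σ₂ n) ≤ ε n := by
    have ha : 0 < 1 / (24 * c * (Γ + 1)) := by positivity
    filter_upwards [eventually_abs_le_of_isLittleO hlamε hε0' ha, hsqrt,
      hpowle (-(1 / 2) + δ / 2) (-(1 / 2) + δ) (by linarith)] with n h1 h2 h3
    have h4 : σ₂ n ≤ lam n * (Γ + 1) := by simp only [hσ₂]; linarith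
    have h5 : lam n ≤ 1 / (24 * c * (Γ + 1)) * ε n := (le_abs_self _).trans h1
    calc 24 * (c * σ₂ n) ≤ 24 * (c * (1 / (24 * c * (Γ + 1)) * ε n * (Γ + 1))) := by
          have : σ₂ n ≤ 1 / (24 * c * (Γ + 1)) * ε n * (Γ + 1) :=
            h4.trans (mul_le_mul_of_nonneg_right h5 (by positivity))
          gcongr
      _ = ε n := by field_simp
  have hfast : ∀ᶠ n : ℕ in atTop, ∀ z ∈ Finset.range j, 0 < z →
      5 * ((1 + 2 * (c * σ₁ n)) * (1 + ε n)) ^ smoothTime k j n (ε n) (η n) z < n := by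
    rw [Filter.eventually_all_finset]
    intro z hz
    rw [Finset.mem_range] at hz
    rcases Nat.eq_zero_or_pos z with h0 | hpos
    · exact Eventually.of_forall fun n hn => absurd h0 hn.ne'
    · filter_upwards [eventually_smoothTime (zero_le_one.trans hc1) hpos hz hjk hε hη0 hσ₁0 hε0'
        hη0' (hσ₁pow.mono fun n h => le_trans (by positivity) h)] with n hn _ using hn
  have hrate : ∀ᶠ n : ℕ in atTop, ∀ l ∈ Finset.range j, 0 < l → ∃ ρ ρ₀ K,
      Rate n k j (ε n) q M c (σ₁ n) (γ₀ n) δ l (smoothTime k j n (ε n) (η n) l) ρ ρ₀ K := by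
    rw [Filter.eventually_all_finset]
    intro z hz
    rw [Finset.mem_range] at hz
    rcases Nat.eq_zero_or_pos z with h0 | hpos
    · exact Eventually.of_forall fun n hn => absurd h0 hn.ne'
    · obtain ⟨ρ', ρ₀', K', h⟩ := eventually_rate (k := k) (M := M) (q := q) hδ (by linarith) hc1
        hpos hz hjk (hqr z hpos hz) hε hη0 hσ₁0 hε0' hη0'
        ((hσ₁pow.and (hpowle (-(δ / 2)) (-δ / 24) (by linarith))).mono fun n h => h.2.trans h.1)
        hγ₀0 hσγ
      filter_upwards [h] with n hn _ using ⟨ρ', ρ₀', K', hn⟩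
  have hcσ : ∀ᶠ n : ℕ in atTop, c * σ₁ n ≤ 1 / 12 := by
    have := hσ₁0.const_mul c
    rw [mul_zero] at this
    exact (this.eventually_lt_const (by norm_num)).mono fun n h => h.le
  have hεφ : ∀ᶠ n : ℕ in atTop, ε n ≤ φ :=
    (hε.eventually_lt_const hφ0).mono fun n h => h.le
  filter_upwards [hε0', hlam0, hη0', hγ₀0, hγ₀small, hσ₁pow, hsqrt, hgrow, hfast, hrate, hcσ, hεφ,
    hp, eventually_failure_le hθ0 hδ hj0, eventually_ge_atTop (8 * k ^ 2),
    tendsto_natCast_atTop_atTop.eventually_ge_atTop q] with n hε hlam hη hγ₀ hγ₀small hσ₁pow hsqrt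
    hgrow hfast hrate hcσ hεφ hp hfail hnk hnq
  have := le_randomHypergraph_isSmooth (n := n) hj0 hjk hM hC hφ0 hφ1 hρ0 hρ1 hrφ hθ0 hθk hΓ hq1 hqj hc
    (σ₁ := σ₁ n) (σ₂ := σ₂ n) rfl rfl hδ hδ' hε hlam hγ₀ hγ₀small hsqrt hgrow
    (fun z hz0 hz => hfast z (Finset.mem_range.2 hz) hz0)
    (fun l hl0 hl => hrate l (Finset.mem_range.2 hl) hl0) hcσ hεφ hp hnk hnq
  linarith

end SmoothBoundary

theorem mainTheorem2 (k j : ℕ) (hj : 1 ≤ j) (hjk : j < k) (δ : ℝ) (hδ : 0 < δ) (hδ' : δ < 1 / 6) :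
    ∃ c : ℝ, 0 < c ∧
      ∀ (ε lam εs η γ₀ : ℕ → ℝ) (p : ℕ → unitInterval),
        (∀ᶠ n in atTop, 0 < ε n) →
        Tendsto ε atTop (𝓝 0) →
        Tendsto (fun n : ℕ => ε n ^ 3 * (n : ℝ) ^ j) atTop atTop →
        Tendsto (fun n : ℕ => ε n ^ 2 * (n : ℝ) ^ (1 - 2 * δ)) atTop atTop →
        SmoothBoundary.Hierarchy j δ ε lam εs η γ₀ →
        (∀ᶠ n in atTop, (p n : ℝ) = (1 + ε n) * SmoothBoundary.critProb k j n) →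
        ∀ᶠ n : ℕ in atTop,
          1 - Real.exp (-((n : ℝ) ^ c)) ≤
            (SmoothBoundary.randomHypergraph n k (p n)).real
              {H | SmoothBoundary.IsSmooth k j δ (ε n) (lam n) (η n) (γ₀ n) H} := by
  -- Single events fail with probability about exp(-θn^(δ/2)). The smaller exponent δ/4 absorbs θ
  -- and the polynomial factor of the union bound.
  refine ⟨δ / 4, by positivity, fun ε lam εs η γ₀ p hε0 hε _ _ hH hp => ?_⟩
  exact SmoothBoundary.eventually_isSmooth hj hjk hδ hδ' hε0 hε hH hp
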